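/- Let $G=(V,E)$ be a directed graph with $n\ge 1$ vertices and $m$ edges (loops and parallel edges are allowed), real edge costs $c:E\to\mathbb{R}$ and one discount factor $\gamma\in(0,1)$, which is part of the input. The discounted cost of a walk $P=e_0e_1\cdots e_{k-1}$ is $c(P)=\sum_{i=0}^{k-1}\gamma^i c(e_i)$, and the discounted distance $\delta_G(s,t)\in\mathbb{R}\cup\{\infty\}$ is the infimum of $c(P)$ over all finite walks $P$ from $s$ to $t$ (it need not be attained, and it is $\infty$ if $t$ is not reachable from $s$). An optimal policy for an end vertex $t$ chooses, at each vertex $v$ from which $t$ is reachable, one outgoing edge to a vertex from which $t$ is still reachable or, only if $v=t$, the option to end the process (equivalently, to stay at $t$ forever at no cost), such that for every $s$ from which $t$ is reachable the total discounted cost $\sum_{i\ge 0}\gamma^i c_i$ of the (finite or infinite) process started at $s$ is $\delta_G(s,t)$; here $c_i$ is the cost incurred in step $i$. There is a deterministic algorithm, on a random access machine with words of $O(\log(n+m))$ bits and with real registers that allow $+,-,\cdot,/$ and comparisons at unit cost, that on every such input computes all discounted distances $\delta_G(s,t)$, $s,t\in V$, together with an optimal policy for every end vertex $t\in V$. If $n^{2/3}\le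 m\le n^2$ (in particular, if $n\le m$ and there are no parallel edges), then it runs in $\tilde O(n^{3/2}m^{3/4})$ time, that is, in at most $C\,n^{3/2}m^{3/4}\log^{k}(n+2)$ steps for constants $C$ and $k$ that depend neither on $G$ nor on $c$ nor on $\gamma$. -/

import Mathlib

/-!
# A word RAM with real registers

Programs of a small imperative language.  A machine state has word (natural number) registers, real
registers, and named word and real arrays indexed by words; a program is finite and so uses finitely
many registers and array names.  Words are restricted to `{0, …, W - 1}`: a program that computes a
larger word is stuck.  Reals are manipulated only by `+ - * /` and comparisons, at unit cost each;
there is no rounding and no conversion between reals and words.  Every operation, memory access and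
test costs one step.  There is no source of randomness.
-/

namespace RealRAM

/-- Machine states. -/
structure Store where
  /-- word registers -/
  wreg : ℕ → ℕ
  /-- real registers -/
  xreg : ℕ → ℝ
  /-- word arrays: `warr a i` is cell `i` of array `a` -/
  warr : ℕ → ℕ → ℕ
  /-- real arrays: `xarr a i` is cell `i` of array `a` -/
  xarr : ℕ → ℕ → ℝ

/-- Word expressions. -/
inductive WExp where
  | lit (k : ℕ)
  | reg (r : ℕ)
  | cell (a : ℕ) (i : WExp)
  | add (e f : WExp)
  | sub (e f : WExp)
  | mul (e f : WExp)
  | div (e f : WExp)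

namespace WExp

/-- The value of a word expression (subtraction is truncated, division is rounded down). -/
def eval (σ : Store) : WExp → ℕ
  | lit k => k
  | reg r => σ.wreg r
  | cell a i => σ.warr a (i.eval σ)
  | add e f => e.eval σ + f.eval σ
  | sub e f => e.eval σ - f.eval σ
  | mul e f => e.eval σ * f.eval σ
  | div e f => e.eval σ / f.eval σ

/-- The number of operations that evaluate a word expression. -/
def size : WExp → ℕ
  | lit _ => 1
  | reg _ => 1
  | cell _ i => i.size + 1
  | add e f => e.size + f.size + 1
  | sub e f => e.size + f.size + 1
  | mul e f => e.size + f.size + 1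
  | div e f => e.size + f.size + 1

/-- All values that occur in the evaluation (in particular all array indices) are below `W`. -/
def Fits (W : ℕ) (σ : Store) : WExp → Prop
  | lit k => k < W
  | reg r => σ.wreg r < W
  | cell a i => i.Fits W σ ∧ σ.warr a (i.eval σ) < W
  | add e f => e.Fits W σ ∧ f.Fits W σ ∧ e.eval σ + f.eval σ < W
  | sub e f => e.Fits W σ ∧ f.Fits W σ
  | mul e f => e.Fits W σ ∧ f.Fits W σ ∧ e.eval σ * f.eval σ < W
  | div e f => e.Fits W σ ∧ f.Fits W σ

end WExp

/-- Real expressions. -/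
inductive XExp where
  | lit (k : ℕ)
  | reg (r : ℕ)
  | cell (a : ℕ) (i : WExp)
  | add (e f : XExp)
  | sub (e f : XExp)
  | mul (e f : XExp)
  | div (e f : XExp)

namespace XExp

/-- The value of a real expression (division by zero returns zero). -/
noncomputable def eval (σ : Store) : XExp → ℝ
  | lit k => (k : ℝ)
  | reg r => σ.xreg r
  | cell a i => σ.xarr a (i.eval σ)
  | add e f => e.eval σ + f.eval σ
  | sub e f => e.eval σ - f.eval σ
  | mul e f => e.eval σ * f.eval σ
  | div e f => e.eval σ / f.eval σ

/-- The number of operations that evaluate a real expression. -/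
def size : XExp → ℕ
  | lit _ => 1
  | reg _ => 1
  | cell _ i => i.size + 1
  | add e f => e.size + f.size + 1
  | sub e f => e.size + f.size + 1
  | mul e f => e.size + f.size + 1
  | div e f => e.size + f.size + 1

/-- All array indices that occur in the evaluation are computed with words below `W`. -/
def Fits (W : ℕ) (σ : Store) : XExp → Prop
  | lit _ => True
  | reg _ => True
  | cell _ i => i.Fits W σ
  | add e f => e.Fits W σ ∧ f.Fits W σ
  | sub e f => e.Fits W σ ∧ f.Fits W σ
  | mul e f => e.Fits W σ ∧ f.Fits W σ
  | div e f => e.Fits W σ ∧ f.Fits W σ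

end XExp

/-- Tests. -/
inductive BExp where
  | wlt (e f : WExp)
  | weq (e f : WExp)
  | xlt (e f : XExp)
  | not (b : BExp)
  | and (b c : BExp)

namespace BExp

/-- The outcome of a test. -/
def Holds (σ : Store) : BExp → Prop
  | wlt e f => e.eval σ < f.eval σ
  | weq e f => e.eval σ = f.eval σ
  | xlt e f => e.eval σ < f.eval σ
  | not b => ¬ b.Holds σ
  | and b c => b.Holds σ ∧ c.Holds σ

/-- The number of operations that evaluate a test. -/
def size : BExp → ℕ
  | wlt e f => e.size + f.size + 1
  | weq e f => e.size + f.size + 1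
  | xlt e f => e.size + f.size + 1
  | not b => b.size + 1
  | and b c => b.size + c.size + 1

/-- All words that occur in the evaluation are below `W`. -/
def Fits (W : ℕ) (σ : Store) : BExp → Prop
  | wlt e f => e.Fits W σ ∧ f.Fits W σ
  | weq e f => e.Fits W σ ∧ f.Fits W σ
  | xlt e f => e.Fits W σ ∧ f.Fits W σ
  | not b => b.Fits W σ
  | and b c => b.Fits W σ ∧ c.Fits W σ

end BExp

/-- Programs. -/
inductive Prog where
  | skip
  /-- assign to a word register -/
  | wset (r : ℕ) (e : WExp)
  /-- assign to a real register -/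
  | xset (r : ℕ) (e : XExp)
  /-- assign to cell `i` of word array `a` -/
  | wput (a : ℕ) (i : WExp) (e : WExp)
  /-- assign to cell `i` of real array `a` -/
  | xput (a : ℕ) (i : WExp) (e : XExp)
  | seq (p q : Prog)
  | ite (b : BExp) (p q : Prog)
  /-- repeat `p` while `b` holds -/
  | loop (b : BExp) (p : Prog)

namespace Store

/-- Overwrite a word register. -/
def setW (σ : Store) (r v : ℕ) : Store :=
  { σ with wreg := Function.update σ.wreg r v }

/-- Overwrite a real register. -/
def setX (σ : Store) (r : ℕ) (v : ℝ) : Store :=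
  { σ with xreg := Function.update σ.xreg r v }

/-- Overwrite a cell of a word array. -/
def putW (σ : Store) (a i v : ℕ) : Store :=
  { σ with warr := Function.update σ.warr a (Function.update (σ.warr a) i v) }

/-- Overwrite a cell of a real array. -/
def putX (σ : Store) (a i : ℕ) (v : ℝ) : Store :=
  { σ with xarr := Function.update σ.xarr a (Function.update (σ.xarr a) i v) }

end Store

/-- `Exec W p σ τ T`: with words bounded by `W`, the program `p` started in state `σ` halts in state
`τ` after exactly `T` steps. -/
inductive Exec (W : ℕ) : Prog → Store → Store → ℕ → Prop where
  | skip (σ : Store) : Exec W Prog.skip σ σ 1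
  | wset (σ : Store) (r : ℕ) (e : WExp) (h : e.Fits W σ) :
      Exec W (Prog.wset r e) σ (σ.setW r (e.eval σ)) (e.size + 1)
  | xset (σ : Store) (r : ℕ) (e : XExp) (h : e.Fits W σ) :
      Exec W (Prog.xset r e) σ (σ.setX r (e.eval σ)) (e.size + 1)
  | wput (σ : Store) (a : ℕ) (i e : WExp) (hi : i.Fits W σ) (h : e.Fits W σ) :
      Exec W (Prog.wput a i e) σ (σ.putW a (i.eval σ) (e.eval σ)) (i.size + e.size + 1)
  | xput (σ : Store) (a : ℕ) (i : WExp) (e : XExp) (hi : i.Fits W σ) (h : e.Fits W σ) :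
      Exec W (Prog.xput a i e) σ (σ.putX a (i.eval σ) (e.eval σ)) (i.size + e.size + 1)
  | seq {p q : Prog} {σ τ υ : Store} {S T : ℕ} (hp : Exec W p σ τ S) (hq : Exec W q τ υ T) :
      Exec W (Prog.seq p q) σ υ (S + T)
  | ite_true {b : BExp} {p q : Prog} {σ τ : Store} {T : ℕ} (hf : b.Fits W σ) (hb : b.Holds σ)
      (hp : Exec W p σ τ T) : Exec W (Prog.ite b p q) σ τ (b.size + 1 + T)
  | ite_false {b : BExp} {p q : Prog} {σ τ : Store} {T : ℕ} (hf : b.Fits W σ) (hb : ¬ b.Holds σ)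
      (hq : Exec W q σ τ T) : Exec W (Prog.ite b p q) σ τ (b.size + 1 + T)
  | loop_done {b : BExp} {p : Prog} {σ : Store} (hf : b.Fits W σ) (hb : ¬ b.Holds σ) :
      Exec W (Prog.loop b p) σ σ (b.size + 1)
  | loop_step {b : BExp} {p : Prog} {σ τ υ : Store} {S T : ℕ} (hf : b.Fits W σ) (hb : b.Holds σ)
      (hp : Exec W p σ τ S) (hl : Exec W (Prog.loop b p) τ υ T) :
      Exec W (Prog.loop b p) σ υ (b.size + 1 + S + T)

end RealRAM

/-! # Discounted all-pairs shortest paths with a uniform discount factor -/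

/-- A directed multigraph (loops allowed) on the vertices `Fin n` with edges `Fin m`, real edge costs
and one discount factor `γ` for all edges. -/
structure DiscountedGraph (n m : ℕ) where
  tail : Fin m → Fin n
  head : Fin m → Fin n
  cost : Fin m → ℝ
  γ : ℝ
  γ_pos : 0 < γ
  γ_lt_one : γ < 1

namespace DiscountedGraph

variable {n m : ℕ}

/-- The list `P` of edges is a walk from `s` to `t`. -/
def IsWalk (G : DiscountedGraph n m) (s t : Fin n) : List (Fin m) → Prop
  | [] => s = t
  | e :: P => G.tail e = s ∧ G.IsWalk (G.head e) t P

/-- The discounted cost `∑ i, γ ^ i * c(eᵢ)` of a walk `e₀ e₁ e₂ …`. -/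
def walkCost (G : DiscountedGraph n m) : List (Fin m) → ℝ
  | [] => 0
  | e :: P => G.cost e + G.γ * G.walkCost P

/-- The minimum cost of a walk from `s` to `t` with exactly `k` edges (`⊤` if there is none). -/
noncomputable def distExact (G : DiscountedGraph n m) (k : ℕ) (s t : Fin n) : EReal :=
  ⨅ (P : List (Fin m)) (_ : G.IsWalk s t P ∧ P.length = k), (G.walkCost P : EReal)

/-- The discounted distance from `s` to `t`. -/
noncomputable def dist (G : DiscountedGraph n m) (s t : Fin n) : EReal :=
  ⨅ k : ℕ, G.distExact k s t

/-- There is a walk from `s` to `t`. -/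
def Reaches (G : DiscountedGraph n m) (s t : Fin n) : Prop :=
  ∃ P : List (Fin m), G.IsWalk s t P

/-- The vertex that follows `v` under the policy `π`, which at each vertex either takes an edge or
stays (`none`). -/
def policyNext (G : DiscountedGraph n m) (π : Fin n → Option (Fin m)) (v : Fin n) : Fin n :=
  (π v).elim v G.head

/-- The immediate cost of the policy `π` at `v`; staying is free. -/
def policyCost (G : DiscountedGraph n m) (π : Fin n → Option (Fin m)) (v : Fin n) : ℝ :=
  (π v).elim 0 G.cost

/-- The policy `π` is optimal for the end vertex `t`, from every start vertex `s` that can reach `t`: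
it takes edges of `G` along which `t` stays reachable, may stop only at `t` (a free loop there), and
the total discounted cost of the resulting infinite process is the discounted distance. -/
def IsOptimalPolicy (G : DiscountedGraph n m) (t : Fin n) (π : Fin n → Option (Fin m)) : Prop :=
  ∀ s : Fin n, G.Reaches s t →
    (π s = none → s = t) ∧
    (∀ e : Fin m, π s = some e → G.tail e = s ∧ G.Reaches (G.head e) t) ∧
    ∃ d : ℝ, HasSum (fun i : ℕ => G.γ ^ i * G.policyCost π ((G.policyNext π)^[i] s)) d ∧
      (d : EReal) = G.dist s t

/-- The input: `n` and `m` in word registers 0 and 1, `γ` in real register 0, the tails and heads of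
the edges in word arrays 0 and 1, their costs in real array 0, and zeros everywhere else. -/
noncomputable def input (G : DiscountedGraph n m) : RealRAM.Store where
  wreg := fun r => if r = 0 then n else if r = 1 then m else 0
  xreg := fun r => if r = 0 then G.γ else 0
  warr := fun a i =>
    if h : i < m then
      if a = 0 then (G.tail ⟨i, h⟩ : ℕ) else if a = 1 then (G.head ⟨i, h⟩ : ℕ) else 0
    else 0
  xarr := fun a i => if h : i < m then (if a = 0 then G.cost ⟨i, h⟩ else 0) else 0

/-- The value that a final state reports for the pair `(s, t)`, at index `s * n + t`: `⊤` if the cell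
of word array 2 is zero, and the number in the cell of real array 1 otherwise. -/
noncomputable def outDist (n : ℕ) (σ : RealRAM.Store) (s t : Fin n) : EReal :=
  if σ.warr 2 (s * n + t) = 0 then ⊤ else (σ.xarr 1 (s * n + t) : EReal)

/-- The policy that a final state reports for the end vertex `t`: at `v`, the cell `v * n + t` of word
array 3 holds `e + 1` for the edge number `e`, or another number for no edge. -/
def outPolicy (n m : ℕ) (σ : RealRAM.Store) (t v : Fin n) : Option (Fin m) :=
  if h : 0 < σ.warr 3 (v * n + t) ∧ σ.warr 3 (v * n + t) ≤ m then
    some ⟨σ.warr 3 (v * n + t) - 1, by omega⟩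
  else none

/-- The state `σ` holds a solution: all discounted distances, and an optimal policy for every end
vertex. -/
def IsSolution (G : DiscountedGraph n m) (σ : RealRAM.Store) : Prop :=
  (∀ s t : Fin n, outDist n σ s t = G.dist s t) ∧
    ∀ t : Fin n, G.IsOptimalPolicy t (outPolicy n m σ t)

end DiscountedGraph

/-! Write x_t(v) for the distance from v to t. These numbers satisfy the optimality equations
`Gr.Val`: x_t(v) is the least value of c(e) + γ x_t(head e) over the edges e at v along which t
stays reachable, or 0 if v = t and stopping is better. There are finitely many edges, so the
equations are attained although the infimum over walks need not be; edges and walks that attain them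
are called tight. Any choice of tight edges is an optimal policy, because its costs telescope and
the remainder is discounted to 0.

A tight walk for t either stops at t with x_t(t) = 0 or can be prolonged until it visits a vertex
twice. A closed tight walk D at w gives x_t(w) ≥ c(D) / (1 - γ^|D|), the cost of repeating D
forever. Conversely the cost of an infinite walk inside a strong component bounds x_t from above for
every t reachable from that component, since the walk may be left arbitrarily late. So infinite
walks can be evaluated once for all end vertices. Distances consist of short tight walks that end at
t, in another short tight walk, or in such an infinite walk.

A walk with j edges and cost d from b to u contributes d + γ^j x_t(u). Hence walks may only be
exchanged for cheaper ones with the same number of edges (`Gr.Tight.of_le`), and the tables hold the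
cheapest walk for each exact length. Level 0 of a hierarchy consists of all vertices, L_0 = min(h,
n) and L_{i+1} = min(h L_i, n); level i + 1 hits an optimal walk with L_i edges from each vertex of
level i to each end of such walks, unless that optimal walk repeats a vertex. A greedy choice makes
level i + 1 of size Õ(n / L_i), so all walks with up to L_i edges from level i are tabulated in time
Õ(n h m). `Gr.Hier.landmark` says that a tight walk with at most L_i edges leads from level i to the
end vertex, to level i + 1 or to a closed tight walk; `Gr.Hier.closed` says that a closed tight walk
can be replaced by one with at most L_j edges at some vertex of some level j, in the same strong
component.

Distances then descend from the top level. For b on level i and u on level i + 1 the functions x ↦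
d_j + γ^j x are lines, whose lower envelope is evaluated at x_t(u) for all t by binary search, in
time Õ(n) per pair. For i ≥ 1 there are only Õ(n² / h³) such pairs (`Lay.pairs_le`); the step to
level 0 is made by about h rounds of Bellman–Ford for each t, in time O(n h m). The sum n h m + n³ /
h³ is balanced by h⁴ ≈ n² / m, which yields n^{3/2} m^{3/4}; the remaining terms, of order n² and n
m up to logarithms, are dominated in the stated range. The descent runs twice: once for
reachability, which the infinite walks need, and once for the values.

Correctness is two-sided throughout. Every table entry is a sound upper bound and tables are only
ever improved (`Imp`), so x_t(v) is never undercut; it remains to show that some entry reaches it.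
Programs are verified by total correctness with time bounds (`Tri`), on unbounded words. `Run.exec`
bounds the words afterwards by the running time, because the program stores only words that grow
additively. -/

namespace RealRAM

/-! ## Executions without a word bound -/

/-- `Run p σ τ T`: the program `p` started in `σ` halts in `τ` after `T` steps, on a machine whose
words are unbounded. -/
inductive Run : Prog → Store → Store → ℕ → Prop where
  | skip (σ : Store) : Run Prog.skip σ σ 1
  | wset (σ : Store) (r : ℕ) (e : WExp) : Run (Prog.wset r e) σ (σ.setW r (e.eval σ)) (e.size + 1)
  | xset (σ : Store) (r : ℕ) (e : XExp) : Run (Prog.xset r e) σ (σ.setX r (e.eval σ)) (e.size + 1)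
  | wput (σ : Store) (a : ℕ) (i e : WExp) :
      Run (Prog.wput a i e) σ (σ.putW a (i.eval σ) (e.eval σ)) (i.size + e.size + 1)
  | xput (σ : Store) (a : ℕ) (i : WExp) (e : XExp) :
      Run (Prog.xput a i e) σ (σ.putX a (i.eval σ) (e.eval σ)) (i.size + e.size + 1)
  | seq {p q : Prog} {σ τ υ : Store} {S T : ℕ} (hp : Run p σ τ S) (hq : Run q τ υ T) :
      Run (Prog.seq p q) σ υ (S + T)
  | ite_true {b : BExp} {p q : Prog} {σ τ : Store} {T : ℕ} (hb : b.Holds σ)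
      (hp : Run p σ τ T) : Run (Prog.ite b p q) σ τ (b.size + 1 + T)
  | ite_false {b : BExp} {p q : Prog} {σ τ : Store} {T : ℕ} (hb : ¬ b.Holds σ)
      (hq : Run q σ τ T) : Run (Prog.ite b p q) σ τ (b.size + 1 + T)
  | loop_done {b : BExp} {p : Prog} {σ : Store} (hb : ¬ b.Holds σ) :
      Run (Prog.loop b p) σ σ (b.size + 1)
  | loop_step {b : BExp} {p : Prog} {σ τ υ : Store} {S T : ℕ} (hb : b.Holds σ)
      (hp : Run p σ τ S) (hl : Run (Prog.loop b p) τ υ T) :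
      Run (Prog.loop b p) σ υ (b.size + 1 + S + T)

/-! ## Word bounds from running times -/

/-- The sum of the word literals of an expression. -/
def WExp.lits : WExp → ℕ
  | lit k => k
  | reg _ => 0
  | cell _ i => i.lits
  | add e f => e.lits + f.lits
  | sub e f => e.lits + f.lits
  | mul e f => e.lits + f.lits
  | div e f => e.lits + f.lits

/-- Expressions whose value exceeds the words that they read by at most their literals. -/
def WExp.safe : WExp → Bool
  | lit _ => true
  | reg _ => true
  | cell _ _ => true
  | add e (lit _) => e.safe
  | sub e _ => e.safe
  | div e _ => e.safe
  | _ => false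

/-- The sum of the word literals of an expression. -/
def XExp.lits : XExp → ℕ
  | lit _ => 0
  | reg _ => 0
  | cell _ i => i.lits
  | add e f => e.lits + f.lits
  | sub e f => e.lits + f.lits
  | mul e f => e.lits + f.lits
  | div e f => e.lits + f.lits

/-- The sum of the word literals of a test. -/
def BExp.lits : BExp → ℕ
  | wlt e f => e.lits + f.lits
  | weq e f => e.lits + f.lits
  | xlt e f => e.lits + f.lits
  | not b => b.lits
  | and b c => b.lits + c.lits

/-- The sum of the word literals of a program. -/
def Prog.lits : Prog → ℕ
  | skip => 0
  | wset _ e => e.lits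
  | xset _ e => e.lits
  | wput _ i e => i.lits + e.lits
  | xput _ i e => i.lits + e.lits
  | seq p q => p.lits + q.lits
  | ite b p q => b.lits + p.lits + q.lits
  | loop b p => b.lits + p.lits

/-- The total size of the expressions of a program. -/
def Prog.esz : Prog → ℕ
  | skip => 0
  | wset _ e => e.size
  | xset _ e => e.size
  | wput _ i e => i.size + e.size
  | xput _ i e => i.size + e.size
  | seq p q => p.esz + q.esz
  | ite b p q => b.size + p.esz + q.esz
  | loop b p => b.size + p.esz

/-- All words that the program stores are values of safe expressions. -/
def Prog.safe : Prog → Bool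
  | skip => true
  | wset _ e => e.safe
  | xset _ _ => true
  | wput _ _ e => e.safe
  | xput _ _ _ => true
  | seq p q => p.safe && q.safe
  | ite _ p q => p.safe && q.safe
  | loop _ p => p.safe

/-- All words of the state are at most `M`. -/
def Store.AllLe (M : ℕ) (σ : Store) : Prop := (∀ r, σ.wreg r ≤ M) ∧ ∀ a i, σ.warr a i ≤ M

theorem Store.AllLe.mono {M N : ℕ} {σ : Store} (h : σ.AllLe M) (hMN : M ≤ N) : σ.AllLe N :=
  ⟨fun r => (h.1 r).trans hMN, fun a i => (h.2 a i).trans hMN⟩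

/-- Stored words grow by at most a literal per assignment, so they stay linear in the running time.
This is why sums of two registers and products are not safe. -/
theorem WExp.eval_le_of_safe {M : ℕ} {σ : Store} (h : σ.AllLe M) :
    ∀ e : WExp, e.safe = true → e.eval σ ≤ M + e.lits := by
  intro e
  induction e with
  | lit k => intro _; simp [WExp.eval, WExp.lits]
  | reg r => intro _; simpa [WExp.eval, WExp.lits] using h.1 r
  | cell a i _ =>
    intro _; simp only [WExp.eval, WExp.lits]; exact (h.2 _ _).trans (Nat.le_add_right _ _)
  | add e f ihe _ =>
    intro hs
    cases f with
    | lit k =>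
      have := ihe (by simpa [WExp.safe] using hs)
      simp only [WExp.eval, WExp.lits]; omega
    | _ => simp [WExp.safe] at hs
  | sub e f ihe _ =>
    intro hs
    have := ihe (by simpa [WExp.safe] using hs)
    simp only [WExp.eval, WExp.lits]; omega
  | mul e f _ _ => intro hs; simp [WExp.safe] at hs
  | div e f ihe _ =>
    intro hs
    have := ihe (by simpa [WExp.safe] using hs)
    simp only [WExp.eval, WExp.lits]
    exact (Nat.div_le_self _ _).trans (by omega)

/-- Intermediate values may be products, but each operation at most multiplies the bounds of its
operands, up to one spare factor `B` that absorbs sums. Only the exponent depends on the program. -/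
theorem WExp.eval_le_pow {B : ℕ} {σ : Store} (h : σ.AllLe B) (hB : 2 ≤ B) :
    ∀ e : WExp, e.lits ≤ B → e.eval σ ≤ B ^ e.size := by
  have key : ∀ a b : ℕ, B ^ a + B ^ b ≤ B ^ (a + b + 1) := fun a b => by
    have ha : B ^ a ≤ B ^ (a + b) := Nat.pow_le_pow_right (by omega) (by omega)
    have hb : B ^ b ≤ B ^ (a + b) := Nat.pow_le_pow_right (by omega) (by omega)
    have : B ^ (a + b) * 2 ≤ B ^ (a + b) * B := Nat.mul_le_mul_left _ hB
    rw [pow_succ]; omega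
  have up : ∀ a b c : ℕ, c ≤ B ^ a → c ≤ B ^ (a + b + 1) := fun a b c hc =>
    hc.trans (Nat.pow_le_pow_right (by omega) (by omega))
  intro e
  induction e with
  | lit k => intro hl; simpa [WExp.eval, WExp.size, WExp.lits] using hl
  | reg r => intro _; simpa [WExp.eval, WExp.size] using h.1 r
  | cell a i _ =>
    intro _; simp only [WExp.eval, WExp.size]
    exact (h.2 _ _).trans (Nat.le_self_pow (by omega) _)
  | add e f ihe ihf =>
    intro hl; simp only [WExp.lits] at hl; simp only [WExp.eval, WExp.size]
    exact (Nat.add_le_add (ihe (by omega)) (ihf (by omega))).trans (key _ _)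
  | sub e f ihe ihf =>
    intro hl; simp only [WExp.lits] at hl; simp only [WExp.eval, WExp.size]
    exact up _ _ _ ((Nat.sub_le _ _).trans (ihe (by omega)))
  | mul e f ihe ihf =>
    intro hl; simp only [WExp.lits] at hl; simp only [WExp.eval, WExp.size]
    calc e.eval σ * f.eval σ ≤ B ^ e.size * B ^ f.size :=
          Nat.mul_le_mul (ihe (by omega)) (ihf (by omega))
      _ = B ^ (e.size + f.size) := (pow_add _ _ _).symm
      _ ≤ _ := Nat.pow_le_pow_right (by omega) (by omega)
  | div e f ihe ihf =>
    intro hl; simp only [WExp.lits] at hl; simp only [WExp.eval, WExp.size]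
    exact up _ _ _ ((Nat.div_le_self _ _).trans (ihe (by omega)))

theorem WExp.fits {B W : ℕ} {σ : Store} (h : σ.AllLe B) (hB : 2 ≤ B) :
    ∀ e : WExp, e.lits ≤ B → B ^ e.size < W → e.Fits W σ := by
  have lt : ∀ {a b : ℕ}, a ≤ b → B ^ b < W → B ^ a < W := fun hab hb =>
    (Nat.pow_le_pow_right (by omega) hab).trans_lt hb
  intro e
  have hv := WExp.eval_le_pow h hB e
  induction e with
  | lit k => intro hl hW; exact (hv hl).trans_lt hW
  | reg r => intro hl hW; exact (hv hl).trans_lt hW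
  | cell a i ih =>
    intro hl hW
    exact ⟨ih (WExp.eval_le_pow h hB i) hl (lt (by simp [WExp.size]) hW), (hv hl).trans_lt hW⟩
  | add e f ihe ihf =>
    intro hl hW
    have hl' := hl
    simp only [WExp.lits] at hl'
    exact ⟨ihe (WExp.eval_le_pow h hB _) (by omega) (lt (by simp only [WExp.size]; omega) hW),
      ihf (WExp.eval_le_pow h hB _) (by omega) (lt (by simp only [WExp.size]; omega) hW),
      (hv hl).trans_lt hW⟩
  | sub e f ihe ihf =>
    intro hl hW
    simp only [WExp.lits] at hl
    exact ⟨ihe (WExp.eval_le_pow h hB _) (by omega) (lt (by simp only [WExp.size]; omega) hW),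
      ihf (WExp.eval_le_pow h hB _) (by omega) (lt (by simp only [WExp.size]; omega) hW)⟩
  | mul e f ihe ihf =>
    intro hl hW
    have hl' := hl
    simp only [WExp.lits] at hl'
    exact ⟨ihe (WExp.eval_le_pow h hB _) (by omega) (lt (by simp only [WExp.size]; omega) hW),
      ihf (WExp.eval_le_pow h hB _) (by omega) (lt (by simp only [WExp.size]; omega) hW),
      (hv hl).trans_lt hW⟩
  | div e f ihe ihf =>
    intro hl hW
    simp only [WExp.lits] at hl
    exact ⟨ihe (WExp.eval_le_pow h hB _) (by omega) (lt (by simp only [WExp.size]; omega) hW),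
      ihf (WExp.eval_le_pow h hB _) (by omega) (lt (by simp only [WExp.size]; omega) hW)⟩

theorem XExp.fits {B W : ℕ} {σ : Store} (h : σ.AllLe B) (hB : 2 ≤ B) :
    ∀ e : XExp, e.lits ≤ B → B ^ e.size < W → e.Fits W σ := by
  have lt : ∀ {a b : ℕ}, a ≤ b → B ^ b < W → B ^ a < W := fun hab hb =>
    (Nat.pow_le_pow_right (by omega) hab).trans_lt hb
  intro e
  induction e with
  | lit k => intro _ _; trivial
  | reg r => intro _ _; trivial
  | cell a i => intro hl hW; exact i.fits h hB hl (lt (by simp [XExp.size]) hW)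
  | add e f ihe ihf | sub e f ihe ihf | mul e f ihe ihf | div e f ihe ihf =>
    intro hl hW
    simp only [XExp.lits] at hl
    exact ⟨ihe (by omega) (lt (by simp only [XExp.size]; omega) hW),
      ihf (by omega) (lt (by simp only [XExp.size]; omega) hW)⟩

theorem BExp.fits {B W : ℕ} {σ : Store} (h : σ.AllLe B) (hB : 2 ≤ B) :
    ∀ e : BExp, e.lits ≤ B → B ^ e.size < W → e.Fits W σ := by
  have lt : ∀ {a b : ℕ}, a ≤ b → B ^ b < W → B ^ a < W := fun hab hb =>
    (Nat.pow_le_pow_right (by omega) hab).trans_lt hb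
  intro e
  induction e with
  | wlt e f | weq e f =>
    intro hl hW
    simp only [BExp.lits] at hl
    exact ⟨e.fits h hB (by omega) (lt (by simp only [BExp.size]; omega) hW),
      f.fits h hB (by omega) (lt (by simp only [BExp.size]; omega) hW)⟩
  | xlt e f =>
    intro hl hW
    simp only [BExp.lits] at hl
    exact ⟨e.fits h hB (by omega) (lt (by simp only [BExp.size]; omega) hW),
      f.fits h hB (by omega) (lt (by simp only [BExp.size]; omega) hW)⟩
  | not b ih => intro hl hW; exact ih hl (lt (by simp [BExp.size]) hW)
  | and b c ihb ihc =>
    intro hl hW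
    simp only [BExp.lits] at hl
    exact ⟨ihb (by omega) (lt (by simp only [BExp.size]; omega) hW),
      ihc (by omega) (lt (by simp only [BExp.size]; omega) hW)⟩

/-- A safe program that runs for `T` steps from small words needs only words polynomial in `T`. -/
theorem Run.exec {B W : ℕ} (hB : 2 ≤ B) {p : Prog} {σ τ : Store} {T : ℕ} (h : Run p σ τ T) :
    ∀ {M : ℕ}, p.safe = true → σ.AllLe M → M + p.lits * (T + 1) ≤ B → B ^ p.esz < W →
      Exec W p σ τ T ∧ τ.AllLe (M + p.lits * T) := by
  have lt : ∀ {a b : ℕ}, a ≤ b → B ^ b < W → B ^ a < W := fun hab hb =>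
    (Nat.pow_le_pow_right (by omega) hab).trans_lt hb
  induction h with
  | skip σ => intro M _ hM _ _; exact ⟨.skip σ, hM.mono (Nat.le_add_right _ _)⟩
  | wset σ r e =>
    intro M hs hM hMB hW
    simp only [Prog.lits, Prog.safe, Prog.esz] at *
    have hl : e.lits ≤ e.lits * (e.size + 1) := Nat.le_mul_of_pos_right _ (by omega)
    have hl2 : e.lits ≤ e.lits * (e.size + 1 + 1) := Nat.le_mul_of_pos_right _ (by omega)
    refine ⟨.wset σ r e (e.fits (hM.mono (by omega)) hB (by omega) hW), fun q => ?_,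
      fun a i => (hM.2 a i).trans (Nat.le_add_right _ _)⟩
    have := e.eval_le_of_safe hM hs
    have := hM.1 q
    simp only [Store.setW, Function.update_apply]
    split_ifs <;> omega
  | xset σ r e =>
    intro M hs hM hMB hW
    simp only [Prog.lits, Prog.safe, Prog.esz] at *
    have hl2 : e.lits ≤ e.lits * (e.size + 1 + 1) := Nat.le_mul_of_pos_right _ (by omega)
    exact ⟨.xset σ r e (e.fits (hM.mono (by omega)) hB (by omega) hW),
      Store.AllLe.mono (M := M) ⟨hM.1, hM.2⟩ (Nat.le_add_right _ _)⟩
  | wput σ a i e =>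
    intro M hs hM hMB hW
    simp only [Prog.lits, Prog.safe, Prog.esz] at *
    have hl : i.lits + e.lits ≤ (i.lits + e.lits) * (i.size + e.size + 1) :=
      Nat.le_mul_of_pos_right _ (by omega)
    have hl2 : i.lits + e.lits ≤ (i.lits + e.lits) * (i.size + e.size + 1 + 1) :=
      Nat.le_mul_of_pos_right _ (by omega)
    refine ⟨.wput σ a i e (i.fits (hM.mono (by omega)) hB (by omega) (lt (by omega) hW))
      (e.fits (hM.mono (by omega)) hB (by omega) (lt (by omega) hW)),
      fun q => (hM.1 q).trans (Nat.le_add_right _ _), fun a' i' => ?_⟩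
    have := e.eval_le_of_safe hM hs
    have h1 := hM.2 a' i'
    have h2 := hM.2 a i'
    simp only [Store.putW, Function.update_apply]
    split_ifs
    · simp only [Function.update_apply]; split_ifs <;> omega
    · omega
  | xput σ a i e =>
    intro M hs hM hMB hW
    simp only [Prog.lits, Prog.safe, Prog.esz] at *
    have hl2 : i.lits + e.lits ≤ (i.lits + e.lits) * (i.size + e.size + 1 + 1) :=
      Nat.le_mul_of_pos_right _ (by omega)
    exact ⟨.xput σ a i e (i.fits (hM.mono (by omega)) hB (by omega) (lt (by omega) hW))
      (e.fits (hM.mono (by omega)) hB (by omega) (lt (by omega) hW)),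
      Store.AllLe.mono (M := M) ⟨hM.1, hM.2⟩ (Nat.le_add_right _ _)⟩
  | @seq p q σ τ υ S T hp hq ihp ihq =>
    intro M hs hM hMB hW
    simp only [Prog.lits, Prog.safe, Prog.esz, Bool.and_eq_true] at *
    have h1 : p.lits * (S + 1) ≤ (p.lits + q.lits) * (S + T + 1) :=
      Nat.mul_le_mul (by omega) (by omega)
    have h2 : p.lits * S + q.lits * (T + 1) ≤ (p.lits + q.lits) * (S + T + 1) := by nlinarith
    have h3 : p.lits * S + q.lits * T ≤ (p.lits + q.lits) * (S + T) := by nlinarith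
    obtain ⟨e1, a1⟩ := ihp hs.1 hM (by omega) (lt (by omega) hW)
    obtain ⟨e2, a2⟩ := ihq hs.2 a1 (by omega) (lt (by omega) hW)
    exact ⟨.seq e1 e2, a2.mono (by omega)⟩
  | @ite_true b p q σ τ T hb hp ihp =>
    intro M hs hM hMB hW
    simp only [Prog.lits, Prog.safe, Prog.esz, Bool.and_eq_true] at *
    have h1 : p.lits * (T + 1) ≤ (b.lits + p.lits + q.lits) * (b.size + 1 + T + 1) :=
      Nat.mul_le_mul (by omega) (by omega)
    have h2 : p.lits * T ≤ (b.lits + p.lits + q.lits) * (b.size + 1 + T) :=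
      Nat.mul_le_mul (by omega) (by omega)
    have h3 : b.lits + p.lits + q.lits ≤ (b.lits + p.lits + q.lits) * (b.size + 1 + T + 1) :=
      Nat.le_mul_of_pos_right _ (by omega)
    obtain ⟨e1, a1⟩ := ihp hs.1 hM (by omega) (lt (by omega) hW)
    exact ⟨.ite_true (b.fits (hM.mono (by omega)) hB (by omega) (lt (by omega) hW)) hb e1,
      a1.mono (by omega)⟩
  | @ite_false b p q σ τ T hb hp ihp =>
    intro M hs hM hMB hW
    simp only [Prog.lits, Prog.safe, Prog.esz, Bool.and_eq_true] at *
    have h1 : q.lits * (T + 1) ≤ (b.lits + p.lits + q.lits) * (b.size + 1 + T + 1) :=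
      Nat.mul_le_mul (by omega) (by omega)
    have h2 : q.lits * T ≤ (b.lits + p.lits + q.lits) * (b.size + 1 + T) :=
      Nat.mul_le_mul (by omega) (by omega)
    have h3 : b.lits + p.lits + q.lits ≤ (b.lits + p.lits + q.lits) * (b.size + 1 + T + 1) :=
      Nat.le_mul_of_pos_right _ (by omega)
    obtain ⟨e1, a1⟩ := ihp hs.2 hM (by omega) (lt (by omega) hW)
    exact ⟨.ite_false (b.fits (hM.mono (by omega)) hB (by omega) (lt (by omega) hW)) hb e1,
      a1.mono (by omega)⟩
  | @loop_done b p σ hb =>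
    intro M hs hM hMB hW
    simp only [Prog.lits, Prog.esz] at *
    have h3 : b.lits + p.lits ≤ (b.lits + p.lits) * (b.size + 1 + 1) :=
      Nat.le_mul_of_pos_right _ (by omega)
    exact ⟨.loop_done (b.fits (hM.mono (by omega)) hB (by omega) (lt (by omega) hW)) hb,
      hM.mono (Nat.le_add_right _ _)⟩
  | @loop_step b p σ τ υ S T hb hp hl ihp ihl =>
    intro M hs hM hMB hW
    have hs' : p.safe = true := hs
    simp only [Prog.lits, Prog.esz] at *
    have h1 : p.lits * (S + 1) ≤ (b.lits + p.lits) * (b.size + 1 + S + T + 1) :=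
      Nat.mul_le_mul (by omega) (by omega)
    have h2 : p.lits * S + (b.lits + p.lits) * (T + 1) ≤
        (b.lits + p.lits) * (b.size + 1 + S + T + 1) := by nlinarith
    have h3 : b.lits + p.lits ≤ (b.lits + p.lits) * (b.size + 1 + S + T + 1) :=
      Nat.le_mul_of_pos_right _ (by omega)
    have h4 : p.lits * S + (b.lits + p.lits) * T ≤
        (b.lits + p.lits) * (b.size + 1 + S + T) := by nlinarith
    obtain ⟨e1, a1⟩ := ihp hs' hM (by omega) (lt (by omega) hW)
    obtain ⟨e2, a2⟩ := ihl hs a1 (by omega) hW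
    exact ⟨.loop_step (b.fits (hM.mono (by omega)) hB (by omega) (lt (by omega) hW)) hb e1 e2,
      a2.mono (by omega)⟩

/-! ## Frames -/

/-- The registers and arrays that a program may modify, coded by `4 * r`, `4 * r + 1`, `4 * a + 2`
and `4 * a + 3` for word registers, real registers, word arrays and real arrays. -/
def Prog.mods : Prog → List ℕ
  | skip => []
  | wset r _ => [4 * r]
  | xset r _ => [4 * r + 1]
  | wput a _ _ => [4 * a + 2]
  | xput a _ _ => [4 * a + 3]
  | seq p q => p.mods ++ q.mods
  | ite _ p q => p.mods ++ q.mods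
  | loop _ p => p.mods

/-- The registers and arrays that an expression reads. -/
def WExp.rds : WExp → List ℕ
  | lit _ => []
  | reg r => [4 * r]
  | cell a i => (4 * a + 2) :: i.rds
  | add e f => e.rds ++ f.rds
  | sub e f => e.rds ++ f.rds
  | mul e f => e.rds ++ f.rds
  | div e f => e.rds ++ f.rds

/-- Two lists of codes have no common element. -/
def disj (l S : List ℕ) : Bool := l.all fun k => !S.contains k

theorem disj_iff {l S : List ℕ} : disj l S = true ↔ ∀ k ∈ l, k ∉ S := by
  simp [disj, List.all_eq_true]

/-- The states agree on all registers and arrays that are not in the list `S`. -/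
structure Agree (S : List ℕ) (σ τ : Store) : Prop where
  wreg : ∀ r, S.contains (4 * r) = false → τ.wreg r = σ.wreg r
  xreg : ∀ r, S.contains (4 * r + 1) = false → τ.xreg r = σ.xreg r
  warr : ∀ a, S.contains (4 * a + 2) = false → τ.warr a = σ.warr a
  xarr : ∀ a, S.contains (4 * a + 3) = false → τ.xarr a = σ.xarr a

theorem Agree.refl (S : List ℕ) (σ : Store) : Agree S σ σ :=
  ⟨fun _ _ => rfl, fun _ _ => rfl, fun _ _ => rfl, fun _ _ => rfl⟩

theorem Agree.trans {S : List ℕ} {σ τ υ : Store} (h : Agree S σ τ) (h' : Agree S τ υ) :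
    Agree S σ υ :=
  ⟨fun r hr => (h'.wreg r hr).trans (h.wreg r hr), fun r hr => (h'.xreg r hr).trans (h.xreg r hr),
    fun r hr => (h'.warr r hr).trans (h.warr r hr), fun r hr => (h'.xarr r hr).trans (h.xarr r hr)⟩

theorem Agree.mono {S S' : List ℕ} {σ τ : Store} (h : Agree S σ τ) (hS : ∀ k ∈ S, k ∈ S') :
    Agree S' σ τ := by
  have key : ∀ k, S'.contains k = false → S.contains k = false := by
    intro k hk
    simp only [List.contains_eq_mem, decide_eq_false_iff_not] at *
    exact fun h => hk (hS k h)
  exact ⟨fun r hr => h.wreg r (key _ hr), fun r hr => h.xreg r (key _ hr),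
    fun r hr => h.warr r (key _ hr), fun r hr => h.xarr r (key _ hr)⟩

/-- Inclusion of lists of codes. -/
def subl (S S' : List ℕ) : Bool := S.all fun k => S'.contains k

theorem Agree.up {S : List ℕ} (S' : List ℕ) {σ τ : Store} (h : Agree S σ τ)
    (hS : subl S S' = true) : Agree S' σ τ :=
  h.mono (by simpa [subl, List.all_eq_true] using hS)

theorem Agree.wexp {S : List ℕ} {σ τ : Store} (h : Agree S σ τ) :
    ∀ e : WExp, disj e.rds S = true → e.eval τ = e.eval σ := by
  intro e
  induction e with
  | lit k => intro _; rfl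
  | reg r => intro hd; exact h.wreg r (by simpa [disj, WExp.rds] using hd)
  | cell a i ih =>
    intro hd
    simp only [disj, WExp.rds, List.all_cons, Bool.and_eq_true] at hd
    simp only [WExp.eval]
    rw [ih hd.2, h.warr a (by simpa using hd.1)]
  | add e f ihe ihf | sub e f ihe ihf | mul e f ihe ihf | div e f ihe ihf =>
    intro hd
    simp only [disj, WExp.rds, List.all_append, Bool.and_eq_true] at hd
    simp only [WExp.eval]
    rw [ihe hd.1, ihf hd.2]

/-- The frame rule: what a program leaves alone is read off its text, so that side conditions become
finite checks on lists of codes and specifications only mention what changes. -/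
theorem Run.agree {p : Prog} {σ τ : Store} {T : ℕ} (h : Run p σ τ T) : Agree p.mods σ τ := by
  induction h with
  | skip σ => exact .refl _ _
  | wset σ r e =>
    refine ⟨fun q hq => ?_, fun _ _ => rfl, fun _ _ => rfl, fun _ _ => rfl⟩
    simp only [Prog.mods, List.contains_eq_mem, List.mem_singleton, decide_eq_false_iff_not] at hq
    exact Function.update_of_ne (by omega) _ _
  | xset σ r e =>
    refine ⟨fun _ _ => rfl, fun q hq => ?_, fun _ _ => rfl, fun _ _ => rfl⟩
    simp only [Prog.mods, List.contains_eq_mem, List.mem_singleton, decide_eq_false_iff_not] at hq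
    exact Function.update_of_ne (by omega) _ _
  | wput σ a i e =>
    refine ⟨fun _ _ => rfl, fun _ _ => rfl, fun q hq => ?_, fun _ _ => rfl⟩
    simp only [Prog.mods, List.contains_eq_mem, List.mem_singleton, decide_eq_false_iff_not] at hq
    exact Function.update_of_ne (by omega) _ _
  | xput σ a i e =>
    refine ⟨fun _ _ => rfl, fun _ _ => rfl, fun _ _ => rfl, fun q hq => ?_⟩
    simp only [Prog.mods, List.contains_eq_mem, List.mem_singleton, decide_eq_false_iff_not] at hq
    exact Function.update_of_ne (by omega) _ _
  | seq _ _ ihp ihq =>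
    exact (ihp.mono fun k hk => List.mem_append_left _ hk).trans
      (ihq.mono fun k hk => List.mem_append_right _ hk)
  | ite_true _ _ ih => exact ih.mono fun k hk => List.mem_append_left _ hk
  | ite_false _ _ ih => exact ih.mono fun k hk => List.mem_append_right _ hk
  | loop_done _ => exact .refl _ _
  | loop_step _ _ _ ihp ihl => exact Agree.trans ihp ihl

/-! ## Total correctness with time bounds -/

/-- From `σ`, the program `p` halts within `T` steps in a state that satisfies `Q`. -/
def Tri (p : Prog) (σ : Store) (T : ℕ) (Q : Store → Prop) : Prop :=
  ∃ τ t, Run p σ τ t ∧ t ≤ T ∧ Q τ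

/-- The consequence rule, with the frame condition available for the new postcondition. `Tri.seq`
passes it to the second program in the same way. -/
theorem Tri.mono {p : Prog} {σ : Store} {S T : ℕ} {P Q : Store → Prop} (h : Tri p σ S P)
    (hT : S ≤ T) (hQ : ∀ τ, Agree p.mods σ τ → P τ → Q τ) : Tri p σ T Q := by
  obtain ⟨τ, t, hr, ht, hP⟩ := h
  exact ⟨τ, t, hr, ht.trans hT, hQ τ hr.agree hP⟩

theorem Tri.seq {p q : Prog} {σ : Store} {S T : ℕ} {P Q : Store → Prop} (hp : Tri p σ S P)
    (hq : ∀ τ, Agree p.mods σ τ → P τ → Tri q τ T Q) : Tri (Prog.seq p q) σ (S + T) Q := by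
  obtain ⟨τ, t, hr, ht, hP⟩ := hp
  obtain ⟨υ, s, hr', hs, hQ⟩ := hq τ hr.agree hP
  exact ⟨υ, t + s, .seq hr hr', by omega, hQ⟩

theorem Tri.seq_le {p q : Prog} {σ : Store} {S T U : ℕ} {P Q : Store → Prop} (hp : Tri p σ S P)
    (hT : S + T ≤ U) (hq : ∀ τ, Agree p.mods σ τ → P τ → Tri q τ T Q) : Tri (Prog.seq p q) σ U Q :=
  Tri.mono (Tri.seq hp hq) hT fun _ _ h => h

theorem Tri.ite {b : BExp} {p q : Prog} {σ : Store} {T : ℕ} {Q : Store → Prop}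
    (hp : b.Holds σ → Tri p σ T Q) (hq : ¬ b.Holds σ → Tri q σ T Q) :
    Tri (Prog.ite b p q) σ (b.size + 1 + T) Q := by
  by_cases hb : b.Holds σ
  · obtain ⟨τ, t, hr, ht, hQ⟩ := hp hb
    exact ⟨τ, _, .ite_true hb hr, by omega, hQ⟩
  · obtain ⟨τ, t, hr, ht, hQ⟩ := hq hb
    exact ⟨τ, _, .ite_false hb hr, by omega, hQ⟩

/-- The program has no loop. -/
def Prog.lf : Prog → Bool
  | seq p q => p.lf && q.lf
  | ite _ p q => p.lf && q.lf
  | loop _ _ => false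
  | _ => true

/-- A bound for the number of steps of a program without loops. -/
def Prog.cost : Prog → ℕ
  | skip => 1
  | wset _ e => e.size + 1
  | xset _ e => e.size + 1
  | wput _ i e => i.size + e.size + 1
  | xput _ i e => i.size + e.size + 1
  | seq p q => p.cost + q.cost
  | ite b p q => b.size + 1 + (p.cost + q.cost)
  | loop _ _ => 0

open Classical in
/-- The final state of a program without loops. -/
noncomputable def Prog.den : Prog → Store → Store
  | skip, σ => σ
  | wset r e, σ => σ.setW r (e.eval σ)
  | xset r e, σ => σ.setX r (e.eval σ)
  | wput a i e, σ => σ.putW a (i.eval σ) (e.eval σ)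
  | xput a i e, σ => σ.putX a (i.eval σ) (e.eval σ)
  | seq p q, σ => q.den (p.den σ)
  | ite b p q, σ => if b.Holds σ then p.den σ else q.den σ
  | loop _ _, σ => σ

theorem Prog.run_den : ∀ (p : Prog) (σ : Store), p.lf = true →
    ∃ t ≤ p.cost, Run p σ (p.den σ) t := by
  intro p
  induction p with
  | skip => intro σ _; exact ⟨_, le_rfl, .skip σ⟩
  | wset r e => intro σ _; exact ⟨_, le_rfl, .wset σ r e⟩
  | xset r e => intro σ _; exact ⟨_, le_rfl, .xset σ r e⟩
  | wput a i e => intro σ _; exact ⟨_, le_rfl, .wput σ a i e⟩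
  | xput a i e => intro σ _; exact ⟨_, le_rfl, .xput σ a i e⟩
  | seq p q ihp ihq =>
    intro σ h
    simp only [Prog.lf, Bool.and_eq_true] at h
    obtain ⟨s, hs, hp⟩ := ihp σ h.1
    obtain ⟨t, ht, hq⟩ := ihq (p.den σ) h.2
    exact ⟨s + t, by simp only [Prog.cost]; omega, .seq hp hq⟩
  | ite b p q ihp ihq =>
    intro σ h
    simp only [Prog.lf, Bool.and_eq_true] at h
    simp only [Prog.cost, Prog.den]
    split_ifs with hb
    · obtain ⟨s, hs, hp⟩ := ihp σ h.1
      exact ⟨_, by omega, .ite_true hb hp⟩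
    · obtain ⟨s, hs, hp⟩ := ihq σ h.2
      exact ⟨_, by omega, .ite_false hb hp⟩
  | loop b p _ => intro σ h; simp [Prog.lf] at h

theorem Tri.lf {p : Prog} {σ : Store} {T : ℕ} {Q : Store → Prop} (h : p.lf = true)
    (hT : p.cost ≤ T) (hQ : Q (p.den σ)) : Tri p σ T Q := by
  obtain ⟨t, ht, hr⟩ := p.run_den σ h
  exact ⟨_, t, hr, ht.trans hT, hQ⟩

/-- The variant `V` bounds the number of iterations, so an amortised cost is expressed by the choice
of `V`. -/
theorem Tri.loop {b : BExp} {p : Prog} {σ₀ : Store} {T : ℕ} (J : Store → Prop) (V : Store → ℕ)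
    (h₀ : J σ₀) (hs : ∀ σ, Agree p.mods σ₀ σ → J σ → b.Holds σ →
      Tri p σ T fun τ => J τ ∧ V τ < V σ) :
    Tri (Prog.loop b p) σ₀ (V σ₀ * (T + b.size + 1) + (b.size + 1))
      fun τ => J τ ∧ ¬ b.Holds τ := by
  suffices H : ∀ v σ, V σ = v → Agree p.mods σ₀ σ → J σ →
      Tri (Prog.loop b p) σ (v * (T + b.size + 1) + (b.size + 1)) fun τ => J τ ∧ ¬ b.Holds τ from
    H _ σ₀ rfl (.refl _ _) h₀
  intro v
  induction v using Nat.strong_induction_on with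
  | _ v ih =>
    intro σ hv ha hJ
    by_cases hb : b.Holds σ
    · obtain ⟨τ, t, hr, ht, hJ', hV⟩ := hs σ ha hJ hb
      obtain ⟨υ, s, hr', hs', hQ⟩ := ih (V τ) (by omega) τ rfl (ha.trans hr.agree) hJ'
      refine ⟨υ, _, .loop_step hb hr hr', ?_, hQ⟩
      have : (V τ + 1) * (T + b.size + 1) ≤ v * (T + b.size + 1) :=
        Nat.mul_le_mul_right _ (by omega)
      rw [Nat.add_mul] at this
      omega
    · exact ⟨σ, _, .loop_done hb, by omega, hJ, hb⟩

/-- `for r = 0, …, e - 1 do p`. -/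
def Prog.for_ (r : ℕ) (e : WExp) (p : Prog) : Prog :=
  .seq (.wset r (.lit 0)) (.loop (.wlt (.reg r) e) (.seq p (.wset r (.add (.reg r) (.lit 1)))))

/-- Times that vary with the iteration are needed for the passes over all vertices in the greedy
choice, where only the sum of the list lengths is bounded. -/
theorem Tri.for_sum {r : ℕ} {e : WExp} {p : Prog} {σ₀ : Store} {N : ℕ} (T : ℕ → ℕ)
    (J : ℕ → Store → Prop) (hN : e.eval σ₀ = N) (hd : disj e.rds (4 * r :: p.mods) = true)
    (hr : p.mods.contains (4 * r) = false) (h₀ : J 0 (σ₀.setW r 0))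
    (hs : ∀ i < N, ∀ σ, Agree (4 * r :: p.mods) σ₀ σ → σ.wreg r = i → J i σ →
      Tri p σ (T i) fun τ => J (i + 1) (τ.setW r (i + 1))) :
    Tri (Prog.for_ r e p) σ₀ (∑ i ∈ Finset.range N, (T i + (e.size + 7)) + (e.size + 5))
      fun τ => J N τ ∧ τ.wreg r = N := by
  have hset : ∀ (σ : Store) v, Agree (4 * r :: p.mods) σ (σ.setW r v) := fun σ v => by
    refine ⟨fun q hq => ?_, fun _ _ => rfl, fun _ _ => rfl, fun _ _ => rfl⟩
    simp only [List.contains_cons, Bool.or_eq_false_iff, beq_eq_false_iff_ne] at hq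
    exact Function.update_of_ne (by omega) _ _
  have hreg : ∀ (σ : Store) v, (σ.setW r v).wreg r = v := fun σ v => Function.update_self _ _ _
  suffices H : ∀ k ≤ N, ∀ σ, Agree (4 * r :: p.mods) σ₀ σ → σ.wreg r = N - k → J (N - k) σ →
      Tri (.loop (.wlt (.reg r) e) (.seq p (.wset r (.add (.reg r) (.lit 1))))) σ
        (∑ i ∈ Finset.Ico (N - k) N, (T i + (e.size + 7)) + (e.size + 3))
        fun τ => J N τ ∧ τ.wreg r = N by
    obtain ⟨τ, t, hrun, ht, hQ⟩ := H N le_rfl (σ₀.setW r 0) (hset _ _)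
      (by simp [hreg]) (by simpa using h₀)
    refine ⟨τ, _, .seq (.wset _ _ _) hrun, ?_, hQ⟩
    simp only [Nat.sub_self, ← Finset.range_eq_Ico] at ht
    simp only [WExp.size]; omega
  intro k
  induction k with
  | zero =>
    intro _ σ ha hw hJ
    refine ⟨σ, _, .loop_done ?_, ?_, by simpa using hJ, by simpa using hw⟩
    · simp only [BExp.Holds, WExp.eval, hw, ha.wexp e hd, hN]; omega
    · simp only [BExp.size, WExp.size]; omega
  | succ k ih =>
    intro hk σ ha hw hJ
    obtain ⟨τ, t, hrun, ht, hJ'⟩ := hs (N - (k + 1)) (by omega) σ ha hw hJ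
    have hτ : τ.wreg r = N - (k + 1) := (hrun.agree.wreg r hr).trans hw
    have hstep : Run (.wset r (.add (.reg r) (.lit 1))) τ (τ.setW r (N - (k + 1) + 1)) 4 := by
      have := Run.wset τ r (.add (.reg r) (.lit 1))
      simpa only [WExp.eval, hτ, WExp.size] using this
    have hNk : N - (k + 1) + 1 = N - k := by omega
    obtain ⟨υ, s, hrun', hs', hQ⟩ := ih (by omega) (τ.setW r (N - (k + 1) + 1))
      ((ha.trans (hrun.agree.mono fun _ h => List.mem_cons_of_mem _ h)).trans (hset _ _))
      (by rw [hreg, hNk]) (by rw [← hNk]; exact hJ')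
    refine ⟨υ, _, .loop_step ?_ (.seq hrun hstep) hrun', ?_, hQ⟩
    · simp only [BExp.Holds, WExp.eval, hw, ha.wexp e hd, hN]; omega
    · rw [Finset.sum_eq_sum_Ico_succ_bot (by omega : N - (k + 1) < N), hNk]
      simp only [BExp.size, WExp.size]; omega

theorem Tri.for_ {r : ℕ} {e : WExp} {p : Prog} {σ₀ : Store} {N : ℕ} (T : ℕ)
    (J : ℕ → Store → Prop) (hN : e.eval σ₀ = N) (hd : disj e.rds (4 * r :: p.mods) = true)
    (hr : p.mods.contains (4 * r) = false) (h₀ : J 0 (σ₀.setW r 0))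
    (hs : ∀ i < N, ∀ σ, Agree (4 * r :: p.mods) σ₀ σ → σ.wreg r = i → J i σ →
      Tri p σ T fun τ => J (i + 1) (τ.setW r (i + 1))) :
    Tri (Prog.for_ r e p) σ₀ (N * (T + (e.size + 7)) + (e.size + 5))
      fun τ => J N τ ∧ τ.wreg r = N := by
  simpa using Tri.for_sum (fun _ => T) J hN hd hr h₀ hs

/-- A loop each of whose iterations achieves something that later iterations preserve. -/
theorem Tri.for_each {r : ℕ} {e : WExp} {p : Prog} {σ₀ : Store} {N : ℕ} (T : ℕ)
    (R : Store → Store → Prop) (Q : ℕ → Store → Prop)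
    (hN : e.eval σ₀ = N) (hd : disj e.rds (4 * r :: p.mods) = true)
    (hr : p.mods.contains (4 * r) = false)
    (hrefl : ∀ σ v, R σ (σ.setW r v)) (htrans : ∀ σ τ υ, R σ τ → R τ υ → R σ υ)
    (hQ : ∀ i < N, ∀ σ τ, R σ τ → Q i σ → Q i τ)
    (hs : ∀ i < N, ∀ σ, Agree (4 * r :: p.mods) σ₀ σ → σ.wreg r = i → R σ₀ σ →
      Tri p σ T fun τ => R σ τ ∧ Q i τ) :
    Tri (Prog.for_ r e p) σ₀ (N * (T + (e.size + 7)) + (e.size + 5))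
      fun τ => R σ₀ τ ∧ ∀ i < N, Q i τ := by
  refine Tri.mono (Tri.for_ T (fun k τ => R σ₀ τ ∧ ∀ i < k, i < N → Q i τ) hN hd hr
    ⟨hrefl _ _, fun i hi => absurd hi (Nat.not_lt_zero i)⟩ ?_) le_rfl
    (fun τ _ h => ⟨h.1.1, fun i hi => h.1.2 i hi hi⟩)
  intro i hi σ ha hw hJ
  refine Tri.mono (hs i hi σ ha hw hJ.1) le_rfl fun τ _ h => ⟨?_, ?_⟩
  · exact htrans _ _ _ hJ.1 (htrans _ _ _ h.1 (hrefl _ _))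
  · intro k hk hkN
    refine hQ k hkN _ _ (hrefl τ _) ?_
    rcases Nat.lt_succ_iff_lt_or_eq.mp hk with h' | h'
    · exact hQ k hkN _ _ h.1 (hJ.2 k h' hkN)
    · exact h' ▸ h.2

end RealRAM

/-! ### Updates of states, and tables that only improve -/

namespace RealRAM

section StoreLemmas
variable (σ : Store) (r q a a' i : ℕ) (v : ℕ) (x : ℝ)

@[simp] theorem setW_wreg : (σ.setW r v).wreg q = if q = r then v else σ.wreg q := by
  simp [Store.setW, Function.update_apply]
@[simp] theorem setW_xreg : (σ.setW r v).xreg = σ.xreg := rfl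
@[simp] theorem setW_warr : (σ.setW r v).warr = σ.warr := rfl
@[simp] theorem setW_xarr : (σ.setW r v).xarr = σ.xarr := rfl
@[simp] theorem setX_xreg : (σ.setX r x).xreg q = if q = r then x else σ.xreg q := by
  simp [Store.setX, Function.update_apply]
@[simp] theorem setX_wreg : (σ.setX r x).wreg = σ.wreg := rfl
@[simp] theorem setX_warr : (σ.setX r x).warr = σ.warr := rfl
@[simp] theorem setX_xarr : (σ.setX r x).xarr = σ.xarr := rfl
@[simp] theorem putW_warr : (σ.putW a i v).warr a' =
    if a' = a then Function.update (σ.warr a) i v else σ.warr a' := by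
  simp [Store.putW, Function.update_apply]
@[simp] theorem putW_wreg : (σ.putW a i v).wreg = σ.wreg := rfl
@[simp] theorem putW_xreg : (σ.putW a i v).xreg = σ.xreg := rfl
@[simp] theorem putW_xarr : (σ.putW a i v).xarr = σ.xarr := rfl
@[simp] theorem putX_xarr : (σ.putX a i x).xarr a' =
    if a' = a then Function.update (σ.xarr a) i x else σ.xarr a' := by
  simp [Store.putX, Function.update_apply]
@[simp] theorem putX_wreg : (σ.putX a i x).wreg = σ.wreg := rfl
@[simp] theorem putX_xreg : (σ.putX a i x).xreg = σ.xreg := rfl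
@[simp] theorem putX_warr : (σ.putX a i x).warr = σ.warr := rfl

end StoreLemmas

/-! ## Tables of upper bounds

A table consists of a word array `fa` of flags (zero means infinity), a real array `va` of values and
a word array `pa` of witnesses. -/

/-- Entry `i` of the table is at most `r`. -/
def Store.ub (σ : Store) (fa va i : ℕ) (r : ℝ) : Prop := σ.warr fa i ≠ 0 ∧ σ.xarr va i ≤ r

theorem Store.ub.mono {σ : Store} {fa va i : ℕ} {r s : ℝ} (h : σ.ub fa va i r) (hrs : r ≤ s) :
    σ.ub fa va i s := ⟨h.1, h.2.trans hrs⟩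

/-- All finite entries of the table satisfy `S`. -/
def Store.Snd (σ : Store) (fa va pa : ℕ) (S : ℕ → ℝ → ℕ → Prop) : Prop :=
  ∀ i, σ.warr fa i ≠ 0 → S i (σ.xarr va i) (σ.warr pa i)

/-- The table has only been improved, by entries that satisfy `S`. -/
structure Imp (fa va pa : ℕ) (S : ℕ → ℝ → ℕ → Prop) (σ τ : Store) : Prop where
  ub : ∀ i r, σ.ub fa va i r → τ.ub fa va i r
  snd : σ.Snd fa va pa S → τ.Snd fa va pa S

theorem Imp.refl' {fa va pa : ℕ} {S : ℕ → ℝ → ℕ → Prop} {σ τ : Store} (hf : τ.warr fa = σ.warr fa)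
    (hv : τ.xarr va = σ.xarr va) (hp : τ.warr pa = σ.warr pa) : Imp fa va pa S σ τ := by
  refine ⟨fun i r h => ?_, fun h i hi => ?_⟩
  · unfold Store.ub at *; rwa [hf, hv]
  · rw [hf] at hi; rw [hv, hp]; exact h i hi

theorem Imp.refl {fa va pa : ℕ} {S : ℕ → ℝ → ℕ → Prop} (σ : Store) : Imp fa va pa S σ σ :=
  .refl' rfl rfl rfl

theorem Imp.trans {fa va pa : ℕ} {S : ℕ → ℝ → ℕ → Prop} {σ τ υ : Store} (h : Imp fa va pa S σ τ)
    (h' : Imp fa va pa S τ υ) : Imp fa va pa S σ υ :=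
  ⟨fun i r hi => h'.ub i r (h.ub i r hi), fun hs => h'.snd (h.snd hs)⟩

theorem Agree.imp {L : List ℕ} {σ τ : Store} (h : Agree L σ τ) (fa va pa : ℕ)
    {S : ℕ → ℝ → ℕ → Prop} (hd : disj [4 * fa + 2, 4 * va + 3, 4 * pa + 2] L = true) :
    Imp fa va pa S σ τ := by
  simp [disj] at hd
  exact .refl' (h.warr fa (by simp [hd])) (h.xarr va (by simp [hd])) (h.warr pa (by simp [hd]))

/-- If `g` holds, improve entry `ie` to `ce` with witness `pe`, unless it is already as good. -/
def Prog.relax (g : BExp) (ce : XExp) (fa va pa : ℕ) (ie pe : WExp) : Prog :=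
  .ite g (.seq (.xset 1 ce)
    (.ite (.not (.and (.not (.weq (.cell fa ie) (.lit 0))) (.not (.xlt (.reg 1) (.cell va ie)))))
      (.seq (.wput fa ie (.lit 1)) (.seq (.xput va ie (.reg 1)) (.wput pa ie pe))) .skip)) .skip

/-- All tables of bounds are changed by this program alone. An entry is replaced only if it is
infinite or larger than the candidate, so known bounds survive; soundness has to be checked for the
candidate only. The index and the witness are evaluated again after real register 1 and the first
two arrays have changed, so they must not read the arrays. -/
theorem Tri.relax {g : BExp} {ce : XExp} {fa va pa : ℕ} {ie pe : WExp} {T : ℕ} {σ : Store}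
    (S : ℕ → ℝ → ℕ → Prop)
    (hd : disj (ie.rds ++ pe.rds) [4 * fa + 2, 5, 4 * va + 3] = true) (hne : fa ≠ pa)
    (hT : (Prog.relax g ce fa va pa ie pe).cost ≤ T)
    (hS : g.Holds σ → σ.Snd fa va pa S → S (ie.eval σ) (ce.eval σ) (pe.eval σ)) :
    Tri (Prog.relax g ce fa va pa ie pe) σ T fun τ =>
      Imp fa va pa S σ τ ∧ (g.Holds σ → τ.ub fa va (ie.eval σ) (ce.eval σ)) := by
  refine Tri.lf rfl hT ?_
  have hdi : disj ie.rds [4 * fa + 2, 5, 4 * va + 3] = true := by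
    rw [disj_iff] at *; exact fun k hk => hd k (List.mem_append_left _ hk)
  have hdp : disj pe.rds [4 * fa + 2, 5, 4 * va + 3] = true := by
    rw [disj_iff] at *; exact fun k hk => hd k (List.mem_append_right _ hk)
  have a1 : ∀ c, Agree [4 * fa + 2, 5, 4 * va + 3] σ (σ.setX 1 c) := fun c =>
    (Run.xset σ 1 (.reg 1)).agree.mono (by simp [Prog.mods]) |>.trans <| by
      refine ⟨fun _ _ => rfl, fun q hq => ?_, fun _ _ => rfl, fun _ _ => rfl⟩
      simp only [List.contains_eq_mem, List.mem_cons, decide_eq_false_iff_not, not_or] at hq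
      have : q ≠ 1 := by omega
      simp [this]
  have a2 : ∀ ρ i c, Agree [4 * fa + 2, 5, 4 * va + 3] σ ρ →
      Agree [4 * fa + 2, 5, 4 * va + 3] σ (ρ.putW fa i c) := fun ρ i c h => h.trans <| by
      refine ⟨fun _ _ => rfl, fun _ _ => rfl, fun q hq => ?_, fun _ _ => rfl⟩
      simp only [List.contains_eq_mem, List.mem_cons, decide_eq_false_iff_not, not_or] at hq
      have : q ≠ fa := by omega
      simp [this]
  have a3 : ∀ ρ i c, Agree [4 * fa + 2, 5, 4 * va + 3] σ ρ →
      Agree [4 * fa + 2, 5, 4 * va + 3] σ (ρ.putX va i c) := fun ρ i c h => h.trans <| by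
      refine ⟨fun _ _ => rfl, fun _ _ => rfl, fun _ _ => rfl, fun q hq => ?_⟩
      simp only [List.contains_eq_mem, List.mem_cons, decide_eq_false_iff_not, not_or] at hq
      have : q ≠ va := by omega
      simp [this]
  by_cases hg : g.Holds σ
  · simp only [Prog.relax, Prog.den, hg, if_true, BExp.Holds, WExp.eval, XExp.eval, setX_warr,
      setX_xarr, setX_xreg, (a1 _).wexp ie hdi, forall_true_left]
    split_ifs with hc
    · simp only [not_lt] at hc
      exact ⟨.refl' rfl rfl rfl, hc⟩
    · rw [(a2 _ _ _ (a1 _)).wexp ie hdi, (a3 _ _ _ (a2 _ _ _ (a1 _))).wexp ie hdi,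
        (a3 _ _ _ (a2 _ _ _ (a1 _))).wexp pe hdp]
      refine ⟨⟨fun i r h => ?_, fun h i hi => ?_⟩, ?_⟩
      · unfold Store.ub at *
        by_cases hi : i = ie.eval σ
        · subst hi
          simp only [not_and, not_not] at hc
          have := hc h.1
          simp [hne]; linarith [h.2]
        · simpa [hne, hi, Function.update_apply] using h
      · by_cases hi' : i = ie.eval σ
        · subst hi'
          simpa [hne] using hS hg h
        · simp [hne, hne.symm, hi'] at hi ⊢
          exact h i hi
      · simp [Store.ub, hne]
  · simp only [Prog.relax, Prog.den, hg, if_false]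
    exact ⟨.refl _, fun h => h.elim⟩

end RealRAM

/-! ## Discounted walks in graphs on natural numbers -/

/-- A directed multigraph with vertices `0, …, n - 1` and edges `0, …, m - 1`. -/
structure Gr where
  n : ℕ
  m : ℕ
  tl : ℕ → ℕ
  hd : ℕ → ℕ
  c : ℕ → ℝ
  g : ℝ
  tl_lt : ∀ e < m, tl e < n
  hd_lt : ∀ e < m, hd e < n
  g_pos : 0 < g
  g_lt : g < 1

namespace Gr

/-- `P` is a walk from `u` to `v`. -/
def W (G : Gr) : ℕ → List ℕ → ℕ → Prop
  | u, [], v => u = v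
  | u, e :: P, v => e < G.m ∧ G.tl e = u ∧ G.W (G.hd e) P v

/-- The discounted cost of a walk. -/
def co (G : Gr) : List ℕ → ℝ
  | [] => 0
  | e :: P => G.c e + G.g * G.co P

/-- There is a walk from `u` to `v`. -/
def R (G : Gr) (u v : ℕ) : Prop := ∃ P, G.W u P v

variable {G : Gr}

theorem W_append {P Q : List ℕ} : ∀ {u v : ℕ}, G.W u (P ++ Q) v ↔ ∃ w, G.W u P w ∧ G.W w Q v := by
  induction P with
  | nil => intro u v; simp [W]
  | cons e P ih =>
    intro u v
    simp only [List.cons_append, W, ih]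
    constructor
    · rintro ⟨h1, h2, w, h3, h4⟩; exact ⟨w, ⟨h1, h2, h3⟩, h4⟩
    · rintro ⟨w, ⟨h1, h2, h3⟩, h4⟩; exact ⟨h1, h2, w, h3, h4⟩

theorem W.append {P Q : List ℕ} {u v w : ℕ} (h : G.W u P v) (h' : G.W v Q w) :
    G.W u (P ++ Q) w := W_append.2 ⟨v, h, h'⟩

theorem W.unique {P : List ℕ} : ∀ {u v w : ℕ}, G.W u P v → G.W u P w → v = w := by
  induction P with
  | nil => intro u v w h h'; exact h.symm.trans h'
  | cons e P ih => intro u v w h h'; exact ih h.2.2 h'.2.2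

theorem co_append (P Q : List ℕ) : G.co (P ++ Q) = G.co P + G.g ^ P.length * G.co Q := by
  induction P with
  | nil => simp [co]
  | cons e P ih => simp only [List.cons_append, co, ih, List.length_cons]; ring

theorem W.lt {P : List ℕ} : ∀ {u v : ℕ}, G.W u P v → u < G.n → v < G.n := by
  induction P with
  | nil => intro u v h hu; exact h ▸ hu
  | cons e P ih => intro u v h _; exact ih h.2.2 (G.hd_lt e h.1)

theorem W.lt_left {P : List ℕ} : ∀ {u v : ℕ}, G.W u P v → v < G.n → u < G.n := by
  cases P with
  | nil => intro u v h hu; exact h ▸ hu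
  | cons e P => intro u v h _; exact h.2.1 ▸ G.tl_lt e h.1

theorem W_snoc {P : List ℕ} {e u v : ℕ} :
    G.W u (P ++ [e]) v ↔ G.W u P (G.tl e) ∧ e < G.m ∧ G.hd e = v := by
  rw [W_append]
  constructor
  · rintro ⟨w, h, h1, h2, h3⟩; exact ⟨h2 ▸ h, h1, h3⟩
  · rintro ⟨h, h1, h2⟩; exact ⟨_, h, h1, rfl, h2⟩

theorem co_snoc (P : List ℕ) (e : ℕ) : G.co (P ++ [e]) = G.co P + G.g ^ P.length * G.c e := by
  simp [co_append, co]

theorem W.split {u v : ℕ} {P : List ℕ} (h : G.W u P v) (k : ℕ) :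
    ∃ w, G.W u (P.take k) w ∧ G.W w (P.drop k) v := by
  rw [← W_append, List.take_append_drop]; exact h

theorem R.refl (u : ℕ) : G.R u u := ⟨[], rfl⟩

theorem R.trans {u v w : ℕ} : G.R u v → G.R v w → G.R u w
  | ⟨P, hP⟩, ⟨Q, hQ⟩ => ⟨P ++ Q, hP.append hQ⟩

theorem W.r {u v : ℕ} {P : List ℕ} (h : G.W u P v) : G.R u v := ⟨P, h⟩

theorem R.edge {e : ℕ} (h : e < G.m) : G.R (G.tl e) (G.hd e) := ⟨[e], h, rfl, rfl⟩

/-- The end of a walk that starts at `u`. -/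
def en (G : Gr) (u : ℕ) (P : List ℕ) : ℕ := P.foldl (fun _ e => G.hd e) u

theorem W.en_eq {P : List ℕ} : ∀ {u v : ℕ}, G.W u P v → G.en u P = v := by
  induction P with
  | nil => intro u v h; exact h
  | cons e P ih => intro u v h; exact ih h.2.2

theorem W.take {u v : ℕ} {P : List ℕ} (h : G.W u P v) (k : ℕ) :
    G.W u (P.take k) (G.en u (P.take k)) ∧ G.W (G.en u (P.take k)) (P.drop k) v := by
  obtain ⟨w, h1, h2⟩ := h.split k
  rw [h1.en_eq]; exact ⟨h1, h2⟩

/-- The walk `P` from `b` to `v` visits some vertex twice. -/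
def Rep (G : Gr) (b : ℕ) (P : List ℕ) (v : ℕ) : Prop :=
  ∃ A C D w, P = A ++ (C ++ D) ∧ C ≠ [] ∧ G.W b A w ∧ G.W w C w ∧ G.W w D v

theorem W.rep {b v : ℕ} {P : List ℕ} (h : G.W b P v) {i j : ℕ} (hij : i < j) (hj : j ≤ P.length)
    (he : G.en b (P.take i) = G.en b (P.take j)) : G.Rep b P v := by
  obtain ⟨h1, h2⟩ := h.take i
  obtain ⟨h3, h4⟩ := h2.take (j - i)
  have e1 : P.take j = P.take i ++ (P.drop i).take (j - i) := by
    rw [← List.take_add]; congr 1; omega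
  have e2 : G.en (G.en b (P.take i)) ((P.drop i).take (j - i)) = G.en b (P.take i) := by
    have := (h.take j).1
    rw [e1] at this
    have := this.unique (h1.append h3)
    rw [← this, ← e1, ← he]
  rw [e2] at h3 h4
  refine ⟨P.take i, (P.drop i).take (j - i), (P.drop i).drop (j - i), _, ?_, ?_, h1, h3, h4⟩
  · simp
  · intro h0
    have := congrArg List.length h0
    simp at this; omega

theorem W.rep_of_length {b v : ℕ} {P : List ℕ} (h : G.W b P v) (hb : b < G.n)
    (hl : G.n ≤ P.length) : G.Rep b P v := by
  have hm : ∀ k ∈ Finset.range (P.length + 1), G.en b (P.take k) ∈ Finset.range G.n := fun k _ =>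
    Finset.mem_range.2 ((h.take k).1.lt hb)
  obtain ⟨i, hi, j, hj, hne, he⟩ :=
    Finset.exists_ne_map_eq_of_card_lt_of_maps_to (by simp; omega) hm
  simp only [Finset.mem_range] at hi hj
  rcases lt_or_gt_of_ne hne with h' | h'
  · exact h.rep h' (by omega) he
  · exact h.rep h' (by omega) he.symm

/-! ## Optimal values and tight walks -/

/-- `x t v` is the discounted distance from `v` to `t` wherever `t` is reachable: the optimality
equations. -/
structure Val (G : Gr) (x : ℕ → ℕ → ℝ) : Prop where
  self_le : ∀ t, x t t ≤ 0
  edge : ∀ t e, e < G.m → G.R (G.hd e) t → x t (G.tl e) ≤ G.c e + G.g * x t (G.hd e)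
  tight : ∀ t v, G.R v t → (v = t ∧ x t t = 0) ∨
    ∃ e < G.m, G.tl e = v ∧ G.R (G.hd e) t ∧ x t v = G.c e + G.g * x t (G.hd e)

variable {x : ℕ → ℕ → ℝ}

/-- The edge inequality iterated along the walk; the source of all soundness statements. -/
theorem Val.walk (hx : G.Val x) {t : ℕ} {P : List ℕ} : ∀ {u v : ℕ}, G.W u P v → G.R v t →
    x t u ≤ G.co P + G.g ^ P.length * x t v := by
  induction P with
  | nil => intro u v h _; simp [co, show u = v from h]
  | cons e P ih =>
    intro u v h hv
    have h1 := hx.edge t e h.1 (R.trans ⟨P, h.2.2⟩ hv)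
    have h2 := mul_le_mul_of_nonneg_left (ih h.2.2 hv) G.g_pos.le
    rw [h.2.1] at h1
    simp only [co, List.length_cons, pow_succ]
    nlinarith

/-- A walk all of whose edges attain the optimality equations for `t`. -/
def Tight (G : Gr) (x : ℕ → ℕ → ℝ) (t u : ℕ) (P : List ℕ) (v : ℕ) : Prop :=
  G.W u P v ∧ G.R v t ∧ G.co P + G.g ^ P.length * x t v ≤ x t u

theorem Tight.append {t u v w : ℕ} {P Q : List ℕ} (h : G.Tight x t u P v)
    (h' : G.Tight x t v Q w) : G.Tight x t u (P ++ Q) w := by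
  refine ⟨h.1.append h'.1, h'.2.1, ?_⟩
  have := mul_le_mul_of_nonneg_left h'.2.2 (pow_pos G.g_pos P.length).le
  rw [co_append, List.length_append, pow_add]
  linarith [h.2.2]

/-- Slack in one part of a walk cannot be recovered in the other, as `Val.walk` holds for both. So
tightness passes to the parts, here and in `Tight.right`, where the positive factor `G.g ^ P.length`
is cancelled. -/
theorem Tight.left (hx : G.Val x) {t u v w : ℕ} {P Q : List ℕ} (h : G.Tight x t u (P ++ Q) v)
    (hP : G.W u P w) (hQ : G.W w Q v) : G.Tight x t u P w := by
  refine ⟨hP, R.trans ⟨Q, hQ⟩ h.2.1, ?_⟩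
  have h1 := hx.walk hQ h.2.1
  have h2 := h.2.2
  have := mul_le_mul_of_nonneg_left h1 (pow_pos G.g_pos P.length).le
  rw [co_append, List.length_append, pow_add] at h2
  linarith

theorem Tight.right (hx : G.Val x) {t u v w : ℕ} {P Q : List ℕ} (h : G.Tight x t u (P ++ Q) v)
    (hP : G.W u P w) (hQ : G.W w Q v) : G.Tight x t w Q v := by
  refine ⟨hQ, h.2.1, ?_⟩
  have h1 := hx.walk hP (R.trans ⟨Q, hQ⟩ h.2.1)
  have h2 := h.2.2
  rw [co_append, List.length_append, pow_add] at h2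
  have : G.g ^ P.length * (G.co Q + G.g ^ Q.length * x t v) ≤ G.g ^ P.length * x t w := by linarith
  exact le_of_mul_le_mul_left this (pow_pos G.g_pos P.length)

theorem Tight.nil {t u : ℕ} (h : G.R u t) : G.Tight x t u [] u := ⟨rfl, h, by simp [co]⟩

/-- Equal lengths keep the discount of the rest unchanged. A cheaper walk of another length could be
worse for the remaining cost. -/
theorem Tight.of_le {t u v : ℕ} {P Q : List ℕ} (h : G.Tight x t u P v) (hQ : G.W u Q v)
    (hl : Q.length = P.length) (hc : G.co Q ≤ G.co P) : G.Tight x t u Q v :=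
  ⟨hQ, h.2.1, by rw [hl]; linarith [h.2.2]⟩

theorem Tight.reach {t u v : ℕ} {P : List ℕ} (h : G.Tight x t u P v) : G.R u t :=
  R.trans ⟨P, h.1⟩ h.2.1

/-- A tight walk of a given length, or one that stops before at `t`. -/
theorem Val.follow (hx : G.Val x) {t : ℕ} : ∀ (L : ℕ) {u : ℕ}, G.R u t →
    (∃ P, P.length ≤ L ∧ G.Tight x t u P t ∧ x t t = 0) ∨
      ∃ P v, P.length = L ∧ G.Tight x t u P v := by
  intro L
  induction L with
  | zero => intro u hu; exact Or.inr ⟨[], u, rfl, .nil hu⟩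
  | succ L ih =>
    intro u hu
    rcases hx.tight t u hu with ⟨rfl, h0⟩ | ⟨e, he, rfl, hr, hc⟩
    · exact Or.inl ⟨[], by simp, .nil hu, h0⟩
    · have h1 : G.Tight x t (G.tl e) [e] (G.hd e) := ⟨⟨he, rfl, rfl⟩, hr, by simp [co, hc]⟩
      rcases ih hr with ⟨P, hl, hP, h0⟩ | ⟨P, v, hl, hP⟩
      · exact Or.inl ⟨[e] ++ P, by simp; omega, h1.append hP, h0⟩
      · exact Or.inr ⟨[e] ++ P, v, by simp; omega, h1.append hP⟩

/-- Cutting a closed part out of a tight walk changes its cost and its discount, yet keeps it tight: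
the parts before and after are tight on their own and meet at the same vertex. -/
theorem Tight.shorten (hx : G.Val x) {t u v : ℕ} (hu : u < G.n) : ∀ {P : List ℕ},
    G.Tight x t u P v → ∃ Q, Q.length ≤ G.n ∧ G.Tight x t u Q v := by
  intro P
  induction hl : P.length using Nat.strong_induction_on generalizing P with
  | _ l ih =>
    intro h
    by_cases hn : P.length ≤ G.n
    · exact ⟨P, hn, h⟩
    · obtain ⟨A, C, D, w, rfl, hC, hA, hCw, hD⟩ := h.1.rep_of_length hu (by omega)
      have h1 := h.left hx hA (hCw.append hD)
      have h2 := (h.right hx hA (hCw.append hD)).right hx hCw hD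
      have : 0 < C.length := List.length_pos_iff.2 hC
      exact ih (A ++ D).length (by simp only [List.length_append] at *; omega) rfl (h1.append h2)

/-! ## Hierarchies of hitting sets -/

/-- `P` is cheapest among the walks from `b` to `v` with as many edges. -/
def Opt (G : Gr) (b v : ℕ) (P : List ℕ) : Prop :=
  G.W b P v ∧ ∀ Q, G.W b Q v → Q.length = P.length → G.co P ≤ G.co Q

/-- For all ends of walks of length `L` that start in `B`, some optimal one visits a vertex twice or
meets `B'`. -/
def Hit (G : Gr) (B B' : ℕ → Prop) (L : ℕ) : Prop :=
  ∀ b v, B b → (∃ P, G.W b P v ∧ P.length = L) → ∃ P, P.length = L ∧ G.Opt b v P ∧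
    (G.Rep b P v ∨ ∃ k ≤ L, B' (G.en b (P.take k)))

/-- A descending hierarchy of hitting sets. -/
structure Hier (G : Gr) (B : ℕ → ℕ → Prop) (L : ℕ → ℕ) (N : ℕ) : Prop where
  zero : ∀ b < G.n, 0 < N ∧ B 0 b
  last : ∀ b, ¬ B N b
  hit : ∀ i < N, G.Hit (B i) (B (i + 1)) (L i)

variable {B : ℕ → ℕ → Prop} {L : ℕ → ℕ} {N : ℕ}

/-- Closed tight walks are recognised from their own or smaller levels. -/
theorem Hier.closed (hH : G.Hier B L N) (hx : G.Val x) {t w : ℕ} {C : List ℕ} (hw : w < G.n)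
    (hC : C ≠ []) (h : G.Tight x t w C w) :
    ∃ i < N, ∃ b A D, B i b ∧ A.length ≤ G.n ∧ G.Tight x t w A b ∧ G.R b w ∧
      G.Tight x t b D b ∧ D ≠ [] ∧ D.length ≤ L i := by
  classical
  -- The least length `l` of a closed tight walk that some tight walk from `w` enters without
  -- leaving the strong component of `w`. The induction below moves a closed walk of this length to
  -- higher and higher levels until `l ≤ L i`.
  let Pr : ℕ → Prop := fun l => 0 < l ∧ ∃ u A D, G.Tight x t w A u ∧ G.R u w ∧ G.Tight x t u D u ∧
    D.length = l
  have hex : ∃ l, Pr l := ⟨C.length, List.length_pos_iff.2 hC, w, [], C, .nil h.reach, R.refl _, h,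
    rfl⟩
  obtain ⟨hl0, u, A, D, hA, hu, hD, hDl⟩ := Nat.find_spec hex
  have hmin : ∀ l, Pr l → Nat.find hex ≤ l := fun l hl => Nat.find_min' hex hl
  set l := Nat.find hex with hl
  have main : ∀ i ≤ N, (∃ j < N, ∃ b A D, B j b ∧ G.Tight x t w A b ∧ G.R b w ∧
      G.Tight x t b D b ∧ D.length = l ∧ l ≤ L j) ∨ ∃ b A D, B i b ∧ G.Tight x t w A b ∧ G.R b w ∧
      G.Tight x t b D b ∧ D.length = l := by
    intro i
    induction i with
    | zero => intro _; exact Or.inr ⟨u, A, D, (hH.zero u (hA.1.lt hw)).2, hA, hu, hD, hDl⟩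
    | succ i ih =>
      intro hi
      rcases ih (by omega) with h' | ⟨b, A, D, hb, hA, hbw, hD, hDl⟩
      · exact Or.inl h'
      by_cases hLi : l ≤ L i
      · exact Or.inl ⟨i, by omega, b, A, D, hb, hA, hbw, hD, hDl, hLi⟩
      obtain ⟨v, h1, h2⟩ := hD.1.split (L i)
      have hD' : G.Tight x t b (D.take (L i) ++ D.drop (L i)) b := by
        rw [List.take_append_drop]; exact hD
      have hlen : (D.take (L i)).length = L i := by simp; omega
      have t1 := hD'.left hx h1 h2
      have t2 := hD'.right hx h1 h2
      obtain ⟨P, hPl, hPo, hP⟩ := hH.hit i (by omega) b v hb ⟨_, h1, hlen⟩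
      have tP : G.Tight x t b P v := t1.of_le hPo.1 (by omega) (hPo.2 _ h1 (by omega))
      rcases hP with ⟨A', C', D', w', rfl, hC', hA', hCC, hDD⟩ | ⟨k, hk, hk'⟩
      -- A repetition on the substitute `P` would cut out a closed tight walk with at most `L i < l`
      -- edges.
      · exfalso
        have s1 := tP.left hx hA' (hCC.append hDD)
        have s2 := (tP.right hx hA' (hCC.append hDD)).left hx hCC hDD
        have := hmin C'.length ⟨List.length_pos_iff.2 hC', w', A ++ A', C', hA.append s1,
          (hCC.append hDD).r.trans (h2.r.trans hbw), s2, rfl⟩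
        simp only [List.length_append] at hPl
        omega
      · obtain ⟨p1, p2⟩ := hPo.1.take k
        have tP' : G.Tight x t b (P.take k ++ P.drop k) v := by
          rw [List.take_append_drop]; exact tP
        have s1 := tP'.left hx p1 p2
        have s2 := tP'.right hx p1 p2
        -- The closed walk is rotated so that it starts at the vertex of level `i + 1`. Its length
        -- is still `l`, since `P` has as many edges as the prefix that it replaces.
        refine Or.inr ⟨_, A ++ P.take k, P.drop k ++ (D.drop (L i) ++ P.take k), hk', hA.append s1,
          p2.r.trans (h2.r.trans hbw), s2.append (t2.append s1), ?_⟩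
        simp; omega
  -- Level `N` is empty, so the induction has stopped at some level whose walks are long enough.
  rcases main N le_rfl with ⟨j, hj, b, A, D, hb, hA, hbw, hD, hDl, hlj⟩ | ⟨b, _, _, hb, _⟩
  · obtain ⟨A', hA'l, hA'⟩ := hA.shorten hx hw
    exact ⟨j, hj, b, A', D, hb, hA'l, hA', hbw, hD,
      List.length_pos_iff.1 (by omega), by omega⟩
  · exact absurd hb (hH.last b)

/-- From a vertex of level `i`, a short tight walk stops at `t`, meets the next level, or enters a
closed tight walk. -/
theorem Hier.landmark (hH : G.Hier B L N) (hx : G.Val x) {t i b : ℕ} (hi : i < N) (hb : B i b)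
    (hr : G.R b t) : ∃ P u, P.length ≤ L i ∧ G.Tight x t b P u ∧
      ((u = t ∧ x t t = 0) ∨ B (i + 1) u ∨ ∃ C, C ≠ [] ∧ G.Tight x t u C u) := by
  rcases hx.follow (L i) hr with ⟨P, hl, hP, h0⟩ | ⟨P, v, hl, hP⟩
  · exact ⟨P, t, hl, hP, Or.inl ⟨rfl, h0⟩⟩
  obtain ⟨Q, hQl, hQo, hQ⟩ := hH.hit i hi b v hb ⟨P, hP.1, hl⟩
  have tQ := hP.of_le hQo.1 (by omega) (hQo.2 _ hP.1 (by omega))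
  rcases hQ with ⟨A, C, D, w, rfl, hC, hA, hCC, hD⟩ | ⟨k, hk, hk'⟩
  · refine ⟨A, w, by simp only [List.length_append] at hQl; omega, tQ.left hx hA (hCC.append hD),
      Or.inr (Or.inr ⟨C, hC, (tQ.right hx hA (hCC.append hD)).left hx hCC hD⟩)⟩
  · obtain ⟨p1, p2⟩ := hQo.1.take k
    rw [← List.take_append_drop k Q] at tQ
    exact ⟨Q.take k, _, by simp; omega, tQ.left hx p1 p2, Or.inr (Or.inl hk')⟩

/-- The counterpart of `Hier.landmark` for mere reachability. On a walk with fewest edges, the first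
`L i` edges can be exchanged for a walk from the hitting condition; a repetition there would allow a
shortcut, so the walk meets the next level. -/
theorem Hier.reach (hH : G.Hier B L N) {t i b : ℕ} (hi : i < N) (hb : B i b)
    (hr : G.R b t) : ∃ P u, P.length ≤ L i ∧ G.W b P u ∧ G.R u t ∧ (u = t ∨ B (i + 1) u) := by
  classical
  have hex : ∃ l P, G.W b P t ∧ P.length = l := by obtain ⟨P, hP⟩ := hr; exact ⟨_, P, hP, rfl⟩
  obtain ⟨P, hP, hl⟩ := Nat.find_spec hex
  have hmin : ∀ Q, G.W b Q t → P.length ≤ Q.length := fun Q hQ =>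
    hl ▸ Nat.find_min' hex ⟨Q, hQ, rfl⟩
  by_cases hLi : P.length ≤ L i
  · exact ⟨P, t, hLi, hP, R.refl t, Or.inl rfl⟩
  obtain ⟨v, h1, h2⟩ := hP.split (L i)
  obtain ⟨Q, hQl, hQo, hQ⟩ := hH.hit i hi b v hb ⟨_, h1, by simp; omega⟩
  rcases hQ with ⟨A, C, D, w, rfl, hC, hA, hCC, hD⟩ | ⟨k, hk, hk'⟩
  · exfalso
    have := hmin (A ++ (D ++ P.drop (L i))) (hA.append (hD.append h2))
    have : 0 < C.length := List.length_pos_iff.2 hC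
    simp only [List.length_append, List.length_drop] at *
    omega
  · obtain ⟨p1, p2⟩ := hQo.1.take k
    exact ⟨Q.take k, _, by simp; omega, p1, p2.r.trans h2.r, Or.inr hk'⟩

end Gr

namespace Dapsp

open RealRAM

/-! ## The program

Word registers: 0 `n`, 1 `m`, 2 `h`, 3 level, 4 walk length `L`, 5 position in a level, 6 start `b`,
7 step `j`, 8 edge, 9 counter, 10 number of traced walks, 11 number of nodes, 12 first node of the
walk, 13 simplicity, 14 cursor, 15 number of alive walks, 16 threshold, 17 vertex, 18 count,
19 position in the next level, 20 its vertex, 21 end vertex `t`, 22 size of the envelope, 23 and 24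
bounds of a binary search, 25 level, 26 round, 27 number of copy instructions, 28 top of the level
lists.

Tables (flags, values, witnesses): distances (2, 1, 21); walks with exactly `j` edges (4, 2, 5);
infinite walks (6, 3, 22); infinite walks from `b` that pass `v` (7, 4, 23).

Word arrays: 8 level lists, 9 their offsets, 10 lengths of the levels, 11 vertices of the nodes,
13 and 14 linked lists of the nodes by vertex, 15 alive walks, 17 numbers of reachable vertices,
18 representatives of strong components, 19 and 20 copy instructions.  Real arrays 5, 6, 7: slopes,
intercepts and breakpoints of the lower envelope. -/

/-- The index `a * n + b`. -/
def ix (a b : WExp) : WExp := .add (.mul a (.reg 0)) b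

/-- The flag `i` of array `a` is set. -/
def fl (a : ℕ) (i : WExp) : BExp := .not (.weq (.cell a i) (.lit 0))

/-- A true test. -/
def tt : BExp := .weq (.lit 0) (.lit 0)

/-- The tail of the current edge. -/
def tlE : WExp := .cell 0 (.reg 8)

/-- The head of the current edge. -/
def hdE : WExp := .cell 1 (.reg 8)

/-- The successor of a word. -/
def suc (e : WExp) : WExp := .add e (.lit 1)

/-- The index of the walks with `j` edges from the current start to `v`. -/
def dIx (j v : WExp) : WExp := ix (ix j (.reg 6)) v

/-- Multiply the current power of the discount factor. -/
def nextPow : Prog := .xset 2 (.mul (.reg 2) (.reg 0))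

/-- Row `j + 1` from row `j`. The witness is the tail of the last edge, from which an optimal walk
can be traced backwards. -/
def dpRound : Prog :=
  .for_ 8 (.reg 1) (.relax (fl 4 (dIx (.reg 7) tlE))
    (.add (.cell 2 (dIx (.reg 7) tlE)) (.mul (.reg 2) (.cell 0 (.reg 8)))) 4 2 5
    (dIx (suc (.reg 7)) hdE) tlE)

/-- Cheapest walks with `0, …, L` edges from `b`. -/
def dpP : Prog :=
  .seq (.relax tt (.lit 0) 4 2 5 (dIx (.lit 0) (.reg 6)) (.lit 0))
    (.seq (.xset 2 (.lit 1)) (.for_ 7 (.reg 4) (.seq dpRound nextPow)))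

/-- Repeat closed walks at `b` forever. -/
def closedP : Prog :=
  .seq (.xset 2 (.reg 0)) (.for_ 7 (.reg 4) (.seq
    (.relax (fl 4 (dIx (suc (.reg 7)) (.reg 6)))
      (.div (.cell 2 (dIx (suc (.reg 7)) (.reg 6))) (.sub (.lit 1) (.reg 2))) 6 3 22 (.reg 6)
      (.lit 0)) nextPow))

/-- Walks from `b` give upper bounds for distances. -/
def directP : Prog :=
  .seq (.relax tt (.lit 0) 2 1 21 (ix (.reg 6) (.reg 6)) (.lit 0))
    (.for_ 7 (.reg 4) (.for_ 8 (.reg 1)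
      (.relax (fl 4 (dIx (suc (.reg 7)) hdE)) (.cell 2 (dIx (suc (.reg 7)) hdE)) 2 1 21
        (ix (.reg 6) hdE) (.lit 0))))

/-- Write the vertices of the walk from `b` to the head of the current edge. -/
def traceP : Prog :=
  .seq (.wset 14 hdE) (.seq (.wput 11 (.add (.reg 11) (.reg 4)) (.reg 14))
    (.for_ 9 (.reg 4) (.seq (.wset 14 (.cell 5 (dIx (.sub (.reg 4) (.reg 9)) (.reg 14))))
      (.wput 11 (.add (.reg 11) (.sub (.sub (.reg 4) (.reg 9)) (.lit 1))) (.reg 14)))))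

/-- Links are one more than node numbers, so a link that exceeds the first node of the current walk
points into this walk: the vertex occurs twice and the walk is not simple. -/
def linkStep : Prog :=
  .seq (.ite (.wlt (.reg 12) (.cell 14 (.cell 11 (.reg 11)))) (.wset 13 (.lit 0)) .skip)
    (.seq (.wput 13 (.reg 11) (.cell 14 (.cell 11 (.reg 11))))
      (.seq (.wput 14 (.cell 11 (.reg 11)) (suc (.reg 11))) (.wset 11 (suc (.reg 11)))))

/-- Link the nodes of the walk into the lists of their vertices. -/
def linkP : Prog :=
  .seq (.wset 12 (.reg 11)) (.seq (.wset 13 (.lit 1)) (.seq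
    (.for_ 9 (suc (.reg 4)) linkStep)
    (.seq (.wput 15 (.reg 10) (.reg 13))
      (.seq (.ite (.weq (.reg 13) (.lit 0)) .skip (.wset 15 (suc (.reg 15))))
        (.wset 10 (suc (.reg 10)))))))

def extractP : Prog :=
  .ite (fl 4 (dIx (.reg 4) hdE)) (.seq traceP linkP) .skip

/-- The walk of the node under the cursor. -/
def curWalk : WExp := .div (.sub (.reg 14) (.lit 1)) (suc (.reg 4))

def nextNode : Prog := .wset 14 (.cell 13 (.sub (.reg 14) (.lit 1)))

/-- Count the alive walks through the current vertex. -/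
def countP : Prog :=
  .seq (.wset 18 (.lit 0)) (.seq (.wset 14 (.cell 14 (.reg 17)))
    (.loop (.not (.weq (.reg 14) (.lit 0)))
      (.seq (.ite (fl 15 curWalk) (.wset 18 (suc (.reg 18))) .skip) nextNode)))

/-- Delete the alive walks through the current vertex. -/
def killP : Prog :=
  .seq (.wset 14 (.cell 14 (.reg 17)))
    (.loop (.not (.weq (.reg 14) (.lit 0)))
      (.seq (.ite (fl 15 curWalk)
        (.seq (.wput 15 curWalk (.lit 0)) (.wset 15 (.sub (.reg 15) (.lit 1)))) .skip) nextNode))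

/-- The vertex is taken if it lies on at least `A (L + 1) / (2 n)` alive walks, where `A` is the
number of alive walks at the beginning of the pass: half of the average number of alive nodes per
vertex. -/
def pickP : Prog :=
  .seq countP (.ite (.wlt (.mul (.reg 18) (.mul (.lit 2) (.reg 0))) (.mul (.reg 16) (suc (.reg 4))))
    .skip (.seq (.wput 8 (.reg 28) (.reg 17)) (.seq (.wset 28 (suc (.reg 28))) killP)))

/-- A hitting set of the alive walks. -/
def greedyP : Prog :=
  .loop (.wlt (.lit 0) (.reg 15)) (.seq (.wset 16 (.reg 15)) (.for_ 17 (.reg 0) pickP))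

/-- The size of level `i`. -/
def lenE (i : WExp) : WExp := .sub (.cell 9 (suc i)) (.cell 9 i)

/-- Load the current vertex of level `i`. -/
def loadP (i : WExp) : Prog := .wset 6 (.cell 8 (.add (.cell 9 i) (.reg 5)))

def resetP : Prog :=
  .seq (.wset 4 (.cell 10 (.reg 3))) (.seq (.for_ 17 (.reg 0) (.wput 14 (.reg 17) (.lit 0)))
    (.seq (.wset 10 (.lit 0)) (.seq (.wset 11 (.lit 0)) (.wset 15 (.lit 0)))))

def startP : Prog :=
  .seq (loadP (.reg 3)) (.seq dpP (.seq closedP (.seq directP (.for_ 8 (.reg 1) extractP))))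

/-- The truncated difference `n - (n - h L)` is the minimum of `h L` and `n`, in a form that is safe
to store. -/
def stepP : Prog :=
  .seq (.wput 10 (suc (.reg 3)) (.sub (.reg 0) (.sub (.reg 0) (.mul (.reg 2) (.reg 4)))))
    (.seq (.wput 9 (suc (suc (.reg 3))) (.reg 28)) (.wset 3 (suc (.reg 3))))

def levelP : Prog :=
  .seq resetP (.seq (.for_ 5 (lenE (.reg 3)) startP) (.seq greedyP stepP))

/-- Build the hierarchy of hitting sets. -/
def upP : Prog := .loop (.wlt (.cell 9 (.reg 3)) (.cell 9 (suc (.reg 3)))) levelP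

/-- Register 2 becomes the least `h ≥ 2` with `n² ≤ h⁴ (m + 1)`, where the costs `n h m` of the walk
tables and `n³ / h³` of the pairs of landmarks balance. No root has to be computed. -/
def initP : Prog :=
  .seq (.wset 2 (.lit 2)) (.seq
    (.loop (.wlt (.mul (.mul (.mul (.reg 2) (.reg 2)) (.mul (.reg 2) (.reg 2))) (suc (.reg 1)))
      (.mul (.reg 0) (.reg 0))) (.wset 2 (suc (.reg 2))))
    (.seq (.for_ 17 (.reg 0) (.wput 8 (.reg 17) (.reg 17)))
      (.seq (.wput 9 (.lit 1) (.reg 0)) (.seq (.wset 28 (.reg 0))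
        (.wput 10 (.lit 0) (.sub (.reg 0) (.sub (.reg 0) (.reg 2))))))))

/-- The last line of the envelope. -/
def topE : WExp := .sub (.reg 22) (.lit 1)

/-- The slopes `γ^j` decrease, so a new line enters the envelope at its right end. One step either
drops the last line, if the new one is no higher where the last one begins, or finishes line `j`. -/
def hullStep : Prog :=
  .ite (fl 4 (dIx (.reg 7) (.reg 20)))
    (.seq (.xset 3 (.cell 2 (dIx (.reg 7) (.reg 20))))
      (.ite (.and (.wlt (.lit 1) (.reg 22))
          (.not (.xlt (.add (.cell 6 topE) (.mul (.cell 5 topE) (.cell 7 topE)))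
            (.add (.reg 3) (.mul (.reg 2) (.cell 7 topE))))))
        (.wset 22 topE)
        (.seq (.xput 7 (.reg 22) (.div (.sub (.reg 3) (.cell 6 topE)) (.sub (.cell 5 topE) (.reg 2))))
          (.seq (.xput 5 (.reg 22) (.reg 2)) (.seq (.xput 6 (.reg 22) (.reg 3))
            (.seq (.wset 22 (suc (.reg 22))) (.seq (.wset 7 (suc (.reg 7))) nextPow)))))))
    (.seq (.wset 7 (suc (.reg 7))) nextPow)

/-- The lower envelope of the lines given by the walks from `b` to `b'`. -/
def hullP : Prog :=
  .seq (.wset 22 (.lit 0)) (.seq (.wset 7 (.lit 0)) (.seq (.xset 2 (.lit 1))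
    (.loop (.wlt (.reg 7) (suc (.reg 4))) hullStep)))

/-- The middle of the search interval. -/
def midE : WExp := .sub (.reg 24) (.div (suc (.sub (.reg 24) (.reg 23))) (.lit 2))

def searchP : Prog :=
  .seq (.wset 23 (.lit 0)) (.seq (.wset 24 (.reg 22))
    (.loop (.wlt (suc (.reg 23)) (.reg 24))
      (.ite (.xlt (.cell 1 (ix (.reg 20) (.reg 21))) (.cell 7 midE))
        (.wset 24 midE) (.wset 23 midE))))

def queryP : Prog :=
  .for_ 21 (.reg 0) (.ite (.and (.wlt (.lit 0) (.reg 22)) (fl 2 (ix (.reg 20) (.reg 21))))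
    (.seq searchP (.relax tt (.add (.cell 6 (.reg 23))
      (.mul (.cell 5 (.reg 23)) (.cell 1 (ix (.reg 20) (.reg 21))))) 2 1 21
      (ix (.reg 6) (.reg 21)) (.lit 0))) .skip)

def pairP : Prog := .seq (loadP (.reg 25)) (.seq hullP queryP)

def rowP : Prog :=
  .seq (.wset 20 (.cell 8 (.add (.cell 9 (suc (.reg 25))) (.reg 19))))
    (.for_ 5 (lenE (.reg 25)) pairP)

/-- The descent ends at level 1. Between level 0 and level 1 there are too many pairs; `bfP` takes
their place. -/
def descP : Prog :=
  .for_ 9 (.sub (.reg 3) (.lit 1)) (.seq (.wset 25 (.sub (.sub (.reg 3) (.lit 1)) (.reg 9)))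
    (.seq (.wset 4 (.cell 10 (.reg 25))) (.for_ 19 (lenE (suc (.reg 25))) rowP)))

def bfP : Prog :=
  .for_ 21 (.reg 0) (.for_ 26 (.cell 10 (.lit 0)) (.for_ 8 (.reg 1)
    (.relax (fl 2 (ix hdE (.reg 21)))
      (.add (.cell 0 (.reg 8)) (.mul (.reg 0) (.cell 1 (ix hdE (.reg 21))))) 2 1 21
      (ix tlE (.reg 21)) (.lit 0))))

/-- Distances from the upper levels down to all vertices. -/
def downP : Prog := .seq descP bfP

/-- Infinite walks inside strong components. -/
def infP : Prog :=
  .for_ 26 (.reg 0) (.for_ 8 (.reg 1)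
    (.relax (.and (fl 2 (ix hdE tlE)) (fl 6 hdE))
      (.add (.cell 0 (.reg 8)) (.mul (.reg 0) (.cell 3 hdE))) 6 3 22 tlE (.lit 0)))

def cntStep : Prog :=
  .ite (fl 2 (ix (.reg 17) (.reg 21))) (.seq (.wset 18 (suc (.reg 18)))
    (.ite (.and (fl 2 (ix (.reg 21) (.reg 17))) (.weq (.reg 14) (.lit 0)))
      (.wset 14 (suc (.reg 21))) .skip)) .skip

/-- Numbers of reachable vertices and representatives of strong components. -/
def cntP : Prog :=
  .for_ 17 (.reg 0) (.seq (.wset 18 (.lit 0)) (.seq (.wset 14 (.lit 0))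
    (.seq (.for_ 21 (.reg 0) cntStep)
      (.seq (.wput 17 (.reg 17) (.reg 18)) (.wput 18 (.reg 17) (.sub (.reg 14) (.lit 1)))))))

/-- Append a copy instruction. -/
def instr (a b : WExp) : Prog :=
  .seq (.wput 19 (.reg 27) a) (.seq (.wput 20 (.reg 27) b) (.wset 27 (suc (.reg 27))))

/-- Copy instructions that propagate along walks. -/
def instrP : Prog :=
  .seq (.wset 27 (.lit 0)) (.for_ 9 (.reg 0) (.seq
    (.for_ 17 (.reg 0) (.ite (.weq (.cell 17 (.reg 17)) (.sub (.reg 0) (.reg 9)))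
      (instr (.reg 17) (.cell 18 (.reg 17))) .skip))
    (.seq (.for_ 17 (.reg 0) (.ite (.weq (.cell 17 (.reg 17)) (.sub (.reg 0) (.reg 9)))
      (instr (.cell 18 (.reg 17)) (.reg 17)) .skip))
      (.for_ 8 (.reg 1) (.ite (.weq (.cell 17 tlE) (.sub (.reg 0) (.reg 9)))
        (instr tlE hdE) .skip)))))

/-- A walk with at most `L` edges from `b` to `v`, continued by an infinite walk in the strong
component of `v`. -/
def viaP : Prog :=
  .seq (.relax (fl 6 (.reg 6)) (.cell 3 (.reg 6)) 7 4 23 (ix (.reg 6) (.reg 6)) (.lit 0))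
    (.seq (.xset 2 (.reg 0)) (.for_ 7 (.reg 4) (.seq (.for_ 8 (.reg 1)
      (.relax (.and (fl 4 (dIx (suc (.reg 7)) hdE)) (fl 6 hdE))
        (.add (.cell 2 (dIx (suc (.reg 7)) hdE)) (.mul (.reg 2) (.cell 3 hdE))) 7 4 23
        (ix (.reg 6) hdE) (.lit 0))) nextPow)))

def copyP : Prog :=
  .for_ 9 (.reg 27) (.relax (fl 7 (ix (.reg 6) (.cell 19 (.reg 9))))
    (.cell 4 (ix (.reg 6) (.cell 19 (.reg 9)))) 7 4 23 (ix (.reg 6) (.cell 20 (.reg 9))) (.lit 0))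

def giveP : Prog :=
  .for_ 21 (.reg 0) (.relax (fl 7 (ix (.reg 6) (.reg 21))) (.cell 4 (ix (.reg 6) (.reg 21))) 2 1 21
    (ix (.reg 6) (.reg 21)) (.lit 0))

/-- Infinite walks give upper bounds for distances. -/
def infDistP : Prog :=
  .for_ 25 (.reg 3) (.seq (.wset 4 (.cell 10 (.reg 25))) (.for_ 5 (lenE (.reg 25))
    (.seq (loadP (.reg 25)) (.seq viaP (.seq copyP giveP)))))

def midP : Prog := .seq infP (.seq cntP (.seq instrP infDistP))

/-- Edges that attain the optimality equations. -/
def polP : Prog :=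
  .for_ 21 (.reg 0) (.for_ 8 (.reg 1)
    (.ite (.and (.and (fl 2 (ix tlE (.reg 21))) (fl 2 (ix hdE (.reg 21))))
      (.not (.xlt (.cell 1 (ix tlE (.reg 21)))
        (.add (.cell 0 (.reg 8)) (.mul (.reg 0) (.cell 1 (ix hdE (.reg 21))))))))
      (.wput 3 (ix tlE (.reg 21)) (suc (.reg 8))) .skip))

/-- The complete algorithm. -/
def mainP : Prog :=
  .seq initP (.seq upP (.seq downP (.seq midP (.seq downP polP))))

theorem mainP_safe : mainP.safe = true := by decide +kernel

/-- The state holds the input graph `G`. -/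
structure Base (G : Gr) (σ : Store) : Prop where
  n : σ.wreg 0 = G.n
  m : σ.wreg 1 = G.m
  g : σ.xreg 0 = G.g
  tl : ∀ e < G.m, σ.warr 0 e = G.tl e
  hd : ∀ e < G.m, σ.warr 1 e = G.hd e
  c : ∀ e < G.m, σ.xarr 0 e = G.c e

theorem Base.agree {G : Gr} {S : List ℕ} {σ τ : Store} (h : Base G σ) (ha : Agree S σ τ)
    (hS : disj [0, 4, 1, 2, 6, 3] S = true) : Base G τ := by
  simp [disj] at hS
  refine ⟨?_, ?_, ?_, fun e he => ?_, fun e he => ?_, fun e he => ?_⟩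
  · rw [ha.wreg 0 (by simp [hS]), h.n]
  · rw [ha.wreg 1 (by simp [hS]), h.m]
  · rw [ha.xreg 0 (by simp [hS]), h.g]
  · rw [ha.warr 0 (by simp [hS]), h.tl e he]
  · rw [ha.warr 1 (by simp [hS]), h.hd e he]
  · rw [ha.xarr 0 (by simp [hS]), h.c e he]

/-- Soundness predicates speak about all decodings of an index, and this makes the decoding unique.
-/
theorem ix_inj {n a b a' b' : ℕ} (hb : b < n) (hb' : b' < n) (h : a * n + b = a' * n + b') :
    a = a' ∧ b = b' := by
  have h1 : (a * n + b) / n = a := by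
    rw [Nat.mul_comm, Nat.mul_add_div (by omega), Nat.div_eq_of_lt hb, Nat.add_zero]
  have h2 : (a' * n + b') / n = a' := by
    rw [Nat.mul_comm, Nat.mul_add_div (by omega), Nat.div_eq_of_lt hb', Nat.add_zero]
  have : a = a' := by rw [← h1, ← h2, h]
  subst this
  exact ⟨rfl, by omega⟩

end Dapsp

namespace Dapsp

open RealRAM

/-! ## Walks with a given number of edges -/

/-- Entries of the walk table are costs of walks whose last edge extends an optimal walk. -/
def SD (G : Gr) (i : ℕ) (val : ℝ) (par : ℕ) : Prop :=
  ∀ j b v, b < G.n → v < G.n → i = (j * G.n + b) * G.n + v → (j = 0 ∧ b = v ∧ val = 0) ∨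
    ∃ P e, e < G.m ∧ G.hd e = v ∧ par = G.tl e ∧ G.Opt b (G.tl e) P ∧ P.length + 1 = j ∧
      val = G.co P + G.g ^ P.length * G.c e

/-- The walk table is complete for walks with `j` edges from `b`. -/
def Exact (G : Gr) (σ : Store) (j b : ℕ) : Prop :=
  ∀ v P, G.W b P v → P.length = j → σ.ub 4 2 ((j * G.n + b) * G.n + v) (G.co P)

theorem Exact.imp {G : Gr} {σ τ : Store} {j b : ℕ} (h : Exact G σ j b)
    (hi : Imp 4 2 5 (SD G) σ τ) : Exact G τ j b := fun v P hP hl => hi.ub _ _ (h v P hP hl)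

/-- Soundness makes the entry the cost of an actual walk, completeness makes it a lower bound for
all walks of that length; together the entry is optimal. -/
theorem Exact.opt {G : Gr} {σ : Store} {j b v : ℕ} (h : Exact G σ j b)
    (hs : σ.Snd 4 2 5 (SD G)) (hb : b < G.n) (hv : v < G.n)
    (hf : σ.warr 4 ((j * G.n + b) * G.n + v) ≠ 0) :
    ∃ P, G.Opt b v P ∧ P.length = j ∧ σ.xarr 2 ((j * G.n + b) * G.n + v) = G.co P := by
  rcases hs _ hf j b v hb hv rfl with ⟨rfl, rfl, h0⟩ | ⟨P, e, he, rfl, -, hP, hl, hval⟩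
  · refine ⟨[], ⟨rfl, fun Q hQ hl => ?_⟩, rfl, h0⟩
    rw [List.length_nil, List.length_eq_zero_iff] at hl
    rw [hl]
  · have hw : G.W b (P ++ [e]) (G.hd e) := Gr.W_snoc.2 ⟨hP.1, he, rfl⟩
    refine ⟨P ++ [e], ⟨hw, fun Q hQ hQl => ?_⟩, by simp [hl], by rw [hval, Gr.co_snoc]⟩
    rw [Gr.co_snoc, ← hval]
    exact (h _ Q hQ (by rw [hQl]; simp [hl])).2

theorem nextPow_spec (σ : Store) :
    Tri nextPow σ 5 fun τ => τ = σ.setX 2 (σ.xreg 2 * σ.xreg 0) := Tri.lf rfl (by decide) rfl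

/-- Row `j` is already complete, so its entries are optimal by `Exact.opt`. Thus each candidate for
row `j + 1` extends an optimal walk by one edge, as `SD` requires, even if the candidate itself is
later improved. -/
theorem dpRound_spec {G : Gr} {σ : Store} {b j : ℕ} (hB : Base G σ) (h6 : σ.wreg 6 = b)
    (hb : b < G.n) (h7 : σ.wreg 7 = j) (h2 : σ.xreg 2 = G.g ^ j) (hs : σ.Snd 4 2 5 (SD G))
    (hE : Exact G σ j b) :
    Tri dpRound σ (G.m * 160 + 20) fun τ => Imp 4 2 5 (SD G) σ τ ∧ Exact G τ (j + 1) b := by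
  refine Tri.mono (Tri.for_each 150 (Imp 4 2 5 (SD G))
    (fun e τ => ∀ P, G.W b P (G.tl e) → P.length = j →
      τ.ub 4 2 (((j + 1) * G.n + b) * G.n + G.hd e) (G.co P + G.g ^ j * G.c e))
    hB.m (by decide) (by decide) (fun σ v => .refl' rfl rfl rfl) (fun _ _ _ => Imp.trans)
    (fun e _ σ τ h hQ P hP hl => h.ub _ _ (hQ P hP hl)) ?_) ?_ ?_
  · intro e he σ' ha hw hi
    have hB' := hB.agree ha (by decide)
    have e6 : σ'.wreg 6 = b := (ha.wreg 6 (by decide)).trans h6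
    have e7 : σ'.wreg 7 = j := (ha.wreg 7 (by decide)).trans h7
    have x2 : σ'.xreg 2 = G.g ^ j := (ha.xreg 2 (by decide)).trans h2
    have hE' := hE.imp hi
    have hs' := hi.snd hs
    refine Tri.mono (Tri.relax (SD G) (by decide) (by decide) (T := 150) (by decide) ?_) le_rfl ?_
    · intro hg _
      simp only [fl, dIx, ix, suc, tlE, hdE, BExp.Holds, WExp.eval, XExp.eval, hw, e6, e7, x2,
        hB'.n, hB'.tl e he, hB'.hd e he, hB'.c e he] at hg ⊢
      intro j' b' v' hb' hv' hi'
      obtain ⟨h1, rfl⟩ := ix_inj (G.hd_lt e he) hv' hi'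
      obtain ⟨rfl, rfl⟩ := ix_inj hb hb' h1
      obtain ⟨P, hP, hl, hv⟩ := hE'.opt hs' hb (G.tl_lt e he) hg
      exact Or.inr ⟨P, e, he, rfl, rfl, hP, by rw [hl], by rw [hv, hl]⟩
    · rintro τ - ⟨hi2, hu⟩
      refine ⟨hi2, fun P hP hl => ?_⟩
      have := hE' _ P hP hl
      simp only [fl, dIx, ix, suc, tlE, hdE, BExp.Holds, WExp.eval, XExp.eval, hw, e6, e7, x2,
        hB'.n, hB'.tl e he, hB'.hd e he, hB'.c e he] at hu
      exact (hu this.1).mono (by linarith [this.2])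
  · show G.m * 158 + 6 ≤ _
    omega
  · rintro τ - ⟨hi, hQ⟩
    refine ⟨hi, fun v P hP hl => ?_⟩
    obtain ⟨Q, e, rfl⟩ : ∃ Q e, P = Q ++ [e] := by
      have hne : P ≠ [] := by rintro rfl; simp at hl
      exact ⟨P.dropLast, P.getLast hne, (List.dropLast_append_getLast hne).symm⟩
    obtain ⟨hQw, he, rfl⟩ := Gr.W_snoc.1 hP
    have hQl : Q.length = j := by simpa using hl
    rw [Gr.co_snoc, hQl]
    exact hQ e he Q hQw hQl

theorem dpP_spec {G : Gr} {σ : Store} {b L : ℕ} (hB : Base G σ) (h6 : σ.wreg 6 = b)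
    (hb : b < G.n) (h4 : σ.wreg 4 = L) (hs : σ.Snd 4 2 5 (SD G)) :
    Tri dpP σ (L * (G.m * 160 + 40) + 200) fun τ =>
      Imp 4 2 5 (SD G) σ τ ∧ ∀ j ≤ L, Exact G τ j b := by
  refine Tri.mono (Tri.seq (Tri.relax (SD G) (by decide) (by decide) (T := 150) (by decide) ?_)
    (fun τ₁ a₁ p₁ => Tri.seq (Tri.lf (T := 2) rfl (by decide)
      (Q := fun τ => τ = τ₁.setX 2 1) (by simp [Prog.den, XExp.eval]))
    (fun τ₂ a₂ p₂ => Tri.for_ (N := L) (G.m * 160 + 30)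
      (fun k τ => Imp 4 2 5 (SD G) σ τ ∧ τ.xreg 2 = G.g ^ k ∧ ∀ j ≤ k, Exact G τ j b)
      ?_ (by decide) (by decide) ?_ ?_))) ?_ (fun τ _ h => ⟨h.1.1, h.1.2.2⟩)
  · intro _ _ j' b' v' hb' hv' hi'
    simp only [dIx, ix, WExp.eval, h6, hB.n, Nat.zero_mul, Nat.zero_add, XExp.eval] at hi' ⊢
    have hi'' : (0 * G.n + b) * G.n + b = (j' * G.n + b') * G.n + v' := by simpa using hi'
    obtain ⟨h1, rfl⟩ := ix_inj hb hv' hi''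
    obtain ⟨rfl, rfl⟩ := ix_inj hb hb' h1
    exact Or.inl ⟨rfl, rfl, by simp⟩
  · subst p₂; simp [WExp.eval, a₁.wreg 4 (by decide), h4]
  · subst p₂
    refine ⟨p₁.1.trans (.refl' rfl rfl rfl), by simp, fun j hj v P hP hl => ?_⟩
    obtain rfl : j = 0 := by omega
    obtain rfl : P = [] := List.length_eq_zero_iff.1 hl
    obtain rfl : b = v := hP
    have := p₁.2 (by simp [tt, BExp.Holds])
    simpa [dIx, ix, WExp.eval, h6, hB.n, XExp.eval, Gr.co, Store.ub] using this
  · rintro k hk σ' ha hw ⟨hi, h2, hE⟩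
    have ha' := (a₁.up (4 * 7 :: (Prog.seq dpP nextPow).mods) (by decide)).trans
      ((a₂.up _ (by decide)).trans (ha.up _ (by decide)))
    refine Tri.seq_le (T := 5) (dpRound_spec (hB.agree ha' (by decide))
      ((ha'.wreg 6 (by decide)).trans h6) hb hw h2 (hi.snd hs) (hE k le_rfl)) (by omega)
      fun τ₃ a₃ p₃ => Tri.mono (nextPow_spec τ₃) le_rfl ?_
    rintro τ - rfl
    have g0 : τ₃.xreg 0 = G.g := (hB.agree (ha'.trans (a₃.up _ (by decide))) (by decide)).g
    refine ⟨(hi.trans p₃.1).trans (.refl' rfl rfl rfl), ?_, fun j hj => ?_⟩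
    · simp [a₃.xreg 2 (by decide), h2, g0, pow_succ]
    · rcases Nat.le_succ_iff.1 hj with hj | rfl
      · exact ((hE j hj).imp p₃.1).imp (.refl' rfl rfl rfl)
      · exact p₃.2.imp (.refl' rfl rfl rfl)
  · simp only [WExp.size]
    have : L * (G.m * 160 + 30 + (1 + 7)) ≤ L * (G.m * 160 + 40) := Nat.mul_le_mul_left _ (by omega)
    omega

end Dapsp

namespace Dapsp

open RealRAM

/-! ## Closed walks and direct walks -/

/-- Sound upper bounds for infinite walks from `v`. -/
def SY (G : Gr) (x : ℕ → ℕ → ℝ) (v : ℕ) (r : ℝ) (_ : ℕ) : Prop := ∀ t, G.R v t → x t v ≤ r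

/-- Sound upper bounds for distances. -/
def SX (G : Gr) (x : ℕ → ℕ → ℝ) (i : ℕ) (r : ℝ) (_ : ℕ) : Prop :=
  ∀ s t, t < G.n → i = s * G.n + t → G.R s t ∧ x t s ≤ r

/-- Sound upper bounds for infinite walks from `b` that pass `v`. -/
def SG (G : Gr) (x : ℕ → ℕ → ℝ) (i : ℕ) (r : ℝ) (_ : ℕ) : Prop :=
  ∀ b v, v < G.n → i = b * G.n + v → G.R b v ∧ ∀ t, G.R v t → x t b ≤ r

theorem closedP_spec {G : Gr} {x : ℕ → ℕ → ℝ} (hx : G.Val x) {σ : Store} {b L : ℕ} (hB : Base G σ)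
    (h6 : σ.wreg 6 = b) (hb : b < G.n) (h4 : σ.wreg 4 = L) (hs : σ.Snd 4 2 5 (SD G))
    (hE : ∀ j ≤ L, Exact G σ j b) :
    Tri closedP σ (L * 170 + 20) fun τ => Imp 6 3 22 (SY G x) σ τ ∧
      ∀ C, G.W b C b → C ≠ [] → C.length ≤ L → τ.ub 6 3 b (G.co C / (1 - G.g ^ C.length)) := by
  refine Tri.seq_le (S := 2) (T := L * 170 + 10) (Tri.lf rfl (by decide)
    (Q := fun τ => τ = σ.setX 2 (σ.xreg 0)) rfl) (by omega) fun τ₁ a₁ p₁ => ?_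
  subst p₁
  refine Tri.mono (Tri.for_ (N := L) 160 (fun k τ => Imp 6 3 22 (SY G x) σ τ ∧
    τ.xreg 2 = G.g ^ (k + 1) ∧ ∀ C, G.W b C b → C ≠ [] → C.length ≤ k →
      τ.ub 6 3 b (G.co C / (1 - G.g ^ C.length))) (by simp [WExp.eval, h4])
      (by decide) (by decide) ?_ ?_) (by simp only [WExp.size]; omega)
      (fun τ _ h => ⟨h.1.1, h.1.2.2⟩)
  · refine ⟨.refl' rfl rfl rfl, by simp [hB.g], fun C _ hC hl => ?_⟩
    exact absurd (List.length_eq_zero_iff.1 (by omega)) hC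
  · rintro k hk σ' ha hw ⟨hi, h2, hQ⟩
    have ha' := (a₁.up closedP.mods (by decide)).trans (ha.up _ (by decide))
    have hB' := hB.agree ha' (by decide)
    have e6 : σ'.wreg 6 = b := (ha'.wreg 6 (by decide)).trans h6
    have iD := ha'.imp 4 2 5 (S := SD G) (by decide)
    have hE' := (hE (k + 1) hk).imp iD
    have hpow : G.g ^ (k + 1) < 1 := pow_lt_one₀ G.g_pos.le G.g_lt (by omega)
    refine Tri.seq_le (S := 150) (T := 5) (Tri.relax (SY G x) (by decide) (by decide) (by decide) ?_)
      (by omega) fun τ₃ a₃ p₃ => Tri.mono (nextPow_spec τ₃) le_rfl ?_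
    · intro hg _ t ht
      simp only [fl, dIx, ix, suc, BExp.Holds, WExp.eval, XExp.eval, hw, e6, h2, hB'.n] at hg ht ⊢
      obtain ⟨P, hP, hl, hv⟩ := hE'.opt (iD.snd hs) hb hb hg
      -- Going round `P` once gives `x ≤ co P + γ^(k + 1) x` for `x = x t b`, which is solved for
      -- `x` because `γ^(k + 1) < 1`.
      have := hx.walk hP.1 ht
      rw [hv, le_div_iff₀ (by push_cast; linarith)]
      rw [hl] at this
      push_cast
      linarith
    · rintro τ - rfl
      have g0 : τ₃.xreg 0 = G.g := (hB'.agree a₃ (by decide)).g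
      refine ⟨(hi.trans p₃.1).trans (.refl' rfl rfl rfl), ?_, fun C hC hne hl => ?_⟩
      · simp [a₃.xreg 2 (by decide), h2, g0, pow_succ]
      · rcases Nat.le_succ_iff.1 hl with hl | hl
        · exact p₃.1.ub _ _ (hQ C hC hne hl)
        · have hub := hE' b C hC hl
          have := p₃.2
          simp only [fl, dIx, ix, suc, BExp.Holds, WExp.eval, XExp.eval, hw, e6, h2, hB'.n] at this
          refine (this hub.1).mono ?_
          rw [hl]
          push_cast
          exact div_le_div_of_nonneg_right hub.2 (by linarith)

theorem directP_spec {G : Gr} {x : ℕ → ℕ → ℝ} (hx : G.Val x) {σ : Store} {b L : ℕ} (hB : Base G σ)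
    (h6 : σ.wreg 6 = b) (hb : b < G.n) (h4 : σ.wreg 4 = L) (hs : σ.Snd 4 2 5 (SD G))
    (hE : ∀ j ≤ L, Exact G σ j b) :
    Tri directP σ (L * (G.m * 160 + 20) + 170) fun τ => Imp 2 1 21 (SX G x) σ τ ∧
      ∀ P v, G.W b P v → P.length ≤ L → τ.ub 2 1 (b * G.n + v) (G.co P) := by
  have hsound : ∀ P v, G.W b P v → v < G.n → SX G x (b * G.n + v) (G.co P) 0 := by
    intro P v hP hv s t ht hi
    obtain ⟨rfl, rfl⟩ := ix_inj hv ht hi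
    refine ⟨⟨P, hP⟩, ?_⟩
    have h1 := hx.walk hP (Gr.R.refl v)
    -- Stopping at the end vertex costs nothing, so the discounted term at the end of the walk is at
    -- most 0.
    have h2 := mul_nonneg (pow_pos G.g_pos P.length).le (neg_nonneg.2 (hx.self_le v))
    linarith
  refine Tri.seq_le (S := 150) (T := L * (G.m * 160 + 20) + 20) (Tri.relax (SX G x) (by decide)
    (by decide) (by decide) ?_) (by omega) fun τ₁ a₁ p₁ => ?_
  · intro _ _
    have := hsound [] b rfl hb
    simpa [ix, WExp.eval, XExp.eval, h6, hB.n, Gr.co] using this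
  refine Tri.mono (Tri.for_each (N := L) (G.m * 160 + 10) (Imp 2 1 21 (SX G x))
    (fun j τ => ∀ P v, G.W b P v → P.length = j + 1 → τ.ub 2 1 (b * G.n + v) (G.co P))
    (by simp [WExp.eval, a₁.wreg 4 (by decide), h4]) (by decide) (by decide)
    (fun σ v => .refl' rfl rfl rfl) (fun _ _ _ => Imp.trans)
    (fun e _ σ τ h hQ P v hP hl => h.ub _ _ (hQ P v hP hl)) ?_) ?_ ?_
  · intro j hj σ₂ a₂ hw₂ i₂
    have ha₂ := (a₁.up directP.mods (by decide)).trans (a₂.up _ (by decide))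
    have hB₂ := hB.agree ha₂ (by decide)
    have hE₂ := (hE (j + 1) hj).imp (ha₂.imp 4 2 5 (by decide))
    refine Tri.mono (Tri.for_each (N := G.m) 150 (Imp 2 1 21 (SX G x))
      (fun e τ => ∀ P, G.W b P (G.hd e) → P.length = j + 1 →
        τ.ub 2 1 (b * G.n + G.hd e) (G.co P))
      hB₂.m (by decide) (by decide)
      (fun σ v => .refl' rfl rfl rfl) (fun _ _ _ => Imp.trans)
      (fun e _ σ τ h hQ P hP hl => h.ub _ _ (hQ P hP hl)) ?_) ?_ ?_
    · intro e he σ₃ a₃ hw₃ i₃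
      have ha₃ := ha₂.trans (a₃.up _ (by decide))
      have hB₃ := hB.agree ha₃ (by decide)
      have e6 : σ₃.wreg 6 = b := (ha₃.wreg 6 (by decide)).trans h6
      have e7 : σ₃.wreg 7 = j := (a₃.wreg 7 (by decide)).trans hw₂
      have iD := ha₃.imp 4 2 5 (S := SD G) (by decide)
      have hE₃ := (hE (j + 1) hj).imp iD
      refine Tri.mono (Tri.relax (SX G x) (by decide) (by decide) (T := 150) (by decide) ?_)
        le_rfl ?_
      · intro hg _
        simp only [fl, dIx, ix, suc, hdE, BExp.Holds, WExp.eval, XExp.eval, hw₃, e6, e7,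
          hB₃.n, hB₃.hd e he] at hg ⊢
        obtain ⟨P, hP, hl, hv⟩ := hE₃.opt (iD.snd hs) hb (G.hd_lt e he) hg
        rw [hv]
        exact hsound P _ hP.1 (G.hd_lt e he)
      · rintro τ - ⟨i4, hu⟩
        refine ⟨i4, fun P hP hl => ?_⟩
        have hub := hE₃ _ P hP hl
        simp only [fl, dIx, ix, suc, hdE, BExp.Holds, WExp.eval, XExp.eval, hw₃, e6, e7,
          hB₃.n, hB₃.hd e he] at hu
        exact (hu hub.1).mono hub.2
    · simp only [WExp.size]; omega
    · rintro τ - ⟨i4, hQ⟩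
      refine ⟨i4, fun P v hP hl => ?_⟩
      obtain ⟨Q, e, rfl⟩ : ∃ Q e, P = Q ++ [e] := by
        have hne : P ≠ [] := by rintro rfl; simp at hl
        exact ⟨P.dropLast, P.getLast hne, (List.dropLast_append_getLast hne).symm⟩
      obtain ⟨hQw, he, rfl⟩ := Gr.W_snoc.1 hP
      exact hQ e he _ hP hl
  · simp only [WExp.size]
    have : L * (G.m * 160 + 10 + (1 + 7)) ≤ L * (G.m * 160 + 20) := Nat.mul_le_mul_left _ (by omega)
    omega
  · rintro τ - ⟨i4, hQ⟩
    refine ⟨p₁.1.trans i4, fun P v hP hl => ?_⟩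
    rcases Nat.eq_zero_or_pos P.length with h0 | h0
    · obtain rfl : P = [] := List.length_eq_zero_iff.1 h0
      obtain rfl : b = v := hP
      have := p₁.2 (by simp [tt, BExp.Holds])
      refine i4.ub _ _ ?_
      simpa [ix, WExp.eval, h6, hB.n, XExp.eval, Gr.co] using this
    · exact hQ (P.length - 1) (by omega) P v hP (by omega)

end Dapsp

namespace Dapsp

open RealRAM

theorem agree_setW (σ : Store) (r v : ℕ) : Agree [4 * r] σ (σ.setW r v) :=
  ⟨fun q hq => by
    have : q ≠ r := by simpa [eq_comm] using hq
    simp [this], fun _ _ => rfl, fun _ _ => rfl, fun _ _ => rfl⟩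

/-! ## Tracing optimal walks -/

/-- The witness in row `j` belongs to the last edge of a walk whose first part is optimal. Following
witnesses down to row 0 therefore spells out, backwards, a walk whose cost is the table entry. -/
theorem traceP_spec {G : Gr} {σ : Store} {b L e q : ℕ} (hB : Base G σ)
    (h6 : σ.wreg 6 = b) (hb : b < G.n) (h4 : σ.wreg 4 = L) (h8 : σ.wreg 8 = e) (he : e < G.m)
    (h11 : σ.wreg 11 = q) (hs : σ.Snd 4 2 5 (SD G))
    (hE : ∀ j ≤ L, Exact G σ j b) (hf : σ.warr 4 ((L * G.n + b) * G.n + G.hd e) ≠ 0) :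
    Tri traceP σ (L * 50 + 20) fun τ => (∃ P, P.length = L ∧ G.Opt b (G.hd e) P ∧
      ∀ k ≤ L, τ.warr 11 (q + k) = G.en b (P.take k)) ∧ ∀ i < q, τ.warr 11 i = σ.warr 11 i := by
  have hv := G.hd_lt e he
  -- The optimal walk behind a witness need not be the one that is traced, but all optimal walks of
  -- a row cost what the table says.
  have hval : ∀ {j u : ℕ}, j ≤ L → u < G.n → σ.warr 4 ((j * G.n + b) * G.n + u) ≠ 0 → ∀ P,
      G.Opt b u P → P.length = j → σ.xarr 2 ((j * G.n + b) * G.n + u) = G.co P := by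
    intro j u hj hu hf P hP hl
    obtain ⟨P', hP', hl', hv'⟩ := (hE j hj).opt hs hb hu hf
    rw [hv']
    exact le_antisymm (hP'.2 _ hP.1 (by omega)) (hP.2 _ hP'.1 (by omega))
  refine Tri.seq_le (S := 3) (T := L * 50 + 16) (Tri.lf rfl (by decide)
    (Q := fun τ => τ = σ.setW 14 (G.hd e))
    (by simp [Prog.den, hdE, WExp.eval, h8, hB.hd e he])) (by omega) fun τ₁ a₁ p₁ => ?_
  subst p₁
  refine Tri.seq_le (S := 5) (T := L * 50 + 10) (Tri.lf rfl (by decide)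
    (Q := fun τ => τ = (σ.setW 14 (G.hd e)).putW 11 (q + L) (G.hd e))
    (by simp [Prog.den, WExp.eval, h11, h4])) (by omega) fun τ₂ a₂ p₂ => ?_
  subst p₂
  -- `S` is the traced part, from the cursor to the end. The entry of row `L` is the entry of row `L
  -- - k` at the cursor plus the cost of `S`, discounted by `L - k` steps.
  refine Tri.mono (Tri.for_ (N := L) 40 (fun k τ => (∃ S, S.length = k ∧
      G.W (τ.wreg 14) S (G.hd e) ∧ σ.warr 4 (((L - k) * G.n + b) * G.n + τ.wreg 14) ≠ 0 ∧
      σ.xarr 2 ((L * G.n + b) * G.n + G.hd e) =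
        σ.xarr 2 (((L - k) * G.n + b) * G.n + τ.wreg 14) + G.g ^ (L - k) * G.co S ∧
      ∀ i ≤ k, τ.warr 11 (q + (L - k) + i) = G.en (τ.wreg 14) (S.take i)) ∧
      ∀ i < q, τ.warr 11 i = σ.warr 11 i) (by simp [WExp.eval, h4]) (by decide) (by decide) ?_ ?_)
      (by simp only [WExp.size]; omega) ?_
  · refine ⟨⟨[], rfl, by simp [Gr.W], by simpa using hf, by simp [Gr.co], fun i hi => ?_⟩,
      fun i hi => ?_⟩
    · obtain rfl : i = 0 := by omega
      simp [Gr.en]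
    · have : i ≠ q + L := by omega
      simp [this]
  · rintro k hk σ' ha hw ⟨⟨S, hSl, hSw, hSf, hSc, hSn⟩, hold⟩
    have ha' := (a₁.up traceP.mods (by decide)).trans
      ((a₂.up _ (by decide)).trans (ha.up _ (by decide)))
    have r4 : σ'.wreg 4 = L := (ha'.wreg 4 (by decide)).trans h4
    have r11 : σ'.wreg 11 = q := (ha'.wreg 11 (by decide)).trans h11
    have hcur := hSw.lt_left hv
    rcases hs _ hSf _ b _ hb hcur rfl with ⟨h0, -⟩ | ⟨P, e', he', hhd, hpar, hPo, hPl, hPv⟩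
    · omega
    have hub := hE _ (by omega) _ P hPo.1 rfl
    have hv2 := hval (by omega) (G.tl_lt e' he') hub.1 P hPo rfl
    have e1 : L - k = P.length + 1 := hPl.symm
    have e2 : L - (k + 1) = P.length := by omega
    refine Tri.lf rfl (by decide) ?_
    simp only [Prog.den, dIx, ix, WExp.eval, r4, ha'.wreg 6 (by decide), h6,
      hw, (hB.agree ha' (by decide)).n, ha'.warr 5 (by decide), hpar]
    refine ⟨⟨e' :: S, by simp [hSl], ?_, ?_, ?_, ?_⟩, ?_⟩
    · simp only [setW_wreg, putW_wreg]
      exact ⟨he', by simp, by rw [hhd]; exact hSw⟩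
    · simpa [e2] using hub.1
    · simp only [setW_wreg, putW_wreg]
      simp only [e2, Gr.co]
      rw [hSc, hPv, e1]
      simp [hv2]
      ring
    · intro i hi
      rcases i with _ | i
      · simp [Gr.en, Nat.sub_sub, r4, r11, hw]
      · have h1 : q + (L - (k + 1)) + (i + 1) = q + (L - k) + i := by omega
        have h2 : q + (L - k) + i ≠ q + (L - k - 1) := by omega
        rw [h1]
        simp [h2, Gr.en, r4, r11, hw]
        have := hSn i (by omega)
        rw [this, ← hhd]; rfl
    · intro i hi
      have h2 : i ≠ q + (L - k - 1) := by omega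
      simpa [h2, r4, r11, hw] using hold i hi
  · rintro τ - ⟨⟨⟨S, hSl, hSw, hSf, hSc, hSn⟩, hold⟩, -⟩
    refine ⟨?_, hold⟩
    simp only [Nat.sub_self] at hSf hSc hSn
    have hcur := hSw.lt_left hv
    -- In row 0 the cursor must be at `b` with value 0, so `S` is a complete walk from `b` whose
    -- cost is the minimum.
    rcases hs _ hSf _ b _ hb hcur rfl with ⟨-, hbb, h0⟩ | ⟨P, _, _, _, _, _, h, _⟩
    · rw [← hbb] at hSw hSc hSn h0
      rw [h0] at hSc
      refine ⟨S, hSl, ⟨hSw, fun Q hQ hQl => ?_⟩, by simpa using hSn⟩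
      have := (hE L le_rfl _ Q hQ (by omega)).2
      rw [hSc] at this
      simpa using this
    · omega

/-! ## Lists of nodes -/

/-- One more than the last position before `k` where `f` takes the value `u`, or zero. -/
def lst (f : ℕ → ℕ) (u : ℕ) : ℕ → ℕ
  | 0 => 0
  | k + 1 => if f k = u then k + 1 else lst f u k

theorem lst_congr {f f' : ℕ → ℕ} {u : ℕ} : ∀ {k : ℕ}, (∀ i < k, f i = f' i) →
    lst f u k = lst f' u k := by
  intro k
  induction k with
  | zero => intro _; rfl
  | succ k ih =>
    intro h
    simp only [lst]
    rw [h k (by omega), ih fun i hi => h i (by omega)]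

theorem lt_lst {f : ℕ → ℕ} {u b : ℕ} : ∀ {k : ℕ}, b < lst f u k ↔ ∃ i, b ≤ i ∧ i < k ∧ f i = u := by
  intro k
  induction k with
  | zero => simp [lst]
  | succ k ih =>
    simp only [lst]
    split_ifs with h
    · constructor
      · intro hb; exact ⟨k, by omega, by omega, h⟩
      · rintro ⟨i, h1, h2, -⟩; omega
    · rw [ih]
      constructor
      · rintro ⟨i, h1, h2, h3⟩; exact ⟨i, h1, by omega, h3⟩
      · rintro ⟨i, h1, h2, h3⟩
        have : i ≠ k := by rintro rfl; exact h h3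
        exact ⟨i, h1, by omega, h3⟩

theorem lst_succ {f : ℕ → ℕ} {u i : ℕ} : ∀ {k : ℕ}, lst f u k = i + 1 → i < k ∧ f i = u := by
  intro k hk
  obtain ⟨j, h1, h2, h3⟩ := (lt_lst (f := f) (u := u) (k := k) (b := i)).1 (by omega)
  have : j < lst f u k := lt_lst.2 ⟨j, le_rfl, h2, h3⟩
  obtain rfl : j = i := by omega
  exact ⟨h2, h3⟩

/-- The traced walks of a level with `L` edges each. -/
structure Wk (G : Gr) (L : ℕ) (σ : Store) : Prop where
  cnt : σ.wreg 11 = σ.wreg 10 * (L + 1)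
  first : ∀ u < G.n, σ.warr 14 u = lst (σ.warr 11) u (σ.wreg 11)
  next : ∀ i < σ.wreg 11, σ.warr 13 i = lst (σ.warr 11) (σ.warr 11 i) i
  lt : ∀ i < σ.wreg 11, σ.warr 11 i < G.n
  simple : ∀ k < σ.wreg 10, σ.warr 15 k ≠ 0 → ∀ a c, a < c → c ≤ L →
    σ.warr 11 (k * (L + 1) + a) ≠ σ.warr 11 (k * (L + 1) + c)
  alive : σ.wreg 15 = ((Finset.range (σ.wreg 10)).filter fun k => σ.warr 15 k ≠ 0).card

theorem Wk.agree {G : Gr} {L : ℕ} {S : List ℕ} {σ τ : Store} (h : Wk G L σ) (ha : Agree S σ τ)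
    (hS : disj [40, 44, 60, 46, 54, 58, 62] S = true) : Wk G L τ := by
  simp [disj] at hS
  have h1 := ha.wreg 10 (by simp [hS])
  have h2 := ha.wreg 11 (by simp [hS])
  have h3 := ha.wreg 15 (by simp [hS])
  have h4 := ha.warr 11 (by simp [hS])
  have h5 := ha.warr 13 (by simp [hS])
  have h6 := ha.warr 14 (by simp [hS])
  have h7 := ha.warr 15 (by simp [hS])
  constructor
  · rw [h1, h2]; exact h.cnt
  · rw [h2, h4, h6]; exact h.first
  · rw [h2, h4, h5]; exact h.next
  · rw [h2, h4]; exact h.lt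
  · rw [h1, h4, h7]; exact h.simple
  · rw [h1, h3, h7]; exact h.alive

/-- Walks have only been added. -/
structure Grow (L : ℕ) (σ τ : Store) : Prop where
  le : σ.wreg 10 ≤ τ.wreg 10
  node : ∀ i < σ.wreg 10 * (L + 1), τ.warr 11 i = σ.warr 11 i
  alive : ∀ k < σ.wreg 10, τ.warr 15 k = σ.warr 15 k

theorem Grow.trans {L : ℕ} {σ τ υ : Store} (h : Grow L σ τ) (h' : Grow L τ υ) : Grow L σ υ :=
  ⟨h.le.trans h'.le, fun i hi => (h'.node i (hi.trans_le (Nat.mul_le_mul_right _ h.le))).trans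
    (h.node i hi), fun k hk => (h'.alive k (hk.trans_le h.le)).trans (h.alive k hk)⟩

theorem grow_of_agree {L : ℕ} {S : List ℕ} {σ τ : Store} (ha : Agree S σ τ)
    (hS : disj [40, 46, 62] S = true) : Grow L σ τ := by
  simp [disj] at hS
  exact ⟨(ha.wreg 10 (by simp [hS])).ge, fun i _ => by rw [ha.warr 11 (by simp [hS])],
    fun i _ => by rw [ha.warr 15 (by simp [hS])]⟩

/-- The walks of length `L` from `b` to `v` are represented. -/
def Done (G : Gr) (L : ℕ) (σ : Store) (b v : ℕ) : Prop :=
  (∃ P, G.W b P v ∧ P.length = L) → ∃ P, P.length = L ∧ G.Opt b v P ∧ (G.Rep b P v ∨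
    ∃ k < σ.wreg 10, σ.warr 15 k ≠ 0 ∧ ∀ i ≤ L, σ.warr 11 (k * (L + 1) + i) = G.en b (P.take i))

theorem mul_succ_add_lt {k p i L : ℕ} (hk : k < p) (hi : i ≤ L) :
    k * (L + 1) + i < p * (L + 1) := by
  have : (k + 1) * (L + 1) ≤ p * (L + 1) := Nat.mul_le_mul_right _ hk
  rw [Nat.add_mul] at this; omega

theorem Done.grow {G : Gr} {L b v : ℕ} {σ τ : Store} (h : Done G L σ b v) (hg : Grow L σ τ) :
    Done G L τ b v := by
  intro hw
  obtain ⟨P, hl, hP, h'⟩ := h hw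
  refine ⟨P, hl, hP, h'.imp id ?_⟩
  rintro ⟨k, hk, ha, hn⟩
  refine ⟨k, hk.trans_le hg.le, by rwa [hg.alive k hk], fun i hi => ?_⟩
  rw [hg.node _ (mul_succ_add_lt hk hi), hn i hi]

theorem linkP_spec {G : Gr} {σ : Store} {L : ℕ} (h4 : σ.wreg 4 = L)
    (hW : Wk G L σ) (hn : ∀ i ≤ L, σ.warr 11 (σ.wreg 11 + i) < G.n) :
    Tri linkP σ (L * 60 + 120) fun τ => Wk G L τ ∧ Grow L σ τ ∧ τ.wreg 10 = σ.wreg 10 + 1 ∧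
      τ.warr 11 = σ.warr 11 ∧ (τ.warr 15 (σ.wreg 10) = 0 → ∃ a c, a < c ∧ c ≤ L ∧
        σ.warr 11 (σ.wreg 11 + a) = σ.warr 11 (σ.wreg 11 + c)) := by
  refine Tri.seq_le (S := 2) (T := L * 60 + 110) (Tri.lf rfl (by decide)
    (Q := fun τ => τ = σ.setW 12 (σ.wreg 11)) rfl) (by omega) fun τ₁ a₁ p₁ => ?_
  subst p₁
  refine Tri.seq_le (S := 2) (T := L * 60 + 108) (Tri.lf rfl (by decide)
    (Q := fun τ => τ = (σ.setW 12 (σ.wreg 11)).setW 13 1) rfl) (by omega) fun τ₂ a₂ p₂ => ?_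
  subst p₂
  set q := σ.wreg 11 with hq
  set f := σ.warr 11 with hfdef
  refine Tri.seq_le (S := L * 60 + 78) (T := 30) (Tri.mono (Tri.for_ (N := L + 1) 50
    (fun k τ => τ.wreg 11 = q + k ∧ (∀ u < G.n, τ.warr 14 u = lst f u (q + k)) ∧
      (∀ i < q + k, τ.warr 13 i = lst f (f i) i) ∧
      (τ.wreg 13 = 0 → ∃ a c, a < c ∧ c < k ∧ f (q + a) = f (q + c)) ∧
      (τ.wreg 13 ≠ 0 → ∀ a c, a < c → c < k → f (q + a) ≠ f (q + c)))
      (by simp [WExp.eval, h4, suc]) (by decide) (by decide) ?_ ?_) ?_ (fun _ _ h => h.1))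
      (by omega) ?_
  · exact ⟨by simp [hq], by simpa using hW.first, by simpa using hW.next, by simp,
      fun _ a c _ h => absurd h (by omega)⟩
  · rintro k hk σ' ha hw ⟨r11, h14, h13, hz, hnz⟩
    have ha' := (a₁.up linkP.mods (by decide)).trans
      ((a₂.up _ (by decide)).trans (ha.up _ (by decide)))
    have r12 : σ'.wreg 12 = q := by rw [ha.wreg 12 (by decide)]; simp
    have f11 : σ'.warr 11 = f := ha'.warr 11 (by decide)
    have hu := hn k (by omega)
    -- Nodes from `q` on belong to the current walk, so the test detects exactly an earlier visit by
    -- this walk.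
    have hmem : q < lst f (f (q + k)) (q + k) ↔ ∃ a < k, f (q + a) = f (q + k) := by
      rw [lt_lst]
      constructor
      · rintro ⟨i, h1, h2, h3⟩; exact ⟨i - q, by omega, by rw [← h3]; congr 1; omega⟩
      · rintro ⟨a, h1, h2⟩; exact ⟨q + a, by omega, by omega, h2⟩
    refine Tri.lf rfl (by decide) ?_
    have hnext : ∀ u < G.n, (if u = f (q + k) then q + k + 1 else σ'.warr 14 u) =
        lst f u (q + (k + 1)) := by
      intro u hu'
      rw [← Nat.add_assoc, lst]
      by_cases h : u = f (q + k)
      · simp [h]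
      · rw [if_neg h, if_neg (Ne.symm h), h14 u hu']
    have hnext' : ∀ i < q + (k + 1), (if i = q + k then σ'.warr 14 (f (q + k)) else σ'.warr 13 i) =
        lst f (f i) i := by
      intro i hi
      by_cases h : i = q + k
      · subst h; rw [if_pos rfl, h14 _ hu]
      · rw [if_neg h, h13 i (by omega)]
    by_cases hc : q < lst f (f (q + k)) (q + k)
    · have hc' : q < σ'.warr 14 (f (q + k)) := by rwa [h14 _ hu]
      simp only [linkStep, Prog.den, BExp.Holds, WExp.eval, r12, r11, f11, hc', if_true, suc]
      simp only [setW_wreg, setW_warr, putW_wreg, putW_warr, r11, f11, Nat.reduceEqDiff, if_true,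
        if_false, Function.update_apply]
      refine ⟨by omega, by simpa using hnext, by simpa using hnext', fun _ => ?_, by simp⟩
      obtain ⟨a, h1, h2⟩ := hmem.1 hc
      exact ⟨a, k, h1, by omega, h2⟩
    · have hc' : ¬ q < σ'.warr 14 (f (q + k)) := by rwa [h14 _ hu]
      simp only [linkStep, Prog.den, BExp.Holds, WExp.eval, r12, r11, f11, hc', if_false, suc]
      simp only [setW_wreg, setW_warr, putW_wreg, putW_warr, r11, f11, Nat.reduceEqDiff, if_true,
        if_false, Function.update_apply]
      refine ⟨by omega, by simpa using hnext, by simpa using hnext', fun h => ?_,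
        fun h a c hac hck => ?_⟩
      · obtain ⟨a, c, h1, h2, h3⟩ := hz h
        exact ⟨a, c, h1, by omega, h3⟩
      · rcases Nat.lt_succ_iff_lt_or_eq.1 hck with h' | rfl
        · exact hnz h a c hac h'
        · intro he
          exact hc (hmem.2 ⟨a, hac, he⟩)
  · simp only [WExp.size, suc]; omega
  · rintro τ₃ a₃ ⟨r11, h14, h13, hz, hnz⟩
    have ha' := (a₁.up linkP.mods (by decide)).trans
      ((a₂.up _ (by decide)).trans (a₃.up _ (by decide)))
    have r10 : τ₃.wreg 10 = σ.wreg 10 := by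
      rw [a₃.wreg 10 (by decide)]; simp
    have r15 : τ₃.wreg 15 = σ.wreg 15 := by
      rw [a₃.wreg 15 (by decide)]; simp
    have f11 : τ₃.warr 11 = f := ha'.warr 11 (by decide)
    have f15 : τ₃.warr 15 = σ.warr 15 := by rw [a₃.warr 15 (by decide)]; simp
    refine Tri.lf rfl (by decide) ?_
    set p := σ.wreg 10 with hp
    have hqp : q + (L + 1) = (p + 1) * (L + 1) := by rw [hq, hW.cnt]; ring
    have hlt : ∀ i < q + (L + 1), f i < G.n := by
      intro i hi
      by_cases h : i < q
      · exact hW.lt i h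
      · have := hn (i - q) (by omega)
        rwa [show q + (i - q) = i by omega] at this
    have hfilter : ∀ v, ((Finset.range p).filter fun k =>
        (Function.update (σ.warr 15) p v) k ≠ 0) =
        (Finset.range p).filter fun k => σ.warr 15 k ≠ 0 := by
      intro v
      refine Finset.filter_congr fun k hk => ?_
      rw [Function.update_of_ne (by simp at hk; omega)]
    have hsimp : ∀ v, (v ≠ 0 → ∀ a c, a < c → c < L + 1 → f (q + a) ≠ f (q + c)) →
        ∀ k < p + 1, Function.update (σ.warr 15) p v k ≠ 0 → ∀ a c, a < c → c ≤ L →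
        f (k * (L + 1) + a) ≠ f (k * (L + 1) + c) := by
      intro v hv k hk hne a c hac hc
      by_cases h : k = p
      · subst h
        rw [Function.update_self] at hne
        have := hv hne a c hac (by omega)
        rwa [hq, hW.cnt] at this
      · rw [Function.update_of_ne h] at hne
        exact hW.simple k (by omega) hne a c hac hc
    have hgrow : ∀ v, ∀ k < p, Function.update (σ.warr 15) p v k = σ.warr 15 k := fun v k hk =>
      Function.update_of_ne (by omega) _ _
    by_cases h0 : τ₃.wreg 13 = 0
    · simp only [Prog.den, BExp.Holds, WExp.eval, r10, putW_wreg, h0, if_true, suc]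
      refine ⟨⟨?_, ?_, ?_, ?_, ?_, ?_⟩, ⟨?_, ?_, ?_⟩, ?_, ?_, ?_⟩
      · simp [r11, hqp]
      · simpa [r11, f11] using h14
      · simpa [r11, f11] using h13
      · simpa [r11, f11] using hlt
      · simpa [f15, f11] using hsimp 0 (by simp)
      · have := hfilter 0
        simp only [setW_wreg, Nat.reduceEqDiff, if_false, if_true, putW_wreg, r15, setW_warr,
          putW_warr, f15, Finset.range_add_one, Finset.filter_insert, Function.update_self, ne_eq,
          not_true] at this ⊢
        rw [this]; exact hW.alive
      · simp [hp]
      · simp [f11, hfdef]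
      · simpa [f15] using hgrow 0
      · simp
      · simpa using f11
      · intro _
        obtain ⟨a, c, h1, h2, h3⟩ := hz h0
        exact ⟨a, c, h1, by omega, h3⟩
    · simp only [Prog.den, BExp.Holds, WExp.eval, r10, putW_wreg, h0, if_false, suc]
      refine ⟨⟨?_, ?_, ?_, ?_, ?_, ?_⟩, ⟨?_, ?_, ?_⟩, ?_, ?_, ?_⟩
      · simp [r11, hqp, r10]
      · simpa [r11, f11] using h14
      · simpa [r11, f11] using h13
      · simpa [r11, f11] using hlt
      · simpa [f15, f11, r10] using hsimp (τ₃.wreg 13) hnz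
      · have := hfilter (τ₃.wreg 13)
        simp only [setW_wreg, Nat.reduceEqDiff, if_false, if_true, putW_wreg, r15, r10, setW_warr,
          putW_warr, f15, Finset.range_add_one, Finset.filter_insert, Function.update_self, ne_eq,
          h0, not_false_iff] at this ⊢
        rw [Finset.card_insert_of_notMem (by simp), this, hW.alive]
      · simp [hp, r10]
      · simp [f11, hfdef]
      · simpa [f15] using hgrow (τ₃.wreg 13)
      · simp [r10]
      · simpa using f11
      · intro h; simp [h0] at h

end Dapsp

/-! ### Collecting optimal walks, and lists of their nodes by vertex -/

namespace Dapsp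

open RealRAM

/-- Walks are collected per edge and not per end vertex: a walk with at least one edge ends at the
head of an edge, and `m` traces of length `L` cost no more than the walk tables. A walk that is not
simple is recorded as dead, since it needs no hitting vertex. -/
theorem extractP_spec {G : Gr} {σ : Store} {b L e : ℕ} (hB : Base G σ)
    (h6 : σ.wreg 6 = b) (hb : b < G.n) (h4 : σ.wreg 4 = L) (h8 : σ.wreg 8 = e) (he : e < G.m)
    (hs : σ.Snd 4 2 5 (SD G)) (hE : ∀ j ≤ L, Exact G σ j b) (hW : Wk G L σ) :
    Tri extractP σ (L * 110 + 160) fun τ => Wk G L τ ∧ Grow L σ τ ∧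
      τ.wreg 10 ≤ σ.wreg 10 + 1 ∧ Done G L τ b (G.hd e) := by
  refine Tri.mono (Tri.ite (T := L * 110 + 140) (fun hf => ?_) (fun hf => ?_)) ?_
    (fun _ _ h => h)
  · simp only [fl, dIx, ix, hdE, BExp.Holds, WExp.eval, h4, h6, h8, hB.n, hB.hd e he] at hf
    refine Tri.seq_le (T := L * 60 + 120) (traceP_spec hB h6 hb h4 h8 he rfl hs hE hf) (by omega) ?_
    rintro τ a ⟨⟨P, hPl, hPo, hPn⟩, hold⟩
    have r10 := a.wreg 10 (by decide)
    have r11 := a.wreg 11 (by decide)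
    have w14 := a.warr 14 (by decide)
    have w13 := a.warr 13 (by decide)
    have w15 := a.warr 15 (by decide)
    have hq := hW.cnt
    have hnode : ∀ k < σ.wreg 10, ∀ i ≤ L, τ.warr 11 (k * (L + 1) + i) =
        σ.warr 11 (k * (L + 1) + i) := fun k hk i hi =>
      hold _ (by rw [hq]; exact mul_succ_add_lt hk hi)
    have hW' : Wk G L τ := by
      constructor
      · rw [r10, r11]; exact hq
      · intro u hu; rw [r11, w14, hW.first u hu]; exact (lst_congr hold).symm
      · intro i hi
        rw [r11] at hi
        rw [w13, hW.next i hi, hold i hi]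
        exact (lst_congr fun j hj => hold j (by omega)).symm
      · intro i hi; rw [r11] at hi; rw [hold i hi]; exact hW.lt i hi
      · intro k hk h0 a' c' hac hc
        rw [r10] at hk; rw [w15] at h0
        rw [hnode k hk _ (by omega), hnode k hk _ hc]
        exact hW.simple k hk h0 a' c' hac hc
      · rw [a.wreg 15 (by decide), r10, w15]; exact hW.alive
    refine Tri.mono (linkP_spec ((a.wreg 4 (by decide)).trans h4) hW' (fun i hi => ?_)) le_rfl ?_
    · rw [r11, hPn i hi]; exact (hPo.1.take i).1.lt hb
    · rintro υ - ⟨hW2, hG2, h10, h11, hdead⟩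
      have hG1 : Grow L σ τ := ⟨r10.ge, fun i hi => hold i (by rw [hq]; exact hi),
        fun k _ => by rw [w15]⟩
      refine ⟨hW2, hG1.trans hG2, by omega, fun _ => ⟨P, hPl, hPo, ?_⟩⟩
      by_cases h0 : υ.warr 15 (τ.wreg 10) = 0
      · obtain ⟨a', c', hac, hc, heq⟩ := hdead h0
        rw [r11, hPn _ (by omega), hPn _ hc] at heq
        exact Or.inl (hPo.1.rep hac (by omega) heq)
      · refine Or.inr ⟨τ.wreg 10, by omega, h0, fun i hi => ?_⟩
        rw [h11, r10, ← hq, hPn i hi]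
  · simp only [fl, dIx, ix, hdE, BExp.Holds, WExp.eval, h4, h6, h8, hB.n, hB.hd e he] at hf
    refine Tri.lf rfl (by show 1 ≤ _; omega) ?_
    refine ⟨hW, grow_of_agree (Agree.refl [] σ) rfl, by simp [Prog.den], ?_⟩
    rintro ⟨P, hP, hl⟩
    exact absurd (hE L le_rfl _ P hP hl).1 hf
  · simp only [fl, dIx, ix, hdE, BExp.size, WExp.size]; omega

/-! ## Hitting sets -/

/-- The number of alive nodes with vertex `u`. -/
def AN (L Q : ℕ) (f al : ℕ → ℕ) (u : ℕ) : ℕ :=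
  ((Finset.range Q).filter fun q => f q = u ∧ al (q / (L + 1)) ≠ 0).card

/-- The number of nodes before `k` with vertex `u`. -/
def NN (f : ℕ → ℕ) (u k : ℕ) : ℕ := ((Finset.range k).filter fun q => f q = u).card

theorem NN_lt {f : ℕ → ℕ} {u i k : ℕ} (h : k ≤ i) (hi : f i = u) : NN f u k < NN f u (i + 1) := by
  refine Finset.card_lt_card ⟨fun q hq => ?_, fun hs => ?_⟩
  · simp only [Finset.mem_filter, Finset.mem_range] at hq ⊢; exact ⟨by omega, hq.2⟩
  · have := @hs i (by simp [hi])
    simp at this; omega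

theorem NN_mono {f : ℕ → ℕ} {u i k : ℕ} (h : k ≤ i) : NN f u k ≤ NN f u i :=
  Finset.card_le_card fun q hq => by
    simp only [Finset.mem_filter, Finset.mem_range] at hq ⊢; exact ⟨by omega, hq.2⟩

theorem lst_le {f : ℕ → ℕ} {u : ℕ} : ∀ k, lst f u k ≤ k
  | 0 => le_rfl
  | k + 1 => by simp only [lst]; split_ifs; exacts [le_rfl, (lst_le k).trans (Nat.le_succ k)]

/-- A link leads to the previous node with the same vertex, so no node of `u` is skipped. The bound
`cur` is one more than the node under the cursor, and zero ends the list. -/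
theorem next_node {G : Gr} {L : ℕ} {σ : Store} (hW : Wk G L σ) {u cur : ℕ}
    (hc : cur = 0 ∨ (cur ≤ σ.wreg 11 ∧ σ.warr 11 (cur - 1) = u)) (h0 : cur ≠ 0) :
    σ.warr 13 (cur - 1) < cur ∧ (σ.warr 13 (cur - 1) = 0 ∨
      (σ.warr 13 (cur - 1) ≤ σ.wreg 11 ∧ σ.warr 11 (σ.warr 13 (cur - 1) - 1) = u)) ∧
      (∀ q, σ.warr 13 (cur - 1) ≤ q → σ.warr 11 q = u → q = cur - 1 ∨ cur ≤ q) := by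
  obtain ⟨hle, hu⟩ := hc.resolve_left h0
  have hn := hW.next (cur - 1) (by omega)
  rw [hu] at hn
  have hl := lst_le (f := σ.warr 11) (u := u) (cur - 1)
  refine ⟨by omega, ?_, fun q hq hqu => ?_⟩
  · rcases Nat.eq_zero_or_pos (σ.warr 13 (cur - 1)) with h | h
    · exact Or.inl h
    · have := lst_succ (f := σ.warr 11) (u := u) (i := σ.warr 13 (cur - 1) - 1) (k := cur - 1)
        (by omega)
      exact Or.inr ⟨by omega, this.2⟩
  · by_contra hcon
    push Not at hcon
    have : σ.warr 13 (cur - 1) < lst (σ.warr 11) u (cur - 1) := lt_lst.2 ⟨q, hq, by omega, hqu⟩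
    omega

theorem first_node {G : Gr} {L : ℕ} {σ : Store} (hW : Wk G L σ) {u : ℕ} (hu : u < G.n) :
    (σ.warr 14 u = 0 ∨ (σ.warr 14 u ≤ σ.wreg 11 ∧ σ.warr 11 (σ.warr 14 u - 1) = u)) ∧
      ∀ q < σ.wreg 11, σ.warr 14 u ≤ q → σ.warr 11 q ≠ u := by
  have hn := hW.first u hu
  have hl := lst_le (f := σ.warr 11) (u := u) (σ.wreg 11)
  refine ⟨?_, fun q hq hle hqu => ?_⟩
  · rcases Nat.eq_zero_or_pos (σ.warr 14 u) with h | h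
    · exact Or.inl h
    · have := lst_succ (f := σ.warr 11) (u := u) (i := σ.warr 14 u - 1) (k := σ.wreg 11) (by omega)
      exact Or.inr ⟨by omega, this.2⟩
  · have : σ.warr 14 u < lst (σ.warr 11) u (σ.wreg 11) := lt_lst.2 ⟨q, hle, hq, hqu⟩
    omega

theorem countP_spec {G : Gr} {L : ℕ} {σ : Store} (hW : Wk G L σ) (h4 : σ.wreg 4 = L)
    (hu : σ.wreg 17 < G.n) :
    Tri countP σ (NN (σ.warr 11) (σ.wreg 17) (σ.wreg 11) * 40 + 20) fun τ =>
      τ.wreg 18 = AN L (σ.wreg 11) (σ.warr 11) (σ.warr 15) (σ.wreg 17) := by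
  refine Tri.seq_le (S := 2) (T := NN (σ.warr 11) (σ.wreg 17) (σ.wreg 11) * 40 + 18)
    (Tri.lf rfl (by decide) (Q := fun τ => τ = σ.setW 18 0) rfl) (by omega) fun τ₁ a₁ p₁ => ?_
  subst p₁
  refine Tri.seq_le (S := 3) (T := NN (σ.warr 11) (σ.wreg 17) (σ.wreg 11) * 40 + 15)
    (Tri.lf rfl (by decide) (Q := fun τ => τ = (σ.setW 18 0).setW 14 (σ.warr 14 (σ.wreg 17))) rfl)
    (by omega) fun τ₂ a₂ p₂ => ?_
  subst p₂
  set u := σ.wreg 17 with hudef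
  obtain ⟨hf1, hf2⟩ := first_node hW hu
  -- The list is run through backwards: the counter holds the alive nodes of `u` whose number is at
  -- least the cursor, and the variant counts the nodes of `u` below it.
  refine Tri.mono (Tri.loop (T := 30) (fun τ => (τ.wreg 14 = 0 ∨ (τ.wreg 14 ≤ σ.wreg 11 ∧
      σ.warr 11 (τ.wreg 14 - 1) = u)) ∧ τ.wreg 18 = ((Finset.range (σ.wreg 11)).filter fun q =>
        τ.wreg 14 ≤ q ∧ σ.warr 11 q = u ∧ σ.warr 15 (q / (L + 1)) ≠ 0).card)
    (fun τ => NN (σ.warr 11) u (τ.wreg 14)) ?_ ?_) ?_ ?_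
  · refine ⟨by simpa using hf1, ?_⟩
    simp only [setW_wreg, Nat.reduceEqDiff, if_true, if_false]
    symm
    rw [Finset.card_eq_zero, Finset.filter_eq_empty_iff]
    rintro q hq ⟨h1, h2, -⟩
    exact hf2 q (by simpa using hq) h1 h2
  · rintro σ' ha ⟨hcur, hcnt⟩ hb
    have ha' := (a₁.up countP.mods (by decide)).trans
      ((a₂.up _ (by decide)).trans (ha.up _ (by decide)))
    simp only [BExp.Holds, WExp.eval] at hb
    have e13 := ha'.warr 13 (by decide)
    have e15 := ha'.warr 15 (by decide)
    have e4 : σ'.wreg 4 = L := (ha'.wreg 4 (by decide)).trans h4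
    obtain ⟨n1, n2, n3⟩ := next_node hW hcur hb
    obtain ⟨hle, hcu⟩ := hcur.resolve_left hb
    refine Tri.lf rfl (by decide) ?_
    have key : (Finset.range (σ.wreg 11)).filter (fun q => σ.warr 13 (σ'.wreg 14 - 1) ≤ q ∧
        σ.warr 11 q = u ∧ σ.warr 15 (q / (L + 1)) ≠ 0) =
        if σ.warr 15 ((σ'.wreg 14 - 1) / (L + 1)) ≠ 0 then
          insert (σ'.wreg 14 - 1) ((Finset.range (σ.wreg 11)).filter fun q =>
            σ'.wreg 14 ≤ q ∧ σ.warr 11 q = u ∧ σ.warr 15 (q / (L + 1)) ≠ 0)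
        else (Finset.range (σ.wreg 11)).filter fun q =>
            σ'.wreg 14 ≤ q ∧ σ.warr 11 q = u ∧ σ.warr 15 (q / (L + 1)) ≠ 0 := by
      split_ifs with hal
      · ext q
        simp only [Finset.mem_filter, Finset.mem_range, Finset.mem_insert]
        constructor
        · rintro ⟨h1, h2, h3, h5⟩
          rcases n3 q h2 h3 with h | h
          · exact Or.inl h
          · exact Or.inr ⟨h1, h, h3, h5⟩
        · rintro (rfl | ⟨h1, h2, h3, h5⟩)
          · exact ⟨by omega, by omega, hcu, hal⟩
          · exact ⟨h1, by omega, h3, h5⟩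
      · refine Finset.filter_congr fun q hq => ⟨?_, ?_⟩
        · rintro ⟨h2, h3, h5⟩
          rcases n3 q h2 h3 with rfl | h
          · exact absurd h5 hal
          · exact ⟨h, h3, h5⟩
        · rintro ⟨h2, h3, h5⟩; exact ⟨by omega, h3, h5⟩
    have hV : NN (σ.warr 11) u (σ.warr 13 (σ'.wreg 14 - 1)) < NN (σ.warr 11) u (σ'.wreg 14) := by
      have := NN_lt (f := σ.warr 11) (u := u) (i := σ'.wreg 14 - 1)
        (k := σ.warr 13 (σ'.wreg 14 - 1)) (by omega) hcu
      rwa [show σ'.wreg 14 - 1 + 1 = σ'.wreg 14 by omega] at this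
    by_cases hal : σ.warr 15 ((σ'.wreg 14 - 1) / (L + 1)) ≠ 0
    · rw [if_pos hal] at key
      simp only [Prog.den, BExp.Holds, fl, curWalk, nextNode, suc, WExp.eval, e4, e15, hal,
        not_false_iff, if_true, setW_warr, e13, setW_wreg, Nat.reduceEqDiff, if_false]
      refine ⟨⟨n2, ?_⟩, hV⟩
      rw [key, Finset.card_insert_of_notMem (by simp; omega), hcnt]
    · rw [if_neg hal] at key
      simp only [Prog.den, BExp.Holds, fl, curWalk, nextNode, suc, WExp.eval, e4, e15, hal,
        if_false, e13, setW_wreg, Nat.reduceEqDiff, if_true]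
      exact ⟨⟨n2, by rw [key, hcnt]⟩, hV⟩
  · simp only [setW_wreg, if_true, BExp.size, WExp.size]
    have := NN_mono (f := σ.warr 11) (u := u) (i := σ.wreg 11) (k := σ.warr 14 u)
      (by rcases hf1 with h | h <;> omega)
    omega
  · rintro τ - ⟨⟨-, hcnt⟩, h0⟩
    simp only [BExp.Holds, WExp.eval, not_not] at h0
    rw [hcnt, AN, h0]
    simp

end Dapsp

/-! ### Deleting the walks through a chosen vertex -/

namespace Dapsp

open RealRAM

theorem killP_spec {G : Gr} {L : ℕ} {σ : Store} (hW : Wk G L σ) (h4 : σ.wreg 4 = L)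
    (hu : σ.wreg 17 < G.n) :
    Tri killP σ (NN (σ.warr 11) (σ.wreg 17) (σ.wreg 11) * 60 + 20) fun τ => Wk G L τ ∧
      ∀ k < σ.wreg 10, τ.warr 15 k ≠ 0 ↔ σ.warr 15 k ≠ 0 ∧
        ∀ q < σ.wreg 11, σ.warr 11 q = σ.wreg 17 → q / (L + 1) ≠ k := by
  refine Tri.seq_le (S := 3) (T := NN (σ.warr 11) (σ.wreg 17) (σ.wreg 11) * 60 + 15)
    (Tri.lf rfl (by decide) (Q := fun τ => τ = σ.setW 14 (σ.warr 14 (σ.wreg 17))) rfl)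
    (by omega) fun τ₂ a₂ p₂ => ?_
  subst p₂
  set u := σ.wreg 17 with hudef
  obtain ⟨hf1, hf2⟩ := first_node hW hu
  refine Tri.mono (Tri.loop (T := 50) (fun τ => (τ.wreg 14 = 0 ∨ (τ.wreg 14 ≤ σ.wreg 11 ∧
      σ.warr 11 (τ.wreg 14 - 1) = u)) ∧
      (∀ k < σ.wreg 10, τ.warr 15 k ≠ 0 ↔ σ.warr 15 k ≠ 0 ∧
        ∀ q < σ.wreg 11, τ.wreg 14 ≤ q → σ.warr 11 q = u → q / (L + 1) ≠ k) ∧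
      τ.wreg 15 = ((Finset.range (σ.wreg 10)).filter fun k => τ.warr 15 k ≠ 0).card)
    (fun τ => NN (σ.warr 11) u (τ.wreg 14)) ?_ ?_) ?_ ?_
  · refine ⟨by simpa using hf1, fun k hk => ?_, hW.alive⟩
    simp only [setW_warr, setW_wreg, if_true]
    exact ⟨fun h => ⟨h, fun q hq h1 h2 => absurd h2 (hf2 q hq h1)⟩, fun h => h.1⟩
  · rintro σ' ha ⟨hcur, hal', hA⟩ hb
    have ha' := (a₂.up killP.mods (by decide)).trans (ha.up _ (by decide))
    simp only [BExp.Holds, WExp.eval] at hb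
    have e13 := ha'.warr 13 (by decide)
    have e4 : σ'.wreg 4 = L := (ha'.wreg 4 (by decide)).trans h4
    obtain ⟨n1, n2, n3⟩ := next_node hW hcur hb
    obtain ⟨hle, hcu⟩ := hcur.resolve_left hb
    have hk0 : (σ'.wreg 14 - 1) / (L + 1) < σ.wreg 10 := by
      rw [Nat.div_lt_iff_lt_mul (by omega), ← hW.cnt]; omega
    have hV : NN (σ.warr 11) u (σ.warr 13 (σ'.wreg 14 - 1)) < NN (σ.warr 11) u (σ'.wreg 14) := by
      have := NN_lt (f := σ.warr 11) (u := u) (i := σ'.wreg 14 - 1)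
        (k := σ.warr 13 (σ'.wreg 14 - 1)) (by omega) hcu
      rwa [show σ'.wreg 14 - 1 + 1 = σ'.wreg 14 by omega] at this
    have key : ∀ k, (∀ q < σ.wreg 11, σ.warr 13 (σ'.wreg 14 - 1) ≤ q → σ.warr 11 q = u →
        q / (L + 1) ≠ k) ↔ (σ'.wreg 14 - 1) / (L + 1) ≠ k ∧
        ∀ q < σ.wreg 11, σ'.wreg 14 ≤ q → σ.warr 11 q = u → q / (L + 1) ≠ k := by
      intro k
      constructor
      · intro h
        exact ⟨h _ (by omega) (by omega) hcu, fun q h1 h2 h3 => h q h1 (by omega) h3⟩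
      · rintro ⟨h1, h2⟩ q h3 h5 h6
        rcases n3 q h5 h6 with rfl | h7
        · exact h1
        · exact h2 q h3 h7 h6
    refine Tri.lf rfl (by decide) ?_
    by_cases hal : σ'.warr 15 ((σ'.wreg 14 - 1) / (L + 1)) ≠ 0
    · simp only [Prog.den, BExp.Holds, fl, curWalk, nextNode, suc, WExp.eval, e4, hal,
        not_false_iff, if_true, setW_warr, e13, setW_wreg, Nat.reduceEqDiff, if_false, putW_warr,
        putW_wreg]
      refine ⟨⟨n2, fun k hk => ?_, ?_⟩, hV⟩
      · rw [key k, Function.update_apply]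
        by_cases h : k = (σ'.wreg 14 - 1) / (L + 1)
        · simp [h]
        · rw [if_neg h, hal' k hk]
          exact ⟨fun ⟨h1, h2⟩ => ⟨h1, Ne.symm h, h2⟩, fun ⟨h1, _, h2⟩ => ⟨h1, h2⟩⟩
      · have : ((Finset.range (σ.wreg 10)).filter fun k =>
            Function.update (σ'.warr 15) ((σ'.wreg 14 - 1) / (L + 1)) 0 k ≠ 0) =
            ((Finset.range (σ.wreg 10)).filter fun k => σ'.warr 15 k ≠ 0).erase
              ((σ'.wreg 14 - 1) / (L + 1)) := by
          ext k
          simp only [Finset.mem_filter, Finset.mem_range, Finset.mem_erase, Function.update_apply]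
          by_cases h : k = (σ'.wreg 14 - 1) / (L + 1) <;> simp [h]
        rw [this, Finset.card_erase_of_mem (by simp [hk0, hal]), hA]
    · simp only [Prog.den, BExp.Holds, fl, curWalk, nextNode, suc, WExp.eval, e4, hal,
        if_false, e13, setW_wreg, Nat.reduceEqDiff, if_true, setW_warr]
      refine ⟨⟨n2, fun k hk => ?_, hA⟩, hV⟩
      rw [key k]
      constructor
      · intro h
        refine ⟨((hal' k hk).1 h).1, ?_, ((hal' k hk).1 h).2⟩
        rintro rfl
        exact hal h
      · rintro ⟨h1, -, h2⟩
        exact (hal' k hk).2 ⟨h1, h2⟩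
  · simp only [setW_wreg, if_true, BExp.size, WExp.size]
    have := NN_mono (f := σ.warr 11) (u := u) (i := σ.wreg 11) (k := σ.warr 14 u)
      (by rcases hf1 with h | h <;> omega)
    omega
  · rintro τ ha ⟨⟨-, hal', hA⟩, h0⟩
    have ha' := (a₂.up killP.mods (by decide)).trans (ha.up _ (by decide))
    simp only [BExp.Holds, WExp.eval, not_not] at h0
    have r10 := ha'.wreg 10 (by decide)
    have r11 := ha'.wreg 11 (by decide)
    have w11 := ha'.warr 11 (by decide)
    have hal2 : ∀ k < σ.wreg 10, τ.warr 15 k ≠ 0 ↔ σ.warr 15 k ≠ 0 ∧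
        ∀ q < σ.wreg 11, σ.warr 11 q = u → q / (L + 1) ≠ k := fun k hk => by
      rw [hal' k hk]; simp [h0]
    refine ⟨⟨?_, ?_, ?_, ?_, ?_, ?_⟩, hal2⟩
    · rw [r10, r11]; exact hW.cnt
    · rw [r11, w11, ha'.warr 14 (by decide)]; exact hW.first
    · rw [r11, w11, ha'.warr 13 (by decide)]; exact hW.next
    · rw [r11, w11]; exact hW.lt
    · rw [r10, w11]; exact fun k hk h => hW.simple k hk ((hal2 k hk).1 h).1
    · rw [r10]; exact hA

/-- New hitting vertices have been collected. -/
structure Hits (G : Gr) (L : ℕ) (σ τ : Store) : Prop where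
  cnt : τ.wreg 10 = σ.wreg 10
  node : τ.warr 11 = σ.warr 11
  top : σ.wreg 28 ≤ τ.wreg 28
  keep : ∀ i < σ.wreg 28, τ.warr 8 i = σ.warr 8 i
  lt : ∀ i, σ.wreg 28 ≤ i → i < τ.wreg 28 → τ.warr 8 i < G.n
  dead : ∀ k < σ.wreg 10, τ.warr 15 k ≠ 0 → σ.warr 15 k ≠ 0
  hit : ∀ k < σ.wreg 10, σ.warr 15 k ≠ 0 → τ.warr 15 k ≠ 0 ∨ ∃ i ≤ L, ∃ z, σ.wreg 28 ≤ z ∧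
    z < τ.wreg 28 ∧ τ.warr 8 z = σ.warr 11 (k * (L + 1) + i)

theorem Hits.trans {G : Gr} {L : ℕ} {σ τ υ : Store} (h : Hits G L σ τ) (h' : Hits G L τ υ) :
    Hits G L σ υ := by
  refine ⟨h'.cnt.trans h.cnt, h'.node.trans h.node, h.top.trans h'.top, fun i hi => ?_,
    fun i hi hi' => ?_, fun k hk h0 => ?_, fun k hk h0 => ?_⟩
  · rw [h'.keep i (hi.trans_le h.top), h.keep i hi]
  · by_cases hc : i < τ.wreg 28
    · rw [h'.keep i hc]; exact h.lt i hi hc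
    · exact h'.lt i (by omega) hi'
  · exact h.dead k hk (h'.dead k (by rwa [h.cnt]) h0)
  · rcases h.hit k hk h0 with h1 | ⟨i, hi, z, h1, h2, h3⟩
    · rcases h'.hit k (by rwa [h.cnt]) h1 with h2 | ⟨i, hi, z, h2, h3, h4⟩
      · exact Or.inl h2
      · exact Or.inr ⟨i, hi, z, h.top.trans h2, h3, by rw [h4, h.node]⟩
    · exact Or.inr ⟨i, hi, z, h1, h2.trans_le h'.top, by rw [h'.keep z h2, h3]⟩

theorem hits_of_agree {G : Gr} {L : ℕ} {S : List ℕ} {σ τ : Store} (ha : Agree S σ τ)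
    (hS : disj [40, 46, 112, 34, 62] S = true) : Hits G L σ τ := by
  simp [disj] at hS
  have h8 := ha.warr 8 (by simp [hS])
  have h15 := ha.warr 15 (by simp [hS])
  have h28 := ha.wreg 28 (by simp [hS])
  exact ⟨ha.wreg 10 (by simp [hS]), ha.warr 11 (by simp [hS]), h28.ge, fun i _ => by rw [h8],
    fun i h1 h2 => by omega, fun k _ h => by rwa [h15] at h, fun k _ h => Or.inl (by rwa [h15])⟩

theorem AN_mono {L Q : ℕ} {f al al' : ℕ → ℕ} (h : ∀ q < Q, al' (q / (L + 1)) ≠ 0 →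
    al (q / (L + 1)) ≠ 0) (u : ℕ) : AN L Q f al' u ≤ AN L Q f al u :=
  Finset.card_le_card fun q hq => by
    simp only [Finset.mem_filter, Finset.mem_range] at hq ⊢
    exact ⟨hq.1, hq.2.1, h q hq.1 hq.2.2⟩

theorem Wk.div_lt {G : Gr} {L : ℕ} {σ : Store} (hW : Wk G L σ) {q : ℕ} (hq : q < σ.wreg 11) :
    q / (L + 1) < σ.wreg 10 := by
  rw [Nat.div_lt_iff_lt_mul (by omega), ← hW.cnt]; exact hq

/-- Deleting the alive walks through `u` deletes as many walks as `u` has alive nodes. -/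
theorem kill_card {G : Gr} {L u : ℕ} {σ τ : Store} (hW : Wk G L σ) (hW' : Wk G L τ)
    (h10 : τ.wreg 10 = σ.wreg 10)
    (hk : ∀ k < σ.wreg 10, τ.warr 15 k ≠ 0 ↔ σ.warr 15 k ≠ 0 ∧
        ∀ q < σ.wreg 11, σ.warr 11 q = u → q / (L + 1) ≠ k) :
    τ.wreg 15 + AN L (σ.wreg 11) (σ.warr 11) (σ.warr 15) u ≤ σ.wreg 15 := by
  classical
  set N := (Finset.range (σ.wreg 11)).filter fun q =>
    σ.warr 11 q = u ∧ σ.warr 15 (q / (L + 1)) ≠ 0 with hN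
  -- Alive walks are simple, so `u` has at most one node on each of them and nodes may be counted
  -- instead of walks.
  have hinj : Set.InjOn (fun q => q / (L + 1)) (N : Set ℕ) := by
    intro q hq q' hq' he
    simp only [hN, Finset.coe_filter, Finset.mem_range, Set.mem_ofPred_eq] at hq hq' he
    have d1 := Nat.div_add_mod q (L + 1)
    have d2 := Nat.div_add_mod q' (L + 1)
    have m1 : q % (L + 1) < L + 1 := Nat.mod_lt q (by omega)
    have m2 : q' % (L + 1) < L + 1 := Nat.mod_lt q' (by omega)
    rw [← he] at d2
    rw [Nat.mul_comm] at d1 d2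
    have hs := hW.simple _ (hW.div_lt hq.1) hq.2.2
    rcases lt_trichotomy (q % (L + 1)) (q' % (L + 1)) with h | h | h
    · exact absurd (by rw [d1, d2, hq.2.1, hq'.2.1]) (hs _ _ h (by omega))
    · omega
    · exact absurd (by rw [d1, d2, hq.2.1, hq'.2.1]) (hs _ _ h (by omega))
  have hcard : (N.image fun q => q / (L + 1)).card = AN L (σ.wreg 11) (σ.warr 11) (σ.warr 15) u :=
    Finset.card_image_of_injOn hinj
  have hdisj : Disjoint ((Finset.range (σ.wreg 10)).filter fun k => τ.warr 15 k ≠ 0)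
      (N.image fun q => q / (L + 1)) := by
    rw [Finset.disjoint_left]
    intro k hk1 hk2
    simp only [Finset.mem_filter, Finset.mem_range, Finset.mem_image, hN] at hk1 hk2
    obtain ⟨q, ⟨h1, h2, -⟩, h3⟩ := hk2
    exact ((hk k hk1.1).1 hk1.2).2 q h1 h2 h3
  rw [hW'.alive, h10, ← hcard, ← Finset.card_union_of_disjoint hdisj, hW.alive]
  refine Finset.card_le_card fun k hk1 => ?_
  simp only [Finset.mem_union, Finset.mem_filter, Finset.mem_range, Finset.mem_image, hN] at hk1 ⊢
  rcases hk1 with h | ⟨q, ⟨h1, -, h2⟩, rfl⟩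
  · exact ⟨h.1, ((hk k h.1).1 h.2).1⟩
  · exact ⟨hW.div_lt h1, h2⟩

/-- The last inequality is a potential argument: each new vertex is paid for by at least `thr (L +
1) / (2 n)` deleted walks. The one before says that afterwards the vertex lies below the threshold,
either because it was rejected or because none of its walks is left; the `- 1` encodes strictness.
-/
theorem pickP_spec {G : Gr} {L thr : ℕ} {σ : Store} (hB : Base G σ) (hW : Wk G L σ)
    (h4 : σ.wreg 4 = L) (hu : σ.wreg 17 < G.n) (h16 : σ.wreg 16 = thr) :
    Tri pickP σ (NN (σ.warr 11) (σ.wreg 17) (σ.wreg 11) * 100 + 80) fun τ => Wk G L τ ∧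
      Hits G L σ τ ∧
      AN L (σ.wreg 11) (σ.warr 11) (τ.warr 15) (σ.wreg 17) * (2 * G.n) ≤ thr * (L + 1) - 1 ∧
      (τ.wreg 28 - σ.wreg 28) * (thr * (L + 1)) + 2 * G.n * τ.wreg 15 ≤ 2 * G.n * σ.wreg 15 := by
  refine Tri.seq_le (T := NN (σ.warr 11) (σ.wreg 17) (σ.wreg 11) * 60 + 60)
    (countP_spec hW h4 hu) (by omega) fun τ₁ a₁ p₁ => ?_
  have hW₁ := hW.agree a₁ (by decide)
  have r28 := a₁.wreg 28 (by decide)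
  have r17 := a₁.wreg 17 (by decide)
  have r15 := a₁.wreg 15 (by decide)
  have r11 := a₁.wreg 11 (by decide)
  have r10 := a₁.wreg 10 (by decide)
  have r4 : τ₁.wreg 4 = L := (a₁.wreg 4 (by decide)).trans h4
  have w11 := a₁.warr 11 (by decide)
  have w15 := a₁.warr 15 (by decide)
  have w8 := a₁.warr 8 (by decide)
  have r0 : τ₁.wreg 0 = G.n := (hB.agree a₁ (by decide)).n
  have r16 : τ₁.wreg 16 = thr := (a₁.wreg 16 (by decide)).trans h16
  refine Tri.mono (Tri.ite (T := NN (σ.warr 11) (σ.wreg 17) (σ.wreg 11) * 60 + 40) (fun hc => ?_)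
    (fun hc => ?_)) ?_ (fun _ _ h => h)
  · refine Tri.lf rfl (by show 1 ≤ _; omega) ?_
    simp only [BExp.Holds, WExp.eval, suc, p₁, r0, r16, r4] at hc
    refine ⟨hW₁, hits_of_agree a₁ (by decide), ?_, ?_⟩
    · simp only [Prog.den, w15]; omega
    · simp [Prog.den, r28, r15]
  · simp only [BExp.Holds, WExp.eval, suc, p₁, r0, r16, r4, not_lt] at hc
    refine Tri.seq_le (S := 3) (T := NN (σ.warr 11) (σ.wreg 17) (σ.wreg 11) * 60 + 30)
      (Tri.lf rfl (by decide) (Q := fun τ => τ = τ₁.putW 8 (σ.wreg 28) (σ.wreg 17))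
      (by simp [Prog.den, WExp.eval, r28, r17])) (by omega) fun τ₂ a₂ p₂ => ?_
    subst p₂
    refine Tri.seq_le (S := 4) (T := NN (σ.warr 11) (σ.wreg 17) (σ.wreg 11) * 60 + 20)
      (Tri.lf rfl (by decide) (Q := fun τ => τ = (τ₁.putW 8 (σ.wreg 28) (σ.wreg 17)).setW 28
        (σ.wreg 28 + 1)) (by simp [Prog.den, WExp.eval, r28, suc])) (by omega) fun τ₃ a₃ p₃ => ?_
    have b3 := (a₂.up pickP.mods (by decide)).trans (a₃.up _ (by decide))
    have hW₃ := hW₁.agree ((a₂.up (Prog.seq (.wput 8 (.reg 28) (.reg 17))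
      (.wset 28 (suc (.reg 28)))).mods (by decide)).trans (a₃.up _ (by decide))) (by decide)
    have k17 : τ₃.wreg 17 = σ.wreg 17 := by rw [p₃]; simp [r17]
    have k11 : τ₃.wreg 11 = σ.wreg 11 := by rw [p₃]; simp [r11]
    have k10 : τ₃.wreg 10 = σ.wreg 10 := by rw [p₃]; simp [r10]
    have k15 : τ₃.wreg 15 = σ.wreg 15 := by rw [p₃]; simp [r15]
    have k28 : τ₃.wreg 28 = σ.wreg 28 + 1 := by rw [p₃]; simp
    have kw11 : τ₃.warr 11 = σ.warr 11 := by rw [p₃]; simp [w11]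
    have kw15 : τ₃.warr 15 = σ.warr 15 := by rw [p₃]; simp [w15]
    have kw8 : τ₃.warr 8 = Function.update (σ.warr 8) (σ.wreg 28) (σ.wreg 17) := by
      rw [p₃]; simp [w8]
    refine Tri.mono (killP_spec hW₃ (by rw [p₃]; simp [r4]) (by rw [k17]; exact hu)) ?_ ?_
    · rw [k17, k11, kw11]
    · rintro τ a₄ ⟨hW₄, hkill⟩
      rw [k10, kw15, k11, kw11, k17] at hkill
      have l10 : τ.wreg 10 = σ.wreg 10 := (a₄.wreg 10 (by decide)).trans k10
      have l28 : τ.wreg 28 = σ.wreg 28 + 1 := (a₄.wreg 28 (by decide)).trans k28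
      have l8 := (a₄.warr 8 (by decide)).trans kw8
      have hcard := kill_card hW hW₄ l10 hkill
      refine ⟨hW₄, ⟨l10, (a₄.warr 11 (by decide)).trans kw11, by omega, fun i hi => ?_,
        fun i h1 h2 => ?_, fun k hk h0 => ((hkill k hk).1 h0).1, fun k hk h0 => ?_⟩, ?_, ?_⟩
      · rw [l8, Function.update_of_ne (by omega)]
      · obtain rfl : i = σ.wreg 28 := by omega
        rw [l8, Function.update_self]; exact hu
      · by_cases h : τ.warr 15 k ≠ 0
        · exact Or.inl h
        · right
          have : ¬ ∀ q < σ.wreg 11, σ.warr 11 q = σ.wreg 17 → q / (L + 1) ≠ k := fun h' =>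
            h ((hkill k hk).2 ⟨h0, h'⟩)
          push Not at this
          obtain ⟨q, h1, h2, rfl⟩ := this
          have m1 : q % (L + 1) < L + 1 := Nat.mod_lt q (by omega)
          refine ⟨q % (L + 1), by omega, σ.wreg 28, le_rfl, by omega, ?_⟩
          rw [l8, Function.update_self, Nat.mul_comm, Nat.div_add_mod, h2]
      · have : AN L (σ.wreg 11) (σ.warr 11) (τ.warr 15) (σ.wreg 17) = 0 := by
          rw [AN, Finset.card_eq_zero, Finset.filter_eq_empty_iff]
          rintro q hq ⟨h1, h2⟩
          have hq' : q < σ.wreg 11 := by simpa using hq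
          exact ((hkill _ (hW.div_lt hq')).1 h2).2 q hq' h1 rfl
        rw [this]; omega
      · rw [l28, Nat.add_sub_cancel_left, Nat.one_mul]
        have := Nat.mul_le_mul_left (2 * G.n) hcard
        rw [Nat.mul_add] at this
        rw [Nat.mul_comm (2 * G.n) (AN _ _ _ _ _)] at this
        omega
  · simp only [suc, BExp.size, WExp.size]; omega

end Dapsp

/-! ### The greedy hitting set -/

namespace Dapsp

open RealRAM

/-- The lists partition the nodes, so one pass over all vertices is linear in the number of nodes.
-/
theorem sum_NN {f : ℕ → ℕ} {Q n : ℕ} (h : ∀ q < Q, f q < n) :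
    ∑ v ∈ Finset.range n, NN f v Q = Q := by
  have := Finset.card_eq_sum_card_fiberwise (s := Finset.range Q) (t := Finset.range n) (f := f)
    (fun q hq => by simpa using h q (by simpa using hq))
  simpa [NN] using this.symm

/-- Each alive walk has `L + 1` nodes. -/
theorem Wk.le_sum_AN {G : Gr} {L : ℕ} {σ : Store} (hW : Wk G L σ) :
    σ.wreg 15 * (L + 1) ≤
      ∑ v ∈ Finset.range G.n, AN L (σ.wreg 11) (σ.warr 11) (σ.warr 15) v := by
  set N := (Finset.range (σ.wreg 11)).filter fun q => σ.warr 15 (q / (L + 1)) ≠ 0 with hN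
  have h1 := Finset.card_eq_sum_card_fiberwise (s := N) (t := Finset.range G.n) (f := σ.warr 11)
    (fun q hq => by
      simp only [hN, Finset.mem_coe, Finset.mem_filter, Finset.mem_range] at hq
      simpa using hW.lt q hq.1)
  have h2 : ∀ v, (N.filter fun q => σ.warr 11 q = v).card =
      AN L (σ.wreg 11) (σ.warr 11) (σ.warr 15) v := by
    intro v
    rw [AN, hN, Finset.filter_filter]
    congr 1
    ext q
    simp only [Finset.mem_filter]
    tauto
  simp only [h2] at h1
  rw [← h1, hW.alive]
  calc _ = ((((Finset.range (σ.wreg 10)).filter fun k => σ.warr 15 k ≠ 0)) ×ˢ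
        (Finset.range (L + 1))).card := by rw [Finset.card_product, Finset.card_range]
    _ ≤ N.card := by
      refine Finset.card_le_card_of_injOn (fun p => p.1 * (L + 1) + p.2) ?_ ?_
      · rintro ⟨k, i⟩ hp
        simp only [Finset.coe_product, Set.mem_prod, Finset.mem_coe, Finset.mem_filter,
          Finset.mem_range] at hp
        obtain ⟨⟨h1, h2⟩, h3⟩ := hp
        have : (k * (L + 1) + i) / (L + 1) = k := by
          rw [Nat.mul_comm, Nat.mul_add_div (by omega), Nat.div_eq_of_lt h3, Nat.add_zero]
        simp only [hN, Finset.mem_coe, Finset.mem_filter, Finset.mem_range, this]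
        exact ⟨by rw [hW.cnt]; exact mul_succ_add_lt h1 (by omega), h2⟩
      · rintro ⟨k, i⟩ hp ⟨k', i'⟩ hp' he
        simp only [Finset.coe_product, Set.mem_prod, Finset.mem_coe, Finset.mem_filter,
          Finset.mem_range] at hp hp'
        obtain ⟨rfl, rfl⟩ := ix_inj hp.2 hp'.2 he
        rfl

/-- After the pass each of the `n` vertices has fewer than `thr (L + 1) / (2 n)` alive nodes, while
each alive walk has `L + 1` of them; so fewer than half of the walks survive. The potential bounds
the new vertices by `2 n / (L + 1)`. -/
theorem passP_spec {G : Gr} {L : ℕ} {σ : Store} (hB : Base G σ) (hn : 0 < G.n) (hW : Wk G L σ)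
    (h4 : σ.wreg 4 = L) (hA : 0 < σ.wreg 15) :
    Tri (.seq (.wset 16 (.reg 15)) (.for_ 17 (.reg 0) pickP)) σ
      (σ.wreg 11 * 100 + G.n * 100 + 20) fun τ => Wk G L τ ∧ Hits G L σ τ ∧
      2 * τ.wreg 15 < σ.wreg 15 ∧ (τ.wreg 28 - σ.wreg 28) * (L + 1) ≤ 2 * G.n := by
  set thr := σ.wreg 15 with hthr
  set Q := σ.wreg 11 with hQ
  set f := σ.warr 11 with hf
  refine Tri.seq_le (S := 2) (T := Q * 100 + G.n * 100 + 10) (Tri.lf rfl (by decide)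
    (Q := fun τ => τ = σ.setW 16 thr) rfl) (by omega) fun τ₁ a₁ p₁ => ?_
  have hH1 : Hits G L σ τ₁ := hits_of_agree a₁ (by decide)
  have hW1 := hW.agree a₁ (by decide)
  refine Tri.mono (Tri.for_sum (N := G.n) (fun v => NN f v Q * 100 + 80) (fun k τ =>
    Wk G L τ ∧ Hits G L σ τ ∧ (∀ u < k, AN L Q f (τ.warr 15) u * (2 * G.n) ≤ thr * (L + 1) - 1) ∧
    (τ.wreg 28 - σ.wreg 28) * (thr * (L + 1)) + 2 * G.n * τ.wreg 15 ≤ 2 * G.n * thr)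
    (by subst p₁; simp [WExp.eval, hB.n]) (by decide) (by decide) ?_ ?_) ?_ ?_
  · refine ⟨hW1.agree (agree_setW _ _ _) (by decide),
      hH1.trans (hits_of_agree (agree_setW _ _ _) (by decide)), by simp, ?_⟩
    subst p₁; simp [hthr]
  · rintro k hk σ' ha hw ⟨hW', hH', hAN, hsum⟩
    have ha' := (a₁.up (4 * 16 :: 4 * 17 :: pickP.mods) (by decide)).trans (ha.up _ (by decide))
    have r16 : σ'.wreg 16 = thr := by rw [ha.wreg 16 (by decide), p₁]; simp
    have r11 : σ'.wreg 11 = Q := ha'.wreg 11 (by decide)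
    have w11 : σ'.warr 11 = f := ha'.warr 11 (by decide)
    refine Tri.mono (pickP_spec (hB.agree ha' (by decide)) hW'
      ((ha'.wreg 4 (by decide)).trans h4) (by rw [hw]; exact hk) r16) (by rw [w11, hw, r11]) ?_
    rintro τ aτ ⟨hWτ, hHτ, hANτ, hsτ⟩
    rw [w11, r11, hw] at hANτ
    refine ⟨hWτ.agree (agree_setW _ _ _) (by decide),
      hH'.trans (hHτ.trans (hits_of_agree (agree_setW _ _ _) (by decide))), fun u hu => ?_, ?_⟩
    · rcases Nat.lt_succ_iff_lt_or_eq.1 hu with hu | rfl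
      -- Vertices treated earlier in the pass stay below the threshold, because walks only die.
      · refine le_trans (Nat.mul_le_mul_right _ (AN_mono (fun q hq h => ?_) u)) (hAN u hu)
        have hq' : q < σ'.wreg 11 := by rw [r11]; exact hq
        exact hHτ.dead _ (hW'.div_lt hq') h
      · exact hANτ
    · simp only [setW_wreg, Nat.reduceEqDiff, if_false]
      have e : τ.wreg 28 - σ.wreg 28 = (τ.wreg 28 - σ'.wreg 28) + (σ'.wreg 28 - σ.wreg 28) := by
        have := hH'.top
        have := hHτ.top
        omega
      rw [e, Nat.add_mul]
      omega
  · have e1 : ∑ i ∈ Finset.range G.n, (NN f i Q * 100 + 80 + ((WExp.reg 0).size + 7)) =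
        Q * 100 + G.n * 88 := by
      have : ∑ i ∈ Finset.range G.n, NN f i Q = Q := sum_NN hW.lt
      simp only [Finset.sum_add_distrib, ← Finset.sum_mul, Finset.sum_const,
        Finset.card_range, smul_eq_mul, WExp.size]
      omega
    rw [e1]; simp only [WExp.size]; omega
  · rintro τ - ⟨⟨hWτ, hHτ, hANτ, hsτ⟩, -⟩
    refine ⟨hWτ, hHτ, ?_, ?_⟩
    · have h1 := hWτ.le_sum_AN
      rw [hHτ.node, show τ.wreg 11 = Q by rw [hWτ.cnt, hHτ.cnt, ← hW.cnt]] at h1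
      have h2 : (∑ v ∈ Finset.range G.n, AN L Q f (τ.warr 15) v) * (2 * G.n) ≤
          G.n * (thr * (L + 1) - 1) := by
        rw [Finset.sum_mul]
        refine (Finset.sum_le_sum fun v hv => hANτ v (by simpa using hv)).trans ?_
        simp
      have h3 := (Nat.mul_le_mul_right (2 * G.n) h1).trans h2
      have h4 : 0 < thr * (L + 1) := by positivity
      have h5 : G.n * (2 * τ.wreg 15 * (L + 1)) ≤ G.n * (thr * (L + 1) - 1) := by
        refine le_trans (le_of_eq ?_) h3; ring
      have h6 := Nat.le_of_mul_le_mul_left h5 hn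
      have h7 : 2 * τ.wreg 15 * (L + 1) < thr * (L + 1) := by omega
      exact Nat.lt_of_mul_lt_mul_right h7
    · have h1 : thr * ((τ.wreg 28 - σ.wreg 28) * (L + 1)) ≤ thr * (2 * G.n) := by
        calc _ = (τ.wreg 28 - σ.wreg 28) * (thr * (L + 1)) := by ring
          _ ≤ 2 * G.n * thr := by omega
          _ = _ := by ring
      exact Nat.le_of_mul_le_mul_left h1 hA

theorem size_lt_size {a b : ℕ} (h : 2 * a < b) : Nat.size a < Nat.size b := by
  have h0 : 0 < Nat.size b := Nat.size_pos.2 (by omega)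
  have h1 := Nat.lt_size_self b
  have : Nat.size a ≤ Nat.size b - 1 := by
    rw [Nat.size_le]
    rw [show Nat.size b = (Nat.size b - 1) + 1 by omega, pow_succ] at h1
    omega
  omega

/-- Each pass more than halves the number of alive walks and hence shortens its binary
representation. So there are at most `Nat.size` many passes, each adding at most `2 n / (L + 1)`
vertices. -/
theorem greedyP_spec {G : Gr} {L : ℕ} {σ : Store} (hB : Base G σ) (hn : 0 < G.n) (hW : Wk G L σ)
    (h4 : σ.wreg 4 = L) :
    Tri greedyP σ (Nat.size (σ.wreg 15) * (σ.wreg 11 * 100 + G.n * 100 + 30) + 10) fun τ =>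
      Hits G L σ τ ∧ (∀ k < σ.wreg 10, τ.warr 15 k = 0) ∧
      (τ.wreg 28 - σ.wreg 28) * (L + 1) ≤ 2 * G.n * Nat.size (σ.wreg 15) := by
  refine Tri.mono (Tri.loop (T := σ.wreg 11 * 100 + G.n * 100 + 20) (fun τ => Wk G L τ ∧
    Hits G L σ τ ∧ (τ.wreg 28 - σ.wreg 28) * (L + 1) + 2 * G.n * Nat.size (τ.wreg 15) ≤
      2 * G.n * Nat.size (σ.wreg 15)) (fun τ => Nat.size (τ.wreg 15))
      ⟨hW, hits_of_agree (Agree.refl [] σ) rfl, by simp⟩ ?_) ?_ ?_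
  · rintro σ' ha ⟨hW', hH', hs⟩ hb
    have r11 : σ'.wreg 11 = σ.wreg 11 := by rw [hW'.cnt, hH'.cnt, ← hW.cnt]
    refine Tri.mono (passP_spec (hB.agree ha (by decide)) hn hW' ((ha.wreg 4 (by decide)).trans h4)
      hb) (by rw [r11]) ?_
    rintro τ - ⟨hWτ, hHτ, h2, h3⟩
    have hlt := size_lt_size h2
    refine ⟨⟨hWτ, hH'.trans hHτ, ?_⟩, hlt⟩
    have e : τ.wreg 28 - σ.wreg 28 = (τ.wreg 28 - σ'.wreg 28) + (σ'.wreg 28 - σ.wreg 28) := by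
      have := hH'.top
      have := hHτ.top
      omega
    have h4 : 2 * G.n * (Nat.size (τ.wreg 15) + 1) ≤ 2 * G.n * Nat.size (σ'.wreg 15) :=
      Nat.mul_le_mul_left _ hlt
    rw [e, Nat.add_mul]
    rw [Nat.mul_add] at h4
    omega
  · simp only [BExp.size, WExp.size]
    have : Nat.size (σ.wreg 15) * (σ.wreg 11 * 100 + G.n * 100 + 20 + (1 + 1 + 1) + 1) ≤
      Nat.size (σ.wreg 15) * (σ.wreg 11 * 100 + G.n * 100 + 30) := Nat.mul_le_mul_left _ (by omega)
    omega
  · rintro τ - ⟨⟨hWτ, hHτ, h2⟩, h0⟩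
    simp only [BExp.Holds, WExp.eval, not_lt, Nat.le_zero] at h0
    refine ⟨hHτ, fun k hk => ?_, by omega⟩
    have h1 := hWτ.alive
    rw [h0, eq_comm, Finset.card_eq_zero, Finset.filter_eq_empty_iff] at h1
    exact not_not.1 (h1 (by rw [hHτ.cnt]; simpa using hk))

end Dapsp

namespace Dapsp

open RealRAM

/-! ## The levels of the hierarchy -/

/-- All tables have only been improved by sound entries. -/
structure Tab (G : Gr) (x : ℕ → ℕ → ℝ) (σ τ : Store) : Prop where
  d : Imp 4 2 5 (SD G) σ τ
  y : Imp 6 3 22 (SY G x) σ τ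
  v : Imp 2 1 21 (SX G x) σ τ
  g : Imp 7 4 23 (SG G x) σ τ

theorem Tab.trans {G : Gr} {x : ℕ → ℕ → ℝ} {σ τ υ : Store} (h : Tab G x σ τ) (h' : Tab G x τ υ) :
    Tab G x σ υ := ⟨h.d.trans h'.d, h.y.trans h'.y, h.v.trans h'.v, h.g.trans h'.g⟩

/-- All tables are sound. -/
structure Sound (G : Gr) (x : ℕ → ℕ → ℝ) (σ : Store) : Prop where
  d : σ.Snd 4 2 5 (SD G)
  y : σ.Snd 6 3 22 (SY G x)
  v : σ.Snd 2 1 21 (SX G x)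
  g : σ.Snd 7 4 23 (SG G x)

theorem Sound.tab {G : Gr} {x : ℕ → ℕ → ℝ} {σ τ : Store} (h : Sound G x σ) (h' : Tab G x σ τ) :
    Sound G x τ := ⟨h'.d.snd h.d, h'.y.snd h.y, h'.v.snd h.v, h'.g.snd h.g⟩

theorem tab_of_agree {G : Gr} {x : ℕ → ℕ → ℝ} {S : List ℕ} {σ τ : Store} (ha : Agree S σ τ)
    (hd : disj [18, 11, 22] S = true) (hy : disj [26, 15, 90] S = true)
    (hx : disj [10, 7, 86] S = true) (hg : disj [30, 19, 94] S = true) : Tab G x σ τ :=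
  ⟨ha.imp 4 2 5 hd, ha.imp 6 3 22 hy, ha.imp 2 1 21 hx, ha.imp 7 4 23 hg⟩

theorem tab_setW {G : Gr} {x : ℕ → ℕ → ℝ} (σ : Store) (r v : ℕ) : Tab G x σ (σ.setW r v) :=
  ⟨.refl' rfl rfl rfl, .refl' rfl rfl rfl, .refl' rfl rfl rfl, .refl' rfl rfl rfl⟩

/-- The tables know the walks of length up to `L` from `b`. -/
structure Known (G : Gr) (σ : Store) (b L : ℕ) : Prop where
  exact : ∀ j ≤ L, Exact G σ j b
  closed : ∀ C, G.W b C b → C ≠ [] → C.length ≤ L → σ.ub 6 3 b (G.co C / (1 - G.g ^ C.length))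
  direct : ∀ P v, G.W b P v → P.length ≤ L → σ.ub 2 1 (b * G.n + v) (G.co P)

theorem Known.tab {G : Gr} {x : ℕ → ℕ → ℝ} {σ τ : Store} {b L : ℕ} (h : Known G σ b L)
    (h' : Tab G x σ τ) : Known G τ b L :=
  ⟨fun j hj => (h.exact j hj).imp h'.d, fun C h1 h2 h3 => h'.y.ub _ _ (h.closed C h1 h2 h3),
    fun P v h1 h2 => h'.v.ub _ _ (h.direct P v h1 h2)⟩

theorem startP_spec {G : Gr} {x : ℕ → ℕ → ℝ} (hx : G.Val x) {σ : Store} {b L : ℕ} (hB : Base G σ)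
    (hb : σ.warr 8 (σ.warr 9 (σ.wreg 3) + σ.wreg 5) = b) (hbn : b < G.n) (h4 : σ.wreg 4 = L)
    (hs : Sound G x σ) (hW : Wk G L σ) :
    Tri startP σ ((L + 1) * (G.m + 1) * 500) fun τ => Wk G L τ ∧ Grow L σ τ ∧
      τ.wreg 10 ≤ σ.wreg 10 + G.m ∧ Tab G x σ τ ∧ Known G τ b L ∧
      ∀ e < G.m, Done G L τ b (G.hd e) := by
  refine Tri.seq_le (S := 8) (T := L * (G.m * 160 + 40) + 200 + (L * 170 + 20 +
    (L * (G.m * 160 + 20) + 170 + (G.m * (L * 110 + 170) + 10)))) (Tri.lf rfl (by decide)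
    (Q := fun τ => τ = σ.setW 6 b)
    (by simp [Prog.den, loadP, WExp.eval, hb])) (by ring_nf; omega) fun τ₁ a₁ p₁ => ?_
  have r6 : τ₁.wreg 6 = b := by rw [p₁]; simp
  have hB₁ := hB.agree a₁ (by decide)
  have r4 : τ₁.wreg 4 = L := (a₁.wreg 4 (by decide)).trans h4
  have t₁ : Tab G x σ τ₁ := by rw [p₁]; exact tab_setW _ _ _
  refine Tri.seq_le (dpP_spec hB₁ r6 hbn r4 (hs.tab t₁).d) le_rfl ?_
  rintro τ₂ a₂ ⟨i₂, hE⟩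
  have ha₂ := (a₁.up startP.mods (by decide)).trans (a₂.up _ (by decide))
  have t₂ : Tab G x τ₁ τ₂ := ⟨i₂, a₂.imp 6 3 22 (by decide), a₂.imp 2 1 21 (by decide),
    a₂.imp 7 4 23 (by decide)⟩
  have r6₂ := (a₂.wreg 6 (by decide)).trans r6
  have r4₂ := (a₂.wreg 4 (by decide)).trans r4
  refine Tri.seq_le (closedP_spec hx (hB.agree ha₂ (by decide)) r6₂ hbn r4₂
    (hs.tab (t₁.trans t₂)).d hE) le_rfl ?_
  rintro τ₃ a₃ ⟨i₃, hC⟩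
  have ha₃ := ha₂.trans (a₃.up _ (by decide))
  have t₃ : Tab G x τ₂ τ₃ := ⟨a₃.imp 4 2 5 (by decide), i₃, a₃.imp 2 1 21 (by decide),
    a₃.imp 7 4 23 (by decide)⟩
  have r6₃ := (a₃.wreg 6 (by decide)).trans r6₂
  have r4₃ := (a₃.wreg 4 (by decide)).trans r4₂
  have hE₃ := fun j hj => (hE j hj).imp t₃.d
  have s₃ := hs.tab (t₁.trans (t₂.trans t₃))
  refine Tri.seq_le (directP_spec hx (hB.agree ha₃ (by decide)) r6₃ hbn r4₃ s₃.d hE₃) le_rfl ?_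
  rintro τ₄ a₄ ⟨i₄, hD⟩
  have ha₄ := ha₃.trans (a₄.up _ (by decide))
  have t₄ : Tab G x τ₃ τ₄ := ⟨a₄.imp 4 2 5 (by decide), a₄.imp 6 3 22 (by decide), i₄,
    a₄.imp 7 4 23 (by decide)⟩
  have tt := t₁.trans (t₂.trans (t₃.trans t₄))
  have r6₄ := (a₄.wreg 6 (by decide)).trans r6₃
  have r4₄ := (a₄.wreg 4 (by decide)).trans r4₃
  have hK : Known G τ₄ b L := ⟨fun j hj => (hE₃ j hj).imp t₄.d,
    fun C h1 h2 h3 => t₄.y.ub _ _ (hC C h1 h2 h3), hD⟩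
  have hB₄ := hB.agree ha₄ (by decide)
  have hab := (a₁.up (Prog.seq (loadP (.reg 3)) (.seq dpP (.seq closedP directP))).mods
    (by decide)).trans ((a₂.up _ (by decide)).trans ((a₃.up _ (by decide)).trans
    (a₄.up _ (by decide))))
  have hW₄ := hW.agree hab (by decide)
  have hG₄ : Grow L σ τ₄ := grow_of_agree hab (by decide)
  have r10 := hab.wreg 10 (by decide)
  refine Tri.mono (Tri.for_ (N := G.m) (L * 110 + 160) (fun k τ => Wk G L τ ∧ Grow L τ₄ τ ∧
    τ.wreg 10 ≤ σ.wreg 10 + k ∧ ∀ e < k, Done G L τ b (G.hd e)) (by simp [WExp.eval, hB₄.m])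
    (by decide) (by decide) ?_ ?_) ?_ ?_
  · exact ⟨hW₄.agree (agree_setW _ _ _) (by decide), grow_of_agree (agree_setW _ _ _) (by decide),
      by simp [r10], by simp⟩
  · rintro e he σ' ha hw ⟨hW', hG', h10, hdn⟩
    have t' : Tab G x τ₄ σ' := tab_of_agree ha (by decide) (by decide) (by decide) (by decide)
    refine Tri.mono (extractP_spec (hB₄.agree ha (by decide)) ((ha.wreg 6 (by decide)).trans r6₄)
      hbn ((ha.wreg 4 (by decide)).trans r4₄) hw he (hs.tab (tt.trans t')).d
      (hK.tab t').exact hW') le_rfl ?_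
    rintro τ aτ ⟨hWτ, hGτ, h10τ, hdτ⟩
    have hG2 : Grow L τ (τ.setW 8 (e + 1)) := grow_of_agree (agree_setW _ _ _) (by decide)
    refine ⟨hWτ.agree (agree_setW _ _ _) (by decide), hG'.trans (hGτ.trans hG2), ?_, ?_⟩
    · simp; omega
    · intro e' he'
      refine Done.grow ?_ hG2
      rcases Nat.lt_succ_iff_lt_or_eq.1 he' with h | rfl
      · exact (hdn e' h).grow hGτ
      · exact hdτ
  · simp only [WExp.size]
    have : G.m * (L * 110 + 160 + (1 + 7)) ≤ G.m * (L * 110 + 170) :=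
      Nat.mul_le_mul_left _ (by omega)
    exact Nat.add_le_add this (by norm_num)
  · rintro τ aτ ⟨⟨hWτ, hGτ, h10, hdn⟩, -⟩
    have t' : Tab G x τ₄ τ := tab_of_agree aτ (by decide) (by decide) (by decide) (by decide)
    exact ⟨hWτ, hG₄.trans hGτ, h10, tt.trans t', hK.tab t', hdn⟩

theorem resetP_spec {G : Gr} {σ : Store} {L : ℕ} (hB : Base G σ) (hL : σ.warr 10 (σ.wreg 3) = L) :
    Tri resetP σ (G.n * 20 + 30) fun τ => Wk G L τ ∧ τ.wreg 4 = L ∧ τ.wreg 10 = 0 := by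
  refine Tri.seq_le (S := 3) (T := G.n * 20 + 20) (Tri.lf rfl (by decide)
    (Q := fun τ => τ = σ.setW 4 L) (by simp [Prog.den, WExp.eval, hL])) (by omega)
    fun τ₁ a₁ p₁ => ?_
  refine Tri.seq_le (S := G.n * 13 + 6) (T := 6) (Tri.mono (Tri.for_ (N := G.n) 5
    (fun k τ => ∀ u < k, τ.warr 14 u = 0)
    (by simp [WExp.eval, (hB.agree a₁ (by decide)).n]) (by decide) (by decide) (by simp) ?_)
    (by simp only [WExp.size]; omega) (fun _ _ h => h.1)) (by omega) fun τ₂ a₂ p₂ => ?_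
  · intro k hk σ' ha hw h
    refine Tri.lf rfl (by decide) fun u hu => ?_
    simp only [Prog.den, setW_warr, putW_warr, if_true, WExp.eval, hw]
    by_cases h' : u = k
    · simp [h']
    · rw [Function.update_of_ne h']; exact h u (by omega)
  · refine Tri.lf rfl (by decide) ?_
    have r4 : τ₂.wreg 4 = L := by rw [a₂.wreg 4 (by decide), p₁]; simp
    refine ⟨⟨?_, ?_, ?_, ?_, ?_, ?_⟩, ?_, ?_⟩
    · simp [Prog.den, WExp.eval]
    · intro u hu; simpa [Prog.den, WExp.eval, lst] using p₂ u hu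
    · simp [Prog.den, WExp.eval]
    · simp [Prog.den, WExp.eval]
    · simp [Prog.den, WExp.eval]
    · simp [Prog.den, WExp.eval]
    · simp [Prog.den, r4]
    · simp [Prog.den, WExp.eval]

end Dapsp

/-! ### Building one level -/

namespace Dapsp

open RealRAM

/-- `b` belongs to level `i`. -/
def InB (σ : Store) (i b : ℕ) : Prop :=
  ∃ k, σ.warr 9 i ≤ k ∧ k < σ.warr 9 (i + 1) ∧ σ.warr 8 k = b

/-- The lengths of the walks of the levels. -/
def Ln (n h : ℕ) : ℕ → ℕ
  | 0 => min h n
  | i + 1 => min (h * Ln n h i) n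

theorem Ln_le (n h i : ℕ) : Ln n h i ≤ n := by cases i <;> exact min_le_right _ _

theorem Ln_pos {n h : ℕ} (hn : 0 < n) (hh : 2 ≤ h) (i : ℕ) : 0 < Ln n h i := by
  induction i with
  | zero => simp only [Ln]; omega
  | succ i ih => simp only [Ln]; have : 0 < h * Ln n h i := by positivity
                 omega

/-- The lengths at least double until they are cut off at `n`, which limits the number of levels to
a logarithm. -/
theorem pow_le_Ln {n h : ℕ} (hh : 2 ≤ h) (i : ℕ) : min (2 ^ (i + 1)) n ≤ Ln n h i := by
  induction i with
  | zero => simp only [Ln]; omega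
  | succ i ih =>
    simp only [Ln]
    have h1 : 2 * Ln n h i ≤ h * Ln n h i := Nat.mul_le_mul_right _ hh
    rw [pow_succ]
    omega

/-- A logarithmic bound. -/
def lg (G : Gr) : ℕ := Nat.size (G.n * (G.n * G.m + 5) * G.m)

theorem mul_lt_two_pow (a : ℕ) : a * (a + 5) < 2 ^ (a + 5) := by
  induction a with
  | zero => norm_num
  | succ a ih =>
    have h1 : a < 2 ^ a := Nat.lt_two_pow_self
    have h2 : 2 ^ (a + 5) = 32 * 2 ^ a := by ring
    have h3 : 2 ^ (a + 1 + 5) = 2 * 2 ^ (a + 5) := by ring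
    rw [h3]
    nlinarith

/-- The size of a level involves the logarithm of the number of walks, which depends on the size of
the previous level. The circle is broken by the crude bound `n (n m + 5)` for the size of every
level, on which `lg` is built; this inequality makes the crude bound reproduce itself. -/
theorem lg_le (G : Gr) : lg G ≤ G.n * G.m + 5 := by
  rw [lg, Nat.size_le]
  have := mul_lt_two_pow (G.n * G.m)
  calc _ = G.n * G.m * (G.n * G.m + 5) := by ring
    _ < _ := this

/-- The first `N` levels are complete, the next one has been collected. -/
structure Lay (G : Gr) (h N : ℕ) (σ : Store) : Prop where
  lev : σ.wreg 3 = N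
  base : σ.wreg 2 = h
  two_le : 2 ≤ h
  off_zero : σ.warr 9 0 = 0
  off_one : σ.warr 9 1 = G.n
  mono : ∀ i ≤ N, σ.warr 9 i ≤ σ.warr 9 (i + 1)
  top : σ.wreg 28 = σ.warr 9 (N + 1)
  lt : ∀ k < σ.warr 9 (N + 1), σ.warr 8 k < G.n
  id : ∀ k < G.n, σ.warr 8 k = k
  len : ∀ i ≤ N, σ.warr 10 i = Ln G.n h i
  ne : ∀ i < N, σ.warr 9 i < σ.warr 9 (i + 1)
  hit : ∀ i < N, G.Hit (InB σ i) (InB σ (i + 1)) (Ln G.n h i)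
  size : ∀ i < N, (σ.warr 9 (i + 2) - σ.warr 9 (i + 1)) * (Ln G.n h i + 1) ≤ 2 * G.n * lg G
  card : ∀ i ≤ N, σ.warr 9 (i + 1) - σ.warr 9 i ≤ G.n * (G.n * G.m + 5)
  last : ∀ i < N, Ln G.n h i = G.n → σ.warr 9 (i + 2) = σ.warr 9 (i + 1)

theorem InB.congr {σ τ : Store} (h8 : τ.warr 8 = σ.warr 8) (h9 : τ.warr 9 = σ.warr 9) :
    InB τ = InB σ := by
  funext i b
  simp only [InB, h8, h9]

theorem Lay.agree {G : Gr} {h N : ℕ} {S : List ℕ} {σ τ : Store} (H : Lay G h N σ)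
    (ha : Agree S σ τ) (hS : disj [12, 8, 112, 34, 38, 42] S = true) :
    Lay G h N τ ∧ InB τ = InB σ := by
  simp [disj] at hS
  have h3 := ha.wreg 3 (by simp [hS])
  have h2 := ha.wreg 2 (by simp [hS])
  have h28 := ha.wreg 28 (by simp [hS])
  have h8 := ha.warr 8 (by simp [hS])
  have h9 := ha.warr 9 (by simp [hS])
  have h10 := ha.warr 10 (by simp [hS])
  have hI := InB.congr h8 h9
  refine ⟨⟨?_, ?_, H.two_le, ?_, ?_, ?_, ?_, ?_, ?_, ?_, ?_, ?_, ?_, ?_, ?_⟩, hI⟩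
  · rw [h3]; exact H.lev
  · rw [h2]; exact H.base
  · rw [h9]; exact H.off_zero
  · rw [h9]; exact H.off_one
  · rw [h9]; exact H.mono
  · rw [h28, h9]; exact H.top
  · rw [h9, h8]; exact H.lt
  · rw [h8]; exact H.id
  · rw [h10]; exact H.len
  · rw [h9]; exact H.ne
  · rw [hI]; exact H.hit
  · rw [h9]; exact H.size
  · rw [h9]; exact H.card
  · rw [h9]; exact H.last

theorem Lay.off_le {G : Gr} {h N : ℕ} {σ : Store} (H : Lay G h N σ) {i j : ℕ} (hij : i ≤ j)
    (hj : j ≤ N + 1) : σ.warr 9 i ≤ σ.warr 9 j := by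
  induction j with
  | zero => obtain rfl : i = 0 := by omega
            exact le_rfl
  | succ j ih =>
    rcases Nat.le_succ_iff.1 hij with h' | rfl
    · exact (ih h' (by omega)).trans (H.mono j (by omega))
    · exact le_rfl

theorem Lay.inB_lt {G : Gr} {h N : ℕ} {σ : Store} (H : Lay G h N σ) {i b : ℕ} (hi : i ≤ N)
    (hb : InB σ i b) : b < G.n := by
  obtain ⟨k, -, h2, rfl⟩ := hb
  exact H.lt k (h2.trans_le (H.off_le (by omega) (by omega)))

/-- The walks of a level have been collected in `σ` and hit in `τ`. -/
theorem hit_of_hits {G : Gr} {L : ℕ} {σ τ : Store} {B B' : ℕ → Prop} (hL : 0 < L)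
    (hD : ∀ b, B b → ∀ e < G.m, Done G L σ b (G.hd e)) (hH : Hits G L σ τ)
    (hdead : ∀ k < σ.wreg 10, τ.warr 15 k = 0)
    (hB' : ∀ z, σ.wreg 28 ≤ z → z < τ.wreg 28 → B' (τ.warr 8 z)) : G.Hit B B' L := by
  rintro b v hb ⟨P, hP, hl⟩
  have hv : ∃ e < G.m, G.hd e = v := by
    have hne : P ≠ [] := by rintro rfl; simp at hl; omega
    rw [← List.dropLast_append_getLast hne] at hP
    exact ⟨_, (Gr.W_snoc.1 hP).2⟩
  obtain ⟨e, he, rfl⟩ := hv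
  obtain ⟨Q, hQl, hQo, hQ⟩ := hD b hb e he ⟨P, hP, hl⟩
  refine ⟨Q, hQl, hQo, hQ.imp id ?_⟩
  rintro ⟨k, hk, hal, hn⟩
  rcases hH.hit k hk hal with h' | ⟨i, hi, z, h1, h2, h3⟩
  · exact absurd (hdead k hk) h'
  · exact ⟨i, hi, by rw [← hn i hi, ← h3]; exact hB' z h1 h2⟩

theorem Wk.alive_le {G : Gr} {L : ℕ} {σ : Store} (hW : Wk G L σ) : σ.wreg 15 ≤ σ.wreg 10 := by
  rw [hW.alive]
  exact (Finset.card_filter_le _ _).trans (by simp)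

/-- No walk of length `n` is simple. -/
theorem Wk.alive_eq_zero {G : Gr} {σ : Store} (hW : Wk G G.n σ) : σ.wreg 15 = 0 := by
  rw [hW.alive, Finset.card_eq_zero, Finset.filter_eq_empty_iff]
  intro k hk h0
  have hk' : k < σ.wreg 10 := by simpa using hk
  obtain ⟨i, hi, j, hj, hne, he⟩ := Finset.exists_ne_map_eq_of_card_lt_of_maps_to
    (s := Finset.range (G.n + 1)) (t := Finset.range G.n)
    (f := fun i => σ.warr 11 (k * (G.n + 1) + i)) (by simp) (fun i hi => by
      simp only [Finset.coe_range, Set.mem_Iio] at hi ⊢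
      exact hW.lt _ (by rw [hW.cnt]; exact mul_succ_add_lt hk' (by omega)))
  simp only [Finset.mem_range] at hi hj
  rcases lt_or_gt_of_ne hne with h' | h'
  · exact hW.simple k hk' h0 i j h' (by omega) he
  · exact hW.simple k hk' h0 j i h' (by omega) he.symm

/-- With `c` vertices on the level, at most `c m` walks with `L + 1` nodes each are collected. So
the walk tables, the traces and each greedy pass all take time `O(c L m)`, up to terms in `n`. -/
theorem levelP_spec {G : Gr} {x : ℕ → ℕ → ℝ} (hx : G.Val x) {σ : Store} {h N : ℕ} (hB : Base G σ)
    (hs : Sound G x σ) (H : Lay G h N σ) (hne : σ.warr 9 N < σ.warr 9 (N + 1))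
    (hK : ∀ i < N, ∀ b, InB σ i b → Known G σ b (Ln G.n h i)) :
    Tri levelP σ ((lg G + 1) * ((σ.warr 9 (N + 1) - σ.warr 9 N) * (Ln G.n h N + 1) * (G.m + 1) * 700
      + G.n * 130 + 200)) fun τ => Tab G x σ τ ∧ Lay G h (N + 1) τ ∧
      ∀ i < N + 1, ∀ b, InB τ i b → Known G τ b (Ln G.n h i) := by
  have hn : 0 < G.n := (Nat.zero_le _).trans_lt (H.lt _ hne)
  set c := σ.warr 9 (N + 1) - σ.warr 9 N with hc
  set L := Ln G.n h N with hL
  set U := c * (L + 1) * (G.m + 1) with hU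
  refine Tri.seq_le (T := c * ((L + 1) * (G.m + 1) * 500 + 20) + 20 +
    (lg G * (U * 100 + G.n * 100 + 30) + 10 + 40))
    (resetP_spec (L := L) hB (by rw [H.lev]; exact H.len N le_rfl)) ?_ ?_
  · have e1 : c * ((L + 1) * (G.m + 1) * 500 + 20) = U * 500 + c * 20 := by rw [hU]; ring
    have e2 : c ≤ U := by
      rw [hU, Nat.mul_assoc]; exact Nat.le_mul_of_pos_right _ (Nat.mul_pos (by omega) (by omega))
    rw [e1, Nat.add_mul]
    have e3 : lg G * (U * 100 + G.n * 100 + 30) ≤ lg G * (U * 700 + G.n * 130 + 200) :=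
      Nat.mul_le_mul_left _ (by omega)
    omega
  rintro τ₁ a₁ ⟨hW₁, h4₁, h10₁⟩
  have t₁ : Tab G x σ τ₁ := tab_of_agree a₁ (by decide) (by decide) (by decide) (by decide)
  obtain ⟨H₁, I₁⟩ := H.agree a₁ (by decide)
  have hB₁ := hB.agree a₁ (by decide)
  have w9₁ := a₁.warr 9 (by decide)
  have w8₁ := a₁.warr 8 (by decide)
  have w10₁ := a₁.warr 10 (by decide)
  refine Tri.seq_le (Tri.mono (Tri.for_ (N := c) ((L + 1) * (G.m + 1) * 500) (fun k τ => Wk G L τ ∧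
    τ.wreg 10 ≤ k * G.m ∧ Tab G x τ₁ τ ∧ ∀ i < k, Known G τ (σ.warr 8 (σ.warr 9 N + i)) L ∧
      ∀ e < G.m, Done G L τ (σ.warr 8 (σ.warr 9 N + i)) (G.hd e))
      (by simp [WExp.eval, lenE, suc, H₁.lev, w9₁, hc]) (by decide) (by decide) ?_ ?_)
      ?_ (fun _ _ h => h.1)) le_rfl ?_
  · exact ⟨hW₁.agree (agree_setW _ _ _) (by decide), by simp [h10₁], tab_setW _ _ _, by simp⟩
  · rintro k hk σ' ha hw ⟨hW', h10', t', hD'⟩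
    obtain ⟨H', I'⟩ := H₁.agree ha (by decide)
    refine Tri.mono (startP_spec hx (b := σ.warr 8 (σ.warr 9 N + k)) (hB₁.agree ha (by decide))
      (by rw [ha.warr 8 (by decide), ha.warr 9 (by decide), H'.lev, hw, w8₁, w9₁])
      (H.lt _ (by omega)) ((ha.wreg 4 (by decide)).trans h4₁) (hs.tab (t₁.trans t')) hW') le_rfl ?_
    rintro τ - ⟨hWτ, hGτ, h10τ, tτ, hKτ, hDτ⟩
    have hG2 : Grow L τ (τ.setW 5 (k + 1)) := grow_of_agree (agree_setW _ _ _) (by decide)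
    have tS : Tab G x τ (τ.setW 5 (k + 1)) := tab_setW _ _ _
    refine ⟨hWτ.agree (agree_setW _ _ _) (by decide), ?_, t'.trans (tτ.trans tS), fun i hi => ?_⟩
    · simp only [setW_wreg, Nat.reduceEqDiff, if_false, Nat.add_mul]; omega
    · rcases Nat.lt_succ_iff_lt_or_eq.1 hi with h' | rfl
      · exact ⟨(hD' i h').1.tab (tτ.trans tS), fun e he => ((hD' i h').2 e he).grow (hGτ.trans hG2)⟩
      · exact ⟨hKτ.tab tS, fun e he => (hDτ e he).grow hG2⟩
  · simp only [WExp.size, lenE, suc]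
    have : c * ((L + 1) * (G.m + 1) * 500 + (1 + 1 + 1 + 1 + (1 + 1) + 1 + 7)) ≤
        c * ((L + 1) * (G.m + 1) * 500 + 20) := Nat.mul_le_mul_left _ (by omega)
    exact Nat.add_le_add this (by norm_num)
  rintro τ₂ a₂ ⟨hW₂, h10₂, t₂, hD₂⟩
  obtain ⟨H₂, I₂⟩ := H₁.agree a₂ (by decide)
  have hB₂ := hB₁.agree a₂ (by decide)
  have h4₂ := (a₂.wreg 4 (by decide)).trans h4₁
  have w9₂ := (a₂.warr 9 (by decide)).trans w9₁
  have w8₂ := (a₂.warr 8 (by decide)).trans w8₁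
  have w10₂ := (a₂.warr 10 (by decide)).trans w10₁
  have hcard := H.card N le_rfl
  have hsz : Nat.size (τ₂.wreg 15) ≤ lg G := by
    refine Nat.size_le_size (hW₂.alive_le.trans (h10₂.trans ?_))
    exact Nat.mul_le_mul_right _ hcard
  have h11 : τ₂.wreg 11 ≤ U := by
    rw [hW₂.cnt, hU]
    calc _ ≤ c * G.m * (L + 1) := Nat.mul_le_mul_right _ h10₂
      _ = c * (L + 1) * G.m := by ring
      _ ≤ _ := Nat.mul_le_mul_left _ (by omega)
  refine Tri.seq_le (T := 40) (Tri.mono (greedyP_spec hB₂ hn hW₂ h4₂) ?_ fun _ _ h => h) le_rfl ?_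
  · have := Nat.mul_le_mul hsz (show τ₂.wreg 11 * 100 + G.n * 100 + 30 ≤ U * 100 + G.n * 100 + 30 by
      omega)
    omega
  rintro τ₃ a₃ ⟨hH, hdead, htop⟩
  have t₃ : Tab G x τ₂ τ₃ := tab_of_agree a₃ (by decide) (by decide) (by decide) (by decide)
  have w9₃ := (a₃.warr 9 (by decide)).trans w9₂
  have w10₃ := (a₃.warr 10 (by decide)).trans w10₂
  have r3 : τ₃.wreg 3 = N := (a₃.wreg 3 (by decide)).trans H₂.lev
  have r2 : τ₃.wreg 2 = h := (a₃.wreg 2 (by decide)).trans H₂.base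
  have r0 : τ₃.wreg 0 = G.n := (hB₂.agree a₃ (by decide)).n
  have r4 : τ₃.wreg 4 = L := (a₃.wreg 4 (by decide)).trans h4₂
  have top₂ : τ₂.wreg 28 = σ.warr 9 (N + 1) := by rw [H₂.top, w9₂]
  rw [top₂] at htop
  -- A walk with `n` edges repeats a vertex, so no collected walk is alive and the next level is
  -- empty: this ends the hierarchy.
  have hLlast : L = G.n → τ₃.wreg 28 = σ.warr 9 (N + 1) := by
    intro hLn
    rw [hLn] at hW₂
    rw [hW₂.alive_eq_zero] at htop
    simp at htop
    have := hH.top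
    omega
  refine Tri.lf rfl (by decide) ?_
  set τ := Prog.den stepP τ₃ with hτ
  have v3 : τ.wreg 3 = N + 1 := by rw [hτ]; simp [stepP, Prog.den, suc, WExp.eval, r3]
  have v2 : τ.wreg 2 = h := by rw [hτ]; simp [stepP, Prog.den, r2]
  have v28 : τ.wreg 28 = τ₃.wreg 28 := by rw [hτ]; simp [stepP, Prog.den]
  have v8 : τ.warr 8 = τ₃.warr 8 := by rw [hτ]; simp [stepP, Prog.den]
  have v9 : τ.warr 9 = Function.update (σ.warr 9) (N + 2) (τ₃.wreg 28) := by
    rw [hτ]; simp [stepP, Prog.den, suc, WExp.eval, r3, w9₃]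
  have v10 : τ.warr 10 = Function.update (σ.warr 10) (N + 1) (Ln G.n h (N + 1)) := by
    rw [hτ]
    simp only [stepP, Prog.den, suc, WExp.eval, r3, w10₃, setW_warr, putW_warr, r0, r2, r4, Ln,
      Nat.reduceEqDiff, if_true, if_false]
    congr 1; rw [← hL]; omega
  have tS : Tab G x τ₃ τ := ⟨.refl' rfl rfl rfl, .refl' rfl rfl rfl, .refl' rfl rfl rfl,
    .refl' rfl rfl rfl⟩
  have keep : ∀ k < σ.warr 9 (N + 1), τ.warr 8 k = σ.warr 8 k := fun k hk => by
    rw [v8, hH.keep k (by omega), w8₂]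
  have off : ∀ i ≤ N + 1, τ.warr 9 i = σ.warr 9 i := fun i hi => by
    rw [v9, Function.update_of_ne (by omega)]
  have offN : τ.warr 9 (N + 2) = τ₃.wreg 28 := by rw [v9, Function.update_self]
  have hI : ∀ i ≤ N, InB τ i = InB σ i := by
    intro i hi
    funext b
    simp only [InB, off i (by omega), off (i + 1) (by omega)]
    apply propext
    constructor
    · rintro ⟨k, h1, h2, h3⟩
      exact ⟨k, h1, h2, by rw [← h3, keep k (h2.trans_le (H.off_le (by omega) (by omega)))]⟩
    · rintro ⟨k, h1, h2, h3⟩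
      exact ⟨k, h1, h2, by rw [← h3, keep k (h2.trans_le (H.off_le (by omega) (by omega)))]⟩
  have htop' := hH.top
  have tall := t₁.trans (t₂.trans (t₃.trans tS))
  refine ⟨tall, ⟨v3, v2, H.two_le, ?_, ?_, ?_, ?_, ?_, ?_, ?_, ?_, ?_, ?_, ?_, ?_⟩, ?_⟩
  · rw [off 0 (by omega)]; exact H.off_zero
  · rw [off 1 (by omega)]; exact H.off_one
  · intro i hi
    rcases Nat.le_succ_iff.1 hi with h' | rfl
    · rw [off i (by omega), off (i + 1) (by omega)]; exact H.mono i h'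
    · rw [off (N + 1) (by omega), offN]; omega
  · rw [v28, offN]
  · intro k hk
    rw [offN] at hk
    by_cases h' : k < σ.warr 9 (N + 1)
    · rw [keep k h']; exact H.lt k h'
    · rw [v8]; exact hH.lt k (by omega) hk
  · intro k hk
    have : G.n ≤ σ.warr 9 (N + 1) := by
      rw [← H.off_one]; exact H.off_le (by omega) (by omega)
    rw [keep k (by omega)]; exact H.id k hk
  · intro i hi
    rw [v10]
    rcases Nat.le_succ_iff.1 hi with h' | rfl
    · rw [Function.update_of_ne (by omega)]; exact H.len i h'
    · rw [Function.update_self]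
  · intro i hi
    rw [off i (by omega), off (i + 1) (by omega)]
    rcases Nat.lt_succ_iff_lt_or_eq.1 hi with h' | rfl
    · exact H.ne i h'
    · exact hne
  · intro i hi
    rcases Nat.lt_succ_iff_lt_or_eq.1 hi with h' | rfl
    · rw [hI i (by omega), hI (i + 1) (by omega)]; exact H.hit i h'
    · rw [hI i le_rfl]
      refine hit_of_hits (Ln_pos hn H.two_le i) ?_ hH hdead ?_
      · rintro b ⟨k, h1, h2, rfl⟩
        have := (hD₂ (k - σ.warr 9 i) (by omega)).2
        rwa [show σ.warr 9 i + (k - σ.warr 9 i) = k by omega] at this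
      · intro z h1 h2
        exact ⟨z, by rw [off _ le_rfl]; omega, by rw [offN]; exact h2, by rw [v8]⟩
  · intro i hi
    rcases Nat.lt_succ_iff_lt_or_eq.1 hi with h' | rfl
    · rw [off (i + 1) (by omega), off (i + 2) (by omega)]; exact H.size i h'
    · rw [off (i + 1) (by omega), offN]
      exact htop.trans (Nat.mul_le_mul_left _ hsz)
  · intro i hi
    rcases Nat.le_succ_iff.1 hi with h' | rfl
    · rw [off i (by omega), off (i + 1) (by omega)]; exact H.card i h'
    · rw [off (N + 1) (by omega), offN]
      have hLp := Ln_pos hn H.two_le N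
      -- The crude bound: `L ≥ 1` gives `2 ≤ L + 1`, and `lg_le` replaces the logarithm.
      have h1 : (τ₃.wreg 28 - σ.warr 9 (N + 1)) * 2 ≤ G.n * (G.n * G.m + 5) * 2 := by
        calc _ ≤ (τ₃.wreg 28 - σ.warr 9 (N + 1)) * (L + 1) := Nat.mul_le_mul_left _ (by omega)
          _ ≤ 2 * G.n * Nat.size (τ₂.wreg 15) := htop
          _ ≤ 2 * G.n * (G.n * G.m + 5) := Nat.mul_le_mul_left _ (hsz.trans (lg_le G))
          _ = _ := by ring
      omega
  · intro i hi hLi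
    rcases Nat.lt_succ_iff_lt_or_eq.1 hi with h' | rfl
    · rw [off (i + 1) (by omega), off (i + 2) (by omega)]; exact H.last i h' hLi
    · rw [off (i + 1) (by omega), offN]; exact hLlast hLi
  · intro i hi b hb
    rcases Nat.lt_succ_iff_lt_or_eq.1 hi with h' | rfl
    · rw [hI i (by omega)] at hb; exact (hK i h' b hb).tab tall
    · rw [hI i le_rfl] at hb
      obtain ⟨k, h1, h2, rfl⟩ := hb
      have := (hD₂ (k - σ.warr 9 i) (by omega)).1
      rw [show σ.warr 9 i + (k - σ.warr 9 i) = k by omega] at this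
      exact this.tab (t₃.trans tS)

end Dapsp

/-! ### The complete hierarchy and the branching parameter -/

namespace Dapsp

open RealRAM

/-- If level `N` is not empty, then the length before it was not yet cut off at `n`. It is at least
`2 ^ N`, so `2 ^ N ≤ n`. -/
theorem Lay.lev_lt {G : Gr} {h N : ℕ} {σ : Store} (H : Lay G h N σ)
    (hne : σ.warr 9 N < σ.warr 9 (N + 1)) : N < Nat.size G.n + 1 := by
  rcases N with _ | N
  · omega
  · have h1 : Ln G.n h N ≠ G.n := fun h' => by
      have : σ.warr 9 (N + 1 + 1) = σ.warr 9 (N + 1) := H.last N (by omega) h'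
      omega
    have h2 := Ln_le G.n h N
    have h3 := pow_le_Ln (n := G.n) H.two_le N
    have h4 : 2 ^ (N + 1) ≤ G.n := by omega
    have := Nat.lt_size.2 h4
    omega

/-- The size of a level times its walk length. -/
theorem Lay.work {G : Gr} {h N : ℕ} {σ : Store} (H : Lay G h N σ) {i : ℕ} (hi : i ≤ N) :
    (σ.warr 9 (i + 1) - σ.warr 9 i) * (Ln G.n h i + 1) ≤ 2 * G.n * h * (lg G + 1) := by
  have h2 := H.two_le
  rcases i with _ | i
  · rw [H.off_zero, H.off_one, Nat.sub_zero, Nat.mul_assoc, Nat.mul_comm 2, Nat.mul_assoc]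
    refine Nat.mul_le_mul_left _ ?_
    have : Ln G.n h 0 ≤ h := min_le_left _ _
    nlinarith
  · have h1 := H.size i (by omega)
    have h3 : Ln G.n h (i + 1) + 1 ≤ h * (Ln G.n h i + 1) := by
      have : Ln G.n h (i + 1) ≤ h * Ln G.n h i := min_le_left _ _
      rw [Nat.mul_add]; omega
    calc _ ≤ (σ.warr 9 (i + 1 + 1) - σ.warr 9 (i + 1)) * (h * (Ln G.n h i + 1)) :=
          Nat.mul_le_mul_left _ h3
      _ = h * ((σ.warr 9 (i + 2) - σ.warr 9 (i + 1)) * (Ln G.n h i + 1)) := by ring_nf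
      _ ≤ h * (2 * G.n * lg G) := Nat.mul_le_mul_left _ h1
      _ ≤ h * (2 * G.n * (lg G + 1)) := Nat.mul_le_mul_left _ (Nat.mul_le_mul_left _ (by omega))
      _ = _ := by ring

/-- All levels are complete. -/
structure Full (G : Gr) (h N : ℕ) (σ : Store) : Prop where
  lay : Lay G h N σ
  last : ¬ σ.warr 9 N < σ.warr 9 (N + 1)
  known : ∀ i < N, ∀ b, InB σ i b → Known G σ b (Ln G.n h i)
  lev_le : N ≤ Nat.size G.n + 1

theorem Full.hier {G : Gr} {h N : ℕ} {σ : Store} (H : Full G h N σ) :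
    G.Hier (fun i b => i ≤ N ∧ InB σ i b) (Ln G.n h) N := by
  refine ⟨fun b hb => ?_, ?_, fun i hi b v hb hP => ?_⟩
  · refine ⟨?_, by omega, b, ?_, ?_, H.lay.id b hb⟩
    · rcases N with _ | N
      · have := H.last
        rw [H.lay.off_zero, H.lay.off_one] at this
        omega
      · omega
    · rw [H.lay.off_zero]; omega
    · rw [H.lay.off_one]; exact hb
  · rintro b ⟨-, k, h1, h2, -⟩
    exact H.last (by omega)
  · obtain ⟨P, h1, h2, h3⟩ := H.lay.hit i hi b v hb.2 hP
    refine ⟨P, h1, h2, h3.imp id ?_⟩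
    rintro ⟨k, hk, hk'⟩
    exact ⟨k, hk, by omega, hk'⟩

theorem Full.agree {G : Gr} {x : ℕ → ℕ → ℝ} {h N : ℕ} {S : List ℕ} {σ τ : Store}
    (H : Full G h N σ) (ha : Agree S σ τ) (t : Tab G x σ τ)
    (hS : disj [12, 8, 112, 34, 38, 42] S = true) : Full G h N τ ∧ InB τ = InB σ := by
  obtain ⟨H', I⟩ := H.lay.agree ha hS
  simp [disj] at hS
  refine ⟨⟨H', ?_, fun i hi b hb => ?_, H.lev_le⟩, I⟩
  · rw [ha.warr 9 (by simp [hS])]; exact H.last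
  · rw [I] at hb; exact (H.known i hi b hb).tab t

/-- The time to build one level. -/
def levelT (G : Gr) (h : ℕ) : ℕ :=
  (lg G + 1) * (2 * G.n * h * (lg G + 1) * (G.m + 1) * 700 + G.n * 130 + 200)

theorem upP_spec {G : Gr} {x : ℕ → ℕ → ℝ} (hx : G.Val x) {σ : Store} {h : ℕ} (hB : Base G σ)
    (hs : Sound G x σ) (H : Lay G h 0 σ) :
    Tri upP σ ((Nat.size G.n + 1) * (levelT G h + 10) + 10) fun τ =>
      Tab G x σ τ ∧ ∃ N, Full G h N τ := by
  refine Tri.mono (Tri.loop (T := levelT G h) (fun τ => Tab G x σ τ ∧ τ.wreg 3 ≤ Nat.size G.n + 1 ∧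
    ∃ N, Lay G h N τ ∧ ∀ i < N, ∀ b, InB τ i b → Known G τ b (Ln G.n h i))
    (fun τ => Nat.size G.n + 1 - τ.wreg 3) ⟨⟨.refl _, .refl _, .refl _, .refl _⟩, by rw [H.lev]; omega,
      0, H, by simp⟩ ?_) ?_ ?_
  · rintro σ' ha ⟨t, -, N, H', hK⟩ hb
    simp only [BExp.Holds, WExp.eval, suc, H'.lev] at hb
    have hlt := H'.lev_lt hb
    refine Tri.mono (levelP_spec hx (hB.agree ha (by decide)) (hs.tab t) H' hb hK) ?_ ?_
    · refine Nat.mul_le_mul_left _ ?_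
      have := Nat.mul_le_mul_right 700 (Nat.mul_le_mul_right (G.m + 1) (H'.work le_rfl))
      exact Nat.add_le_add_right (Nat.add_le_add_right this _) _
    · rintro τ - ⟨tτ, Hτ, hKτ⟩
      rw [Hτ.lev, H'.lev]
      exact ⟨⟨t.trans tτ, by omega, N + 1, Hτ, hKτ⟩, by omega⟩
  · rw [H.lev]
    simp only [BExp.size, WExp.size, suc, Nat.sub_zero]
    have : (Nat.size G.n + 1) * (levelT G h + (1 + 1 + (1 + 1 + 1 + 1) + 1) + 1) ≤
        (Nat.size G.n + 1) * (levelT G h + 10) := Nat.mul_le_mul_left _ (by omega)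
    omega
  · rintro τ - ⟨⟨t, hle, N, H', hK⟩, hb⟩
    simp only [BExp.Holds, WExp.eval, suc, H'.lev] at hb hle
    exact ⟨t, N, H', hb, hK, hle⟩

theorem initP_spec {G : Gr} {σ : Store} (hB : Base G σ) (h3 : σ.wreg 3 = 0)
    (h9 : σ.warr 9 0 = 0) :
    Tri initP σ (G.n * 60 + 120) fun τ => ∃ h, Lay G h 0 τ ∧
      G.n * G.n ≤ h * h * (h * h) * (G.m + 1) ∧
      (h = 2 ∨ (h - 1) * (h - 1) * ((h - 1) * (h - 1)) * (G.m + 1) < G.n * G.n) := by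
  refine Tri.seq_le (S := 2) (T := G.n * 60 + 110) (Tri.lf rfl (by decide)
    (Q := fun τ => τ = σ.setW 2 2) rfl) (by omega) fun τ₁ a₁ p₁ => ?_
  have hB₁ := hB.agree a₁ (by decide)
  refine Tri.seq_le (S := G.n * 30 + 20) (T := G.n * 20 + 60) (Tri.mono (Tri.loop (T := 4)
    (fun τ => 2 ≤ τ.wreg 2 ∧ (τ.wreg 2 = 2 ∨
      (τ.wreg 2 - 1) * (τ.wreg 2 - 1) * ((τ.wreg 2 - 1) * (τ.wreg 2 - 1)) * (G.m + 1) < G.n * G.n))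
    (fun τ => G.n - τ.wreg 2) ?_ ?_) ?_ fun _ _ h => h) (by omega) ?_
  · rw [p₁]; simp
  · rintro σ' ha ⟨h2, -⟩ hb
    have hB' := hB₁.agree ha (by decide)
    simp only [BExp.Holds, WExp.eval, suc, hB'.n, hB'.m] at hb
    refine Tri.lf rfl (by decide) ?_
    simp only [Prog.den, suc, WExp.eval, setW_wreg, if_true, Nat.add_sub_cancel]
    -- For `h ≥ n` already `h²` is at least `n²`, so the loop test fails; this bounds the search by
    -- `n` steps.
    have hlt : σ'.wreg 2 < G.n := by
      by_contra hc
      push Not at hc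
      have h1 := Nat.mul_le_mul hc hc
      have h4 : 1 ≤ σ'.wreg 2 * σ'.wreg 2 * (G.m + 1) := Nat.mul_pos (Nat.mul_pos (by omega) (by omega)) (by omega)
      have h5 := Nat.mul_le_mul_left (σ'.wreg 2 * σ'.wreg 2) h4
      rw [← Nat.mul_assoc, ← Nat.mul_assoc, Nat.mul_one] at h5
      rw [← Nat.mul_assoc] at hb
      omega
    exact ⟨⟨by omega, Or.inr hb⟩, by omega⟩
  · simp only [BExp.size, WExp.size, suc]
    have : (G.n - τ₁.wreg 2) * 22 ≤ G.n * 22 := Nat.mul_le_mul_right _ (by omega)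
    omega
  · rintro τ₂ a₂ ⟨⟨h2, hmin⟩, hge⟩
    have hB₂ := hB₁.agree a₂ (by decide)
    simp only [BExp.Holds, WExp.eval, suc, hB₂.n, hB₂.m, not_lt] at hge
    refine Tri.seq_le (S := G.n * 20 + 10) (T := 30) (Tri.mono (Tri.for_ (N := G.n) 5
      (fun k τ => ∀ u < k, τ.warr 8 u = u) (by simp [WExp.eval, hB₂.n]) (by decide) (by decide)
      (by simp) ?_) (by simp only [WExp.size]; omega) (fun _ _ h => h.1)) (by omega) ?_
    · intro k hk σ' ha hw h
      refine Tri.lf rfl (by decide) fun u hu => ?_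
      simp only [Prog.den, setW_warr, putW_warr, if_true, WExp.eval, hw]
      by_cases h' : u = k
      · simp [h']
      · rw [Function.update_of_ne h']; exact h u (by omega)
    · intro τ₃ a₃ p₃
      have ha := (a₁.up initP.mods (by decide)).trans
        ((a₂.up _ (by decide)).trans (a₃.up _ (by decide)))
      have r3 := (ha.wreg 3 (by decide)).trans h3
      have w9 : τ₃.warr 9 0 = 0 := by
        rw [a₃.warr 9 (by decide), a₂.warr 9 (by decide), a₁.warr 9 (by decide), h9]
      have r0 := (hB₂.agree a₃ (by decide)).n
      have r2 : τ₃.wreg 2 = τ₂.wreg 2 := a₃.wreg 2 (by decide)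
      refine Tri.lf rfl (by decide) ⟨τ₂.wreg 2, ⟨?_, ?_, h2, ?_, ?_, ?_, ?_, ?_, ?_, ?_, ?_, ?_, ?_,
        ?_, ?_⟩, hge, hmin⟩
      all_goals simp [Prog.den, WExp.eval, r0, r3, r2, w9, Ln]
      · exact fun k hk => by rw [p₃ k hk]; exact hk
      · exact p₃
      · omega
      · exact Nat.le_mul_of_pos_right _ (by omega)

end Dapsp

namespace Dapsp

open RealRAM

/-! ## Lower envelopes -/

/-- The lines `S k * x + I k` for `k < sz`, the `k`-th one starting at `Z k`, form the lower envelope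
of the lines `g ^ i * x + d i` for `i < j` with `F i`, up to line `j` if it is present. -/
structure Hull (F : ℕ → Prop) (d : ℕ → ℝ) (g : ℝ) (j sz : ℕ) (S I Z : ℕ → ℝ) : Prop where
  src : ∀ k < sz, ∃ i < j, F i ∧ S k = g ^ i ∧ I k = d i
  mono : ∀ k k', 1 ≤ k → k ≤ k' → k' < sz → Z k ≤ Z k'
  pos : ∀ i < j, F i → 0 < sz
  le : sz ≤ j
  best : ∀ x, ∀ k < sz, (1 ≤ k → Z k ≤ x) → (k + 1 < sz → x < Z (k + 1)) → ∀ i < j, F i →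
    I k + S k * x ≤ d i + g ^ i * x ∨ (F j ∧ d j + g ^ j * x ≤ d i + g ^ i * x)

variable {F : ℕ → Prop} {d : ℕ → ℝ} {g : ℝ} {j sz : ℕ} {S I Z : ℕ → ℝ}

theorem Hull.skip (H : Hull F d g j sz S I Z) (hF : ¬ F j) : Hull F d g (j + 1) sz S I Z := by
  have hlt : ∀ i < j + 1, F i → i < j := fun i hi h => by
    rcases Nat.lt_succ_iff_lt_or_eq.1 hi with h' | rfl
    · exact h'
    · exact absurd h hF
  refine ⟨fun k hk => ?_, H.mono, fun i hi h => H.pos i (hlt i hi h) h, H.le.trans (by omega),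
    fun x k hk h1 h2 i hi h => ?_⟩
  · obtain ⟨i, hi, h⟩ := H.src k hk
    exact ⟨i, by omega, h⟩
  · exact Or.inl ((H.best x k hk h1 h2 i (hlt i hi h) h).resolve_right fun h' => hF h'.1)

theorem Hull.pop (hg : 0 < g) (hg1 : g < 1) (H : Hull F d g j (sz + 1) S I Z) (hF : F j)
    (hsz : 0 < sz) (hc : d j + g ^ j * Z sz ≤ I sz + S sz * Z sz) :
    Hull F d g j sz S I Z := by
  refine ⟨fun k hk => H.src k (by omega), fun k k' h1 h2 h3 => H.mono k k' h1 h2 (by omega),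
    fun _ _ _ => hsz, (Nat.le_succ _).trans H.le, fun x k hk h1 h2 i hi h => ?_⟩
  by_cases hk' : k + 1 < sz
  · exact H.best x k (by omega) h1 (fun _ => h2 hk') i hi h
  · have e : k + 1 = sz := by omega
    by_cases hx : x < Z sz
    · exact H.best x k (by omega) h1 (fun _ => by rw [e]; exact hx) i hi h
    · push Not at hx
      obtain ⟨i', hi', -, hS, -⟩ := H.src sz (by omega)
      have hs : g ^ j < S sz := by rw [hS]; exact pow_lt_pow_right_of_lt_one₀ hg hg1 hi'
      right
      refine ⟨hF, ?_⟩
      rcases H.best x sz (by omega) (fun _ => hx) (by omega) i hi h with h' | h'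
      · nlinarith
      · exact h'.2

/-- The new line crosses the last one at `X` and lies below it exactly to the right. If the last
line is not the first, it is strictly lower at its own start, so `X` is no smaller than that start
and the breakpoints stay sorted. For an empty envelope the new breakpoint is a default value, but `Z
0` is never used. -/
theorem Hull.push (hg : 0 < g) (hg1 : g < 1) (H : Hull F d g j sz S I Z) (hF : F j)
    (hc : 1 < sz → I (sz - 1) + S (sz - 1) * Z (sz - 1) < d j + g ^ j * Z (sz - 1)) :
    Hull F d g (j + 1) (sz + 1) (Function.update S sz (g ^ j)) (Function.update I sz (d j))
      (Function.update Z sz ((d j - I (sz - 1)) / (S (sz - 1) - g ^ j))) := by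
  have hsrc : ∀ k < sz + 1, ∃ i < j + 1, F i ∧ Function.update S sz (g ^ j) k = g ^ i ∧
      Function.update I sz (d j) k = d i := by
    intro k hk
    rcases Nat.lt_succ_iff_lt_or_eq.1 hk with h | rfl
    · obtain ⟨i, hi, h'⟩ := H.src k h
      refine ⟨i, by omega, ?_⟩
      rwa [Function.update_of_ne (by omega), Function.update_of_ne (by omega)]
    · exact ⟨j, by omega, hF, by simp, by simp⟩
  rcases sz with _ | t
  · refine ⟨hsrc, fun k k' h1 h2 h3 => by omega, fun _ _ _ => by omega, by have := H.le; omega,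
      fun x k hk _ _ i hi h => ?_⟩
    obtain rfl : k = 0 := by omega
    rcases Nat.lt_succ_iff_lt_or_eq.1 hi with h' | rfl
    · exact absurd (H.pos i h' h) (by omega)
    · left; simp
  · simp only [Nat.add_sub_cancel] at hc ⊢
    obtain ⟨it, hit, hFt, hSt, hIt⟩ := H.src t (by omega)
    have hs : 0 < S t - g ^ j := by
      rw [hSt]; linarith [pow_lt_pow_right_of_lt_one₀ hg hg1 hit]
    set X := (d j - I t) / (S t - g ^ j) with hX
    have hle : ∀ x, X ≤ x → d j + g ^ j * x ≤ I t + S t * x := fun x hx => by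
      rw [hX, div_le_iff₀ hs] at hx; nlinarith
    have hge : ∀ x, x < X → I t + S t * x ≤ d j + g ^ j * x := fun x hx => by
      rw [hX, lt_div_iff₀ hs] at hx; nlinarith
    have hZ : 1 ≤ t → Z t ≤ X := fun ht => by
      rw [hX, le_div_iff₀ hs]; have := hc (by omega); nlinarith
    refine ⟨hsrc, fun k k' h1 h2 h3 => ?_, fun _ _ _ => by omega, by have := H.le; omega,
      fun x k hk h1 h2 i hi h => Or.inl ?_⟩
    · rcases Nat.lt_succ_iff_lt_or_eq.1 h3 with h' | rfl
      · rw [Function.update_of_ne (by omega), Function.update_of_ne (by omega)]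
        exact H.mono k k' h1 h2 h'
      · rw [Function.update_self]
        rcases Nat.lt_or_ge k (t + 1) with h' | h'
        · rw [Function.update_of_ne (by omega)]
          exact (H.mono k t h1 (by omega) (by omega)).trans (hZ (by omega))
        · obtain rfl : k = t + 1 := by omega
          rw [Function.update_self]
    · have hbest : ∀ k < t + 1, (1 ≤ k → Z k ≤ x) → (k + 1 < t + 1 → x < Z (k + 1)) →
          I k + S k * x ≤ d j + g ^ j * x → I k + S k * x ≤ d i + g ^ i * x := by
        intro k hk h1 h2 h3
        rcases Nat.lt_succ_iff_lt_or_eq.1 hi with h' | rfl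
        · rcases H.best x k hk h1 h2 i h' h with h4 | ⟨-, h4⟩
          · exact h4
          · linarith
        · exact h3
      rcases Nat.lt_succ_iff_lt_or_eq.1 hk with hk' | rfl
      · rw [Function.update_of_ne (by omega)] at h1
        rw [Function.update_of_ne (by omega), Function.update_of_ne (by omega)]
        rcases Nat.lt_succ_iff_lt_or_eq.1 hk' with hkt | rfl
        · have hx := h2 (by omega)
          rw [Function.update_of_ne (by omega)] at hx
          refine hbest k hk' h1 (fun _ => hx) ?_
          -- To the left of `Z t` the last line lies strictly below the new one, as it has the
          -- larger slope. So line `j` cannot be the alternative here, and the line valid at `x` is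
          -- below the last line and hence below the new one.
          have h3 : x < Z t := hx.trans_le (H.mono (k + 1) t (by omega) (by omega) (by omega))
          have h4 := hc (by omega)
          have h5 : I t + S t * x < d j + g ^ j * x := by nlinarith
          rcases H.best x k hk' h1 (fun _ => hx) it hit hFt with h6 | ⟨-, h6⟩
          · rw [hSt, hIt] at h5; linarith
          · rw [hSt, hIt] at h5; linarith
        · have hx := h2 (by omega)
          rw [Function.update_self] at hx
          exact hbest k hk' h1 (by omega) (hge x hx)
      · have hx := h1 (by omega)
        rw [Function.update_self] at hx
        rw [Function.update_self, Function.update_self]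
        have h3 := hle x hx
        rcases Nat.lt_succ_iff_lt_or_eq.1 hi with h' | rfl
        · rcases H.best x t (by omega) (fun ht => (hZ ht).trans hx) (by omega) i h' h with
            h4 | ⟨-, h4⟩
          · linarith
          · exact h4
        · exact le_rfl

/-- The current walks from `b` to `v` form a lower envelope. -/
def HullAt (G : Gr) (σ : Store) (b v L j : ℕ) (τ : Store) : Prop :=
  Hull (fun i => i ≤ L ∧ σ.warr 4 ((i * G.n + b) * G.n + v) ≠ 0)
    (fun i => σ.xarr 2 ((i * G.n + b) * G.n + v)) G.g j (τ.wreg 22) (τ.xarr 5) (τ.xarr 6) (τ.xarr 7)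

theorem hullP_spec {G : Gr} {σ : Store} {b v L : ℕ} (hB : Base G σ) (h6 : σ.wreg 6 = b)
    (h20 : σ.wreg 20 = v) (h4 : σ.wreg 4 = L) :
    Tri hullP σ ((L + 1) * 300 + 30) (HullAt G σ b v L (L + 1)) := by
  refine Tri.seq_le (S := 2) (T := (L + 1) * 300 + 20) (Tri.lf rfl (by decide)
    (Q := fun τ => τ = σ.setW 22 0) rfl) (by omega) fun τ₁ a₁ p₁ => ?_
  refine Tri.seq_le (S := 2) (T := (L + 1) * 300 + 15) (Tri.lf rfl (by decide)
    (Q := fun τ => τ = τ₁.setW 7 0) rfl) (by omega) fun τ₂ a₂ p₂ => ?_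
  refine Tri.seq_le (S := 2) (T := (L + 1) * 300 + 10) (Tri.lf rfl (by decide)
    (Q := fun τ => τ = τ₂.setX 2 1) (by simp [Prog.den, XExp.eval])) (by omega) fun τ₃ a₃ p₃ => ?_
  -- Amortisation by the variant `2 (L + 1 - j) + size`: appending a line spends 2 and returns 1,
  -- dropping one spends 1.
  refine Tri.mono (Tri.loop (T := 140) (fun τ => τ.wreg 7 ≤ L + 1 ∧ τ.xreg 2 = G.g ^ τ.wreg 7 ∧
    HullAt G σ b v L (τ.wreg 7) τ) (fun τ => 2 * (L + 1 - τ.wreg 7) + τ.wreg 22) ?_ ?_) ?_ ?_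
  · subst p₁ p₂ p₃
    refine ⟨by simp, by simp, ⟨by simp, by simp, by simp, by simp, by simp⟩⟩
  · rintro σ' ha ⟨hj, h2, hH⟩ hb
    have ha' := (a₁.up hullP.mods (by decide)).trans ((a₂.up _ (by decide)).trans
      ((a₃.up _ (by decide)).trans (ha.up _ (by decide))))
    have hB' := hB.agree ha' (by decide)
    have r6 : σ'.wreg 6 = b := (ha'.wreg 6 (by decide)).trans h6
    have r20 : σ'.wreg 20 = v := (ha'.wreg 20 (by decide)).trans h20
    have r4 : σ'.wreg 4 = L := (ha'.wreg 4 (by decide)).trans h4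
    have w4 := ha'.warr 4 (by decide)
    have x2 := ha'.xarr 2 (by decide)
    simp only [BExp.Holds, WExp.eval, suc, r4] at hb
    refine Tri.lf rfl (by decide) ?_
    by_cases hf : σ.warr 4 ((σ'.wreg 7 * G.n + b) * G.n + v) ≠ 0
    · have hF : (fun i => i ≤ L ∧ σ.warr 4 ((i * G.n + b) * G.n + v) ≠ 0) (σ'.wreg 7) :=
        ⟨by omega, hf⟩
      by_cases hc : 1 < σ'.wreg 22 ∧ ¬ (σ'.xarr 6 (σ'.wreg 22 - 1) +
          σ'.xarr 5 (σ'.wreg 22 - 1) * σ'.xarr 7 (σ'.wreg 22 - 1) <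
          σ.xarr 2 ((σ'.wreg 7 * G.n + b) * G.n + v) +
            G.g ^ σ'.wreg 7 * σ'.xarr 7 (σ'.wreg 22 - 1))
      · simp only [hullStep, Prog.den, fl, dIx, ix, topE, BExp.Holds, WExp.eval, XExp.eval, r6, r20,
          hB'.n, w4, hf, not_false_iff, if_true, setX_wreg, setX_xarr, setX_xreg, x2, h2,
          Nat.reduceEqDiff, if_false, hc, and_self]
        obtain ⟨h1, hc⟩ := hc
        obtain ⟨s, hs⟩ : ∃ s, σ'.wreg 22 = s + 1 := ⟨σ'.wreg 22 - 1, by omega⟩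
        refine ⟨⟨by simpa using hj, by simp [h2], ?_⟩, by simp; omega⟩
        unfold HullAt at hH ⊢
        simp only [hs, setW_wreg, setX_wreg, setW_xarr, setX_xarr, Nat.add_sub_cancel, if_true,
          Nat.reduceEqDiff, if_false] at hH hc ⊢
        exact hH.pop G.g_pos G.g_lt hF (by omega) (not_lt.1 hc)
      · simp only [hullStep, Prog.den, fl, dIx, ix, topE, BExp.Holds, WExp.eval, XExp.eval, r6, r20,
          hB'.n, w4, hf, not_false_iff, if_true, setX_wreg, setX_xarr, setX_xreg, x2, h2,
          Nat.reduceEqDiff, if_false, hc, nextPow]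
        refine ⟨⟨?_, ?_, ?_⟩, ?_⟩
        · simp [suc, WExp.eval]; omega
        · simp [suc, WExp.eval, h2, hB'.g, pow_succ]
        · have := hH.push G.g_pos G.g_lt hF (fun h1 => by
            by_contra h'; exact hc ⟨h1, h'⟩)
          unfold HullAt
          simp [suc, WExp.eval, h2]
          convert this using 2
        · simp [suc, WExp.eval]; omega
    · have hF : ¬ (fun i => i ≤ L ∧ σ.warr 4 ((i * G.n + b) * G.n + v) ≠ 0) (σ'.wreg 7) :=
        fun h => hf h.2
      simp only [hullStep, Prog.den, fl, dIx, ix, BExp.Holds, WExp.eval, r6, r20,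
        hB'.n, w4, hf, if_false, nextPow, XExp.eval, suc]
      refine ⟨⟨by simp; omega, by simp [h2, hB'.g, pow_succ], ?_⟩, by simp; omega⟩
      unfold HullAt at hH ⊢
      simpa using hH.skip hF
  · have e7 : τ₃.wreg 7 = 0 := by subst p₁ p₂ p₃; simp
    have e22 : τ₃.wreg 22 = 0 := by subst p₁ p₂ p₃; simp
    simp only [e7, e22, BExp.size, WExp.size, suc]
    omega
  · rintro τ a ⟨⟨hj, -, hH⟩, hb⟩
    have ha' := (a₁.up hullP.mods (by decide)).trans ((a₂.up _ (by decide)).trans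
      ((a₃.up _ (by decide)).trans (a.up _ (by decide))))
    have r4 : τ.wreg 4 = L := (ha'.wreg 4 (by decide)).trans h4
    simp only [BExp.Holds, WExp.eval, suc, r4] at hb
    obtain e : τ.wreg 7 = L + 1 := by omega
    rwa [e] at hH

end Dapsp

namespace Dapsp

open RealRAM

/-! ## Downwards propagation -/

/-- Bisection of the sorted breakpoints, with the rounded-up binary logarithm of the interval length
as variant. The midpoint is stored as `hi - ⌈(hi - lo) / 2⌉`, since a sum of two registers would not
be safe. -/
theorem searchP_spec {G : Gr} {σ : Store} {v t sz : ℕ} (hB : Base G σ) (h20 : σ.wreg 20 = v)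
    (h21 : σ.wreg 21 = t) (h22 : σ.wreg 22 = sz) (h0 : 0 < sz) (hsz : sz ≤ G.n + 1) :
    Tri searchP σ (Nat.size G.n * 50 + 20) fun τ => τ.wreg 23 < sz ∧
      (1 ≤ τ.wreg 23 → σ.xarr 7 (τ.wreg 23) ≤ σ.xarr 1 (v * G.n + t)) ∧
      (τ.wreg 23 + 1 < sz → σ.xarr 1 (v * G.n + t) < σ.xarr 7 (τ.wreg 23 + 1)) := by
  refine Tri.seq_le (S := 2) (T := Nat.size G.n * 50 + 15) (Tri.lf rfl (by decide)
    (Q := fun τ => τ = σ.setW 23 0) rfl) (by omega) fun τ₁ a₁ p₁ => ?_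
  refine Tri.seq_le (S := 2) (T := Nat.size G.n * 50 + 10) (Tri.lf rfl (by decide)
    (Q := fun τ => τ = τ₁.setW 24 sz)
    (by subst p₁; simp [Prog.den, WExp.eval, h22])) (by omega) fun τ₂ a₂ p₂ => ?_
  refine Tri.mono (Tri.loop (T := 40) (fun τ => τ.wreg 23 < τ.wreg 24 ∧ τ.wreg 24 ≤ sz ∧
      (1 ≤ τ.wreg 23 → σ.xarr 7 (τ.wreg 23) ≤ σ.xarr 1 (v * G.n + t)) ∧
      (τ.wreg 24 < sz → σ.xarr 1 (v * G.n + t) < σ.xarr 7 (τ.wreg 24)))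
      (fun τ => Nat.clog 2 (τ.wreg 24 - τ.wreg 23)) ?_ ?_) ?_ ?_
  · subst p₁ p₂; simp [h0]
  · rintro σ' ha ⟨h1, h2, h3, h4⟩ hb
    have ha' := (a₁.up searchP.mods (by decide)).trans ((a₂.up _ (by decide)).trans
      (ha.up _ (by decide)))
    have hB' := hB.agree ha' (by decide)
    have r20 : σ'.wreg 20 = v := (ha'.wreg 20 (by decide)).trans h20
    have r21 : σ'.wreg 21 = t := (ha'.wreg 21 (by decide)).trans h21
    have x1 := ha'.xarr 1 (by decide)
    have x7 := ha'.xarr 7 (by decide)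
    simp only [BExp.Holds, WExp.eval, suc] at hb
    have hclog := Nat.clog_of_two_le (b := 2) (n := σ'.wreg 24 - σ'.wreg 23) (by omega) (by omega)
    have hmono : ∀ w, w ≤ (σ'.wreg 24 - σ'.wreg 23 + 2 - 1) / 2 →
        Nat.clog 2 w < Nat.clog 2 (σ'.wreg 24 - σ'.wreg 23) := fun w hw => by
      have := Nat.clog_mono_right 2 hw
      omega
    refine Tri.lf rfl (by decide) ?_
    by_cases hc : σ.xarr 1 (v * G.n + t) <
        σ.xarr 7 (σ'.wreg 24 - (σ'.wreg 24 - σ'.wreg 23 + 1) / 2)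
    · simp only [Prog.den, BExp.Holds, WExp.eval, XExp.eval, midE, suc, ix, r20, r21, hB'.n, x1, x7,
        hc, if_true]
      simp only [setW_wreg, if_true, Nat.reduceEqDiff, if_false]
      exact ⟨⟨by omega, by omega, h3, fun _ => hc⟩, hmono _ (by omega)⟩
    · simp only [Prog.den, BExp.Holds, WExp.eval, XExp.eval, midE, suc, ix, r20, r21, hB'.n, x1, x7,
        hc, if_false]
      simp only [setW_wreg, if_true, Nat.reduceEqDiff, if_false]
      exact ⟨⟨by omega, h2, fun _ => not_lt.1 hc, h4⟩, hmono _ (by omega)⟩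
  · have e : τ₂.wreg 24 - τ₂.wreg 23 = sz := by subst p₁ p₂; simp
    rw [e]
    have h1 : Nat.clog 2 sz ≤ Nat.size G.n := Nat.clog_le_of_le_pow (by
      have := Nat.lt_size_self G.n
      omega)
    simp only [BExp.size, WExp.size, suc]
    omega
  · rintro τ - ⟨⟨h1, h2, h3, h4⟩, hb⟩
    simp only [BExp.Holds, WExp.eval, suc] at hb
    have e : τ.wreg 24 = τ.wreg 23 + 1 := by omega
    rw [e] at h4
    exact ⟨by omega, h3, h4⟩

/-- The line that is found belongs to an actual walk from `b` to `v`, whence soundness; by the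
envelope it is at most every other line at the current bound for `v`. Slopes are positive, so a
smaller bound for `v` only helps. -/
theorem queryP_spec {G : Gr} {x : ℕ → ℕ → ℝ} (hx : G.Val x) {σ : Store} {b v L : ℕ} (hB : Base G σ)
    (h6 : σ.wreg 6 = b) (hb : b < G.n) (h20 : σ.wreg 20 = v) (hv : v < G.n) (hL : L ≤ G.n)
    (hs : Sound G x σ) (hE : ∀ j ≤ L, Exact G σ j b) (hH : HullAt G σ b v L (L + 1) σ) :
    Tri queryP σ (G.n * (Nat.size G.n * 50 + 250) + 10) fun τ => Imp 2 1 21 (SX G x) σ τ ∧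
      ∀ t < G.n, ∀ P r, G.W b P v → P.length ≤ L → σ.ub 2 1 (v * G.n + t) r →
        τ.ub 2 1 (b * G.n + t) (G.co P + G.g ^ P.length * r) := by
  refine Tri.mono (Tri.for_each (N := G.n) (Nat.size G.n * 50 + 240) (Imp 2 1 21 (SX G x))
    (fun t τ => ∀ P r, G.W b P v → P.length ≤ L → σ.ub 2 1 (v * G.n + t) r →
        τ.ub 2 1 (b * G.n + t) (G.co P + G.g ^ P.length * r)) hB.n (by decide) (by decide)
    (fun σ v => .refl' rfl rfl rfl) (fun _ _ _ => Imp.trans)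
    (fun t _ σ' τ h hQ P r h1 h2 h3 => h.ub _ _ (hQ P r h1 h2 h3)) ?_) ?_ (fun _ _ h => h)
  · intro t ht σ' ha hw hi
    have hB' := hB.agree ha (by decide)
    have r6 : σ'.wreg 6 = b := (ha.wreg 6 (by decide)).trans h6
    have r20 : σ'.wreg 20 = v := (ha.wreg 20 (by decide)).trans h20
    have r22 := ha.wreg 22 (by decide)
    have x5 := ha.xarr 5 (by decide)
    have x6 := ha.xarr 6 (by decide)
    have x7 := ha.xarr 7 (by decide)
    refine Tri.mono (Tri.ite (T := Nat.size G.n * 50 + 200) (fun hc => ?_) (fun hc => ?_)) ?_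
      (fun _ _ h => h)
    · simp only [BExp.Holds, WExp.eval, fl, ix, r20, hw, hB'.n, r22] at hc
      refine Tri.seq_le (T := 150) (searchP_spec hB' r20 hw r22 hc.1
        (hH.le.trans (by omega))) (by omega) ?_
      rintro τ₁ a₁ ⟨p1, p2, p3⟩
      rw [x7] at p2 p3
      obtain ⟨i, hiL, ⟨-, hFi⟩, hSi, hIi⟩ := hH.src _ p1
      have q5 := (a₁.xarr 5 (by decide)).trans x5
      have q6 := (a₁.xarr 6 (by decide)).trans x6
      have q1 := a₁.xarr 1 (by decide)
      have q2 := a₁.warr 2 (by decide)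
      have q20 := (a₁.wreg 20 (by decide)).trans r20
      have q6' := (a₁.wreg 6 (by decide)).trans r6
      have q21 := (a₁.wreg 21 (by decide)).trans hw
      have q0 := (hB'.agree a₁ (by decide)).n
      have i₁ : Imp 2 1 21 (SX G x) σ' τ₁ := a₁.imp 2 1 21 (by decide)
      refine Tri.mono (Tri.relax (SX G x) (by decide) (by decide) (T := 150) (by decide) ?_) le_rfl
        ?_
      · intro _ hS2
        simp only [ix, WExp.eval, XExp.eval, q5, q6, q1, q20, q6', q21, q0, hSi, hIi]
        obtain ⟨P, hP, hPl, hPv⟩ := (hE i (by omega)).opt hs.d hb hv hFi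
        obtain ⟨hr, hxle⟩ := hi.snd hs.v _ hc.2 v t ht rfl
        intro s' t' ht' he
        obtain ⟨rfl, rfl⟩ := ix_inj ht ht' he
        refine ⟨hP.1.r.trans hr, ?_⟩
        have h1 := hx.walk hP.1 hr
        have h2 := mul_le_mul_of_nonneg_left hxle (pow_pos G.g_pos i).le
        rw [hPv, ← hPl] at *
        linarith
      · rintro τ - ⟨i₂, hu⟩
        refine ⟨i₁.trans i₂, fun P r hP hl hr => ?_⟩
        have hu' := hu (by simp [tt, BExp.Holds])
        simp only [ix, WExp.eval, XExp.eval, q5, q6, q1, q20, q6', q21, q0] at hu'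
        refine hu'.mono ?_
        have hD := hE _ hl v P hP rfl
        have hr' := (hi.ub _ _ hr).2
        -- The alternative in `Hull.best` is void: line `L + 1` is not among the lines.
        have := hH.best _ _ p1 p2 p3 P.length (by omega) ⟨hl, hD.1⟩
        rcases this with h1 | ⟨⟨h1, -⟩, -⟩
        · have h2 := mul_le_mul_of_nonneg_left hr' (pow_pos G.g_pos P.length).le
          linarith [hD.2]
        · omega
    · refine Tri.lf rfl (by show 1 ≤ _; omega) ⟨.refl _, fun P r hP hl hr => ?_⟩
      exfalso
      simp only [BExp.Holds, WExp.eval, fl, ix, r20, hw, hB'.n, r22] at hc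
      have hD := hE _ hl v P hP rfl
      exact hc ⟨hH.pos _ (by omega : P.length < L + 1) ⟨hl, hD.1⟩, (hi.ub _ _ hr).1⟩
    · simp only [BExp.size, WExp.size, fl, ix]; omega
  · simp only [WExp.size]
    have : G.n * (Nat.size G.n * 50 + 240 + (1 + 7)) ≤ G.n * (Nat.size G.n * 50 + 250) :=
      Nat.mul_le_mul_left _ (by omega)
    exact Nat.add_le_add this (by norm_num)

/-- The time for one pair of landmarks. -/
def pairT (G : Gr) : ℕ := G.n * (Nat.size G.n * 50 + 550) + 400

theorem pairP_spec {G : Gr} {x : ℕ → ℕ → ℝ} (hx : G.Val x) {σ : Store} {b v L : ℕ} (hB : Base G σ)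
    (hb : σ.warr 8 (σ.warr 9 (σ.wreg 25) + σ.wreg 5) = b) (hbn : b < G.n) (h20 : σ.wreg 20 = v)
    (hv : v < G.n) (h4 : σ.wreg 4 = L) (hL : L ≤ G.n)
    (hs : Sound G x σ) (hE : ∀ j ≤ L, Exact G σ j b) :
    Tri pairP σ (pairT G) fun τ => Tab G x σ τ ∧
      ∀ t < G.n, ∀ P r, G.W b P v → P.length ≤ L → σ.ub 2 1 (v * G.n + t) r →
        τ.ub 2 1 (b * G.n + t) (G.co P + G.g ^ P.length * r) := by
  refine Tri.seq_le (S := 8) (T := (L + 1) * 300 + 30 + (G.n * (Nat.size G.n * 50 + 250) + 10))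
    (Tri.lf rfl (by decide) (Q := fun τ => τ = σ.setW 6 b)
    (by simp [Prog.den, loadP, WExp.eval, hb])) ?_ fun τ₁ a₁ p₁ => ?_
  · have h1 : (L + 1) * 300 ≤ (G.n + 1) * 300 := Nat.mul_le_mul_right _ (by omega)
    simp only [pairT, Nat.mul_add] at *
    omega
  have r6 : τ₁.wreg 6 = b := by rw [p₁]; simp
  refine Tri.seq_le (hullP_spec (hB.agree a₁ (by decide)) r6 ((a₁.wreg 20 (by decide)).trans h20)
    ((a₁.wreg 4 (by decide)).trans h4)) le_rfl fun τ₂ a₂ p₂ => ?_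
  have ha := (a₁.up (Prog.seq (loadP (.reg 25)) hullP).mods (by decide)).trans (a₂.up _ (by decide))
  have t₂ : Tab G x σ τ₂ := tab_of_agree ha (by decide) (by decide) (by decide) (by decide)
  have hH : HullAt G τ₂ b v L (L + 1) τ₂ := by
    unfold HullAt at p₂ ⊢
    rw [a₂.warr 4 (by decide), a₂.xarr 2 (by decide)]
    exact p₂
  refine Tri.mono (queryP_spec hx (hB.agree ha (by decide)) ((a₂.wreg 6 (by decide)).trans r6) hbn
    ((ha.wreg 20 (by decide)).trans h20) hv hL (hs.tab t₂) (fun j hj => (hE j hj).imp t₂.d) hH)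
    le_rfl ?_
  rintro τ a₃ ⟨i₃, hQ⟩
  exact ⟨t₂.trans ⟨a₃.imp 4 2 5 (by decide), a₃.imp 6 3 22 (by decide), i₃,
    a₃.imp 7 4 23 (by decide)⟩, fun t ht P r h1 h2 h3 => hQ t ht P r h1 h2 (t₂.v.ub _ _ h3)⟩

end Dapsp

/-! ### The descent through the levels -/

namespace Dapsp

open RealRAM

theorem rowP_spec {G : Gr} {x : ℕ → ℕ → ℝ} (hx : G.Val x) {σ : Store} {h N i v : ℕ} (hB : Base G σ)
    (hs : Sound G x σ) (H : Full G h N σ) (hi : i < N) (h25 : σ.wreg 25 = i)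
    (h4 : σ.wreg 4 = Ln G.n h i) (hv : σ.warr 8 (σ.warr 9 (i + 1) + σ.wreg 19) = v) (hvn : v < G.n) :
    Tri rowP σ ((σ.warr 9 (i + 1) - σ.warr 9 i) * (pairT G + 20) + 30) fun τ => Tab G x σ τ ∧
      ∀ b, InB σ i b → ∀ t < G.n, ∀ P r, G.W b P v → P.length ≤ Ln G.n h i →
        σ.ub 2 1 (v * G.n + t) r → τ.ub 2 1 (b * G.n + t) (G.co P + G.g ^ P.length * r) := by
  set c := σ.warr 9 (i + 1) - σ.warr 9 i with hc
  refine Tri.seq_le (S := 10) (T := c * (pairT G + 20) + 20) (Tri.lf rfl (by decide)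
    (Q := fun τ => τ = σ.setW 20 v)
    (by simp [Prog.den, WExp.eval, suc, h25, hv])) (by omega) fun τ₁ a₁ p₁ => ?_
  have r20 : τ₁.wreg 20 = v := by rw [p₁]; simp
  have t₁ : Tab G x σ τ₁ := by rw [p₁]; exact tab_setW _ _ _
  refine Tri.mono (Tri.for_each (N := c) (pairT G) (Tab G x)
    (fun k τ => ∀ t < G.n, ∀ P r, G.W (σ.warr 8 (σ.warr 9 i + k)) P v → P.length ≤ Ln G.n h i →
        σ.ub 2 1 (v * G.n + t) r →
        τ.ub 2 1 (σ.warr 8 (σ.warr 9 i + k) * G.n + t) (G.co P + G.g ^ P.length * r))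
    (by simp [lenE, suc, WExp.eval, a₁.wreg 25 (by decide), h25, a₁.warr 9 (by decide), hc])
    (by decide) (by decide) (fun σ v => tab_setW _ _ _) (fun _ _ _ => Tab.trans)
    (fun k _ σ' τ h hQ t ht P r h1 h2 h3 => h.v.ub _ _ (hQ t ht P r h1 h2 h3)) ?_) ?_ ?_
  · intro k hk σ' ha hw t'
    have ha' := (a₁.up rowP.mods (by decide)).trans (ha.up _ (by decide))
    have tt := t₁.trans t'
    have hin : InB σ i (σ.warr 8 (σ.warr 9 i + k)) := ⟨_, by omega, by omega, rfl⟩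
    refine Tri.mono (pairP_spec hx (b := σ.warr 8 (σ.warr 9 i + k)) (hB.agree ha' (by decide))
      ?_ (H.lay.inB_lt hi.le hin) ((ha.wreg 20 (by decide)).trans r20) hvn
      ((ha'.wreg 4 (by decide)).trans h4) (Ln_le _ _ _) (hs.tab tt)
      ((H.known i hi _ hin).tab tt).exact) le_rfl ?_
    · rw [ha'.warr 8 (by decide), ha'.warr 9 (by decide), ha'.wreg 25 (by decide), h25, hw]
    · rintro τ - ⟨tτ, hQ⟩
      exact ⟨tτ, fun t ht P r h1 h2 h3 => hQ t ht P r h1 h2 (tt.v.ub _ _ h3)⟩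
  · simp only [WExp.size, lenE, suc]
    have : c * (pairT G + (1 + 1 + 1 + 1 + (1 + 1) + 1 + 7)) ≤ c * (pairT G + 20) :=
      Nat.mul_le_mul_left _ (by omega)
    exact Nat.add_le_add this (by norm_num)
  · rintro τ - ⟨tτ, hQ⟩
    refine ⟨t₁.trans tτ, ?_⟩
    rintro b ⟨k, h1, h2, rfl⟩ t ht P r
    have := hQ (k - σ.warr 9 i) (by omega) t ht P r
    rwa [show σ.warr 9 i + (k - σ.warr 9 i) = k by omega] at this

/-- The number of pairs of landmarks on consecutive levels. -/
def pairs (G : Gr) (h : ℕ) : ℕ := 4 * G.n ^ 2 * lg G ^ 2 / h ^ 3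

/-- If the upper of the two levels is not empty, then neither of the two lengths that determine the
sizes has been cut off at `n`. So they are at least `h` and `h²`, and the sizes are at most `2 n lg
/ h` and `2 n lg / h²`. -/
theorem Lay.pairs_le {G : Gr} {h N : ℕ} {σ : Store} (H : Lay G h N σ) {i : ℕ} (hi : i + 1 < N) :
    (σ.warr 9 (i + 2) - σ.warr 9 (i + 1)) * (σ.warr 9 (i + 3) - σ.warr 9 (i + 2)) ≤ pairs G h := by
  have h2 := H.two_le
  rw [pairs, Nat.le_div_iff_mul_le (by positivity)]
  by_cases h0 : σ.warr 9 (i + 3) - σ.warr 9 (i + 2) = 0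
  · rw [h0]; simp
  have l1 : Ln G.n h (i + 1) ≠ G.n := fun h' => by
    have : σ.warr 9 (i + 3) = σ.warr 9 (i + 2) := H.last (i + 1) hi h'
    omega
  have l2 := Ln_le G.n h (i + 1)
  have l3 : Ln G.n h (i + 1) = h * Ln G.n h i := by
    simp only [Ln] at l1 l2 ⊢; omega
  have l4 : h ≤ Ln G.n h i := by
    have l5 : Ln G.n h i ≠ G.n := fun h' => by
      have : 2 * Ln G.n h i ≤ h * Ln G.n h i := Nat.mul_le_mul_right _ h2
      omega
    have l6 := Ln_le G.n h i
    rcases i with _ | i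
    · simp only [Ln] at l5 l6 ⊢; omega
    · simp only [Ln] at l5 l6 ⊢
      have l7 := Ln_pos (n := G.n) (h := h) (by omega) h2 i
      have : h * 1 ≤ h * Ln G.n h i := Nat.mul_le_mul_left _ l7
      omega
  have s1 := H.size i (by omega)
  have s2 := H.size (i + 1) hi
  rw [l3] at s2
  set p := σ.warr 9 (i + 2) - σ.warr 9 (i + 1)
  set q := σ.warr 9 (i + 3) - σ.warr 9 (i + 2)
  have s1' : p * h ≤ 2 * G.n * lg G := (Nat.mul_le_mul_left p (by omega)).trans s1
  have s2' : q * (h * h) ≤ 2 * G.n * lg G :=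
    (Nat.mul_le_mul_left q ((Nat.mul_le_mul_left h l4).trans (Nat.le_succ _))).trans s2
  calc p * q * h ^ 3 = (p * h) * (q * (h * h)) := by ring
    _ ≤ (2 * G.n * lg G) * (2 * G.n * lg G) := Nat.mul_le_mul s1' s2'
    _ = _ := by ring

/-- The time of the descent. -/
def descT (G : Gr) (h : ℕ) : ℕ :=
  (Nat.size G.n + 1) * (pairs G h * (pairT G + 80) + 80) + 20

/-- `U b t` is the set of bounds that are good enough for the pair, so that one proof serves both
runs: all reals when only reachability matters, and the reals up to `x t b` when the distances are
wanted. The hypothesis says that such a bound is known or is inherited along a short walk from the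
next level. -/
theorem descP_spec {G : Gr} {x : ℕ → ℕ → ℝ} (hx : G.Val x) {σ : Store} {h N : ℕ} (hB : Base G σ)
    (hs : Sound G x σ) (H : Full G h N σ) (U : ℕ → ℕ → Set ℝ)
    (hU : ∀ i < N, ∀ b, InB σ i b → ∀ t < G.n, G.R b t → (∃ r ∈ U b t, σ.ub 2 1 (b * G.n + t) r) ∨
      ∃ P u, P.length ≤ Ln G.n h i ∧ G.W b P u ∧ InB σ (i + 1) u ∧ G.R u t ∧
        ∀ r ∈ U u t, G.co P + G.g ^ P.length * r ∈ U b t) :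
    Tri descP σ (descT G h) fun τ => Tab G x σ τ ∧
      ∀ b, InB σ 1 b → ∀ t < G.n, G.R b t → ∃ r ∈ U b t, τ.ub 2 1 (b * G.n + t) r := by
  have h3 := H.lay.lev
  refine Tri.mono (Tri.for_ (N := N - 1) (pairs G h * (pairT G + 80) + 60) (fun k τ => Tab G x σ τ ∧
    ∀ b, InB σ (N - k) b → ∀ t < G.n, G.R b t → ∃ r ∈ U b t, τ.ub 2 1 (b * G.n + t) r)
    (by simp [WExp.eval, h3]) (by decide) (by decide) ?_ ?_) ?_ ?_
  · refine ⟨tab_setW _ _ _, ?_⟩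
    rintro b ⟨k, h1, h2, -⟩
    exact absurd (h1.trans_lt h2) H.last
  · rintro k hk σ₁ a₁ hw₁ ⟨t₁, hg₁⟩
    set i := N - 1 - k with hi
    refine Tri.seq_le (S := 8) (T := pairs G h * (pairT G + 80) + 50) (Tri.lf rfl (by decide)
      (Q := fun τ => τ = σ₁.setW 25 i)
      (by simp [Prog.den, WExp.eval, a₁.wreg 3 (by decide), h3, hw₁, hi])) (by omega)
      fun τ₂ a₂ p₂ => ?_
    refine Tri.seq_le (S := 3) (T := pairs G h * (pairT G + 80) + 40) (Tri.lf rfl (by decide)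
      (Q := fun τ => τ = τ₂.setW 4 (Ln G.n h i)) (by
        subst p₂
        simp [Prog.den, WExp.eval, a₁.warr 10 (by decide), H.lay.len i (by omega)]))
      (by omega) fun τ₃ a₃ p₃ => ?_
    have ha := (a₁.up (4 * 9 :: descP.mods) (by decide)).trans ((a₂.up _ (by decide)).trans
      (a₃.up _ (by decide)))
    have t₃ : Tab G x σ₁ τ₃ := by
      subst p₂ p₃; exact (tab_setW _ _ _).trans (tab_setW _ _ _)
    have tt := t₁.trans t₃
    have w9 := ha.warr 9 (by decide)
    have w8 := ha.warr 8 (by decide)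
    have r25 : τ₃.wreg 25 = i := by subst p₂ p₃; simp
    have r4 : τ₃.wreg 4 = Ln G.n h i := by subst p₂ p₃; simp
    have hB₃ := hB.agree ha (by decide)
    set c := σ.warr 9 (i + 1) - σ.warr 9 i with hc
    set c' := σ.warr 9 (i + 2) - σ.warr 9 (i + 1) with hc'
    refine Tri.mono (Tri.for_each (N := c') (c * (pairT G + 20) + 30) (Tab G x)
      (fun z τ => ∀ b, InB σ i b → ∀ t < G.n, ∀ P r,
        G.W b P (σ.warr 8 (σ.warr 9 (i + 1) + z)) → P.length ≤ Ln G.n h i →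
        σ₁.ub 2 1 (σ.warr 8 (σ.warr 9 (i + 1) + z) * G.n + t) r →
        τ.ub 2 1 (b * G.n + t) (G.co P + G.g ^ P.length * r))
      (by simp [lenE, suc, WExp.eval, r25, w9, hc'])
      (by decide) (by decide) (fun σ v => tab_setW _ _ _) (fun _ _ _ => Tab.trans)
      (fun z _ σ' τ h hQ b hb t ht P r h1 h2 h3 => h.v.ub _ _ (hQ b hb t ht P r h1 h2 h3)) ?_) ?_ ?_
    · intro z hz σ' ha' hw' t'
      have ha4 := ha.trans (ha'.up _ (by decide))
      have t4 := tt.trans t'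
      obtain ⟨H', I'⟩ := H.agree ha4 t4 (by decide)
      have w9' := ha4.warr 9 (by decide)
      have w8' := ha4.warr 8 (by decide)
      refine Tri.mono (rowP_spec hx (hB.agree ha4 (by decide)) (hs.tab t4) H' (i := i)
        (v := σ.warr 8 (σ.warr 9 (i + 1) + z)) (by omega) ((ha'.wreg 25 (by decide)).trans r25)
        ((ha'.wreg 4 (by decide)).trans r4) (by rw [w9', w8', hw'])
        (H.lay.inB_lt (i := i + 1) (by omega)
          ⟨_, Nat.le_add_right _ z, show _ < σ.warr 9 (i + 2) by omega, rfl⟩)) (by rw [w9']) ?_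
      rintro τ - ⟨tτ, hQ⟩
      rw [I'] at hQ
      exact ⟨tτ, fun b hb t ht P r h1 h2 h3 =>
        hQ b hb t ht P r h1 h2 ((t₃.trans t').v.ub _ _ h3)⟩
    · simp only [WExp.size, lenE, suc]
      -- The lower level is not empty, so the overhead per vertex of the upper level is absorbed by
      -- the number of pairs.
      have hc1 : 1 ≤ c := by
        have := H.lay.ne i (by omega)
        omega
      obtain ⟨i', hi'⟩ : ∃ i', i = i' + 1 := ⟨i - 1, by omega⟩
      have hp : c * c' ≤ pairs G h := by
        rw [hc, hc', hi']; exact H.lay.pairs_le (by omega)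
      have h1 : c' ≤ c * c' := Nat.le_mul_of_pos_left _ hc1
      have h2 : c' * (c * (pairT G + 20) + 30 + (1 + 1 + 1 + 1 + 1 + 1 + (1 + 1 + 1 + 1) + 1 + 7)) ≤
          pairs G h * (pairT G + 80) := by
        calc _ = c * c' * (pairT G + 20) + c' * 48 := by ring
          _ ≤ c * c' * (pairT G + 20) + (c * c') * 60 := by omega
          _ = c * c' * (pairT G + 80) := by ring
          _ ≤ _ := Nat.mul_le_mul_right _ hp
      exact Nat.add_le_add h2 (by norm_num)
    · rintro τ aτ ⟨tτ, hQ⟩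
      have tS : Tab G x τ (τ.setW 9 (k + 1)) := tab_setW _ _ _
      refine ⟨tt.trans (tτ.trans tS), fun b hb t ht hr => ?_⟩
      rw [show N - (k + 1) = i by omega] at hb
      rcases hU i (by omega) b hb t ht hr with ⟨r, hr1, hr2⟩ | ⟨P, u, hPl, hP, hu, hur, hPr⟩
      · exact ⟨r, hr1, (tt.trans (tτ.trans tS)).v.ub _ _ hr2⟩
      · obtain ⟨r, hr1, hr2⟩ := hg₁ u (by rwa [show N - k = i + 1 by omega]) t ht hur
        refine ⟨_, hPr r hr1, tS.v.ub _ _ ?_⟩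
        obtain ⟨z, z1, z2, rfl⟩ := hu
        change z < σ.warr 9 (i + 2) at z2
        have := hQ (z - σ.warr 9 (i + 1)) (by omega) b hb t ht P r
        rw [show σ.warr 9 (i + 1) + (z - σ.warr 9 (i + 1)) = z by omega] at this
        exact this hP hPl hr2
  · simp only [WExp.size, descT]
    have h1 := H.lev_le
    have : (N - 1) * (pairs G h * (pairT G + 80) + 60 + (1 + 1 + 1 + 7)) ≤
        (Nat.size G.n + 1) * (pairs G h * (pairT G + 80) + 80) :=
      Nat.mul_le_mul (by omega) (by omega)
    exact Nat.add_le_add this (by norm_num)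
  · rintro τ - ⟨⟨tτ, hg⟩, -⟩
    refine ⟨tτ, fun b hb => ?_⟩
    rcases Nat.eq_zero_or_pos N with h0 | h0
    · intro t ht hr
      exfalso
      have := H.last
      rw [h0, H.lay.off_zero, H.lay.off_one] at this
      omega
    · rw [show N - (N - 1) = 1 by omega] at hg
      exact hg b hb

/-- For each end vertex, `L` rounds over all edges extend known bounds backwards along all walks
with at most `L` edges. With `L ≤ h` this takes time `O(n h m)` up to lower terms, without any
landmark on level 0. -/
theorem bfP_spec {G : Gr} {x : ℕ → ℕ → ℝ} (hx : G.Val x) {σ : Store} {L : ℕ} (hB : Base G σ)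
    (hL : σ.warr 10 0 = L) :
    Tri bfP σ (G.n * (L * (G.m * 160 + 20) + 20) + 10) fun τ => Tab G x σ τ ∧
      ∀ t < G.n, ∀ s P u r, G.W s P u → P.length ≤ L → u < G.n → σ.ub 2 1 (u * G.n + t) r →
        τ.ub 2 1 (s * G.n + t) (G.co P + G.g ^ P.length * r) := by
  have tabX : ∀ {S : List ℕ} {σ τ : Store}, Agree S σ τ → Imp 2 1 21 (SX G x) σ τ →
      disj [18, 11, 22] S = true → disj [26, 15, 90] S = true → disj [30, 19, 94] S = true →
      Tab G x σ τ := fun ha hi h1 h2 h3 =>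
    ⟨ha.imp 4 2 5 h1, ha.imp 6 3 22 h2, hi, ha.imp 7 4 23 h3⟩
  refine Tri.mono (Tri.for_each (N := G.n) (L * (G.m * 160 + 20) + 10) (Imp 2 1 21 (SX G x))
    (fun t τ => ∀ s P u r, G.W s P u → P.length ≤ L → u < G.n → σ.ub 2 1 (u * G.n + t) r →
        τ.ub 2 1 (s * G.n + t) (G.co P + G.g ^ P.length * r)) hB.n (by decide) (by decide)
    (fun σ v => .refl' rfl rfl rfl) (fun _ _ _ => Imp.trans)
    (fun t _ σ' τ h hQ s P u r h1 h2 h3 h4 => h.ub _ _ (hQ s P u r h1 h2 h3 h4)) ?_) ?_ ?_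
  · intro t ht σ₁ a₁ hw₁ i₁
    refine Tri.mono (Tri.for_ (N := L) (G.m * 160 + 10) (fun k τ => Imp 2 1 21 (SX G x) σ₁ τ ∧
      ∀ s P u r, G.W s P u → P.length ≤ k → u < G.n → σ.ub 2 1 (u * G.n + t) r →
        τ.ub 2 1 (s * G.n + t) (G.co P + G.g ^ P.length * r))
      (by simp [WExp.eval, a₁.warr 10 (by decide), hL]) (by decide) (by decide) ?_ ?_) ?_
      (fun _ _ h => h.1)
    · refine ⟨.refl' rfl rfl rfl, fun s P u r hP hl _ hu => ?_⟩
      obtain rfl : P = [] := List.length_eq_zero_iff.1 (by omega)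
      obtain rfl : s = u := hP
      have iS : Imp 2 1 21 (SX G x) σ₁ (σ₁.setW 26 0) := .refl' rfl rfl rfl
      simpa [Gr.co] using iS.ub _ _ (i₁.ub _ _ hu)
    · rintro k hk σ₂ a₂ hw₂ ⟨i₂, hQ₂⟩
      have ha₂ := (a₁.up (4 * 21 :: bfP.mods) (by decide)).trans (a₂.up _ (by decide))
      refine Tri.mono (Tri.for_each (N := G.m) 150 (Imp 2 1 21 (SX G x))
        (fun e τ => ∀ r, σ₂.ub 2 1 (G.hd e * G.n + t) r →
          τ.ub 2 1 (G.tl e * G.n + t) (G.c e + G.g * r)) (hB.agree ha₂ (by decide)).m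
        (by decide) (by decide) (fun σ v => .refl' rfl rfl rfl) (fun _ _ _ => Imp.trans)
        (fun e _ σ' τ h hQ r h1 => h.ub _ _ (hQ r h1)) ?_) ?_ ?_
      · intro e he σ₃ a₃ hw₃ i₃
        have ha₃ := ha₂.trans (a₃.up _ (by decide))
        have hB₃ := hB.agree ha₃ (by decide)
        have r21 : σ₃.wreg 21 = t := by
          rw [a₃.wreg 21 (by decide), a₂.wreg 21 (by decide), hw₁]
        refine Tri.mono (Tri.relax (SX G x) (by decide) (by decide) (T := 150) (by decide) ?_)
          le_rfl ?_
        · intro hg hS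
          simp only [fl, ix, tlE, hdE, BExp.Holds, WExp.eval, XExp.eval, hw₃, r21,
            hB₃.n, hB₃.tl e he, hB₃.hd e he, hB₃.c e he, hB₃.g] at hg ⊢
          obtain ⟨hr, hle⟩ := hS _ hg (G.hd e) t ht rfl
          intro s' t' ht' he'
          obtain ⟨rfl, rfl⟩ := ix_inj ht ht' he'
          refine ⟨(Gr.R.edge he).trans hr, (hx.edge t e he hr).trans ?_⟩
          have := mul_le_mul_of_nonneg_left hle G.g_pos.le
          linarith
        · rintro τ - ⟨i4, hu⟩
          refine ⟨i4, fun r hr => ?_⟩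
          have hr' := i₃.ub _ _ hr
          simp only [fl, ix, tlE, hdE, BExp.Holds, WExp.eval, XExp.eval, hw₃, r21,
            hB₃.n, hB₃.tl e he, hB₃.hd e he, hB₃.c e he, hB₃.g] at hu
          refine (hu hr'.1).mono ?_
          have := mul_le_mul_of_nonneg_left hr'.2 G.g_pos.le
          linarith
      · simp only [WExp.size]; omega
      · rintro τ - ⟨i3, hQ⟩
        refine ⟨i₂.trans (i3.trans (.refl' rfl rfl rfl)), fun s P u r hP hl hu hr => ?_⟩
        have iS : Imp 2 1 21 (SX G x) τ (τ.setW 26 (k + 1)) := .refl' rfl rfl rfl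
        refine iS.ub _ _ ?_
        rcases P with _ | ⟨e, P⟩
        · exact i3.ub _ _ (hQ₂ s [] u r hP (by simp) hu hr)
        · obtain ⟨he, rfl, hP'⟩ := hP
          have := hQ e he _ (hQ₂ _ P u r hP' (by simpa using hl) hu hr)
          refine this.mono (le_of_eq ?_)
          simp only [Gr.co, List.length_cons, pow_succ]
          ring
    · simp only [WExp.size]
      have : L * (G.m * 160 + 10 + (1 + 1 + 7)) ≤ L * (G.m * 160 + 20) :=
        Nat.mul_le_mul_left _ (by omega)
      omega
  · simp only [WExp.size]
    have : G.n * (L * (G.m * 160 + 20) + 10 + (1 + 7)) ≤ G.n * (L * (G.m * 160 + 20) + 20) :=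
      Nat.mul_le_mul_left _ (by omega)
    exact Nat.add_le_add this (by norm_num)
  · rintro τ a ⟨i, hQ⟩
    exact ⟨tabX a i (by decide) (by decide) (by decide), hQ⟩

/-- The time of the downwards propagation. -/
def downT (G : Gr) (h : ℕ) : ℕ := descT G h + (G.n * (h * (G.m * 160 + 20) + 20) + 10)

/-- If upper bounds in `U` are available or propagate from the next level, then they are found. -/
theorem downP_spec {G : Gr} {x : ℕ → ℕ → ℝ} (hx : G.Val x) {σ : Store} {h N : ℕ} (hB : Base G σ)
    (hs : Sound G x σ) (H : Full G h N σ) (U : ℕ → ℕ → Set ℝ)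
    (hU : ∀ i < N, ∀ b, InB σ i b → ∀ t < G.n, G.R b t → (∃ r ∈ U b t, σ.ub 2 1 (b * G.n + t) r) ∨
      ∃ P u, P.length ≤ Ln G.n h i ∧ G.W b P u ∧ InB σ (i + 1) u ∧ G.R u t ∧
        ∀ r ∈ U u t, G.co P + G.g ^ P.length * r ∈ U b t) :
    Tri downP σ (downT G h) fun τ => Tab G x σ τ ∧
      ∀ s < G.n, ∀ t < G.n, G.R s t → ∃ r ∈ U s t, τ.ub 2 1 (s * G.n + t) r := by
  refine Tri.seq_le (descP_spec hx hB hs H U hU) le_rfl ?_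
  rintro τ₁ a₁ ⟨t₁, hg⟩
  have hL : τ₁.warr 10 0 = Ln G.n h 0 := by
    rw [a₁.warr 10 (by decide)]; exact H.lay.len 0 (Nat.zero_le _)
  refine Tri.mono (bfP_spec hx (hB.agree a₁ (by decide)) hL) ?_ ?_
  · have : Ln G.n h 0 ≤ h := min_le_left _ _
    exact Nat.add_le_add_right (Nat.mul_le_mul_left _
      (Nat.add_le_add_right (Nat.mul_le_mul_right _ this) _)) _
  · rintro τ - ⟨t₂, hQ⟩
    refine ⟨t₁.trans t₂, fun s hs' t ht hr => ?_⟩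
    obtain ⟨hN, -, hin⟩ := H.hier.zero s hs'
    rcases hU 0 hN s hin t ht hr with ⟨r, h1, h2⟩ | ⟨P, u, hl, hP, hu, hur, hPr⟩
    · exact ⟨r, h1, (t₁.trans t₂).v.ub _ _ h2⟩
    · obtain ⟨r, h1, h2⟩ := hg u hu t ht hur
      exact ⟨_, hPr r h1, hQ t ht s P u r hP hl (hP.lt hs') h2⟩

end Dapsp

namespace Dapsp

open RealRAM

/-! ## Infinite walks -/

/-- The distance flags describe reachability. -/
def Flags (G : Gr) (σ : Store) : Prop :=
  ∀ s < G.n, ∀ t < G.n, σ.warr 2 (s * G.n + t) ≠ 0 ↔ G.R s t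

/-- Only edges inside strong components are used, so that a bound holds for all end vertices at
once. Walks with at most `n` edges suffice by `Gr.Tight.shorten`, hence `n` rounds. -/
theorem infP_spec {G : Gr} {x : ℕ → ℕ → ℝ} (hx : G.Val x) {σ : Store} (hB : Base G σ)
    (hf : Flags G σ) :
    Tri infP σ (G.n * (G.m * 160 + 20) + 10) fun τ => Imp 6 3 22 (SY G x) σ τ ∧
      ∀ w A b r, G.W w A b → A.length ≤ G.n → w < G.n → G.R b w → σ.ub 6 3 b r →
        τ.ub 6 3 w (G.co A + G.g ^ A.length * r) := by
  refine Tri.mono (Tri.for_ (N := G.n) (G.m * 160 + 10) (fun k τ => Imp 6 3 22 (SY G x) σ τ ∧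
      ∀ w A b r, G.W w A b → A.length ≤ k → w < G.n → G.R b w → σ.ub 6 3 b r →
        τ.ub 6 3 w (G.co A + G.g ^ A.length * r)) hB.n (by decide) (by decide) ?_ ?_) ?_
      (fun _ _ h => h.1)
  · have iS : Imp 6 3 22 (SY G x) σ (σ.setW 26 0) := .refl' rfl rfl rfl
    refine ⟨iS, fun w A b r hP hl _ _ hu => ?_⟩
    obtain rfl : A = [] := List.length_eq_zero_iff.1 (by omega)
    obtain rfl : w = b := hP
    simpa [Gr.co] using iS.ub _ _ hu
  · rintro k hk σ₂ a₂ hw₂ ⟨i₂, hQ₂⟩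
    refine Tri.mono (Tri.for_each (N := G.m) 150 (Imp 6 3 22 (SY G x))
      (fun e τ => ∀ r, G.R (G.hd e) (G.tl e) → σ₂.ub 6 3 (G.hd e) r →
        τ.ub 6 3 (G.tl e) (G.c e + G.g * r)) (hB.agree a₂ (by decide)).m
      (by decide) (by decide) (fun σ v => .refl' rfl rfl rfl) (fun _ _ _ => Imp.trans)
      (fun e _ σ' τ h hQ r h1 h2 => h.ub _ _ (hQ r h1 h2)) ?_) ?_ ?_
    · intro e he σ₃ a₃ hw₃ i₃
      have ha₃ := (a₂.up (4 * 26 :: infP.mods) (by decide)).trans (a₃.up _ (by decide))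
      have hB₃ := hB.agree ha₃ (by decide)
      have w2 := ha₃.warr 2 (by decide)
      have hfe := hf (G.hd e) (G.hd_lt e he) (G.tl e) (G.tl_lt e he)
      refine Tri.mono (Tri.relax (SY G x) (by decide) (by decide) (T := 150) (by decide) ?_)
        le_rfl ?_
      · intro hg hS
        simp only [fl, ix, tlE, hdE, BExp.Holds, WExp.eval, XExp.eval, hw₃, w2,
          hB₃.n, hB₃.tl e he, hB₃.hd e he, hB₃.c e he, hB₃.g] at hg ⊢
        intro t ht
        -- The head leads back to the tail, so it reaches every `t` that the tail reaches.
        have hr : G.R (G.hd e) t := (hfe.1 hg.1).trans ht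
        have h1 := hx.edge t e he hr
        have h2 := mul_le_mul_of_nonneg_left (hS _ hg.2 t hr) G.g_pos.le
        linarith
      · rintro τ - ⟨i4, hu⟩
        refine ⟨i4, fun r hr1 hr => ?_⟩
        have hr' := i₃.ub _ _ hr
        simp only [fl, ix, tlE, hdE, BExp.Holds, WExp.eval, XExp.eval, hw₃, w2,
          hB₃.n, hB₃.tl e he, hB₃.hd e he, hB₃.c e he, hB₃.g] at hu
        refine (hu ⟨hfe.2 hr1, hr'.1⟩).mono ?_
        have := mul_le_mul_of_nonneg_left hr'.2 G.g_pos.le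
        linarith
    · simp only [WExp.size]; omega
    · rintro τ - ⟨i3, hQ⟩
      have iS : Imp 6 3 22 (SY G x) τ (τ.setW 26 (k + 1)) := .refl' rfl rfl rfl
      refine ⟨i₂.trans (i3.trans iS), fun w A b r hP hl hw hbw hr => iS.ub _ _ ?_⟩
      rcases A with _ | ⟨e, A⟩
      · exact i3.ub _ _ (hQ₂ w [] b r hP (by simp) hw hbw hr)
      · obtain ⟨he, rfl, hP'⟩ := hP
        have := hQ e he _ (hP'.r.trans hbw) (hQ₂ _ A b r hP' (by simpa using hl) (G.hd_lt e he)
          (hbw.trans (Gr.R.edge he)) hr)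
        refine this.mono (le_of_eq ?_)
        simp only [Gr.co, List.length_cons, pow_succ]
        ring
  · simp only [WExp.size]
    have : G.n * (G.m * 160 + 10 + (1 + 7)) ≤ G.n * (G.m * 160 + 20) :=
      Nat.mul_le_mul_left _ (by omega)
    exact Nat.add_le_add this (by norm_num)

open Classical in
/-- The number of vertices reachable from `v`. -/
noncomputable def rc (G : Gr) (v : ℕ) : ℕ := ((Finset.range G.n).filter fun t => G.R v t).card

/-- `r` represents the strong component of `v`. -/
def Rp (G : Gr) (v r : ℕ) : Prop :=
  r < G.n ∧ G.R v r ∧ G.R r v ∧ ∀ t < r, ¬ (G.R v t ∧ G.R t v)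

theorem Rp.unique {G : Gr} {v w r s : ℕ} (h : Rp G v r) (h' : Rp G w s) (h1 : G.R v w)
    (h2 : G.R w v) : r = s := by
  rcases lt_trichotomy r s with hl | hl | hl
  · exact absurd ⟨h2.trans h.2.1, h.2.2.1.trans h1⟩ (h'.2.2.2 r hl)
  · exact hl
  · exact absurd ⟨h1.trans h'.2.1, h'.2.2.1.trans h2⟩ (h.2.2.2 s hl)

theorem rc_pos {G : Gr} {v : ℕ} (hv : v < G.n) : 0 < rc G v :=
  Finset.card_pos.2 ⟨v, by simp [hv, Gr.R.refl]⟩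

theorem rc_le (G : Gr) (v : ℕ) : rc G v ≤ G.n := by
  classical
  exact (Finset.card_filter_le _ _).trans (by simp)

theorem rc_le_of {G : Gr} {v w : ℕ} (h : G.R v w) : rc G w ≤ rc G v := by
  classical
  exact Finset.card_le_card fun t ht => by
    simp only [Finset.mem_filter] at ht ⊢
    exact ⟨ht.1, h.trans ht.2⟩

/-- Thus the number of reachable vertices orders the strong components topologically, and no graph
search is needed to process them. -/
theorem rc_lt_of {G : Gr} {v w : ℕ} (hv : v < G.n) (h : G.R v w) (h' : ¬ G.R w v) :
    rc G w < rc G v := by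
  classical
  refine Finset.card_lt_card ⟨fun t ht => ?_, fun hs => ?_⟩
  · simp only [Finset.mem_filter] at ht ⊢
    exact ⟨ht.1, h.trans ht.2⟩
  · have := hs (show v ∈ _ by simp [hv, Gr.R.refl])
    simp only [Finset.mem_filter] at this
    exact h' this.2

theorem cntP_spec {G : Gr} {σ : Store} (hB : Base G σ) (hf : Flags G σ) :
    Tri cntP σ (G.n * (G.n * 60 + 40) + 10) fun τ => ∀ v < G.n, τ.warr 17 v = rc G v ∧
      Rp G v (τ.warr 18 v) := by
  classical
  refine Tri.mono (Tri.for_ (N := G.n) (G.n * 60 + 30) (fun k τ => ∀ v < k, v < G.n →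
    τ.warr 17 v = rc G v ∧ Rp G v (τ.warr 18 v)) hB.n (by decide) (by decide) (by simp) ?_) ?_
    (fun _ _ h v hv => h.1 v hv hv)
  · intro v hv σ₁ a₁ hw₁ hJ
    refine Tri.seq_le (S := 2) (T := G.n * 60 + 25) (Tri.lf rfl (by decide)
      (Q := fun τ => τ = σ₁.setW 18 0) rfl) (by omega) fun τ₂ a₂ p₂ => ?_
    refine Tri.seq_le (S := 2) (T := G.n * 60 + 20) (Tri.lf rfl (by decide)
      (Q := fun τ => τ = τ₂.setW 14 0) rfl) (by omega) fun τ₃ a₃ p₃ => ?_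
    have ha₃ := (a₁.up (4 * 17 :: cntP.mods) (by decide)).trans ((a₂.up _ (by decide)).trans
      (a₃.up _ (by decide)))
    refine Tri.seq_le (S := G.n * 60 + 8) (T := 10) (Tri.mono (Tri.for_ (N := G.n) 52 (fun k τ =>
      τ.wreg 18 = ((Finset.range k).filter fun t => G.R v t).card ∧
      ((τ.wreg 14 = 0 ∧ ∀ t < k, ¬ (G.R v t ∧ G.R t v)) ∨
        (0 < τ.wreg 14 ∧ τ.wreg 14 ≤ k ∧ Rp G v (τ.wreg 14 - 1))))
      (by simp [WExp.eval, (hB.agree ha₃ (by decide)).n]) (by decide) (by decide) ?_ ?_)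
      (by simp only [WExp.size]; omega) (fun _ _ h => h.1)) (by omega) ?_
    · subst p₂ p₃; simp
    · rintro t ht σ' ha hw ⟨h18, h14⟩
      have ha' := ha₃.trans (ha.up _ (by decide))
      have hB' := hB.agree ha' (by decide)
      have w2 := ha'.warr 2 (by decide)
      have r17 : σ'.wreg 17 = v := by
        rw [ha.wreg 17 (by decide), a₃.wreg 17 (by decide), a₂.wreg 17 (by decide), hw₁]
      have f1 := hf v hv t ht
      have f2 := hf t ht v hv
      refine Tri.lf rfl (by decide) ?_
      by_cases h1 : G.R v t
      · have g1 := f1.2 h1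
        by_cases h2 : G.R t v ∧ σ'.wreg 14 = 0
        · have g2 := f2.2 h2.1
          simp only [cntStep, Prog.den, fl, ix, BExp.Holds, WExp.eval, r17, hw, hB'.n, w2, g1,
            not_false_iff, if_true, setW_warr, setW_wreg, Nat.reduceEqDiff, if_false, g2, h2.2,
            and_self, suc]
          refine ⟨?_, Or.inr ⟨by omega, by omega, ?_⟩⟩
          · rw [h18, Finset.range_add_one, Finset.filter_insert, if_pos h1,
              Finset.card_insert_of_notMem (by simp)]
          · simp only [Nat.add_sub_cancel]
            refine ⟨ht, h1, h2.1, ?_⟩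
            rcases h14 with h | h
            · exact h.2
            · omega
        · have g2 : ¬ (σ.warr 2 (t * G.n + v) ≠ 0 ∧ σ'.wreg 14 = 0) := fun h => h2 ⟨f2.1 h.1, h.2⟩
          have g2' : ¬ (¬ σ.warr 2 (t * G.n + v) = 0 ∧ σ'.wreg 14 = 0) := g2
          simp only [cntStep, Prog.den, fl, ix, BExp.Holds, WExp.eval, r17, hw, hB'.n, w2, g1,
            not_false_iff, if_true, setW_warr, setW_wreg, Nat.reduceEqDiff, if_false, g2', suc]
          refine ⟨?_, ?_⟩
          · rw [h18, Finset.range_add_one, Finset.filter_insert, if_pos h1,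
              Finset.card_insert_of_notMem (by simp)]
          · rcases h14 with h | h
            · refine Or.inl ⟨h.1, fun t' ht' h' => ?_⟩
              rcases Nat.lt_succ_iff_lt_or_eq.1 ht' with h3 | rfl
              · exact h.2 t' h3 h'
              · exact h2 ⟨h'.2, h.1⟩
            · exact Or.inr ⟨h.1, by omega, h.2.2⟩
      · have g1 : ¬ σ.warr 2 (v * G.n + t) ≠ 0 := fun h => h1 (f1.1 h)
        have g1' : ¬ ¬ σ.warr 2 (v * G.n + t) = 0 := g1
        simp only [cntStep, Prog.den, fl, ix, BExp.Holds, WExp.eval, r17, hw, hB'.n, w2, g1',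
          if_false, setW_wreg, Nat.reduceEqDiff]
        refine ⟨?_, ?_⟩
        · rw [h18, Finset.range_add_one, Finset.filter_insert, if_neg h1]
        · rcases h14 with h | h
          · refine Or.inl ⟨h.1, fun t' ht' h' => ?_⟩
            rcases Nat.lt_succ_iff_lt_or_eq.1 ht' with h3 | rfl
            · exact h.2 t' h3 h'
            · exact h1 h'.1
          · exact Or.inr ⟨h.1, by omega, h.2.2⟩
    · rintro τ₄ a₄ ⟨h18, h14⟩
      have ha₄ := (a₂.up cntP.mods (by decide)).trans ((a₃.up _ (by decide)).trans
        (a₄.up _ (by decide)))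
      have r17 : τ₄.wreg 17 = v := by
        rw [a₄.wreg 17 (by decide), a₃.wreg 17 (by decide), a₂.wreg 17 (by decide), hw₁]
      have w17 : τ₄.warr 17 = σ₁.warr 17 := by
        rw [a₄.warr 17 (by decide), a₃.warr 17 (by decide), a₂.warr 17 (by decide)]
      have w18 : τ₄.warr 18 = σ₁.warr 18 := by
        rw [a₄.warr 18 (by decide), a₃.warr 18 (by decide), a₂.warr 18 (by decide)]
      refine Tri.lf rfl (by decide) fun u hu hun => ?_
      simp only [Prog.den, WExp.eval, setW_warr, putW_warr, putW_wreg, r17, Nat.reduceEqDiff,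
        if_true, if_false, w17, w18]
      rcases Nat.lt_succ_iff_lt_or_eq.1 hu with h | rfl
      · rw [Function.update_of_ne (by omega), Function.update_of_ne (by omega)]
        exact hJ u h hun
      · rw [Function.update_self, Function.update_self]
        refine ⟨h18, ?_⟩
        rcases h14 with h | h
        · exact absurd ⟨Gr.R.refl u, Gr.R.refl u⟩ (h.2 u hv)
        · exact h.2.2
  · simp only [WExp.size]
    have : G.n * (G.n * 60 + 30 + (1 + 7)) ≤ G.n * (G.n * 60 + 40) :=
      Nat.mul_le_mul_left _ (by omega)
    exact Nat.add_le_add this (by norm_num)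

end Dapsp

namespace Dapsp

open RealRAM

/-! ## Copy instructions -/

/-- The first `q` copy instructions `s i → d i` carry values from `u` to `v`. -/
def Conn (s d : ℕ → ℕ) : ℕ → ℕ → ℕ → Prop
  | 0, u, v => u = v
  | q + 1, u, v => Conn s d q u v ∨ (Conn s d q u (s q) ∧ v = d q)

theorem Conn.congr {s d s' d' : ℕ → ℕ} : ∀ {q : ℕ}, (∀ i < q, s i = s' i) → (∀ i < q, d i = d' i) →
    Conn s d q = Conn s' d' q := by
  intro q
  induction q with
  | zero => intro _ _; rfl
  | succ q ih =>
    intro h1 h2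
    funext u v
    simp only [Conn, ih (fun i hi => h1 i (by omega)) (fun i hi => h2 i (by omega)),
      h1 q (by omega), h2 q (by omega)]

theorem Conn.refl (s d : ℕ → ℕ) (q u : ℕ) : Conn s d q u u := by
  induction q with
  | zero => rfl
  | succ q ih => exact Or.inl ih

/-- The copy instructions carry values from `u` to `v`. -/
def Carry (σ : Store) (u v : ℕ) : Prop := Conn (σ.warr 19) (σ.warr 20) (σ.wreg 27) u v

/-- All copy instructions follow walks. -/
def InstrSound (G : Gr) (σ : Store) : Prop :=
  ∀ q < σ.wreg 27, σ.warr 19 q < G.n ∧ σ.warr 20 q < G.n ∧ G.R (σ.warr 19 q) (σ.warr 20 q)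

theorem instr_den {a b : WExp} {σ : Store} {u v : ℕ} (ha : a.eval σ = u)
    (hb : b.eval (σ.putW 19 (σ.wreg 27) u) = v) {G : Gr} :
    (∀ w z, Carry σ w z → Carry ((instr a b).den σ) w z) ∧
    (∀ w, Carry σ w u → Carry ((instr a b).den σ) w v) ∧
    (u < G.n → v < G.n → G.R u v → InstrSound G σ → InstrSound G ((instr a b).den σ)) ∧
    ((instr a b).den σ).wreg 27 = σ.wreg 27 + 1 := by
  have e27 : ((instr a b).den σ).wreg 27 = σ.wreg 27 + 1 := by simp [instr, Prog.den, suc, WExp.eval]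
  have e19 : ((instr a b).den σ).warr 19 = Function.update (σ.warr 19) (σ.wreg 27) u := by
    simp [instr, Prog.den, WExp.eval, ha]
  have e20 : ((instr a b).den σ).warr 20 = Function.update (σ.warr 20) (σ.wreg 27) v := by
    simp [instr, Prog.den, WExp.eval, ha, hb]
  have hc : Conn (Function.update (σ.warr 19) (σ.wreg 27) u)
      (Function.update (σ.warr 20) (σ.wreg 27) v) (σ.wreg 27) =
      Conn (σ.warr 19) (σ.warr 20) (σ.wreg 27) := Conn.congr
    (fun i hi => Function.update_of_ne (by omega) _ _)
    (fun i hi => Function.update_of_ne (by omega) _ _)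
  refine ⟨fun w z h => ?_, fun w h => ?_, fun hu hv hr hs q hq => ?_, e27⟩
  · unfold Carry at h ⊢
    rw [e27, e19, e20, Conn, hc]
    exact Or.inl h
  · unfold Carry at h ⊢
    rw [e27, e19, e20, Conn, hc]
    exact Or.inr ⟨by rw [Function.update_self]; exact h, by rw [Function.update_self]⟩
  · rw [e27] at hq
    rw [e19, e20]
    rcases Nat.lt_succ_iff_lt_or_eq.1 hq with h | rfl
    · rw [Function.update_of_ne (by omega), Function.update_of_ne (by omega)]
      exact hs q h
    · rw [Function.update_self, Function.update_self]
      exact ⟨hu, hv, hr⟩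

/-- A loop that emits the instruction `A i → B i` for all `i < N` with `D i`. -/
theorem emit_spec {G : Gr} {r : ℕ} {e a b : WExp} {tst : BExp} {σ : Store} {N : ℕ} {D : ℕ → Prop}
    [DecidablePred D] {A B : ℕ → ℕ} (hN : e.eval σ = N)
    (hd : disj e.rds (4 * r :: (Prog.ite tst (instr a b) .skip).mods) = true)
    (hr : (Prog.ite tst (instr a b) .skip).mods.contains (4 * r) = false)
    (hsz : e.size ≤ 3) (hc : (Prog.ite tst (instr a b) .skip).cost ≤ 30)
    (h27 : 27 ≠ r)
    (hev : ∀ i < N, ∀ σ', Agree (4 * r :: (Prog.ite tst (instr a b) .skip).mods) σ σ' →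
      σ'.wreg r = i → (tst.Holds σ' ↔ D i) ∧ a.eval σ' = A i ∧
        b.eval (σ'.putW 19 (σ'.wreg 27) (A i)) = B i)
    (hAB : ∀ i < N, D i → A i < G.n ∧ B i < G.n ∧ G.R (A i) (B i)) (hs : InstrSound G σ) :
    Tri (.for_ r e (.ite tst (instr a b) .skip)) σ (N * 40 + 10) fun τ => InstrSound G τ ∧
      (∀ u v, Carry σ u v → Carry τ u v) ∧ (∀ i < N, D i → ∀ u, Carry σ u (A i) → Carry τ u (B i)) ∧
      τ.wreg 27 = σ.wreg 27 + ((Finset.range N).filter D).card := by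
  have cS : ∀ (τ : Store) v, Carry (τ.setW r v) = Carry τ := fun τ v => by
    funext u w; simp [Carry, h27]
  have iS : ∀ (τ : Store) v, InstrSound G τ → InstrSound G (τ.setW r v) := fun τ v h => by
    unfold InstrSound at h ⊢; simpa [h27] using h
  refine Tri.mono (Tri.for_ (N := N) 30 (fun k τ => InstrSound G τ ∧
      (∀ u v, Carry σ u v → Carry τ u v) ∧ (∀ i < k, D i → ∀ u, Carry σ u (A i) → Carry τ u (B i)) ∧
      τ.wreg 27 = σ.wreg 27 + ((Finset.range k).filter D).card) hN hd hr ?_ ?_) ?_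
      (fun _ _ h => h.1)
  · exact ⟨iS _ _ hs, by rw [cS]; exact fun _ _ h => h, by simp, by simp [h27]⟩
  · rintro i hi σ' ha hw ⟨hs', hm, hdone, hcnt⟩
    obtain ⟨h1, h2, h3⟩ := hev i hi σ' ha hw
    refine Tri.lf rfl hc ?_
    rw [cS]
    by_cases hD : D i
    · have : (Prog.ite tst (instr a b) .skip).den σ' = (instr a b).den σ' := by
        rw [Prog.den, if_pos (h1.2 hD)]
      rw [this]
      obtain ⟨g1, g2, g3, g4⟩ := instr_den (G := G) h2 h3
      obtain ⟨k1, k2, k3⟩ := hAB i hi hD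
      refine ⟨iS _ _ (g3 k1 k2 k3 hs'), fun u v h => g1 u v (hm u v h), fun i' hi' hDi u h => ?_, ?_⟩
      · rcases Nat.lt_succ_iff_lt_or_eq.1 hi' with h' | rfl
        · exact g1 _ _ (hdone i' h' hDi u h)
        · exact g2 u (hm _ _ h)
      · rw [setW_wreg, if_neg h27, g4, hcnt, Finset.range_add_one, Finset.filter_insert, if_pos hD,
          Finset.card_insert_of_notMem (by simp)]
        omega
    · have : (Prog.ite tst (instr a b) .skip).den σ' = σ' := by
        rw [Prog.den, if_neg fun h => hD (h1.1 h), Prog.den]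
      rw [this]
      refine ⟨iS _ _ hs', hm, fun i' hi' hDi u h => ?_, ?_⟩
      · rcases Nat.lt_succ_iff_lt_or_eq.1 hi' with h' | rfl
        · exact hdone i' h' hDi u h
        · exact absurd hDi hD
      · rw [setW_wreg, if_neg h27, hcnt, Finset.range_add_one, Finset.filter_insert, if_neg hD]
  · have : N * (30 + (e.size + 7)) ≤ N * 40 := Nat.mul_le_mul_left _ (by omega)
    omega

/-- Walks that leave a strong component for the last time. -/
theorem enter {G : Gr} {P : List ℕ} : ∀ {u v : ℕ}, G.W u P v → u < G.n →
    (G.R v u) ∨ ∃ e < G.m, G.R u (G.tl e) ∧ ¬ G.R v (G.tl e) ∧ G.R (G.hd e) v ∧ G.R v (G.hd e) := by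
  induction P with
  | nil => intro u v h _; left; rw [show u = v from h]; exact Gr.R.refl _
  | cons e P ih =>
    intro u v h hu
    obtain ⟨he, rfl, hP⟩ := h
    rcases ih hP (G.hd_lt e he) with h1 | ⟨e', he', h1, h2⟩
    · by_cases h2 : G.R v (G.tl e)
      · exact Or.inl h2
      · exact Or.inr ⟨e, he, Gr.R.refl _, h2, hP.r, h1⟩
    · exact Or.inr ⟨e', he', (Gr.R.edge he).trans h1, h2⟩

/-- A straight-line list of `O(n + m)` copies, computed once, that carries a value from each vertex
to all vertices reachable from it. Components are treated by decreasing `rc`: values are gathered at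
the representative, spread over the component and sent along all outgoing edges. Without it each
landmark would need a quadratic number of updates. -/
theorem instrP_spec {G : Gr} {σ : Store} (hB : Base G σ)
    (hc : ∀ v < G.n, σ.warr 17 v = rc G v ∧ Rp G v (σ.warr 18 v)) :
    Tri instrP σ (G.n * (G.n * 80 + G.m * 40 + 50) + 20) fun τ => InstrSound G τ ∧
      τ.wreg 27 ≤ 2 * G.n + G.m ∧ ∀ u < G.n, ∀ v < G.n, G.R u v → Carry τ u v := by
  set rp := σ.warr 18 with hrp
  refine Tri.seq_le (S := 2) (T := G.n * (G.n * 80 + G.m * 40 + 50) + 10) (Tri.lf rfl (by decide)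
    (Q := fun τ => τ = σ.setW 27 0) rfl) (by omega) fun τ₁ a₁ p₁ => ?_
  -- After `k` rounds everything is settled for vertices, and for edges by their tails, with more
  -- than `n - k` reachable vertices; each vertex has two instructions and each edge one.
  refine Tri.mono (Tri.for_ (N := G.n) (G.n * 80 + G.m * 40 + 40) (fun k τ => InstrSound G τ ∧
    τ.wreg 27 = 2 * ((Finset.range G.n).filter fun i => G.n - k < rc G i).card +
      ((Finset.range G.m).filter fun i => G.n - k < rc G (G.tl i)).card ∧
    (∀ u < G.n, ∀ v < G.n, G.R u v → G.n - k < rc G v → Carry τ u v) ∧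
    ∀ u < G.n, ∀ e < G.m, G.R u (G.tl e) → G.n - k < rc G (G.tl e) → Carry τ u (G.hd e))
    (by simp [WExp.eval, (hB.agree a₁ (by decide)).n]) (by decide) (by decide) ?_ ?_) ?_ ?_
  · have hz : ∀ f : ℕ → ℕ, ∀ N, ((Finset.range N).filter fun i => G.n < rc G (f i)) = ∅ :=
      fun f N => Finset.filter_eq_empty_iff.2 fun i _ => by have := rc_le G (f i); omega
    refine ⟨?_, ?_, fun u _ v _ _ h => absurd h (by have := rc_le G v; omega),
      fun u _ e _ _ h => absurd h (by have := rc_le G (G.tl e); omega)⟩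
    · subst p₁; intro q hq; simp at hq
    · subst p₁
      simp only [Nat.sub_zero]
      rw [hz (fun i => i), hz G.tl]; simp
  · rintro k hk σ' ha hw ⟨hs', hcnt, hv', he'⟩
    have ha' := (a₁.up (4 * 9 :: instrP.mods) (by decide)).trans (ha.up _ (by decide))
    set c := G.n - k with hcdef
    have hB' := hB.agree ha' (by decide)
    have w17 := ha'.warr 17 (by decide)
    have w18 := ha'.warr 18 (by decide)
    refine Tri.seq_le (S := G.n * 40 + 10) (T := G.n * 40 + 10 + (G.m * 40 + 10))
      (emit_spec (G := G) (D := fun i => rc G i = c) (A := fun i => i) (B := fun i => rp i)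
      (N := G.n) hB'.n (by decide) (by decide) (by decide) (by decide) (by decide) ?_ ?_ hs')
      (by omega) ?_
    · intro i hi σ₂ a₂ hw₂
      have b₂ := a₂.warr 17 (by decide)
      have c₂ := a₂.warr 18 (by decide)
      have d₂ := (hB'.agree a₂ (by decide)).n
      have e₂ := a₂.wreg 9 (by decide)
      simp [BExp.Holds, WExp.eval, hw₂, b₂, c₂, w17, w18, d₂, e₂, hw, (hc i hi).1, hcdef, hrp]
    · intro i hi _
      obtain ⟨-, h1, h2, -⟩ := hc i hi
      exact ⟨hi, h1, h2⟩
    rintro τ₂ a₂ ⟨s₂, m₂, d₂, n₂⟩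
    have hB₂ := hB'.agree a₂ (by decide)
    have w17₂ := (a₂.warr 17 (by decide)).trans w17
    have w18₂ := (a₂.warr 18 (by decide)).trans w18
    have r9₂ := (a₂.wreg 9 (by decide)).trans hw
    refine Tri.seq_le (S := G.n * 40 + 10) (T := G.m * 40 + 10)
      (emit_spec (G := G) (D := fun i => rc G i = c) (A := fun i => rp i) (B := fun i => i)
      (N := G.n) hB₂.n (by decide) (by decide) (by decide) (by decide) (by decide) ?_ ?_ s₂)
      (by omega) ?_
    · intro i hi σ₃ a₃ hw₃
      have b₃ := a₃.warr 17 (by decide)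
      have c₃ := a₃.warr 18 (by decide)
      have d₃ := (hB₂.agree a₃ (by decide)).n
      have e₃ := a₃.wreg 9 (by decide)
      simp [BExp.Holds, WExp.eval, hw₃, b₃, c₃, w17₂, w18₂, d₃, e₃, r9₂, (hc i hi).1, hcdef, hrp]
    · intro i hi _
      obtain ⟨-, h1, -, h2, -⟩ := hc i hi
      exact ⟨h1, hi, h2⟩
    rintro τ₃ a₃ ⟨s₃, m₃, d₃, n₃⟩
    have hB₃ := hB₂.agree a₃ (by decide)
    have w17₃ := (a₃.warr 17 (by decide)).trans w17₂
    have r9₃ := (a₃.wreg 9 (by decide)).trans r9₂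
    refine Tri.mono
      (emit_spec (G := G) (D := fun i => rc G (G.tl i) = c) (A := G.tl) (B := G.hd)
      (N := G.m) hB₃.m (by decide) (by decide) (by decide) (by decide) (by decide) ?_ ?_ s₃)
      le_rfl ?_
    · intro i hi σ₄ a₄ hw₄
      have b₄ := a₄.warr 17 (by decide)
      have hB₄ := hB₃.agree a₄ (by decide)
      have e₄ := a₄.wreg 9 (by decide)
      simp [BExp.Holds, WExp.eval, tlE, hdE, hw₄, b₄, w17₃, hB₄.n, hB₄.tl i hi, hB₄.hd i hi, e₄, r9₃,
        (hc _ (G.tl_lt i hi)).1, hcdef]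
    · intro i hi _
      exact ⟨G.tl_lt i hi, G.hd_lt i hi, Gr.R.edge hi⟩
    rintro τ a₄ ⟨s₄, m₄, d₄, n₄⟩
    have hck : c = G.n - (k + 1) + 1 := by omega
    have key : ∀ u < G.n, ∀ v < G.n, G.R u v → G.n - (k + 1) < rc G v → Carry τ₃ u v := by
      intro u hu v hv hr hlt
      by_cases hcv : rc G v = c
      -- The last entrance of the walk into the component of `v`: the tail of the entering edge has
      -- a larger `rc`, so that edge has been served in an earlier round. If there is no such edge,
      -- `u` is itself in the component.
      · obtain ⟨w, hw1, hw2, hw3, hw4⟩ : ∃ w, w < G.n ∧ G.R w v ∧ G.R v w ∧ Carry σ' u w := by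
          obtain ⟨P, hP⟩ := hr
          rcases enter hP hu with h1 | ⟨e, he, h1, h2, h3, h4⟩
          · exact ⟨u, hu, hP.r, h1, Conn.refl _ _ _ _⟩
          · refine ⟨G.hd e, G.hd_lt e he, h3, h4, he' u hu e he h1 ?_⟩
            rw [← hcv]
            exact rc_lt_of (G.tl_lt e he) ((Gr.R.edge he).trans h3) h2
        have hcw : rc G w = c := le_antisymm ((rc_le_of hw3).trans hcv.le)
          (hcv.ge.trans (rc_le_of hw2))
        have h1 := d₂ w hw1 hcw u hw4
        rw [(hc w hw1).2.unique (hc v hv).2 hw2 hw3] at h1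
        exact d₃ v hv hcv u h1
      · exact m₃ _ _ (m₂ _ _ (hv' u hu v hv hr (by omega)))
    have cS : Carry (τ.setW 9 (k + 1)) = Carry τ := by funext u w; simp [Carry]
    have iS : InstrSound G (τ.setW 9 (k + 1)) := by
      unfold InstrSound at s₄ ⊢; simpa using s₄
    rw [cS]
    refine ⟨iS, ?_, fun u hu v hv hr hlt => m₄ _ _ (key u hu v hv hr hlt),
      fun u hu e he hr hlt => ?_⟩
    · have e1 : ∀ f : ℕ → ℕ, ∀ N, ((Finset.range N).filter fun i => G.n - (k + 1) < f i).card =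
          ((Finset.range N).filter fun i => c < f i).card +
          ((Finset.range N).filter fun i => f i = c).card := by
        intro f N
        rw [← Finset.card_union_of_disjoint]
        · congr 1
          ext i
          simp only [Finset.mem_union, Finset.mem_filter, ← and_or_left]
          exact and_congr_right fun _ => by omega
        · rw [Finset.disjoint_left]
          intro i h1 h2
          simp only [Finset.mem_filter] at h1 h2
          omega
      rw [e1 (fun i => rc G i), e1 (fun i => rc G (G.tl i))]
      simp only [setW_wreg, Nat.reduceEqDiff, if_false]
      omega
    · by_cases h : rc G (G.tl e) = c
      · exact d₄ e he h u (key u hu _ (G.tl_lt e he) hr hlt)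
      · exact m₄ _ _ (m₃ _ _ (m₂ _ _ (he' u hu e he hr (by omega))))
  · simp only [WExp.size]
    have : G.n * (G.n * 80 + G.m * 40 + 40 + (1 + 7)) ≤ G.n * (G.n * 80 + G.m * 40 + 50) :=
      Nat.mul_le_mul_left _ (by omega)
    exact Nat.add_le_add this (by norm_num)
  · rintro τ - ⟨⟨hs, hcnt, hv, -⟩, -⟩
    refine ⟨hs, ?_, fun u hu v hv' hr => hv u hu v hv' hr (by have := rc_pos hv'; omega)⟩
    have h1 := (Finset.card_filter_le (Finset.range G.n) fun i => G.n - G.n < rc G i).trans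
      (by simp : _ ≤ G.n)
    have h2 := (Finset.card_filter_le (Finset.range G.m) fun i => G.n - G.n < rc G (G.tl i)).trans
      (by simp : _ ≤ G.m)
    omega

end Dapsp

/-! ### Bounds for distances from infinite walks -/

namespace Dapsp

open RealRAM

theorem viaP_spec {G : Gr} {x : ℕ → ℕ → ℝ} (hx : G.Val x) {σ : Store} {b L : ℕ} (hB : Base G σ)
    (h6 : σ.wreg 6 = b) (hb : b < G.n) (h4 : σ.wreg 4 = L) (hs : Sound G x σ)
    (hE : ∀ j ≤ L, Exact G σ j b) :
    Tri viaP σ (L * (G.m * 160 + 30) + 180) fun τ => Imp 7 4 23 (SG G x) σ τ ∧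
      ∀ P v r, G.W b P v → P.length ≤ L → σ.ub 6 3 v r →
        τ.ub 7 4 (b * G.n + v) (G.co P + G.g ^ P.length * r) := by
  refine Tri.seq_le (S := 150) (T := L * (G.m * 160 + 30) + 30) (Tri.relax (SG G x) (by decide)
    (by decide) (by decide) ?_) (by omega) ?_
  · intro hg _
    simp only [fl, ix, BExp.Holds, WExp.eval, XExp.eval, h6, hB.n] at hg ⊢
    intro b' v' hv' he
    obtain ⟨rfl, rfl⟩ := ix_inj hb hv' he
    exact ⟨Gr.R.refl _, fun t ht => hs.y _ hg t ht⟩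
  rintro τ₁ a₁ ⟨i₁, hu₁⟩
  simp only [fl, ix, BExp.Holds, WExp.eval, XExp.eval, h6, hB.n] at hu₁
  refine Tri.seq_le (S := 2) (T := L * (G.m * 160 + 30) + 20) (Tri.lf rfl (by decide)
    (Q := fun τ => τ = τ₁.setX 2 (τ₁.xreg 0)) rfl) (by omega) fun τ₂ a₂ p₂ => ?_
  have ha₂ := (a₁.up viaP.mods (by decide)).trans (a₂.up _ (by decide))
  have i₂ : Imp 7 4 23 (SG G x) τ₁ τ₂ := a₂.imp 7 4 23 (by decide)
  have hB₂ := hB.agree ha₂ (by decide)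
  refine Tri.mono (Tri.for_ (N := L) (G.m * 160 + 20) (fun k τ => Imp 7 4 23 (SG G x) σ τ ∧
    τ.xreg 2 = G.g ^ (k + 1) ∧ ∀ P v r, G.W b P v → P.length ≤ k → σ.ub 6 3 v r →
        τ.ub 7 4 (b * G.n + v) (G.co P + G.g ^ P.length * r))
    (by simp [WExp.eval, ha₂.wreg 4 (by decide), h4]) (by decide) (by decide) ?_ ?_) ?_
    (fun τ _ h => ⟨h.1.1, h.1.2.2⟩)
  · have iS : Imp 7 4 23 (SG G x) τ₂ (τ₂.setW 7 0) := .refl' rfl rfl rfl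
    refine ⟨i₁.trans (i₂.trans iS), ?_, fun P v r hP hl hr => ?_⟩
    · rw [p₂]; simp [(hB.agree a₁ (by decide)).g]
    · obtain rfl : P = [] := List.length_eq_zero_iff.1 (by omega)
      obtain rfl : b = v := hP
      have := (i₂.trans iS).ub _ _ ((hu₁ hr.1).mono hr.2)
      simpa [Gr.co] using this
  · rintro k hk σ' ha hw ⟨hi, h2, hQ⟩
    have ha' := ha₂.trans (ha.up _ (by decide))
    have hB' := hB.agree ha' (by decide)
    refine Tri.seq_le (S := G.m * 160 + 10) (T := 5) (Tri.mono (Tri.for_each (N := G.m) 150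
      (Imp 7 4 23 (SG G x)) (fun e τ => ∀ P r, G.W b P (G.hd e) → P.length = k + 1 →
        σ.ub 6 3 (G.hd e) r → τ.ub 7 4 (b * G.n + G.hd e) (G.co P + G.g ^ P.length * r))
      hB'.m (by decide) (by decide) (fun σ v => .refl' rfl rfl rfl) (fun _ _ _ => Imp.trans)
      (fun e _ σ' τ h hQ P r h1 h2 h3 => h.ub _ _ (hQ P r h1 h2 h3)) ?_) ?_ fun _ _ h => h)
      (by omega) ?_
    · intro e he σ₃ a₃ hw₃ i₃
      have ha₃ := ha'.trans (a₃.up _ (by decide))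
      have hB₃ := hB.agree ha₃ (by decide)
      have r6 : σ₃.wreg 6 = b := (ha₃.wreg 6 (by decide)).trans h6
      have r7 : σ₃.wreg 7 = k := (a₃.wreg 7 (by decide)).trans hw
      have x2 : σ₃.xreg 2 = G.g ^ (k + 1) := (a₃.xreg 2 (by decide)).trans h2
      have iD := ha₃.imp 4 2 5 (S := SD G) (by decide)
      have iY := ha₃.imp 6 3 22 (S := SY G x) (by decide)
      have hE₃ := (hE (k + 1) hk).imp iD
      refine Tri.mono (Tri.relax (SG G x) (by decide) (by decide) (T := 150) (by decide) ?_)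
        le_rfl ?_
      · intro hg _
        simp only [fl, dIx, ix, suc, hdE, BExp.Holds, WExp.eval, XExp.eval, hw₃, r6, r7, x2,
          hB₃.n, hB₃.hd e he] at hg ⊢
        obtain ⟨P, hP, hl, hv⟩ := hE₃.opt (iD.snd hs.d) hb (G.hd_lt e he) hg.1
        intro b' v' hv' he'
        obtain ⟨rfl, rfl⟩ := ix_inj (G.hd_lt e he) hv' he'
        refine ⟨hP.1.r, fun t ht => ?_⟩
        have h3 := hx.walk hP.1 ht
        have h5 := mul_le_mul_of_nonneg_left (iY.snd hs.y _ hg.2 t ht)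
          (pow_pos G.g_pos (k + 1)).le
        rw [hv]
        rw [hl] at h3
        linarith
      · rintro τ - ⟨i4, hu⟩
        refine ⟨i4, fun P r hP hl hr => ?_⟩
        have hub := hE₃ _ P hP hl
        have hr' := iY.ub _ _ hr
        simp only [fl, dIx, ix, suc, hdE, BExp.Holds, WExp.eval, XExp.eval, hw₃, r6, r7, x2,
          hB₃.n, hB₃.hd e he] at hu
        refine (hu ⟨hub.1, hr'.1⟩).mono ?_
        rw [hl]
        have h5 := mul_le_mul_of_nonneg_left hr'.2 (pow_pos G.g_pos (k + 1)).le
        linarith [hub.2]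
    · simp only [WExp.size]; omega
    · rintro τ₃ a₃ ⟨i₃, hQ₃⟩
      refine Tri.mono (nextPow_spec τ₃) le_rfl ?_
      rintro τ - rfl
      have g0 : τ₃.xreg 0 = G.g := (hB'.agree a₃ (by decide)).g
      refine ⟨(hi.trans i₃).trans (.refl' rfl rfl rfl), ?_, fun P v r hP hl hr => ?_⟩
      · simp [a₃.xreg 2 (by decide), h2, g0, pow_succ]
      · rcases Nat.le_succ_iff.1 hl with hl | hl
        · exact i₃.ub _ _ (hQ P v r hP hl hr)
        · obtain ⟨Q, e, rfl⟩ : ∃ Q e, P = Q ++ [e] := by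
            have hne : P ≠ [] := by rintro rfl; simp at hl
            exact ⟨P.dropLast, P.getLast hne, (List.dropLast_append_getLast hne).symm⟩
          obtain ⟨hQw, he, rfl⟩ := Gr.W_snoc.1 hP
          exact hQ₃ e he _ r hP hl hr
  · simp only [WExp.size]
    have : L * (G.m * 160 + 20 + (1 + 7)) ≤ L * (G.m * 160 + 30) := Nat.mul_le_mul_left _ (by omega)
    exact Nat.add_le_add this (by norm_num)

/-- A bound through `v` is valid for all end vertices reachable from `v`, hence also when it is
recorded at any vertex reachable from `v`. The order of the instructions matters, as `Conn`
expresses. -/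
theorem copyP_spec {G : Gr} {x : ℕ → ℕ → ℝ} {σ : Store} {b : ℕ} (hB : Base G σ)
    (h6 : σ.wreg 6 = b) (hI : InstrSound G σ) :
    Tri copyP σ (σ.wreg 27 * 160 + 10) fun τ => Imp 7 4 23 (SG G x) σ τ ∧
      ∀ u v r, Carry σ u v → σ.ub 7 4 (b * G.n + u) r → τ.ub 7 4 (b * G.n + v) r := by
  refine Tri.mono (Tri.for_ (N := σ.wreg 27) 150 (fun k τ => Imp 7 4 23 (SG G x) σ τ ∧
      ∀ u v r, Conn (σ.warr 19) (σ.warr 20) k u v → σ.ub 7 4 (b * G.n + u) r →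
        τ.ub 7 4 (b * G.n + v) r) rfl (by decide) (by decide) ?_ ?_) ?_ (fun _ _ h => h.1)
  · have iS : Imp 7 4 23 (SG G x) σ (σ.setW 9 0) := .refl' rfl rfl rfl
    refine ⟨iS, fun u v r h hu => ?_⟩
    obtain rfl : u = v := h
    exact iS.ub _ _ hu
  · rintro k hk σ' ha hw ⟨hi, hQ⟩
    obtain ⟨hs1, hd1, hr⟩ := hI k hk
    have hB' := hB.agree ha (by decide)
    have r6 : σ'.wreg 6 = b := (ha.wreg 6 (by decide)).trans h6
    have w19 := ha.warr 19 (by decide)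
    have w20 := ha.warr 20 (by decide)
    refine Tri.mono (Tri.relax (SG G x) (by decide) (by decide) (T := 150) (by decide) ?_) le_rfl ?_
    · intro hg hS
      simp only [fl, ix, BExp.Holds, WExp.eval, XExp.eval, hw, r6, hB'.n, w19, w20] at hg ⊢
      obtain ⟨h1, h2⟩ := hS _ hg b _ hs1 rfl
      intro b' v' hv' he'
      obtain ⟨rfl, rfl⟩ := ix_inj hd1 hv' he'
      exact ⟨h1.trans hr, fun t ht => h2 t (hr.trans ht)⟩
    · rintro τ - ⟨i4, hu⟩
      have iS : Imp 7 4 23 (SG G x) τ (τ.setW 9 (k + 1)) := .refl' rfl rfl rfl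
      simp only [fl, ix, BExp.Holds, WExp.eval, XExp.eval, hw, r6, hB'.n, w19, w20] at hu
      refine ⟨hi.trans (i4.trans iS), fun u v r hc hr' => iS.ub _ _ ?_⟩
      rcases hc with hc | ⟨hc, rfl⟩
      · exact i4.ub _ _ (hQ u v r hc hr')
      · have := hQ u _ r hc hr'
        exact (hu this.1).mono this.2
  · simp only [WExp.size]; omega

theorem giveP_spec {G : Gr} {x : ℕ → ℕ → ℝ} {σ : Store} {b : ℕ} (hB : Base G σ)
    (h6 : σ.wreg 6 = b) (hs : σ.Snd 7 4 23 (SG G x)) :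
    Tri giveP σ (G.n * 160 + 10) fun τ => Imp 2 1 21 (SX G x) σ τ ∧
      ∀ t < G.n, ∀ r, σ.ub 7 4 (b * G.n + t) r → τ.ub 2 1 (b * G.n + t) r := by
  refine Tri.mono (Tri.for_each (N := G.n) 150 (Imp 2 1 21 (SX G x))
      (fun t τ => ∀ r, σ.ub 7 4 (b * G.n + t) r → τ.ub 2 1 (b * G.n + t) r) hB.n
      (by decide) (by decide) (fun σ v => .refl' rfl rfl rfl) (fun _ _ _ => Imp.trans)
      (fun e _ σ' τ h hQ r h1 => h.ub _ _ (hQ r h1)) ?_) ?_ fun _ _ h => h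
  · intro t ht σ' ha hw hi
    have hB' := hB.agree ha (by decide)
    have r6 : σ'.wreg 6 = b := (ha.wreg 6 (by decide)).trans h6
    have iG := ha.imp 7 4 23 (S := SG G x) (by decide)
    refine Tri.mono (Tri.relax (SX G x) (by decide) (by decide) (T := 150) (by decide) ?_) le_rfl ?_
    · intro hg _
      simp only [fl, ix, BExp.Holds, WExp.eval, XExp.eval, hw, r6, hB'.n] at hg ⊢
      obtain ⟨h1, h2⟩ := iG.snd hs _ hg b t ht rfl
      intro b' v' hv' he'
      obtain ⟨rfl, rfl⟩ := ix_inj ht hv' he'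
      exact ⟨h1, h2 _ (Gr.R.refl _)⟩
    · rintro τ - ⟨i4, hu⟩
      simp only [fl, ix, BExp.Holds, WExp.eval, XExp.eval, hw, r6, hB'.n] at hu
      refine ⟨i4, fun r hr => ?_⟩
      have := iG.ub _ _ hr
      exact (hu this.1).mono this.2
  · simp only [WExp.size]; omega

/-- The time for one vertex of a level with walks of length `L`. -/
def viaT (G : Gr) (L : ℕ) : ℕ := L * (G.m * 160 + 30) + ((2 * G.n + G.m) * 160 + G.n * 160) + 220

theorem viaCopyGive_spec {G : Gr} {x : ℕ → ℕ → ℝ} (hx : G.Val x) {σ : Store} {b L : ℕ}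
    (hB : Base G σ) (hb : σ.warr 8 (σ.warr 9 (σ.wreg 25) + σ.wreg 5) = b) (hbn : b < G.n)
    (h4 : σ.wreg 4 = L) (hs : Sound G x σ) (hE : ∀ j ≤ L, Exact G σ j b) (hI : InstrSound G σ)
    (h27 : σ.wreg 27 ≤ 2 * G.n + G.m)
    (hC : ∀ u < G.n, ∀ v < G.n, G.R u v → Carry σ u v) :
    Tri (.seq (loadP (.reg 25)) (.seq viaP (.seq copyP giveP))) σ (viaT G L) fun τ =>
      Tab G x σ τ ∧ ∀ P v r t, G.W b P v → P.length ≤ L → σ.ub 6 3 v r → t < G.n → G.R v t →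
        τ.ub 2 1 (b * G.n + t) (G.co P + G.g ^ P.length * r) := by
  refine Tri.seq_le (S := 8) (T := L * (G.m * 160 + 30) + 180 + ((2 * G.n + G.m) * 160 + 10 +
    (G.n * 160 + 10)))
    (Tri.lf rfl (by decide) (Q := fun τ => τ = σ.setW 6 b)
    (by simp [Prog.den, loadP, WExp.eval, hb])) (by simp only [viaT]; omega) fun τ₁ a₁ p₁ => ?_
  have t₁ : Tab G x σ τ₁ := by rw [p₁]; exact tab_setW _ _ _
  have r6 : τ₁.wreg 6 = b := by rw [p₁]; simp
  refine Tri.seq_le (viaP_spec hx (hB.agree a₁ (by decide)) r6 hbn ((a₁.wreg 4 (by decide)).trans h4)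
    (hs.tab t₁) fun j hj => (hE j hj).imp t₁.d) le_rfl ?_
  rintro τ₂ a₂ ⟨i₂, hQ₂⟩
  have t₂ : Tab G x τ₁ τ₂ := ⟨a₂.imp 4 2 5 (by decide), a₂.imp 6 3 22 (by decide),
    a₂.imp 2 1 21 (by decide), i₂⟩
  have ha := (a₁.up (Prog.seq (loadP (.reg 25)) viaP).mods (by decide)).trans (a₂.up _ (by decide))
  have r27 := ha.wreg 27 (by decide)
  have w19 := ha.warr 19 (by decide)
  have w20 := ha.warr 20 (by decide)
  have hI₂ : InstrSound G τ₂ := by unfold InstrSound at *; rwa [r27, w19, w20]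
  have hC₂ : ∀ u v, Carry τ₂ u v = Carry σ u v := fun u v => by simp only [Carry, r27, w19, w20]
  have r6₂ := (a₂.wreg 6 (by decide)).trans r6
  refine Tri.seq_le (Tri.mono (copyP_spec (x := x) (hB.agree ha (by decide)) r6₂ hI₂)
    (Nat.add_le_add_right (Nat.mul_le_mul_right 160 (r27.le.trans h27)) 10) fun _ _ h => h)
    le_rfl ?_
  rintro τ₃ a₃ ⟨i₃, hQ₃⟩
  have t₃ : Tab G x τ₂ τ₃ := ⟨a₃.imp 4 2 5 (by decide), a₃.imp 6 3 22 (by decide),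
    a₃.imp 2 1 21 (by decide), i₃⟩
  have tt := t₁.trans (t₂.trans t₃)
  refine Tri.mono (giveP_spec (x := x) ((hB.agree ha (by decide)).agree a₃ (by decide))
    ((a₃.wreg 6 (by decide)).trans r6₂) (hs.tab tt).g) le_rfl ?_
  rintro τ a₄ ⟨i₄, hQ₄⟩
  have t₄ : Tab G x τ₃ τ := ⟨a₄.imp 4 2 5 (by decide), a₄.imp 6 3 22 (by decide), i₄,
    a₄.imp 7 4 23 (by decide)⟩
  refine ⟨tt.trans t₄, fun P v r t hP hl hr ht hvt => hQ₄ t ht _ ?_⟩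
  refine hQ₃ v t _ ?_ (hQ₂ P v r hP hl (t₁.y.ub _ _ hr))
  rw [hC₂]
  exact hC v (hP.lt hbn) t ht hvt

/-- The time to use infinite walks. -/
def infDistT (G : Gr) (h : ℕ) : ℕ := (Nat.size G.n + 1) *
  (2 * G.n * h * (lg G + 1) * (G.m + 1) * 160 + G.n * (lg G + 1) * (G.n * 480 + G.m * 160 + 260)
    + 40) + 20

theorem Lay.card_le {G : Gr} {h N : ℕ} {σ : Store} (H : Lay G h N σ) {i : ℕ} (hi : i ≤ N) :
    σ.warr 9 (i + 1) - σ.warr 9 i ≤ G.n * (lg G + 1) := by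
  rcases i with _ | i
  · rw [H.off_zero, H.off_one, Nat.sub_zero]
    exact Nat.le_mul_of_pos_right _ (by omega)
  · have h1 := H.size i (by omega)
    rcases Nat.eq_zero_or_pos G.n with h0 | h0
    · rw [h0] at h1 ⊢
      simp only [Nat.mul_zero, Nat.zero_mul, Nat.le_zero, Nat.mul_eq_zero] at h1 ⊢
      rcases h1 with h1 | h1
      · exact h1
      · omega
    · have h2 := Ln_pos h0 H.two_le i
      have h3 : (σ.warr 9 (i + 2) - σ.warr 9 (i + 1)) * 2 ≤ 2 * G.n * lg G :=
        (Nat.mul_le_mul_left _ (by omega)).trans h1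
      have : G.n * (lg G + 1) * 2 = 2 * G.n * lg G + 2 * G.n := by ring
      show σ.warr 9 (i + 2) - σ.warr 9 (i + 1) ≤ _
      omega

theorem infDistP_spec {G : Gr} {x : ℕ → ℕ → ℝ} (hx : G.Val x) {σ : Store} {h N : ℕ} (hB : Base G σ)
    (hs : Sound G x σ) (H : Full G h N σ) (hI : InstrSound G σ) (h27 : σ.wreg 27 ≤ 2 * G.n + G.m)
    (hC : ∀ u < G.n, ∀ v < G.n, G.R u v → Carry σ u v) :
    Tri infDistP σ (infDistT G h) fun τ => Tab G x σ τ ∧ ∀ i < N, ∀ b, InB σ i b → ∀ P v r t,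
      G.W b P v → P.length ≤ Ln G.n h i → σ.ub 6 3 v r → t < G.n → G.R v t →
        τ.ub 2 1 (b * G.n + t) (G.co P + G.g ^ P.length * r) := by
  refine Tri.mono (Tri.for_each (N := N) (2 * G.n * h * (lg G + 1) * (G.m + 1) * 160 +
    G.n * (lg G + 1) * (G.n * 480 + G.m * 160 + 260) + 30) (Tab G x)
    (fun i τ => ∀ b, InB σ i b → ∀ P v r t,
      G.W b P v → P.length ≤ Ln G.n h i → σ.ub 6 3 v r → t < G.n → G.R v t →
        τ.ub 2 1 (b * G.n + t) (G.co P + G.g ^ P.length * r))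
    H.lay.lev (by decide) (by decide) (fun σ v => tab_setW _ _ _) (fun _ _ _ => Tab.trans)
    (fun i _ σ' τ h hQ b hb P v r t h1 h2 h3 h4 h5 =>
      h.v.ub _ _ (hQ b hb P v r t h1 h2 h3 h4 h5)) ?_) ?_ (fun _ _ h => h)
  · intro i hi σ₁ a₁ hw₁ t₁
    set c := σ.warr 9 (i + 1) - σ.warr 9 i with hc
    set L := Ln G.n h i with hL
    refine Tri.seq_le (S := 3) (T := c * (viaT G L + 20) + 20)
      (Tri.lf rfl (by decide) (Q := fun τ => τ = σ₁.setW 4 L)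
      (by simp [Prog.den, WExp.eval, hw₁, a₁.warr 10 (by decide), H.lay.len i hi.le, hL])) ?_ ?_
    · have h1 := H.lay.work hi.le
      have h2 := H.lay.card_le hi.le
      rw [← hc, ← hL] at h1
      rw [← hc] at h2
      have h3 : c * (viaT G L + 20) ≤ c * (L + 1) * (G.m + 1) * 160 +
          c * (G.n * 480 + G.m * 160 + 260) := by
        have : viaT G L + 20 ≤ (L + 1) * (G.m + 1) * 160 + (G.n * 480 + G.m * 160 + 260) := by
          simp only [viaT]; ring_nf; omega
        calc _ ≤ c * ((L + 1) * (G.m + 1) * 160 + (G.n * 480 + G.m * 160 + 260)) :=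
              Nat.mul_le_mul_left _ this
          _ = _ := by ring
      have h4 := Nat.mul_le_mul_right 160 (Nat.mul_le_mul_right (G.m + 1) h1)
      have h5 := Nat.mul_le_mul_right (G.n * 480 + G.m * 160 + 260) h2
      have h6 := h3.trans (Nat.add_le_add h4 h5)
      calc 3 + (c * (viaT G L + 20) + 20) = c * (viaT G L + 20) + 23 := by ring
        _ ≤ _ := Nat.add_le_add h6 (by norm_num)
    intro τ₂ a₂ p₂
    have t₂ : Tab G x σ₁ τ₂ := by rw [p₂]; exact tab_setW _ _ _
    have ha₂ := (a₁.up (4 * 25 :: infDistP.mods) (by decide)).trans (a₂.up _ (by decide))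
    have r25 := (a₂.wreg 25 (by decide)).trans hw₁
    have r4 : τ₂.wreg 4 = L := by rw [p₂]; simp
    refine Tri.mono (Tri.for_each (N := c) (viaT G L) (Tab G x)
      (fun k τ => ∀ P v r t, G.W (σ.warr 8 (σ.warr 9 i + k)) P v → P.length ≤ L →
        σ.ub 6 3 v r → t < G.n → G.R v t →
        τ.ub 2 1 (σ.warr 8 (σ.warr 9 i + k) * G.n + t) (G.co P + G.g ^ P.length * r))
      (by simp [lenE, suc, WExp.eval, r25, ha₂.warr 9 (by decide), hc])
      (by decide) (by decide) (fun σ v => tab_setW _ _ _) (fun _ _ _ => Tab.trans)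
      (fun k _ σ' τ h hQ P v r t h1 h2 h3 h4 h5 => h.v.ub _ _ (hQ P v r t h1 h2 h3 h4 h5)) ?_) ?_ ?_
    · intro k hk σ' ha hw t'
      have ha' := ha₂.trans (ha.up _ (by decide))
      have tt := t₁.trans (t₂.trans t')
      have hin : InB σ i (σ.warr 8 (σ.warr 9 i + k)) := ⟨_, by omega, by omega, rfl⟩
      have r27 := ha'.wreg 27 (by decide)
      have w19 := ha'.warr 19 (by decide)
      have w20 := ha'.warr 20 (by decide)
      refine Tri.mono (viaCopyGive_spec hx (b := σ.warr 8 (σ.warr 9 i + k)) (L := L)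
        (hB.agree ha' (by decide)) ?_ (H.lay.inB_lt hi.le hin)
        ((ha.wreg 4 (by decide)).trans r4) (hs.tab tt) ((H.known i hi _ hin).tab tt).exact ?_ ?_ ?_)
        le_rfl ?_
      · rw [ha'.warr 8 (by decide), ha'.warr 9 (by decide), ha.wreg 25 (by decide), r25, hw]
      · unfold InstrSound at *; rwa [r27, w19, w20]
      · rwa [r27]
      · unfold Carry at *; rwa [r27, w19, w20]
      · rintro τ - ⟨tτ, hQ⟩
        exact ⟨tτ, fun P v r t h1 h2 h3 h4 h5 => hQ P v r t h1 h2 (tt.y.ub _ _ h3) h4 h5⟩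
    · simp only [WExp.size, lenE, suc]
      have : c * (viaT G L + (1 + 1 + 1 + 1 + (1 + 1) + 1 + 7)) ≤ c * (viaT G L + 20) :=
        Nat.mul_le_mul_left _ (by omega)
      exact Nat.add_le_add this (by norm_num)
    · rintro τ - ⟨tτ, hQ⟩
      refine ⟨t₂.trans tτ, ?_⟩
      rintro b ⟨k, h1, h2, rfl⟩ P v r t
      have := hQ (k - σ.warr 9 i) (by omega) P v r t
      rwa [show σ.warr 9 i + (k - σ.warr 9 i) = k by omega] at this
  · simp only [WExp.size, infDistT]
    refine Nat.add_le_add (Nat.mul_le_mul H.lev_le ?_) (by norm_num)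
    omega

end Dapsp

/-! ### Assembly of the algorithm -/

namespace Dapsp

open RealRAM

/-- The time to find infinite walks and their upper bounds for distances. -/
def midT (G : Gr) (h : ℕ) : ℕ :=
  G.n * (G.m * 160 + 20) + 10 + (G.n * (G.n * 60 + 40) + 10 +
    (G.n * (G.n * 80 + G.m * 40 + 50) + 20 + infDistT G h))

/-- Three pieces are composed: a short walk `P` from a landmark, a walk `A` inside a strong
component, and the infinite walk already evaluated at the end of `A`. These are the pieces that
`Gr.Hier.landmark` and `Gr.Hier.closed` provide. -/
theorem midP_spec {G : Gr} {x : ℕ → ℕ → ℝ} (hx : G.Val x) {σ : Store} {h N : ℕ} (hB : Base G σ)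
    (hs : Sound G x σ) (H : Full G h N σ) (hf : Flags G σ) :
    Tri midP σ (midT G h) fun τ => Tab G x σ τ ∧ ∀ i < N, ∀ b, InB σ i b → ∀ P u A w r t,
      G.W b P u → P.length ≤ Ln G.n h i → G.W u A w → A.length ≤ G.n → G.R w u → σ.ub 6 3 w r →
      t < G.n → G.R u t →
      τ.ub 2 1 (b * G.n + t) (G.co P + G.g ^ P.length * (G.co A + G.g ^ A.length * r)) := by
  refine Tri.seq_le (infP_spec hx hB hf) le_rfl ?_
  rintro τ₁ a₁ ⟨i₁, hQ₁⟩
  have t₁ : Tab G x σ τ₁ := ⟨a₁.imp 4 2 5 (by decide), i₁, a₁.imp 2 1 21 (by decide),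
    a₁.imp 7 4 23 (by decide)⟩
  have hf₁ : Flags G τ₁ := by unfold Flags at *; rwa [a₁.warr 2 (by decide)]
  have hB₁ := hB.agree a₁ (by decide)
  refine Tri.seq_le (cntP_spec hB₁ hf₁) le_rfl ?_
  intro τ₂ a₂ hc₂
  have hB₂ := hB₁.agree a₂ (by decide)
  have t₂ : Tab G x τ₁ τ₂ := tab_of_agree a₂ (by decide) (by decide) (by decide) (by decide)
  refine Tri.seq_le (instrP_spec hB₂ hc₂) le_rfl ?_
  rintro τ₃ a₃ ⟨hI, h27, hC⟩
  have t₃ : Tab G x τ₂ τ₃ := tab_of_agree a₃ (by decide) (by decide) (by decide) (by decide)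
  have ha := (a₁.up midP.mods (by decide)).trans ((a₂.up _ (by decide)).trans (a₃.up _ (by decide)))
  have tt := t₁.trans (t₂.trans t₃)
  obtain ⟨H₃, I₃⟩ := H.agree ha tt (by decide)
  refine Tri.mono (infDistP_spec hx (hB₂.agree a₃ (by decide)) (hs.tab tt) H₃ hI h27 hC) le_rfl ?_
  rintro τ - ⟨t₄, hQ⟩
  rw [I₃] at hQ
  refine ⟨tt.trans t₄, fun i hi b hb P u A w r t hP hl hA hAl hwu hr ht hut => ?_⟩
  have hbn := H.lay.inB_lt hi.le hb
  exact hQ i hi b hb P u _ t hP hl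
    ((t₂.trans t₃).y.ub _ _ (hQ₁ u A w r hA hAl (hP.lt hbn) hwu hr)) ht hut

/-- The distance table is exact. -/
def Solved (G : Gr) (x : ℕ → ℕ → ℝ) (σ : Store) : Prop :=
  ∀ s < G.n, ∀ t < G.n, (σ.warr 2 (s * G.n + t) ≠ 0 ↔ G.R s t) ∧
    (G.R s t → σ.xarr 1 (s * G.n + t) = x t s)

/-- The edge `e` attains the optimality equation for `t`. -/
def TightEdge (G : Gr) (x : ℕ → ℕ → ℝ) (t e : ℕ) : Prop :=
  e < G.m ∧ G.R (G.hd e) t ∧ x t (G.tl e) = G.c e + G.g * x t (G.hd e)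

/-- The policy table holds only tight edges. -/
def PolSound (G : Gr) (x : ℕ → ℕ → ℝ) (σ : Store) : Prop :=
  ∀ v t, t < G.n → σ.warr 3 (v * G.n + t) ≠ 0 →
    ∃ e, σ.warr 3 (v * G.n + t) = e + 1 ∧ TightEdge G x t e ∧ G.tl e = v

theorem polP_spec {G : Gr} {x : ℕ → ℕ → ℝ} (hx : G.Val x) {σ : Store} (hB : Base G σ)
    (hS : Solved G x σ) (h3 : PolSound G x σ) :
    Tri polP σ (G.n * (G.m * 80 + 20) + 10) fun τ => PolSound G x τ ∧
      ∀ t < G.n, ∀ e, TightEdge G x t e → τ.warr 3 (G.tl e * G.n + t) ≠ 0 := by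
  have hr : ∀ (σ : Store) (r v : ℕ), (PolSound G x σ → PolSound G x (σ.setW r v)) ∧
      ∀ i, σ.warr 3 i ≠ 0 → (σ.setW r v).warr 3 i ≠ 0 := fun σ r v => ⟨fun h => h, fun i h => h⟩
  refine Tri.mono (Tri.for_each (N := G.n) (G.m * 80 + 10)
    (fun σ τ => (PolSound G x σ → PolSound G x τ) ∧ ∀ i, σ.warr 3 i ≠ 0 → τ.warr 3 i ≠ 0)
    (fun t τ => ∀ e < G.m, TightEdge G x t e → τ.warr 3 (G.tl e * G.n + t) ≠ 0) hB.n
    (by decide) (by decide) (fun σ v => hr σ _ v)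
    (fun _ _ _ h h' => ⟨fun a => h'.1 (h.1 a), fun i a => h'.2 i (h.2 i a)⟩)
    (fun t _ σ' τ h hQ e he h1 => h.2 _ (hQ e he h1)) ?_) ?_ ?_
  · intro t ht σ₁ a₁ hw₁ _
    refine Tri.mono (Tri.for_each (N := G.m) 70
      (fun σ τ => (PolSound G x σ → PolSound G x τ) ∧ ∀ i, σ.warr 3 i ≠ 0 → τ.warr 3 i ≠ 0)
      (fun e τ => TightEdge G x t e → τ.warr 3 (G.tl e * G.n + t) ≠ 0)
      (hB.agree a₁ (by decide)).m
      (by decide) (by decide) (fun σ v => hr σ _ v)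
      (fun _ _ _ h h' => ⟨fun a => h'.1 (h.1 a), fun i a => h'.2 i (h.2 i a)⟩)
      (fun t _ σ' τ h hQ h1 => h.2 _ (hQ h1)) ?_) ?_ (fun _ _ h => h)
    · intro e he σ₂ a₂ hw₂ _
      have ha := (a₁.up (4 * 21 :: polP.mods) (by decide)).trans (a₂.up _ (by decide))
      have hB₂ := hB.agree ha (by decide)
      have r21 := (a₂.wreg 21 (by decide)).trans hw₁
      have w2 := ha.warr 2 (by decide)
      have x1 := ha.xarr 1 (by decide)
      obtain ⟨f1, v1⟩ := hS (G.tl e) (G.tl_lt e he) t ht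
      obtain ⟨f2, v2⟩ := hS (G.hd e) (G.hd_lt e he) t ht
      have hiff : ((¬ σ.warr 2 (G.tl e * G.n + t) = 0 ∧ ¬ σ.warr 2 (G.hd e * G.n + t) = 0) ∧
          ¬ σ.xarr 1 (G.tl e * G.n + t) < G.c e + G.g * σ.xarr 1 (G.hd e * G.n + t)) ↔
          TightEdge G x t e := by
        constructor
        · rintro ⟨⟨h1, h2⟩, h4⟩
          have hr2 := f2.1 h2
          rw [v1 (f1.1 h1), v2 hr2] at h4
          -- One inequality always holds, so the comparison of exact distances decides equality.
          exact ⟨he, hr2, le_antisymm (hx.edge t e he hr2) (not_lt.1 h4)⟩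
        · rintro ⟨-, hr2, h4⟩
          have hr1 := (Gr.R.edge he).trans hr2
          rw [v1 hr1, v2 hr2, h4]
          exact ⟨⟨f1.2 hr1, f2.2 hr2⟩, lt_irrefl _⟩
      refine Tri.lf rfl (by decide) ?_
      rw [Prog.den]
      have htest : BExp.Holds σ₂ (((fl 2 (ix tlE (.reg 21))).and (fl 2 (ix hdE (.reg 21)))).and
          (BExp.xlt (.cell 1 (ix tlE (.reg 21))) (.add (.cell 0 (.reg 8)) (.mul (.reg 0)
            (.cell 1 (ix hdE (.reg 21)))))).not) ↔ TightEdge G x t e := by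
        rw [← hiff]
        simp only [fl, ix, tlE, hdE, BExp.Holds, WExp.eval, XExp.eval, hw₂, r21, w2, x1,
          hB₂.n, hB₂.tl e he, hB₂.hd e he, hB₂.c e he, hB₂.g]
      by_cases hc : TightEdge G x t e
      on_goal 1 => rw [if_pos (htest.2 hc)]
      on_goal 2 => rw [if_neg (fun h => hc (htest.1 h))]
      all_goals simp only [Prog.den, ix, tlE, suc, WExp.eval, hw₂, r21, hB₂.n, hB₂.tl e he]
      · refine ⟨⟨fun hP v t' ht' hne => ?_, fun i hne => ?_⟩, fun _ => by simp⟩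
        · by_cases hi : v * G.n + t' = G.tl e * G.n + t
          · obtain ⟨rfl, rfl⟩ := ix_inj ht' ht hi
            exact ⟨e, by simp, hc, rfl⟩
          · simp only [putW_warr, if_true, Function.update_of_ne hi] at hne ⊢
            exact hP v t' ht' hne
        · by_cases hi : i = G.tl e * G.n + t
          · simp [hi]
          · simpa [Function.update_of_ne hi] using hne
      · exact ⟨⟨fun h => h, fun i h => h⟩, fun h => absurd h hc⟩
    · simp only [WExp.size]; omega
  · simp only [WExp.size]
    have : G.n * (G.m * 80 + 10 + (1 + 7)) ≤ G.n * (G.m * 80 + 20) := Nat.mul_le_mul_left _ (by omega)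
    exact Nat.add_le_add this (by norm_num)
  · rintro τ - ⟨h1, h2⟩
    exact ⟨h1.1 h3, fun t ht e he => h2 t ht e he.1 he⟩

/-- The total time. -/
def mainT (G : Gr) (h : ℕ) : ℕ :=
  G.n * 60 + 120 + ((Nat.size G.n + 1) * (levelT G h + 10) + 10 + (downT G h + (midT G h +
    (downT G h + (G.n * (G.m * 80 + 20) + 10)))))

/-- The branching parameter is the least one with `n ^ 2 ≤ h ^ 4 * (m + 1)`. -/
def IsParam (G : Gr) (h : ℕ) : Prop :=
  2 ≤ h ∧ G.n * G.n ≤ h * h * (h * h) * (G.m + 1) ∧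
    (h = 2 ∨ (h - 1) * (h - 1) * ((h - 1) * (h - 1)) * (G.m + 1) < G.n * G.n)

theorem mainP_spec {G : Gr} {x : ℕ → ℕ → ℝ} (hx : G.Val x) {σ : Store} (hB : Base G σ)
    (h3 : σ.wreg 3 = 0) (hz : ∀ a i, 2 ≤ a → σ.warr a i = 0) :
    ∃ h, IsParam G h ∧ Tri mainP σ (mainT G h) fun τ => Solved G x τ ∧ PolSound G x τ ∧
      ∀ t < G.n, ∀ e, TightEdge G x t e → τ.warr 3 (G.tl e * G.n + t) ≠ 0 := by
  have hs : Sound G x σ := ⟨fun i h => absurd (hz 4 i (by omega)) h,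
    fun i h => absurd (hz 6 i (by omega)) h, fun i h => absurd (hz 2 i (by omega)) h,
    fun i h => absurd (hz 7 i (by omega)) h⟩
  obtain ⟨τ₁, t₁, run₁, le₁, h, H₁, hp1, hp2⟩ := initP_spec hB h3 (hz 9 0 (by omega))
  refine ⟨h, ⟨H₁.two_le, hp1, hp2⟩, ?_⟩
  have a₁ := run₁.agree
  have hB₁ := hB.agree a₁ (by decide)
  have s₁ : Tab G x σ τ₁ := tab_of_agree a₁ (by decide) (by decide) (by decide) (by decide)
  refine Tri.seq_le (P := fun τ => τ = τ₁) ⟨τ₁, t₁, run₁, le₁, rfl⟩ le_rfl ?_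
  rintro _ - rfl
  refine Tri.seq_le (upP_spec hx hB₁ (hs.tab s₁) H₁) le_rfl ?_
  rintro τ₂ a₂ ⟨s₂, N, H₂⟩
  have b₂ := (a₁.up mainP.mods (by decide)).trans (a₂.up _ (by decide))
  have hB₂ := hB.agree b₂ (by decide)
  have hs₂ := hs.tab (s₁.trans s₂)
  have hH := H₂.hier
  -- The first descent: any finite bound is acceptable, so the flags become the reachability
  -- relation. The values found are sound and are kept.
  refine Tri.seq_le (downP_spec hx hB₂ hs₂ H₂ (fun _ _ => Set.univ) ?_) le_rfl ?_
  · intro i hi b hb t ht hr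
    obtain ⟨P, u, hl, hP, hur, hu⟩ := hH.reach hi ⟨hi.le, hb⟩ hr
    rcases hu with rfl | hu
    · exact Or.inl ⟨_, trivial, (H₂.known i hi b hb).direct P u hP hl⟩
    · exact Or.inr ⟨P, u, hl, hP, hu.2, hur, fun _ _ => trivial⟩
  rintro τ₃ a₃ ⟨s₃, hg₃⟩
  have b₃ := b₂.trans (a₃.up _ (by decide))
  have hs₃ := hs₂.tab s₃
  have hf : ∀ τ, Tab G x τ₃ τ → Flags G τ := by
    intro τ hτ s hs t ht
    constructor
    · intro h
      exact ((hs₃.tab hτ).v _ h s t ht rfl).1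
    · intro h
      obtain ⟨r, -, hr⟩ := hg₃ s hs t ht h
      exact (hτ.v.ub _ _ hr).1
  obtain ⟨H₃, I₃⟩ := H₂.agree a₃ s₃ (by decide)
  refine Tri.seq_le (midP_spec hx (hB.agree b₃ (by decide)) hs₃ H₃
    (hf _ ⟨.refl _, .refl _, .refl _, .refl _⟩)) le_rfl ?_
  rintro τ₄ a₄ ⟨s₄, hg₄⟩
  have b₄ := b₃.trans (a₄.up _ (by decide))
  obtain ⟨H₄, I₄⟩ := H₃.agree a₄ s₄ (by decide)
  -- The second descent. At each landmark, `Hier.landmark` leaves three cases: a direct walk to `t`,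
  -- a vertex of the next level, or a closed tight walk whose bound the infinite walks have already
  -- supplied.
  refine Tri.seq_le (downP_spec hx (hB.agree b₄ (by decide)) (hs₃.tab s₄) H₄
    (fun b t => Set.Iic (x t b)) ?_) le_rfl ?_
  · intro i hi b hb t ht hr
    rw [I₄, I₃] at hb ⊢
    obtain ⟨P, u, hl, hP, hu⟩ := hH.landmark hx hi ⟨hi.le, hb⟩ hr
    rcases hu with ⟨rfl, h0⟩ | hu | ⟨C, hC, hCt⟩
    · refine Or.inl ⟨G.co P, ?_, (H₄.known i hi b (by rw [I₄, I₃]; exact hb)).direct P u hP.1 hl⟩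
      have := hP.2.2
      rw [h0] at this
      simpa using this
    · refine Or.inr ⟨P, u, hl, hP.1, hu.2, hP.2.1, fun r hr => ?_⟩
      have h1 := mul_le_mul_of_nonneg_left (Set.mem_Iic.1 hr) (pow_pos G.g_pos P.length).le
      have h2 := hP.2.2
      exact Set.mem_Iic.2 (by linarith)
    · have hbn := H₂.lay.inB_lt hi.le hb
      obtain ⟨j, hj, w, A, D, hw, hAl, hA, hwu, hD, hDne, hDl⟩ :=
        hH.closed hx (hP.1.lt hbn) hC hCt
      have hy := (H₃.known j hj w (by rw [I₃]; exact hw.2)).closed D hD.1 hDne hDl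
      refine Or.inl ⟨_, ?_, hg₄ i hi b (by rw [I₃]; exact hb) P u A w _ t hP.1 hl hA.1 hAl hwu hy ht
        hP.2.1⟩
      have hlt : G.g ^ D.length < 1 :=
        pow_lt_one₀ G.g_pos.le G.g_lt (List.length_pos_iff.2 hDne).ne'
      -- Tightness of the closed walk is the inequality opposite to the one that makes this value
      -- sound.
      have h1 : G.co D / (1 - G.g ^ D.length) ≤ x t w := by
        rw [div_le_iff₀ (by linarith)]
        have := hD.2.2
        linarith
      have h2 := mul_le_mul_of_nonneg_left h1 (pow_pos G.g_pos A.length).le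
      have h3 : G.co A + G.g ^ A.length * (G.co D / (1 - G.g ^ D.length)) ≤ x t u := by
        linarith [hA.2.2]
      have h4 := mul_le_mul_of_nonneg_left h3 (pow_pos G.g_pos P.length).le
      exact Set.mem_Iic.2 (by linarith [hP.2.2])
  rintro τ₅ a₅ ⟨s₅, hg₅⟩
  have b₅ := b₄.trans (a₅.up _ (by decide))
  have hs₅ := (hs₃.tab s₄).tab s₅
  have hsol : Solved G x τ₅ := by
    intro s hs t ht
    refine ⟨hf _ (s₄.trans s₅) s hs t ht, fun hr => ?_⟩
    obtain ⟨r, h1, h2⟩ := hg₅ s hs t ht hr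
    exact le_antisymm (h2.2.trans h1) (hs₅.v _ h2.1 s t ht rfl).2
  refine Tri.mono (polP_spec hx (hB.agree b₅ (by decide)) hsol ?_) le_rfl ?_
  · intro v t ht hne
    have bb := (a₁.up (Prog.seq initP (.seq upP (.seq downP (.seq midP downP)))).mods
      (by decide)).trans ((a₂.up _ (by decide)).trans ((a₃.up _ (by decide)).trans
      ((a₄.up _ (by decide)).trans (a₅.up _ (by decide)))))
    rw [bb.warr 3 (by decide)] at hne
    exact absurd (hz 3 _ (by omega)) hne
  · rintro τ a₆ ⟨h1, h2⟩
    refine ⟨?_, h1, h2⟩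
    unfold Solved at *
    rwa [a₆.warr 2 (by decide), a₆.xarr 1 (by decide)]

end Dapsp

/-! ## The discounted distances solve the optimality equations -/

namespace Gr

variable {G : Gr}

/-- A bound for the absolute costs of all walks. -/
noncomputable def coBound (G : Gr) : ℝ := (∑ e ∈ Finset.range G.m, |G.c e|) / (1 - G.g)

theorem W.abs_co_le {P : List ℕ} : ∀ {u v : ℕ}, G.W u P v → |G.co P| ≤ G.coBound := by
  have h1 : 0 < 1 - G.g := sub_pos.2 G.g_lt
  have h0 : 0 ≤ ∑ e ∈ Finset.range G.m, |G.c e| := Finset.sum_nonneg fun _ _ => abs_nonneg _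
  induction P with
  | nil => intro u v _; rw [co, abs_zero]; exact div_nonneg h0 h1.le
  | cons e P ih =>
    intro u v h
    have he : |G.c e| ≤ ∑ e ∈ Finset.range G.m, |G.c e| :=
      Finset.single_le_sum (f := fun e => |G.c e|) (fun _ _ => abs_nonneg _)
        (Finset.mem_range.2 h.1)
    have hA : G.coBound * (1 - G.g) = ∑ e ∈ Finset.range G.m, |G.c e| :=
      div_mul_cancel₀ _ h1.ne'
    have h2 := mul_le_mul_of_nonneg_left (ih h.2.2) G.g_pos.le
    calc |G.c e + G.g * G.co P| ≤ |G.c e| + |G.g * G.co P| := abs_add_le _ _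
      _ = |G.c e| + G.g * |G.co P| := by rw [abs_mul, abs_of_pos G.g_pos]
      _ ≤ G.coBound := by linarith

/-- The discounted distance from `v` to `t`. -/
noncomputable def dst (G : Gr) (t v : ℕ) : ℝ := sInf {r | ∃ P, G.W v P t ∧ r = G.co P}

theorem dst_le {t v : ℕ} {P : List ℕ} (h : G.W v P t) : G.dst t v ≤ G.co P := by
  refine csInf_le ⟨-G.coBound, ?_⟩ ⟨P, h, rfl⟩
  rintro _ ⟨Q, hQ, rfl⟩
  exact (abs_le.1 hQ.abs_co_le).1

theorem le_dst {t v : ℕ} {r : ℝ} (hr : G.R v t) (h : ∀ P, G.W v P t → r ≤ G.co P) :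
    r ≤ G.dst t v := by
  obtain ⟨P, hP⟩ := hr
  refine le_csInf ⟨_, P, hP, rfl⟩ ?_
  rintro _ ⟨Q, hQ, rfl⟩
  exact h Q hQ

theorem R.abs_dst_le {t v : ℕ} (h : G.R v t) : |G.dst t v| ≤ G.coBound := by
  refine abs_le.2 ⟨le_dst h fun P hP => (abs_le.1 hP.abs_co_le).1, ?_⟩
  obtain ⟨P, hP⟩ := h
  exact (dst_le hP).trans (abs_le.1 hP.abs_co_le).2

/-- Prepending an edge acts on costs by an increasing affine map, which respects infima; hence the
division by the positive `G.g`. -/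
theorem dst_edge {t e : ℕ} (he : e < G.m) (hr : G.R (G.hd e) t) :
    G.dst t (G.tl e) ≤ G.c e + G.g * G.dst t (G.hd e) := by
  have : (G.dst t (G.tl e) - G.c e) / G.g ≤ G.dst t (G.hd e) := le_dst hr fun P hP => by
    have := dst_le (show G.W (G.tl e) (e :: P) t from ⟨he, rfl, hP⟩)
    rw [div_le_iff₀ G.g_pos]
    simp only [co] at this
    linarith
  rw [div_le_iff₀ G.g_pos] at this
  linarith

/-- The infimum over walks need not be attained, but the optimality equation is. If all its finitely
many alternatives were larger than the distance, some `b` above the distance would still be below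
all of them; every walk starts with one of the alternatives and so costs at least `b`, a
contradiction. -/
theorem val_dst (G : Gr) : G.Val G.dst where
  self_le t := dst_le (P := []) rfl
  edge t e he hr := dst_edge he hr
  tight t v hv := by
    by_contra! hcon
    obtain ⟨h0, h1⟩ := hcon
    have e0 : ∀ᶠ b in nhdsWithin (G.dst t v) (Set.Ioi (G.dst t v)), v = t → b ≤ 0 := by
      by_cases hvt : v = t
      · have : G.dst t v < 0 := by
          rw [hvt]
          exact lt_of_le_of_ne (dst_le (P := []) rfl) (h0 hvt)
        filter_upwards [Ioc_mem_nhdsGT this] with b hb _ using hb.2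
      · exact Filter.Eventually.of_forall fun b h => absurd h hvt
    have e1 : ∀ᶠ b in nhdsWithin (G.dst t v) (Set.Ioi (G.dst t v)), ∀ e ∈ Finset.range G.m,
        G.tl e = v → G.R (G.hd e) t → b ≤ G.c e + G.g * G.dst t (G.hd e) := by
      rw [Filter.eventually_all_finset]
      intro e he
      have he := Finset.mem_range.1 he
      by_cases hc : G.tl e = v ∧ G.R (G.hd e) t
      · have : G.dst t v < G.c e + G.g * G.dst t (G.hd e) :=
          lt_of_le_of_ne (hc.1 ▸ dst_edge he hc.2) (h1 e he hc.1 hc.2)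
        filter_upwards [Ioc_mem_nhdsGT this] with b hb _ _ using hb.2
      · exact Filter.Eventually.of_forall fun b h h' => absurd ⟨h, h'⟩ hc
    obtain ⟨b, ⟨hb0, hb1⟩, hb⟩ := ((e0.and e1).and self_mem_nhdsWithin).exists
    refine absurd (le_dst hv (r := b) fun P hP => ?_) (not_le.2 hb)
    cases P with
    | nil => exact hb0 hP
    | cons e P =>
      have h2 := hb1 e (Finset.mem_range.2 hP.1) hP.2.1 ⟨P, hP.2.2⟩
      have h3 := mul_le_mul_of_nonneg_left (dst_le hP.2.2) G.g_pos.le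
      simp only [co]
      linarith

end Gr

namespace DiscountedGraph

variable {n m : ℕ} (G : DiscountedGraph n m)

/-- The same graph on natural numbers. -/
noncomputable def toGr : Gr where
  n := n
  m := m
  tl e := if h : e < m then (G.tail ⟨e, h⟩ : ℕ) else 0
  hd e := if h : e < m then (G.head ⟨e, h⟩ : ℕ) else 0
  c e := if h : e < m then G.cost ⟨e, h⟩ else 0
  g := G.γ
  tl_lt e h := by simp [h]
  hd_lt e h := by simp [h]
  g_pos := G.γ_pos
  g_lt := G.γ_lt_one

variable {G}

theorem toGr_tl (e : Fin m) : G.toGr.tl e = G.tail e := by simp [toGr]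

theorem toGr_hd (e : Fin m) : G.toGr.hd e = G.head e := by simp [toGr]

theorem toGr_c (e : Fin m) : G.toGr.c e = G.cost e := by simp [toGr]

theorem toGr_W {P : List (Fin m)} {t : Fin n} :
    ∀ {s : Fin n}, G.toGr.W s (P.map Fin.val) t ↔ G.IsWalk s t P := by
  induction P with
  | nil => intro s; exact Fin.val_inj
  | cons e P ih =>
    intro s
    simp only [List.map_cons, Gr.W, IsWalk, toGr_tl, toGr_hd, ih, Fin.val_inj]
    exact and_iff_right e.2

theorem toGr_co (P : List (Fin m)) : G.toGr.co (P.map Fin.val) = G.walkCost P := by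
  induction P with
  | nil => rfl
  | cons e P ih => simp only [List.map_cons, Gr.co, walkCost, toGr_c, ih]; rfl

theorem exists_map_val {P : List ℕ} : ∀ {s t : ℕ}, G.toGr.W s P t →
    ∃ Q : List (Fin m), P = Q.map Fin.val := by
  induction P with
  | nil => exact fun _ => ⟨[], rfl⟩
  | cons e P ih =>
    intro s t h
    obtain ⟨Q, rfl⟩ := ih h.2.2
    exact ⟨⟨e, h.1⟩ :: Q, rfl⟩

theorem toGr_R {s t : Fin n} : G.toGr.R s t ↔ G.Reaches s t := by
  constructor
  · rintro ⟨P, hP⟩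
    obtain ⟨Q, rfl⟩ := exists_map_val hP
    exact ⟨Q, toGr_W.1 hP⟩
  · rintro ⟨Q, hQ⟩
    exact ⟨_, toGr_W.2 hQ⟩

theorem le_dist {s t : Fin n} {r : EReal} (h : ∀ P, G.IsWalk s t P → r ≤ G.walkCost P) :
    r ≤ G.dist s t :=
  le_iInf fun _ => le_iInf fun P => le_iInf fun hP => h P hP.1

theorem dist_le {s t : Fin n} {P : List (Fin m)} (h : G.IsWalk s t P) :
    G.dist s t ≤ G.walkCost P :=
  (iInf_le _ P.length).trans ((iInf_le _ P).trans (iInf_le _ ⟨h, rfl⟩))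

theorem dist_eq_dst {s t : Fin n} (h : G.Reaches s t) : G.dist s t = (G.toGr.dst t s : EReal) := by
  refine le_antisymm (not_lt.1 fun hlt => ?_) (le_dist fun P hP => ?_)
  · obtain ⟨r, h1, h2⟩ := EReal.lt_iff_exists_real_btwn.1 hlt
    refine absurd (Gr.le_dst (toGr_R.2 h) fun P hP => ?_) (not_le.2 (EReal.coe_lt_coe_iff.1 h1))
    obtain ⟨Q, rfl⟩ := exists_map_val hP
    rw [toGr_co]
    exact EReal.coe_le_coe_iff.1 (h2.le.trans (dist_le (toGr_W.1 hP)))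
  · rw [← toGr_co]
    exact EReal.coe_le_coe_iff.2 (Gr.dst_le (toGr_W.2 hP))

theorem dist_eq_top {s t : Fin n} (h : ¬ G.Reaches s t) : G.dist s t = ⊤ :=
  top_le_iff.1 (le_dist fun P hP => absurd ⟨P, hP⟩ h)

/-- A policy that takes only tight edges, and an edge wherever the optimality equation does not
allow to stop, is optimal. -/
theorem isOptimalPolicy_of_tight {t : Fin n} {π : Fin n → Option (Fin m)}
    (hs : ∀ s e, π s = some e → G.tail e = s ∧ G.Reaches (G.head e) t ∧
      G.toGr.dst t s = G.cost e + G.γ * G.toGr.dst t (G.head e))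
    (hn : ∀ s, G.Reaches s t → π s = none → s = t ∧ G.toGr.dst t t = 0) :
    G.IsOptimalPolicy t π := by
  refine fun s hst => ⟨fun h => (hn s hst h).1, fun e he => ⟨(hs s e he).1, (hs s e he).2.1⟩,
    G.toGr.dst t s, ?_, (dist_eq_dst hst).symm⟩
  have step : ∀ v, G.Reaches v t → G.Reaches (G.policyNext π v) t ∧
      G.policyCost π v = G.toGr.dst t v - G.γ * G.toGr.dst t (G.policyNext π v) := by
    intro v hv
    unfold policyNext policyCost
    cases h : π v with
    | none =>
      obtain ⟨rfl, h0⟩ := hn v hv h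
      simp [hv, h0]
    | some e =>
      obtain ⟨-, h1, h2⟩ := hs v e h
      exact ⟨h1, by simp [h2]⟩
  have hreach : ∀ i, G.Reaches ((G.policyNext π)^[i] s) t := by
    intro i
    induction i with
    | zero => exact hst
    | succ i ih => rw [Function.iterate_succ_apply']; exact (step _ ih).1
  let y : ℕ → ℝ := fun i => G.γ ^ i * G.toGr.dst t ((G.policyNext π)^[i] s : Fin n)
  have hy : Summable y := by
    refine Summable.of_norm_bounded (g := fun i => G.γ ^ i * G.toGr.coBound)
      ((summable_geometric_of_lt_one G.γ_pos.le G.γ_lt_one).mul_right _) fun i => ?_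
    rw [Real.norm_eq_abs, abs_mul, abs_of_pos (pow_pos G.γ_pos i)]
    exact mul_le_mul_of_nonneg_left (Gr.R.abs_dst_le (toGr_R.2 (hreach i))) (pow_pos G.γ_pos i).le
  have hf : (fun i => G.γ ^ i * G.policyCost π ((G.policyNext π)^[i] s)) =
      fun i => y i - y (i + 1) := by
    funext i
    simp only [y, Function.iterate_succ_apply', (step _ (hreach i)).2, pow_succ]
    ring
  -- The series telescopes to `y 0` minus a limit that vanishes because distances are bounded. So
  -- the policy need not ever arrive at `t`.
  rw [hf, (hy.sub ((summable_nat_add_iff 1).2 hy)).hasSum_iff_tendsto_nat]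
  simp only [Finset.sum_range_sub']
  simpa [y] using hy.tendsto_atTop_zero.const_sub (y 0)

end DiscountedGraph

/-! ### From the final state to a solution for the given graph -/

namespace Dapsp

open RealRAM DiscountedGraph

variable {n m : ℕ} {G : DiscountedGraph n m}

theorem base_input (G : DiscountedGraph n m) : Base G.toGr G.input where
  n := rfl
  m := rfl
  g := rfl
  tl e he := by simp [toGr, input]
  hd e he := by simp [toGr, input]
  c e he := by simp [toGr, input]

theorem input_allLe (G : DiscountedGraph n m) : G.input.AllLe (n + m) := by
  refine ⟨fun r => ?_, fun a i => ?_⟩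
  · simp only [input]; split_ifs <;> omega
  · simp only [input]
    split_ifs with h
    · exact (G.tail ⟨i, h⟩).2.le.trans (Nat.le_add_right _ _)
    · exact (G.head ⟨i, h⟩).2.le.trans (Nat.le_add_right _ _)
    · omega
    · omega

theorem isSolution_of_solved {τ : Store} (h : Solved G.toGr G.toGr.dst τ)
    (hp : PolSound G.toGr G.toGr.dst τ) (ht : ∀ t < G.toGr.n, ∀ e,
      TightEdge G.toGr G.toGr.dst t e → τ.warr 3 (G.toGr.tl e * G.toGr.n + t) ≠ 0) :
    G.IsSolution τ := by
  refine ⟨fun s t => ?_, fun t => isOptimalPolicy_of_tight (fun s e hse => ?_) fun s hr hs => ?_⟩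
  · obtain ⟨h1, h2⟩ : (τ.warr 2 (s * n + t) ≠ 0 ↔ G.toGr.R s t) ∧
      (G.toGr.R s t → τ.xarr 1 (s * n + t) = G.toGr.dst t s) := h s s.2 t t.2
    unfold outDist
    by_cases hr : G.Reaches s t
    · have hr' := toGr_R.2 hr
      rw [if_neg (h1.2 hr'), dist_eq_dst hr]
      exact congrArg _ (h2 hr')
    · rw [if_pos (not_not.1 fun h0 => hr (toGr_R.1 (h1.1 h0))), dist_eq_top hr]
  · unfold outPolicy at hse
    split_ifs at hse with hc
    obtain ⟨e', he', htt, htl⟩ := hp s t t.2 (Nat.pos_iff_ne_zero.1 hc.1)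
    have he' : τ.warr 3 (s * n + t) = e' + 1 := he'
    have hv : (e : ℕ) = e' := by
      rw [← Option.some.inj hse]
      show τ.warr 3 (s * n + t) - 1 = e'
      omega
    rw [← hv] at htt htl
    obtain ⟨-, h1, h2⟩ := htt
    rw [htl, toGr_hd, toGr_c] at h2
    rw [toGr_tl] at htl
    rw [toGr_hd] at h1
    exact ⟨Fin.val_injective htl, toGr_R.1 h1, h2⟩
  -- No edge is reported only where no edge is tight, and there the optimality equation must be
  -- attained by stopping.
  · rcases G.toGr.val_dst.tight t s (toGr_R.2 hr) with h1 | ⟨e, he, htl, h1, h2⟩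
    · exact ⟨Fin.val_injective h1.1, h1.2⟩
    · exfalso
      have hne := ht t t.2 e ⟨he, h1, by rw [htl]; exact h2⟩
      obtain ⟨e', he', htt, -⟩ := hp _ t t.2 hne
      rw [htl] at he'
      have he' : τ.warr 3 (s * n + t) = e' + 1 := he'
      have hlt : e' < m := htt.1
      unfold outPolicy at hs
      rw [dif_pos (by omega)] at hs
      exact absurd hs (by simp)

end Dapsp

/-! ## The running time -/

namespace Dapsp

open RealRAM

theorem pairT_add_le (G : Gr) : pairT G + 80 ≤ 600 * ((Nat.size G.n + 1) * (G.n + 1)) := by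
  unfold pairT
  have h : 0 ≤ Nat.size G.n * G.n := Nat.zero_le _
  nlinarith

/-- A logarithmic factor. -/
def logT (G : Gr) : ℕ := Nat.size G.n + 1 + (lg G + 1)

/-- The main terms of the running time. -/
def mainX (G : Gr) (h : ℕ) : ℕ := G.n * h * (G.m + 1) + G.n * G.n + 1

/-- The products that occur are treated as atoms: `y` for the walk tables, `q` for the pairs of
landmarks, `X` for the other main terms. Logarithmic factors occur at most three times in a product
besides those in `pairs`. -/
theorem mainT_le (G : Gr) {h : ℕ} (hh : 1 ≤ h) :
    mainT G h ≤ 6000 * logT G ^ 3 * (mainX G h + pairs G h * (G.n + 1)) := by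
  have hp := pairT_add_le G
  unfold mainT midT downT descT infDistT levelT logT mainX
  set n := G.n
  set m := G.m
  set p := pairs G h
  generalize hy : n * h * (m + 1) = y
  have e1 : ∀ b, 2 * n * h * b * (m + 1) * 700 = 1400 * (b * y) := fun b => by rw [← hy]; ring
  have e2 : ∀ b, 2 * n * h * b * (m + 1) * 160 = 320 * (b * y) := fun b => by rw [← hy]; ring
  have e3 : n * (h * (m * 160 + 20) + 20) ≤ 160 * y + 20 * n := by
    rw [← hy]
    have : 0 ≤ n * h := Nat.zero_le _
    nlinarith
  have hnm : n * m + n ≤ y := by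
    rw [← hy]
    calc n * m + n = n * 1 * (m + 1) := by ring
      _ ≤ n * h * (m + 1) := by gcongr
  rw [e1, e2]
  generalize hq : p * (n + 1) = q
  have hpq : p * (pairT G + 80) ≤ 600 * ((Nat.size n + 1) * q) := by
    calc _ ≤ p * (600 * ((Nat.size n + 1) * (n + 1))) := Nat.mul_le_mul_left _ hp
      _ = _ := by rw [← hq]; ring
  generalize p * (pairT G + 80) = r at hpq ⊢
  generalize n * (h * (m * 160 + 20) + 20) = w at e3 ⊢
  generalize hX : y + n * n + 1 = X
  have ha : 1 ≤ Nat.size n + 1 := Nat.le_add_left _ _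
  have hb : 1 ≤ lg G + 1 := Nat.le_add_left _ _
  generalize Nat.size n + 1 = a at *
  generalize lg G + 1 = b at *
  generalize hL : a + b = L
  have hL1 : 1 ≤ L := by omega
  have haL : a ≤ L := by omega
  have hbL : b ≤ L := by omega
  have c1 : X ≤ L * X := Nat.le_mul_of_pos_left _ hL1
  have c2 : L * X ≤ L * (L * X) := Nat.le_mul_of_pos_left _ hL1
  have c3 : L * (L * X) ≤ L * (L * (L * X)) := Nat.le_mul_of_pos_left _ hL1
  have hX1 : 1 ≤ X := by omega
  have hnX : n ≤ X := by omega
  have hb1 : b * y ≤ L * X := Nat.mul_le_mul hbL (by omega)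
  have k1 : (b * (1400 * (b * y) + n * 130 + 200)) ≤ 1730 * (L * (L * X)) := by
    calc _ ≤ L * (1400 * (L * X) + (L * X) * 130 + (L * X) * 200) := by
          gcongr <;> omega
      _ = _ := by ring
  have k2 : a * (b * (1400 * (b * y) + n * 130 + 200) + 10) + 10 ≤
      1750 * (L * (L * (L * X))) := by
    calc _ ≤ L * (1730 * (L * (L * X)) + 10 * (L * (L * X))) + 10 * (L * (L * (L * X))) := by
          gcongr <;> omega
      _ = _ := by ring
  have k3 : a * (r + 80) + 20 ≤ 600 * (L * (L * q)) + 100 * (L * X) := by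
    have : r ≤ 600 * (L * q) := hpq.trans (by gcongr)
    calc _ ≤ L * (600 * (L * q) + 80 * X) + 20 * (L * X) := by gcongr <;> omega
      _ = _ := by ring
  have k4 : n * b * (n * 480 + m * 160 + 260) ≤ 900 * (L * X) := by
    calc _ = b * (n * n * 480 + n * m * 160 + n * 260) := by ring
      _ ≤ L * (X * 480 + X * 160 + X * 260) := by gcongr <;> omega
      _ = _ := by ring
  have k5 : a * (320 * (b * y) + n * b * (n * 480 + m * 160 + 260) + 40) + 20 ≤
      1280 * (L * (L * X)) := by
    calc _ ≤ L * (320 * (L * X) + 900 * (L * X) + 40 * (L * X)) + 20 * (L * (L * X)) := by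
          gcongr <;> omega
      _ = _ := by ring
  have k6 : n * (m * 160 + 20) ≤ 180 * X := by
    rw [show n * (m * 160 + 20) = 160 * (n * m) + 20 * n by ring]; omega
  have k7 : n * (n * 60 + 40) ≤ 100 * X := by
    rw [show n * (n * 60 + 40) = 60 * (n * n) + 40 * n by ring]; omega
  have k8 : n * (n * 80 + m * 40 + 50) ≤ 170 * X := by
    rw [show n * (n * 80 + m * 40 + 50) = 80 * (n * n) + 40 * (n * m) + 50 * n by ring]; omega
  have k9 : n * (m * 80 + 20) ≤ 100 * X := by
    rw [show n * (m * 80 + 20) = 80 * (n * m) + 20 * n by ring]; omega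
  have c4 : L * (L * q) ≤ L * (L * (L * q)) := by gcongr; exact Nat.le_mul_of_pos_left _ hL1
  have e : 6000 * L ^ 3 * (X + q) = 6000 * (L * (L * (L * X))) + 6000 * (L * (L * (L * q))) := by
    ring
  rw [e]
  omega

theorem param_le {G : Gr} {h : ℕ} (H : IsParam G h) : h ≤ G.n + 2 := by
  obtain ⟨h2, -, rfl | h3⟩ := H
  · omega
  · obtain ⟨k, rfl⟩ : ∃ k, h = k + 1 := ⟨h - 1, by omega⟩
    simp only [Nat.add_sub_cancel] at h3
    have hk : 1 ≤ k := by omega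
    have : k * k ≤ k * k * (k * k) * (G.m + 1) := by
      calc k * k = k * k * 1 * 1 := by ring
        _ ≤ k * k * (k * k) * (G.m + 1) := by
          gcongr
          · exact Nat.mul_pos hk hk
          · omega
    have : k < G.n := by
      by_contra hn
      push Not at hn
      have := Nat.mul_le_mul hn hn
      omega
    omega

theorem size_le_self (n : ℕ) : Nat.size n ≤ n := Nat.size_le.2 Nat.lt_two_pow_self

/-- The running time is polynomial. -/
theorem mainT_le_pow {G : Gr} {h : ℕ} (H : IsParam G h) : mainT G h ≤ (G.n + G.m + 2) ^ 55 := by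
  have hh := param_le H
  refine (mainT_le G (by linarith [H.1])).trans ?_
  obtain ⟨N, hN⟩ : ∃ N, N = G.n + G.m + 2 := ⟨_, rfl⟩
  rw [← hN]
  have h2 : 2 ≤ N := by omega
  have two : ∀ k, 2 ^ k ≤ N ^ k := fun k => Nat.pow_le_pow_left h2 k
  have up : ∀ {i j}, i ≤ j → N ^ i ≤ N ^ j := fun h => Nat.pow_le_pow_right (by omega) h
  have dbl : ∀ i j, i + 1 = j → N ^ i + N ^ i ≤ N ^ j := fun i j h => by
    rw [← h, pow_succ, ← mul_two]; exact Nat.mul_le_mul_left _ h2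
  have hn : G.n ≤ N := by omega
  have hm : G.m ≤ N := by omega
  have hl : lg G ≤ N ^ 6 := by
    refine (size_le_self _).trans ?_
    have h8 := two 3
    have : G.n * G.m ≤ N ^ 2 := by rw [pow_two]; exact Nat.mul_le_mul hn hm
    have h1 := up (show 2 ≤ 3 by omega)
    have h4 : G.n * G.m + 5 ≤ N ^ 4 := by have := dbl 3 4 rfl; omega
    calc G.n * (G.n * G.m + 5) * G.m ≤ N * N ^ 4 * N := by gcongr
      _ = N ^ 6 := by ring
  have hL : logT G ≤ N ^ 8 := by
    have h1 := size_le_self G.n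
    have h3 : N ≤ N ^ 6 := Nat.le_self_pow (by omega) _
    have h4 := dbl 6 7 rfl
    have h5 := dbl 7 8 rfl
    have h6 := two 7
    unfold logT
    omega
  have hX : mainX G h ≤ N ^ 5 := by
    have h1 : G.n * h * (G.m + 1) ≤ N ^ 3 := by
      calc G.n * h * (G.m + 1) ≤ N * N * N := by gcongr <;> omega
        _ = N ^ 3 := by ring
    have h3 : G.n * G.n ≤ N ^ 2 := by rw [pow_two]; exact Nat.mul_le_mul hn hn
    have h4 := dbl 3 4 rfl
    have h5 := dbl 4 5 rfl
    have h6 := up (show 2 ≤ 3 by omega)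
    have h7 := two 4
    unfold mainX
    omega
  have hZ : pairs G h * (G.n + 1) ≤ N ^ 17 := by
    have : pairs G h ≤ N ^ 16 := by
      refine (Nat.div_le_self _ _).trans ?_
      calc 4 * G.n ^ 2 * lg G ^ 2 ≤ N ^ 2 * N ^ 2 * (N ^ 6) ^ 2 := by gcongr; exact two 2
        _ = N ^ 16 := by ring
    calc pairs G h * (G.n + 1) ≤ N ^ 16 * N := by gcongr; omega
      _ = N ^ 17 := by ring
  have hXZ : mainX G h + pairs G h * (G.n + 1) ≤ N ^ 18 := by
    have := up (show 5 ≤ 17 by omega)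
    have := dbl 17 18 rfl
    omega
  calc 6000 * logT G ^ 3 * (mainX G h + pairs G h * (G.n + 1)) ≤ N ^ 13 * (N ^ 8) ^ 3 * N ^ 18 := by
        gcongr
        exact (by norm_num : 6000 ≤ 2 ^ 13).trans (two 13)
    _ = N ^ 55 := by ring

/-- The largest stored word, as it enters `Run.exec`: input words plus the literals of the program
for each step. -/
theorem add_mul_le_pow {N M l T : ℕ} (hN : 2 ≤ N) (hM : M ≤ N) (hl : l ≤ 2 ^ 8) (hT : T ≤ N ^ 55) :
    M + l * (T + 1) ≤ N ^ 65 := by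
  have h0 : 1 ≤ N := by omega
  have h1 : T + 1 ≤ N ^ 56 := by
    have := Nat.mul_le_mul_left (N ^ 55) hN
    have := Nat.one_le_pow 55 N h0
    rw [pow_succ]
    omega
  have h2 : l * (T + 1) ≤ N ^ 64 := by
    calc l * (T + 1) ≤ N ^ 8 * N ^ 56 := Nat.mul_le_mul (hl.trans (Nat.pow_le_pow_left hN 8)) h1
      _ = N ^ 64 := by rw [← pow_add]
  have h3 : N ≤ N ^ 64 := Nat.le_self_pow (by omega) _
  have h4 := Nat.mul_le_mul_left (N ^ 64) hN
  rw [pow_succ _ 64]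
  omega

theorem size_le_of_lt_pow {x y k : ℕ} (h : x < y ^ k) : Nat.size x ≤ Nat.size y * k := by
  rw [Nat.size_le, pow_mul]
  exact h.trans_le (Nat.pow_le_pow_left (Nat.lt_size_self y).le k)

theorem size_le_log {y : ℕ} (hy : 2 ≤ y) : (Nat.size y : ℝ) ≤ 4 * Real.log y := by
  have h0 : (0 : ℝ) < y := by exact_mod_cast (by omega : 0 < y)
  have h1 : 2 ^ (Nat.size y - 1) ≤ y :=
    Nat.lt_size.1 (Nat.sub_lt (Nat.size_pos.2 (by omega)) one_pos)
  have h2 : ((Nat.size y - 1 : ℕ) : ℝ) * Real.log 2 ≤ Real.log y := by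
    rw [← Real.log_pow]
    exact Real.log_le_log (by positivity) (by exact_mod_cast h1)
  have h3 : (Nat.size y : ℝ) ≤ ((Nat.size y - 1 : ℕ) : ℝ) + 1 := by
    exact_mod_cast (by omega : Nat.size y ≤ Nat.size y - 1 + 1)
  have h4 : Real.log 2 ≤ Real.log y := Real.log_le_log two_pos (by exact_mod_cast hy)
  have h5 : (1 / 2 : ℝ) < Real.log 2 := by have := Real.log_two_gt_d9; linarith
  have h6 : (0 : ℝ) ≤ ((Nat.size y - 1 : ℕ) : ℝ) := Nat.cast_nonneg _
  nlinarith

/-- Since `m ≤ n²`, the argument of `lg` is below `(n + 2)^6`. Altogether at most nine times the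
binary length of `n + 2` arises, and a binary length is at most four natural logarithms. -/
theorem logT_le {G : Gr} (hm : G.m ≤ G.n ^ 2) : (logT G : ℝ) ≤ 36 * Real.log ((G.n : ℝ) + 2) := by
  have h1 : lg G ≤ Nat.size (G.n + 2) * 6 := by
    refine size_le_of_lt_pow ?_
    have h3 : G.n ^ 3 + 8 ≤ (G.n + 2) ^ 3 := by
      have : 0 ≤ G.n ^ 2 + G.n := Nat.zero_le _
      nlinarith
    have h4 : G.n ^ 3 + 5 < (G.n + 2) ^ 3 := by omega
    calc G.n * (G.n * G.m + 5) * G.m ≤ G.n * (G.n * G.n ^ 2 + 5) * G.n ^ 2 := by gcongr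
      _ = G.n ^ 3 * (G.n ^ 3 + 5) := by ring
      _ < (G.n + 2) ^ 3 * (G.n + 2) ^ 3 := Nat.mul_lt_mul'' (by omega) h4
      _ = _ := by ring
  have h2 : Nat.size G.n ≤ Nat.size (G.n + 2) := Nat.size_le_size (by omega)
  have h3 : 1 ≤ Nat.size (G.n + 2) := Nat.size_pos.2 (by omega)
  have h4 : logT G ≤ 9 * Nat.size (G.n + 2) := by unfold logT; omega
  have h5 := size_le_log (y := G.n + 2) (by omega)
  have h6 : (logT G : ℝ) ≤ 9 * Nat.size (G.n + 2) := by exact_mod_cast h4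
  push_cast at h5
  linarith

/-- Fourth powers turn the exponents 3/2 and 3/4 into natural numbers, so each main term is compared
with `D` in ℕ. The five logarithms are the three of `mainT_le` and the two in the number of pairs.
-/
theorem mainT_le_real {G : Gr} {h : ℕ} (H : IsParam G h) (hn : 0 < G.n) (h1 : G.n ^ 2 ≤ G.m ^ 3)
    (h2 : G.m ≤ G.n ^ 2) : (mainT G h : ℝ) ≤ 132000 * 36 ^ 5 *
      ((G.n : ℝ) ^ (3 / 2 : ℝ) * (G.m : ℝ) ^ (3 / 4 : ℝ)) * Real.log ((G.n : ℝ) + 2) ^ 5 := by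
  have hm : 0 < G.m := by
    by_contra hm
    have : G.m = 0 := by omega
    rw [this] at h1
    have := Nat.pow_pos (n := 2) hn
    omega
  obtain ⟨hh, hp1, hp2⟩ := H
  set D : ℝ := (G.n : ℝ) ^ (3 / 2 : ℝ) * (G.m : ℝ) ^ (3 / 4 : ℝ) with hD
  have hD0 : 0 ≤ D := by positivity
  have hD4 : D ^ 4 = (G.n : ℝ) ^ 6 * (G.m : ℝ) ^ 3 := by
    rw [hD, mul_pow, ← Real.rpow_mul_natCast (Nat.cast_nonneg _),
      ← Real.rpow_mul_natCast (Nat.cast_nonneg _), ← Real.rpow_natCast _ 6,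
      ← Real.rpow_natCast _ 3]
    norm_num
  have cmp : ∀ {a C : ℕ}, a ^ 4 ≤ C ^ 4 * (G.n ^ 6 * G.m ^ 3) → (a : ℝ) ≤ C * D := by
    intro a C h
    refine le_of_pow_le_pow_left₀ (n := 4) (by norm_num) (by positivity) ?_
    rw [mul_pow, hD4]
    exact_mod_cast h
  -- This is where `n² ≤ m³` is needed: it makes the size of the output negligible.
  have hnn : ((G.n * G.n : ℕ) : ℝ) ≤ D := by
    have := cmp (a := G.n * G.n) (C := 1) (by
      calc (G.n * G.n) ^ 4 = G.n ^ 6 * G.n ^ 2 := by ring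
        _ ≤ G.n ^ 6 * G.m ^ 3 := by gcongr
        _ = _ := by ring)
    simpa using this
  -- Minimality of `h` bounds `(h - 1)⁴ (m + 1)` by `n²`. If `h = 2`, then `m ≤ n²` takes its place.
  have hY : ((G.n * h * (G.m + 1) : ℕ) : ℝ) ≤ (4 : ℕ) * D := by
    refine cmp ?_
    rcases hp2 with rfl | hp2
    · calc (G.n * 2 * (G.m + 1)) ^ 4 ≤ (G.n * 2 * (G.m + G.m)) ^ 4 := by gcongr; omega
        _ = 4 ^ 4 * (G.n ^ 4 * G.m ^ 3 * G.m) := by ring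
        _ ≤ 4 ^ 4 * (G.n ^ 4 * G.m ^ 3 * G.n ^ 2) := by gcongr
        _ = _ := by ring
    · obtain ⟨k, rfl⟩ : ∃ k, h = k + 1 := ⟨h - 1, by omega⟩
      simp only [Nat.add_sub_cancel] at hp2
      calc (G.n * (k + 1) * (G.m + 1)) ^ 4 ≤ (G.n * (k + k) * (G.m + G.m)) ^ 4 := by
            gcongr <;> omega
        _ = 4 ^ 4 * (G.n ^ 4 * G.m ^ 3 * (k * k * (k * k) * G.m)) := by ring
        _ ≤ 4 ^ 4 * (G.n ^ 4 * G.m ^ 3 * (k * k * (k * k) * (G.m + 1))) := by gcongr; omega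
        _ ≤ 4 ^ 4 * (G.n ^ 4 * G.m ^ 3 * (G.n * G.n)) := by gcongr
        _ = _ := by ring
  -- The other half of the balance, from `n² ≤ h⁴ (m + 1)`: it bounds the cost `n³ / h³` of the
  -- pairs.
  have hn3 : ((G.n ^ 3 : ℕ) : ℝ) ≤ (2 * h ^ 3 : ℕ) * D := by
    refine cmp ?_
    calc (G.n ^ 3) ^ 4 = G.n ^ 6 * (G.n * G.n) ^ 3 := by ring
      _ ≤ G.n ^ 6 * (h * h * (h * h) * (G.m + 1)) ^ 3 := by gcongr
      _ ≤ G.n ^ 6 * (h * h * (h * h) * (G.m + G.m)) ^ 3 := by gcongr; omega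
      _ = 8 * ((h ^ 3) ^ 4 * (G.n ^ 6 * G.m ^ 3)) := by ring
      _ ≤ 16 * ((h ^ 3) ^ 4 * (G.n ^ 6 * G.m ^ 3)) := by gcongr; omega
      _ = _ := by ring
  have hL1 : 1 ≤ logT G := by unfold logT; omega
  have hlL : lg G ≤ logT G := by unfold logT; omega
  have hZ : ((pairs G h * (G.n + 1) : ℕ) : ℝ) ≤ 16 * (logT G : ℝ) ^ 2 * D := by
    have e : pairs G h * (G.n + 1) * h ^ 3 ≤ 8 * logT G ^ 2 * G.n ^ 3 := by
      calc pairs G h * (G.n + 1) * h ^ 3 = pairs G h * h ^ 3 * (G.n + 1) := by ring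
        _ ≤ 4 * G.n ^ 2 * lg G ^ 2 * (G.n + G.n) :=
          Nat.mul_le_mul (Nat.div_mul_le_self _ _) (by omega)
        _ ≤ 4 * G.n ^ 2 * logT G ^ 2 * (G.n + G.n) := by gcongr
        _ = _ := by ring
    have hpos : (0 : ℝ) < (h : ℝ) ^ 3 := by
      have : (0 : ℝ) < h := by exact_mod_cast (by omega : 0 < h)
      positivity
    refine le_of_mul_le_mul_right ?_ hpos
    have e' : ((pairs G h * (G.n + 1) : ℕ) : ℝ) * (h : ℝ) ^ 3 ≤
        8 * (logT G : ℝ) ^ 2 * ((G.n ^ 3 : ℕ) : ℝ) := by exact_mod_cast e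
    refine e'.trans ((mul_le_mul_of_nonneg_left hn3 (by positivity)).trans (le_of_eq ?_))
    push_cast
    ring
  have hone : (1 : ℝ) ≤ D := by
    refine le_trans ?_ hnn
    exact_mod_cast Nat.mul_pos hn hn
  have hL1' : (1 : ℝ) ≤ (logT G : ℝ) ^ 2 := one_le_pow₀ (by exact_mod_cast hL1)
  have hX : (mainX G h : ℝ) ≤ 6 * D := by
    have : (mainX G h : ℝ) = ((G.n * h * (G.m + 1) : ℕ) : ℝ) + ((G.n * G.n : ℕ) : ℝ) + 1 := by
      unfold mainX; push_cast; ring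
    rw [this]
    push_cast at hY hnn ⊢
    linarith
  have hXZ : (mainX G h : ℝ) + ((pairs G h * (G.n + 1) : ℕ) : ℝ) ≤ 22 * (logT G : ℝ) ^ 2 * D := by
    nlinarith
  have hmain : (mainT G h : ℝ) ≤ 6000 * (logT G : ℝ) ^ 3 *
      ((mainX G h : ℝ) + ((pairs G h * (G.n + 1) : ℕ) : ℝ)) := by
    exact_mod_cast mainT_le G (by omega)
  calc (mainT G h : ℝ) ≤ 6000 * (logT G : ℝ) ^ 3 * (22 * (logT G : ℝ) ^ 2 * D) :=
        hmain.trans (mul_le_mul_of_nonneg_left hXZ (by positivity))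
    _ = 132000 * D * (logT G : ℝ) ^ 5 := by ring
    _ ≤ 132000 * D * (36 * Real.log ((G.n : ℝ) + 2)) ^ 5 := by
        gcongr
        exact logT_le h2
    _ = _ := by ring

end Dapsp

theorem theorem3 :
    ∃ (prog : RealRAM.Prog) (K k : ℕ) (C : ℝ),
      ∀ (n m : ℕ) (G : DiscountedGraph n m),
        ∃ (σ : RealRAM.Store) (T : ℕ),
          RealRAM.Exec ((n + m + 2) ^ K) prog G.input σ T ∧
          G.IsSolution σ ∧
          (0 < n → n ^ 2 ≤ m ^ 3 → m ≤ n ^ 2 →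
            (T : ℝ) ≤ C * ((n : ℝ) ^ (3 / 2 : ℝ) * (m : ℝ) ^ (3 / 4 : ℝ))
              * Real.log ((n : ℝ) + 2) ^ k) := by
  refine ⟨Dapsp.mainP, 65 * Dapsp.mainP.esz + 1, 5, 132000 * 36 ^ 5, fun n m G => ?_⟩
  obtain ⟨h, H, σ, T, hrun, hT, h1, h2, h3⟩ := Dapsp.mainP_spec G.toGr.val_dst
    (Dapsp.base_input G) rfl (fun a i ha => by
      simp [DiscountedGraph.input, show a ≠ 0 by omega, show a ≠ 1 by omega])
  refine ⟨σ, T, ?_, Dapsp.isSolution_of_solved h1 h2 h3, fun hn hm hm' =>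
    (Nat.cast_le.2 hT).trans (Dapsp.mainT_le_real H hn hm hm')⟩
  have hpoly : T ≤ (n + m + 2) ^ 55 := hT.trans (Dapsp.mainT_le_pow H)
  have hN : 2 ≤ n + m + 2 := Nat.le_add_left _ _
  have hl : Dapsp.mainP.lits ≤ 2 ^ 8 := by decide +kernel
  -- Stored words stay below `B`, and evaluating the fixed expressions of the program raises this to
  -- at most the power `mainP.esz`. The extra 1 in the exponent of the word bound makes the
  -- inequality strict.
  refine (hrun.exec (B := (n + m + 2) ^ 65) (M := n + m) (hN.trans (Nat.le_self_pow (by omega) _))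
    Dapsp.mainP_safe (Dapsp.input_allLe G) ?_ ?_).1
  · exact Dapsp.add_mul_le_pow hN (Nat.le_add_right _ _) hl hpoly
  · rw [← pow_mul]
    exact Nat.pow_lt_pow_right (by omega) (Nat.lt_succ_self _)
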